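/- Let $G$ be a Lie group with Lie algebra $\mathfrak g$, let $q:P\to S$ be a principal (right) $G$-bundle over a symplectic manifold $(S,\omega_S)$ (manifolds are smooth, Hausdorff, second countable, finite dimensional and without boundary), and let $\theta\in\Omega^1(P,\mathfrak g)$ be a principal connection. Let $G$ act on $P\times\mathfrak g^*$ by $(p,\xi)\cdot g=(p\cdot g,\xi\circ \mathrm{Ad}_g)$, put $\widetilde\theta_{(p,\xi)}:=\langle\xi,\theta_p\rangle$ and $$\omega:=q^*\omega_S-d\widetilde\theta\in\Omega^2(P\times\mathfrak g^*),$$ let $\Sigma\subset P\times\mathfrak g^*$ be the set of points at which $\omega$ is nondegenerate, and let $\mu:\Sigma\to\mathfrak g^*$, $\mu(p,\xi)=\xi$. Then $\Sigma$ is open, $G$-invariant and contains $P\times\{0\}$, and: (1) The quotient $N(P):=\Sigma/G$ is a (Hausdorff, second countable) manifold such that $\Sigma\to N(P)$ is a submersion, and it carries a Poisson structure $\pi_P$ such that $(\Sigma,\omega)\to(N(P),\pi_P)$ is a Poisson map. (The pair $(N(P),\pi_P)$ is the local model associated to $P$; the leaf $S$ is identified with the submanifold $(P\times\{0\})/G$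 of $N(P)$.) (2) $(N(P),\pi_P)$ is integrable by a Hausdorff symplectic groupoid, namely $$\mathcal G:=(\Sigma\times_\mu\Sigma)/G\rightrightarrows N(P),\qquad s([x_1,x_2])=[x_2],\quad t([x_1,x_2])=[x_1],\quad [x_1,x_2]\,[x_2,x_3]=[x_1,x_3].$$ That is: $(\Sigma\times_\mu\Sigma)/G$ is a Hausdorff, second countable manifold such that $\Sigma\times_\mu\Sigma\to(\Sigma\times_\mu\Sigma)/G$ is a submersion, these maps make it a Lie groupoid over $N(P)$, and it carries a symplectic form $\Omega$ whose pullback to $\Sigma\times_\mu\Sigma$ is $s^*\omega-t^*\omega$ (with $s(x_1,x_2)=x_2$, $t(x_1,x_2)=x_1$); the graph of the multiplication of $\mathcal G$ is Lagrangian for $pr_1^*\Omega+pr_2^*\Omega-pr_3^*\Omega$, the source map of $\mathcal G$ is Poisson and the target map is anti-Poisson with respect to $\Omega$ and $\pi_P$, and the Lie algebroid of $\mathcal G$ is isomorphic to the cotangent Lie algebroid $T^*N(P)$ of $\pi_P$. (3) If $P$ is compact, then every open neighborhood of $S$ in $N(P)$ contains an open neighborhood $U$ of $S$ that is $\mathcal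 G$-invariant (for every arrow $g$ of $\mathcal G$, $s(g)\in U$ if and only if $t(g)\in U$) and such that for every $x\in U$ the $s$-fiber $s^{-1}(x)\subset\mathcal G$ is diffeomorphic to $P$. -/

import Mathlib

open Set Topology MulOpposite
open scoped Manifold ContDiff

noncomputable section

set_option linter.unusedSectionVars false

namespace LocalModel

/-! ### Differential forms

All manifolds below are real, smooth, finite dimensional and without boundary. -/

section Forms

variable {E H : Type*} [NormedAddCommGroup E] [NormedSpace ℝ E] [TopologicalSpace H]
  {I : ModelWithCorners ℝ E H} {M : Type*} [TopologicalSpace M] [ChartedSpace H M]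
  {E' H' : Type*} [NormedAddCommGroup E'] [NormedSpace ℝ E'] [TopologicalSpace H']
  {I' : ModelWithCorners ℝ E' H'} {M' : Type*} [TopologicalSpace M'] [ChartedSpace H' M']
  {F : Type*} [NormedAddCommGroup F] [NormedSpace ℝ F] {k : ℕ}

variable (I M) in
/-- (Not necessarily smooth) differential `k`-forms on `M` with values in the vector space `F`. -/
abbrev DiffForm (k : ℕ) (F : Type*) [NormedAddCommGroup F] [NormedSpace ℝ F] :=
  ∀ x : M, TangentSpace I x [⋀^Fin k]→L[ℝ] F

/-- The coordinate expression of a form in the preferred chart at `x₀`: its pullback by the inverse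
of that chart. It is meaningful on the target of the chart. -/
def DiffForm.inChart (η : DiffForm I M k F) (x₀ : M) (y : E) : E [⋀^Fin k]→L[ℝ] F :=
  (η ((extChartAt I x₀).symm y)).compContinuousLinearMap
    ((mfderiv 𝓘(ℝ, E) I (extChartAt I x₀).symm y) ∘L
      ((NormedSpace.fromTangentSpace (𝕜 := ℝ) y).symm : E →L[ℝ] TangentSpace 𝓘(ℝ, E) y))

/-- A form is smooth if its coordinate expressions are. -/
def DiffForm.IsSmooth (η : DiffForm I M k F) : Prop :=
  ∀ x₀ : M, ContDiffOn ℝ ∞ (η.inChart x₀) (extChartAt I x₀).target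

/-- The exterior derivative, computed in the preferred chart at each point. -/
def DiffForm.d (η : DiffForm I M k F) : DiffForm I M (k + 1) F := fun x =>
  (extDeriv (η.inChart x) (extChartAt I x x)).compContinuousLinearMap
    ((NormedSpace.fromTangentSpace (𝕜 := ℝ) (extChartAt I x x) :
        TangentSpace 𝓘(ℝ, E) (extChartAt I x x) →L[ℝ] E) ∘L
      (mfderiv I 𝓘(ℝ, E) (extChartAt I x) x))

variable (I) in
/-- The pullback `f^* η`. -/
def DiffForm.pullback (f : M → M') (η : DiffForm I' M' k F) : DiffForm I M k F := fun x =>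
  (η (f x)).compContinuousLinearMap (mfderiv I I' f x)

/-- A `2`-form is nondegenerate at a point. -/
def DiffForm.NondegenerateAt (η : DiffForm I M 2 ℝ) (x : M) : Prop :=
  ∀ v : TangentSpace I x, (∀ w : TangentSpace I x, η x ![v, w] = 0) → v = 0

/-- Symplectic forms: smooth closed nondegenerate `2`-forms. -/
structure IsSymplectic (η : DiffForm I M 2 ℝ) : Prop where
  smooth : η.IsSmooth
  closed : ∀ x, η.d x = 0
  nondegenerate : ∀ x, η.NondegenerateAt x

variable (I I') in
/-- Smooth submersions between finite dimensional manifolds. -/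
structure IsSmoothSubmersion (f : M → M') : Prop where
  smooth : ContMDiff I I' ∞ f
  surjective_mfderiv : ∀ x, Function.Surjective (mfderiv I I' f x)

variable (I) in
/-- The velocity at time `0` of a curve, as a point of the tangent bundle. -/
def velocity (γ : ℝ → M) : TangentBundle I M := tangentMap 𝓘(ℝ, ℝ) I γ ⟨0, (1 : ℝ)⟩

variable (I) in
/-- The tangent space at `x` of an embedded submanifold `L`: the velocities of the smooth curves
in `L` that pass through `x` at time `0`. -/
def tangentVectors (L : Set M) (x : M) : Set (TangentSpace I x) :=
  {v | ∃ γ : ℝ → M, ContMDiff 𝓘(ℝ, ℝ) I ∞ γ ∧ (∀ t, γ t ∈ L) ∧ velocity I γ = ⟨x, v⟩}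

/-- The submanifold `L` is Lagrangian for the `2`-form `η`: at each of its points the tangent space
of `L` is equal to its own `η`-orthogonal. -/
def IsLagrangian (η : DiffForm I M 2 ℝ) (L : Set M) : Prop :=
  ∀ x ∈ L, ∀ v : TangentSpace I x,
    v ∈ tangentVectors I L x ↔ ∀ w ∈ tangentVectors I L x, η x ![v, w] = 0

variable (I I') in
/-- The embedded submanifold `A` of `M'` is diffeomorphic to `M`: it is the image of a smooth
embedding (an immersion that is a homeomorphism onto its image) of `M`. -/
def IsDiffeomorphicToSubmanifold (M : Type*) [TopologicalSpace M] [ChartedSpace H M]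
    (A : Set M') : Prop :=
  ∃ f : M → M', ContMDiff I I' ∞ f ∧ IsEmbedding f ∧
    (∀ x, Function.Injective (mfderiv I I' f x)) ∧ range f = A

end Forms

/-! ### Poisson structures and their cotangent Lie algebroids -/

section Poisson

variable {E H : Type*} [NormedAddCommGroup E] [NormedSpace ℝ E] [TopologicalSpace H]
  {I : ModelWithCorners ℝ E H} {M : Type*} [TopologicalSpace M] [ChartedSpace H M]
  {E' H' : Type*} [NormedAddCommGroup E'] [NormedSpace ℝ E'] [TopologicalSpace H']
  {I' : ModelWithCorners ℝ E' H'} {M' : Type*} [TopologicalSpace M'] [ChartedSpace H' M']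

/-- The bracket `{f, g} = ⟨dg, π^♯(df)⟩` of two functions. -/
def bracketOf (sharp : ∀ x : M, (TangentSpace I x →L[ℝ] ℝ) →ₗ[ℝ] TangentSpace I x)
    (f g : M → ℝ) (x : M) : ℝ :=
  mvfderiv I g x (sharp x (mvfderiv I f x))

variable (I M) in
/-- A Poisson structure on `M`, given by a smooth bivector `π`, which is encoded by the maps
`π^♯ : T^*M → TM`, such that the bracket satisfies the Jacobi identity. -/
structure PoissonStructure where
  sharp : ∀ x : M, (TangentSpace I x →L[ℝ] ℝ) →ₗ[ℝ] TangentSpace I x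
  alternating : ∀ (x : M) (α : TangentSpace I x →L[ℝ] ℝ), α (sharp x α) = 0
  smooth : ∀ f g : M → ℝ, ContMDiff I 𝓘(ℝ, ℝ) ∞ f → ContMDiff I 𝓘(ℝ, ℝ) ∞ g →
    ContMDiff I 𝓘(ℝ, ℝ) ∞ (bracketOf sharp f g)
  jacobi : ∀ f g h : M → ℝ, ContMDiff I 𝓘(ℝ, ℝ) ∞ f → ContMDiff I 𝓘(ℝ, ℝ) ∞ g →
    ContMDiff I 𝓘(ℝ, ℝ) ∞ h → ∀ x,
      bracketOf sharp f (bracketOf sharp g h) x + bracketOf sharp g (bracketOf sharp h f) x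
        + bracketOf sharp h (bracketOf sharp f g) x = 0

/-- Let `η` be nondegenerate and let `π_η` be its inverse, so that `v = π_η^♯(β)` means
`η(v, ·) = β`. The map `f : (M, η) → (M', π)` is Poisson: `df ∘ π_η^♯ ∘ (df)^* = π^♯`. -/
def IsPoissonMap (η : DiffForm I M 2 ℝ) (π : PoissonStructure I' M') (f : M → M') : Prop :=
  ∀ (x : M) (v : TangentSpace I x) (α : TangentSpace I' (f x) →L[ℝ] ℝ),
    (∀ w : TangentSpace I x, η x ![v, w] = α (mfderiv I I' f x w)) →
      mfderiv I I' f x v = π.sharp (f x) α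

/-- The map `f : (M, η) → (M', π)` is anti-Poisson: it is Poisson as a map to `(M', -π)`. -/
def IsAntiPoissonMap (η : DiffForm I M 2 ℝ) (π : PoissonStructure I' M') (f : M → M') : Prop :=
  ∀ (x : M) (v : TangentSpace I x) (α : TangentSpace I' (f x) →L[ℝ] ℝ),
    (∀ w : TangentSpace I x, η x ![v, w] = α (mfderiv I I' f x w)) →
      mfderiv I I' f x v = -π.sharp (f x) α

variable (I M) in
/-- (Not necessarily smooth) sections of `T^*M`. -/
abbrev CovectorField := ∀ x : M, TangentSpace I x →L[ℝ] ℝ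

/-- A section of `T^*M` as a differential `1`-form. -/
def CovectorField.toForm (α : CovectorField I M) : DiffForm I M 1 ℝ := fun x =>
  ContinuousAlternatingMap.ofSubsingleton ℝ (TangentSpace I x) ℝ (0 : Fin 1) (α x)

/-- The Lie derivative of a `1`-form, `L_X β = i_X dβ + d(i_X β)`. -/
def lieDerivative (X : ∀ x : M, TangentSpace I x) (β : CovectorField I M) : CovectorField I M :=
  fun x => (β.toForm.d x).toContinuousLinearMap ![X x, 0] 1 + mvfderiv I (fun y => β y (X y)) x

/-- The bracket of the cotangent Lie algebroid of a Poisson manifold,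
`[α, β]_π = L_{π^♯ α} β - L_{π^♯ β} α - d(π(α, β))`; the anchor is `π^♯`. -/
def PoissonStructure.cotangentBracket (π : PoissonStructure I M) (α β : CovectorField I M) :
    CovectorField I M := fun x =>
  lieDerivative (fun y => π.sharp y (α y)) β x - lieDerivative (fun y => π.sharp y (β y)) α x
    - mvfderiv I (fun y => β y (π.sharp y (α y))) x

end Poisson

/-! ### Lie groupoids and symplectic groupoids -/

section Groupoids

/-- A groupoid with set of arrows `Γ` over the set of objects `M`. The product `mul g h` is
meaningful only for composable arrows, i.e. when `src g = tgt h`. -/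
structure GroupoidOver (Γ M : Type*) where
  src : Γ → M
  tgt : Γ → M
  unit : M → Γ
  inv : Γ → Γ
  mul : Γ → Γ → Γ
  src_unit : ∀ x, src (unit x) = x
  tgt_unit : ∀ x, tgt (unit x) = x
  src_inv : ∀ g, src (inv g) = tgt g
  tgt_inv : ∀ g, tgt (inv g) = src g
  src_mul : ∀ g h, src g = tgt h → src (mul g h) = src h
  tgt_mul : ∀ g h, src g = tgt h → tgt (mul g h) = tgt g
  mul_assoc : ∀ g h k, src g = tgt h → src h = tgt k → mul (mul g h) k = mul g (mul h k)
  unit_mul : ∀ g, mul (unit (tgt g)) g = g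
  mul_unit : ∀ g, mul g (unit (src g)) = g
  inv_mul : ∀ g, mul (inv g) g = unit (src g)
  mul_inv : ∀ g, mul g (inv g) = unit (tgt g)

variable {E H : Type*} [NormedAddCommGroup E] [NormedSpace ℝ E] [TopologicalSpace H]
  {I : ModelWithCorners ℝ E H} {Γ : Type*} [TopologicalSpace Γ] [ChartedSpace H Γ]
  {E' H' : Type*} [NormedAddCommGroup E'] [NormedSpace ℝ E'] [TopologicalSpace H']
  {I' : ModelWithCorners ℝ E' H'} {M : Type*} [TopologicalSpace M] [ChartedSpace H' M]

variable (I I') in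
/-- Lie groupoids. The product is smooth along the embedded submanifold of composable pairs. -/
structure GroupoidOver.IsLieGroupoid (𝒢 : GroupoidOver Γ M) : Prop where
  src_submersion : IsSmoothSubmersion I I' 𝒢.src
  tgt_submersion : IsSmoothSubmersion I I' 𝒢.tgt
  smooth_unit : ContMDiff I' I ∞ 𝒢.unit
  smooth_inv : ContMDiff I I ∞ 𝒢.inv
  smooth_mul : ContMDiffOn (I.prod I) I ∞ (fun z : Γ × Γ => 𝒢.mul z.1 z.2)
    {z : Γ × Γ | 𝒢.src z.1 = 𝒢.tgt z.2}

/-- The graph of the product. -/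
def GroupoidOver.mulGraph (𝒢 : GroupoidOver Γ M) : Set (Γ × Γ × Γ) :=
  {z | 𝒢.src z.1 = 𝒢.tgt z.2.1 ∧ 𝒢.mul z.1 z.2.1 = z.2.2}

/-- The `2`-form `pr₁^* Ω + pr₂^* Ω - pr₃^* Ω` on `Γ × Γ × Γ`. -/
def tripleForm (Ω : DiffForm I Γ 2 ℝ) : DiffForm (I.prod (I.prod I)) (Γ × Γ × Γ) 2 ℝ :=
  DiffForm.pullback (I.prod (I.prod I)) (fun z : Γ × Γ × Γ => z.1) Ω
    + DiffForm.pullback (I.prod (I.prod I)) (fun z : Γ × Γ × Γ => z.2.1) Ω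
    - DiffForm.pullback (I.prod (I.prod I)) (fun z : Γ × Γ × Γ => z.2.2) Ω

variable (I') in
/-- Symplectic groupoids: Lie groupoids with a symplectic form on the space of arrows for which the
graph of the product is Lagrangian. -/
structure GroupoidOver.IsSymplecticGroupoid (𝒢 : GroupoidOver Γ M) (Ω : DiffForm I Γ 2 ℝ) :
    Prop where
  isLieGroupoid : 𝒢.IsLieGroupoid I I'
  symplectic : IsSymplectic Ω
  lagrangian : IsLagrangian (tripleForm Ω) 𝒢.mulGraph

variable (I) in
/-- The right invariant vector field on `Γ` that extends a section `a` of the Lie algebroid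
`A = ker(ds)|_M`: its value at `g` is the image of `a(t(g))` under the differential of the right
translation by `g`, which is a map from the `s`-fiber of `t(g)` to `Γ`. -/
def GroupoidOver.rightInvariantExt (𝒢 : GroupoidOver Γ M)
    (a : ∀ x : M, TangentSpace I (𝒢.unit x)) (g : Γ) : TangentSpace I g :=
  (𝒢.unit_mul g) ▸ (mfderivWithin I I (fun h => 𝒢.mul h g) (𝒢.src ⁻¹' {𝒢.tgt g})
    (𝒢.unit (𝒢.tgt g)) (a (𝒢.tgt g)))

/-- The bracket of two sections of the Lie algebroid of `𝒢`: the restriction to the units of the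
bracket of the corresponding right invariant vector fields. -/
def GroupoidOver.algebroidBracket (𝒢 : GroupoidOver Γ M)
    (a b : ∀ x : M, TangentSpace I (𝒢.unit x)) (x : M) : TangentSpace I (𝒢.unit x) :=
  VectorField.mlieBracket I (𝒢.rightInvariantExt I a) (𝒢.rightInvariantExt I b) (𝒢.unit x)

/-- The linear maps `Φ x : T_x^*M → T_{u(x)} Γ` form an isomorphism of Lie algebroids from the
cotangent Lie algebroid of `(M, π)` onto the Lie algebroid of `𝒢`, i.e. the vector bundle over `M`
with fibers `ker(d_{u(x)} s)` and anchor `dt`. -/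
structure IsCotangentAlgebroidIso [IsManifold I ∞ Γ] (𝒢 : GroupoidOver Γ M) (π : PoissonStructure I' M)
    (Φ : ∀ x : M, (TangentSpace I' x →L[ℝ] ℝ) →ₗ[ℝ] TangentSpace I (𝒢.unit x)) : Prop where
  injective : ∀ x, Function.Injective (Φ x)
  range_eq : ∀ x, range (Φ x) = {v | mfderiv I I' 𝒢.src (𝒢.unit x) v = 0}
  smooth : ∀ α : CovectorField I' M, α.toForm.IsSmooth →
    ContMDiff I' I.tangent ∞ (fun x => (⟨𝒢.unit x, Φ x (α x)⟩ : TangentBundle I Γ))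
  anchor : ∀ (x : M) (α : TangentSpace I' x →L[ℝ] ℝ),
    tangentMap I I' 𝒢.tgt ⟨𝒢.unit x, Φ x α⟩ = ⟨x, π.sharp x α⟩
  bracket : ∀ α β : CovectorField I' M, α.toForm.IsSmooth → β.toForm.IsSmooth → ∀ x,
    𝒢.algebroidBracket (fun y => Φ y (α y)) (fun y => Φ y (β y)) x
      = Φ x (π.cotangentBracket α β x)

/-- The symplectic groupoid `(𝒢, Ω)` integrates the Poisson manifold `(M, π)`: the source is
Poisson, the target is anti-Poisson, and the Lie algebroid of `𝒢` is isomorphic to the cotangent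
Lie algebroid of `(M, π)`. -/
structure GroupoidOver.Integrates [IsManifold I ∞ Γ] (𝒢 : GroupoidOver Γ M) (Ω : DiffForm I Γ 2 ℝ)
    (π : PoissonStructure I' M) : Prop where
  isSymplecticGroupoid : 𝒢.IsSymplecticGroupoid I' Ω
  src_poisson : IsPoissonMap Ω π 𝒢.src
  tgt_antiPoisson : IsAntiPoissonMap Ω π 𝒢.tgt
  algebroid_iso : ∃ Φ : ∀ x : M, (TangentSpace I' x →L[ℝ] ℝ) →ₗ[ℝ] TangentSpace I (𝒢.unit x),
    IsCotangentAlgebroidIso 𝒢 π Φ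

end Groupoids

/-! ### Principal bundles and the local model -/

section Model

variable {E₀ G : Type*} [NormedAddCommGroup E₀] [NormedSpace ℝ E₀]
  [TopologicalSpace G] [ChartedSpace E₀ G] [Group G]
  {E₁ P : Type*} [NormedAddCommGroup E₁] [NormedSpace ℝ E₁]
  [TopologicalSpace P] [ChartedSpace E₁ P] [MulAction Gᵐᵒᵖ P]
  {E₂ S : Type*} [NormedAddCommGroup E₂] [NormedSpace ℝ E₂]
  [TopologicalSpace S] [ChartedSpace E₂ S]

/-- A principal `G`-bundle `q : P → S`: the group `G` acts smoothly on `P` from the right, and `q`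
is locally, over open sets `U` that cover `S`, isomorphic to `U × G → U`. -/
structure IsPrincipalBundle (E₀ G E₁ E₂ : Type*) {P S : Type*}
    [NormedAddCommGroup E₀] [NormedSpace ℝ E₀]
    [TopologicalSpace G] [ChartedSpace E₀ G] [Group G]
    [NormedAddCommGroup E₁] [NormedSpace ℝ E₁]
    [TopologicalSpace P] [ChartedSpace E₁ P] [MulAction Gᵐᵒᵖ P]
    [NormedAddCommGroup E₂] [NormedSpace ℝ E₂]
    [TopologicalSpace S] [ChartedSpace E₂ S] (q : P → S) : Prop where
  smooth_act : ContMDiff (𝓘(ℝ, E₁).prod 𝓘(ℝ, E₀)) 𝓘(ℝ, E₁) ∞ (fun z : P × G => op z.2 • z.1)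
  preserves_fibers : ∀ (p : P) (g : G), q (op g • p) = q p
  locally_trivial : ∀ x : S, ∃ e : Bundle.Trivialization G q, x ∈ e.baseSet ∧
    ContMDiffOn 𝓘(ℝ, E₁) (𝓘(ℝ, E₂).prod 𝓘(ℝ, E₀)) ∞ e e.source ∧
    ContMDiffOn (𝓘(ℝ, E₂).prod 𝓘(ℝ, E₀)) 𝓘(ℝ, E₁) ∞ e.toOpenPartialHomeomorph.symm e.target ∧
    ∀ p ∈ e.source, ∀ g : G, e (op g • p) = ((e p).1, (e p).2 * g)

/-- The adjoint action of `G` on its Lie algebra `𝔤 = T₁G`. By definition of the tangent spaces in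
Mathlib, `𝔤` is the vector space `E₀` on which `G` is modelled. -/
def lieAd (g : G) : E₀ →L[ℝ] E₀ :=
  mfderiv 𝓘(ℝ, E₀) 𝓘(ℝ, E₀) (fun h : G => g * h * g⁻¹) (1 : G)

/-- The dual `𝔤^*` of the Lie algebra. -/
abbrev LieDual (E₀ : Type*) [NormedAddCommGroup E₀] [NormedSpace ℝ E₀] := E₀ →L[ℝ] ℝ

/-- Principal connections `θ ∈ Ω¹(P, 𝔤)`: they map the vector field on `P` generated by `X ∈ 𝔤` to
`X`, and they satisfy `R_g^* θ = Ad_{g⁻¹} ∘ θ`. -/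
structure PrincipalConnection (E₀ G E₁ P : Type*)
    [NormedAddCommGroup E₀] [NormedSpace ℝ E₀]
    [TopologicalSpace G] [ChartedSpace E₀ G] [Group G]
    [NormedAddCommGroup E₁] [NormedSpace ℝ E₁]
    [TopologicalSpace P] [ChartedSpace E₁ P] [MulAction Gᵐᵒᵖ P] where
  form : DiffForm 𝓘(ℝ, E₁) P 1 E₀
  smooth : form.IsSmooth
  generator : ∀ (p : P) (X : TangentSpace 𝓘(ℝ, E₀) (1 : G)),
    form (op (1 : G) • p)
      ![mfderiv 𝓘(ℝ, E₀) 𝓘(ℝ, E₁) (fun g : G => op g • p) (1 : G) X] = X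
  equivariant : ∀ (g : G) (p : P) (v : TangentSpace 𝓘(ℝ, E₁) p),
    form (op g • p) ![mfderiv 𝓘(ℝ, E₁) 𝓘(ℝ, E₁) (fun p' : P => op g • p') p v]
      = lieAd (g⁻¹) (form p ![v])

/-- The right action of `G` on `P × 𝔤^*`, by the coadjoint action on `𝔤^*`:
`(p, ξ) · g = (p · g, ξ ∘ Ad_g)`. -/
def coadAct (x : P × LieDual E₀) (g : G) : P × LieDual E₀ :=
  (op g • x.1, x.2 ∘L lieAd g)

/-- The right action of `G` on `P × P × 𝔤^*`: `(p₁, p₂, ξ) · g = (p₁ · g, p₂ · g, ξ ∘ Ad_g)`. -/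
def coadAct₂ (z : P × P × LieDual E₀) (g : G) : P × P × LieDual E₀ :=
  (op g • z.1, op g • z.2.1, z.2.2 ∘L lieAd g)

theorem lieAd_one : (lieAd (1 : G) : E₀ →L[ℝ] E₀) = ContinuousLinearMap.id ℝ E₀ := by
  have h : (fun h : G => 1 * h * (1 : G)⁻¹) = id := by
    funext h
    simp
  unfold lieAd
  rw [h]
  exact mfderiv_id

theorem lieAd_mul [LieGroup 𝓘(ℝ, E₀) ∞ G] (g h : G) :
    (lieAd (g * h) : E₀ →L[ℝ] E₀) = (lieAd g : E₀ →L[ℝ] E₀) ∘L lieAd h := by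
  have hd : ∀ (a : G) (b : G), MDifferentiableAt 𝓘(ℝ, E₀) 𝓘(ℝ, E₀) (fun k : G => a * k * a⁻¹) b := by
    intro a b
    have : ContMDiff 𝓘(ℝ, E₀) 𝓘(ℝ, E₀) ∞ (fun k : G => a * k * a⁻¹) :=
      (contMDiff_const.mul contMDiff_id).mul contMDiff_const
    exact this.mdifferentiableAt (by simp)
  have hc : (fun k : G => g * h * k * (g * h)⁻¹)
      = (fun k : G => g * k * g⁻¹) ∘ (fun k : G => h * k * h⁻¹) := by
    funext k
    simp [mul_assoc]
  have h1 : h * 1 * h⁻¹ = 1 := by simp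
  have key := mfderiv_comp (1 : G) (hd g (h * 1 * h⁻¹)) (hd h 1)
  have h2 : ∀ b : G, b = 1 → @Eq (E₀ →L[ℝ] E₀)
      (mfderiv 𝓘(ℝ, E₀) 𝓘(ℝ, E₀) (fun k : G => g * k * g⁻¹) b) (lieAd g) := by
    rintro _ rfl
    rfl
  have h3 : (lieAd (g * h) : E₀ →L[ℝ] E₀) =
      mfderiv 𝓘(ℝ, E₀) 𝓘(ℝ, E₀) ((fun k : G => g * k * g⁻¹) ∘ (fun k : G => h * k * h⁻¹)) 1 := by
    unfold lieAd
    rw [hc]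
  exact (h3.trans key).trans
    (congrArg (fun A : E₀ →L[ℝ] E₀ => A ∘L (lieAd h : E₀ →L[ℝ] E₀)) (h2 _ (by simp)))

theorem coadAct_one (x : P × LieDual E₀) : coadAct x (1 : G) = x := by
  simp [coadAct, lieAd_one]

theorem coadAct_mul [LieGroup 𝓘(ℝ, E₀) ∞ G] (x : P × LieDual E₀) (g h : G) :
    coadAct x (g * h) = coadAct (coadAct x g) h := by
  simp [coadAct, lieAd_mul, mul_smul, ContinuousLinearMap.comp_assoc]

theorem coadAct₂_one (z : P × P × LieDual E₀) : coadAct₂ z (1 : G) = z := by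
  simp [coadAct₂, lieAd_one]

theorem coadAct₂_mul [LieGroup 𝓘(ℝ, E₀) ∞ G] (z : P × P × LieDual E₀) (g h : G) :
    coadAct₂ z (g * h) = coadAct₂ (coadAct₂ z g) h := by
  simp [coadAct₂, lieAd_mul, mul_smul, ContinuousLinearMap.comp_assoc]

variable (E₀ G P) in
/-- The orbit equivalence relation of `G` on `P × 𝔤^*`. -/
def coadSetoid [LieGroup 𝓘(ℝ, E₀) ∞ G] : Setoid (P × LieDual E₀) where
  r x y := ∃ g : G, y = coadAct x g
  iseqv :=
    { refl := fun x => ⟨1, (coadAct_one x).symm⟩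
      symm := by
        rintro x _ ⟨g, rfl⟩
        exact ⟨g⁻¹, by rw [← coadAct_mul, mul_inv_cancel, coadAct_one]⟩
      trans := by
        rintro x _ _ ⟨g, rfl⟩ ⟨h, rfl⟩
        exact ⟨g * h, (coadAct_mul x g h).symm⟩ }

variable (E₀ G P) in
/-- The orbit equivalence relation of `G` on `P × P × 𝔤^*`. -/
def coadSetoid₂ [LieGroup 𝓘(ℝ, E₀) ∞ G] : Setoid (P × P × LieDual E₀) where
  r x y := ∃ g : G, y = coadAct₂ x g
  iseqv :=
    { refl := fun x => ⟨1, (coadAct₂_one x).symm⟩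
      symm := by
        rintro x _ ⟨g, rfl⟩
        exact ⟨g⁻¹, by rw [← coadAct₂_mul, mul_inv_cancel, coadAct₂_one]⟩
      trans := by
        rintro x _ _ ⟨g, rfl⟩ ⟨h, rfl⟩
        exact ⟨g * h, (coadAct₂_mul x g h).symm⟩ }

variable (E₀ E₁) in
/-- The model with corners of `P × 𝔤^*`. -/
abbrev modelSigma := 𝓘(ℝ, E₁).prod 𝓘(ℝ, LieDual E₀)

variable (E₀ E₁) in
/-- The model with corners of `P × P × 𝔤^*`. -/
abbrev modelPairs := 𝓘(ℝ, E₁).prod (𝓘(ℝ, E₁).prod 𝓘(ℝ, LieDual E₀))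

/-- The `1`-form `θ̃` on `P × 𝔤^*`, `θ̃_{(p, ξ)} = ⟨ξ, θ_p⟩`. -/
def thetaTilde (θ : PrincipalConnection E₀ G E₁ P) :
    DiffForm (modelSigma E₀ E₁) (P × LieDual E₀) 1 ℝ := fun x =>
  x.2.compContinuousAlternatingMap
    (DiffForm.pullback (modelSigma E₀ E₁) (fun y : P × LieDual E₀ => y.1) θ.form x)

/-- The `2`-form `ω = q^* ω_S - dθ̃` on `P × 𝔤^*`. -/
def omega (q : P → S) (ωS : DiffForm 𝓘(ℝ, E₂) S 2 ℝ) (θ : PrincipalConnection E₀ G E₁ P) :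
    DiffForm (modelSigma E₀ E₁) (P × LieDual E₀) 2 ℝ :=
  DiffForm.pullback (modelSigma E₀ E₁) (fun x : P × LieDual E₀ => q x.1) ωS - (thetaTilde θ).d

/-- The set of points where `ω` is nondegenerate. -/
def nondegenerateSet (q : P → S) (ωS : DiffForm 𝓘(ℝ, E₂) S 2 ℝ)
    (θ : PrincipalConnection E₀ G E₁ P) : Set (P × LieDual E₀) :=
  {x | (omega q ωS θ).NondegenerateAt x}

/-- The open set `Σ` where `ω` is nondegenerate. The set of these points is always open; taking the
interior only turns it into an element of `Opens` without a proof of this fact. -/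
def sigma (q : P → S) (ωS : DiffForm 𝓘(ℝ, E₂) S 2 ℝ)
    (θ : PrincipalConnection E₀ G E₁ P) : TopologicalSpace.Opens (P × LieDual E₀) :=
  ⟨interior (nondegenerateSet q ωS θ), isOpen_interior⟩

/-- The fibre product `Σ ×_μ Σ` over the moment map `μ(p, ξ) = ξ`, as an open part of the manifold
`P × P × 𝔤^*`: the triple `(p₁, p₂, ξ)` stands for the pair `((p₁, ξ), (p₂, ξ))`. -/
def sigmaPairs (q : P → S) (ωS : DiffForm 𝓘(ℝ, E₂) S 2 ℝ)
    (θ : PrincipalConnection E₀ G E₁ P) : TopologicalSpace.Opens (P × P × LieDual E₀) :=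
  ⟨{z | (z.1, z.2.2) ∈ sigma q ωS θ ∧ (z.2.1, z.2.2) ∈ sigma q ωS θ},
    ((sigma q ωS θ).isOpen.preimage (by fun_prop)).inter
      ((sigma q ωS θ).isOpen.preimage (by fun_prop))⟩

/-- The first projection `Σ ×_μ Σ → Σ`, which is the target map of the pair groupoid. -/
def pairTgt (q : P → S) (ωS : DiffForm 𝓘(ℝ, E₂) S 2 ℝ) (θ : PrincipalConnection E₀ G E₁ P)
    (z : sigmaPairs q ωS θ) : sigma q ωS θ :=
  ⟨(z.1.1, z.1.2.2), z.2.1⟩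

/-- The second projection `Σ ×_μ Σ → Σ`, which is the source map of the pair groupoid. -/
def pairSrc (q : P → S) (ωS : DiffForm 𝓘(ℝ, E₂) S 2 ℝ) (θ : PrincipalConnection E₀ G E₁ P)
    (z : sigmaPairs q ωS θ) : sigma q ωS θ :=
  ⟨(z.1.2.1, z.1.2.2), z.2.2⟩

/-- The restriction of `ω` to `Σ`. -/
def omegaSigma (q : P → S) (ωS : DiffForm 𝓘(ℝ, E₂) S 2 ℝ) (θ : PrincipalConnection E₀ G E₁ P) :
    DiffForm (modelSigma E₀ E₁) (sigma q ωS θ) 2 ℝ :=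
  DiffForm.pullback (modelSigma E₀ E₁) Subtype.val (omega q ωS θ)

/-- The `2`-form `s^* ω - t^* ω` on `Σ ×_μ Σ`. -/
def omegaPairs (q : P → S) (ωS : DiffForm 𝓘(ℝ, E₂) S 2 ℝ) (θ : PrincipalConnection E₀ G E₁ P) :
    DiffForm (modelPairs E₀ E₁) (sigmaPairs q ωS θ) 2 ℝ :=
  DiffForm.pullback (modelPairs E₀ E₁) (pairSrc q ωS θ) (omegaSigma q ωS θ)
    - DiffForm.pullback (modelPairs E₀ E₁) (pairTgt q ωS θ) (omegaSigma q ωS θ)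

section Quotients

variable [LieGroup 𝓘(ℝ, E₀) ∞ G]

/-- The space `N(P) = Σ / G`, with the quotient topology. -/
abbrev NP (q : P → S) (ωS : DiffForm 𝓘(ℝ, E₂) S 2 ℝ) (θ : PrincipalConnection E₀ G E₁ P) :=
  Quotient ((coadSetoid E₀ G P).comap (Subtype.val : sigma q ωS θ → P × LieDual E₀))

/-- The projection `Σ → N(P)`. -/
def projNP (q : P → S) (ωS : DiffForm 𝓘(ℝ, E₂) S 2 ℝ) (θ : PrincipalConnection E₀ G E₁ P) :
    sigma q ωS θ → NP q ωS θ :=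
  Quotient.mk _

/-- The space `(Σ ×_μ Σ) / G`, with the quotient topology. -/
abbrev GP (q : P → S) (ωS : DiffForm 𝓘(ℝ, E₂) S 2 ℝ) (θ : PrincipalConnection E₀ G E₁ P) :=
  Quotient ((coadSetoid₂ E₀ G P).comap (Subtype.val : sigmaPairs q ωS θ → P × P × LieDual E₀))

/-- The projection `Σ ×_μ Σ → (Σ ×_μ Σ) / G`. -/
def projGP (q : P → S) (ωS : DiffForm 𝓘(ℝ, E₂) S 2 ℝ) (θ : PrincipalConnection E₀ G E₁ P) :
    sigmaPairs q ωS θ → GP q ωS θ :=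
  Quotient.mk _

/-- The submanifold `S` of `N(P)`, i.e. the quotient of `P × {0}`. -/
def zeroSection (q : P → S) (ωS : DiffForm 𝓘(ℝ, E₂) S 2 ℝ) (θ : PrincipalConnection E₀ G E₁ P) :
    Set (NP q ωS θ) :=
  projNP q ωS θ '' {x | x.1.2 = 0}

/-- The groupoid `𝒢` on `(Σ ×_μ Σ) / G` over `N(P)` is the quotient of the pair groupoid:
`s[x₁, x₂] = [x₂]`, `t[x₁, x₂] = [x₁]` and `[x₁, x₂][x₂, x₃] = [x₁, x₃]`. Units and inverses are
determined by this. -/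
structure IsQuotientOfPairGroupoid (q : P → S) (ωS : DiffForm 𝓘(ℝ, E₂) S 2 ℝ)
    (θ : PrincipalConnection E₀ G E₁ P) (𝒢 : GroupoidOver (GP q ωS θ) (NP q ωS θ)) : Prop where
  src_eq : ∀ z, 𝒢.src (projGP q ωS θ z) = projNP q ωS θ (pairSrc q ωS θ z)
  tgt_eq : ∀ z, 𝒢.tgt (projGP q ωS θ z) = projNP q ωS θ (pairTgt q ωS θ z)
  mul_eq : ∀ z w u : sigmaPairs q ωS θ,
    pairSrc q ωS θ z = pairTgt q ωS θ w → pairTgt q ωS θ u = pairTgt q ωS θ z →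
      pairSrc q ωS θ u = pairSrc q ωS θ w →
        𝒢.mul (projGP q ωS θ z) (projGP q ωS θ w) = projGP q ωS θ u

end Quotients

end Model

end LocalModel

end

noncomputable section

set_option linter.unusedSectionVars false

namespace LocalModel

/-! ### Pullback, smoothness and exterior derivative of forms on manifolds -/

section FormCalculus

variable {E H : Type*} [NormedAddCommGroup E] [NormedSpace ℝ E] [TopologicalSpace H]
  {I : ModelWithCorners ℝ E H} {M : Type*} [TopologicalSpace M] [ChartedSpace H M]
  {E' H' : Type*} [NormedAddCommGroup E'] [NormedSpace ℝ E'] [TopologicalSpace H']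
  {I' : ModelWithCorners ℝ E' H'} {M' : Type*} [TopologicalSpace M'] [ChartedSpace H' M']
  {F : Type*} [NormedAddCommGroup F] [NormedSpace ℝ F] {k : ℕ}

/-! The theorem rests on one identity: μ is a moment map for the action of G on (P × 𝔤^*, ω), so
that the generator of X ∈ 𝔤 pairs with w to ⟨dμ(w), X⟩ (`omega_gen`). Indeed θ̃ is invariant, hence
i_X dθ̃ = -d⟨μ, X⟩, and q^*ω_S vanishes on vertical vectors. On P × {0} the form restricts to
q^*ω_S, and the identity pairs orbit directions with 𝔤^*, which gives nondegeneracy there. Wherever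
ω is nondegenerate, the identity also says that the ω-orthogonal of a fiber of μ is the tangent
space of the orbit (`exists_eq_of_orthogonal`).

The action on P is free and has slices coming from the trivializations, so both quotients are
manifolds whose projections have smooth local sections (`IsPrincipalBundle.nonempty_quotientSlice`,
`exists_smooth_quotient`). Through these sections smooth maps and forms descend. The invariant form
ω yields a Poisson structure on N(P) by reduction (`exists_reduced_poissonStructure`). The null
directions of s^*ω - t^*ω on Σ ×_μ Σ are exactly the directions of the diagonal orbits
(`omegaPairs_eq_zero_iff`), so this form descends to a symplectic form Ω.

Composition of arrows is well defined because the action on the common middle point is free. The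
graph of the product is the image of Σ ×_μ Σ ×_μ Σ. The three copies of Ω telescope on it, and a
vector orthogonal to the graph is put back into it by applying the orthogonality principle at each
of the three points (`isLagrangian_mulGraph`). The same principle at one end of an arrow shows that
s is Poisson and t is anti-Poisson.

For the Lie algebroid, a covector a at x goes to the vector v at the unit with Ω(v, ·) = -a ∘ dt.
Right translation by [p₁, p₂, ξ] sends [p, p₁, ξ] to [p, p₂, ξ], whence the right invariant
extension of the image of α contracts with Ω to -t^*α (`rightInvariantExt_gaugeGroupoid`). As Ω is
closed, the contraction of Ω with a Lie bracket of two such fields is -t^* of the cotangent bracket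
(`isCotangentAlgebroidIso_algebroidMap`).

The source fiber of [p₂, ξ] consists of the classes [p, p₂, ξ] with (p, ξ) ∈ Σ. If P is compact, the
ξ for which P × {ξ} lies in a given invariant open subset of Σ form an open coadjoint invariant set,
and over it the source fibers are copies of P. -/

theorem DiffForm.apply_congr (η : DiffForm I M k F) {x y : M} (h : x = y) (v : Fin k → E) :
    η x v = η y v := by
  subst h; rfl

theorem DiffForm.inChart_apply (η : DiffForm I M k F) (x₀ : M) (y : E) (v : Fin k → E) :
    η.inChart x₀ y v =
      η ((extChartAt I x₀).symm y)
        (fun i => mfderiv 𝓘(ℝ, E) I (extChartAt I x₀).symm y (v i)) := rfl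

theorem DiffForm.pullback_apply (f : M → M') (η : DiffForm I' M' k F) (x : M)
    (v : Fin k → TangentSpace I x) :
    DiffForm.pullback I f η x v = η (f x) (fun i => mfderiv I I' f x (v i)) := rfl

theorem mdifferentiableAt_extChartAt_symm [IsManifold I ∞ M] [I.Boundaryless] {x₀ : M} {y : E}
    (hy : y ∈ (extChartAt I x₀).target) :
    MDifferentiableAt 𝓘(ℝ, E) I (extChartAt I x₀).symm y :=
  (((contMDiffOn_extChartAt_symm (n := ∞) x₀).contMDiffAt
    ((isOpen_extChartAt_target x₀).mem_nhds hy))).mdifferentiableAt (by simp)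

/-- Near the point, f read from the chart at x₀ agrees with the inverse chart at y₀ composed with
the coordinate expression of f, so uniqueness of derivatives applies. This reduces pullbacks between
manifolds to pullbacks between vector spaces. -/
theorem DiffForm.inChart_pullback_of_mem [IsManifold I ∞ M] [I.Boundaryless]
    [IsManifold I' ∞ M'] [I'.Boundaryless] (f : M → M') (η : DiffForm I' M' k F) (x₀ : M) (y₀ : M')
    {y : E} (hy : y ∈ (extChartAt I x₀).target)
    (hfy : f ((extChartAt I x₀).symm y) ∈ (extChartAt I' y₀).source)
    (hf : MDifferentiableAt I I' f ((extChartAt I x₀).symm y)) :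
    (DiffForm.pullback I f η).inChart x₀ y =
      (η.inChart y₀ ((extChartAt I' y₀ ∘ f ∘ (extChartAt I x₀).symm) y)).compContinuousLinearMap
        (fderiv ℝ (extChartAt I' y₀ ∘ f ∘ (extChartAt I x₀).symm) y) := by
  set G := extChartAt I' y₀ ∘ f ∘ (extChartAt I x₀).symm with hG
  have hs : MDifferentiableAt 𝓘(ℝ, E) I (extChartAt I x₀).symm y :=
    mdifferentiableAt_extChartAt_symm hy
  have hφ : MDifferentiableAt I' 𝓘(ℝ, E') (extChartAt I' y₀) (f ((extChartAt I x₀).symm y)) :=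
    mdifferentiableAt_extChartAt (by simpa using hfy)
  have hGd : MDifferentiableAt 𝓘(ℝ, E) 𝓘(ℝ, E') G y :=
    hφ.comp y (hf.comp y hs)
  have hGt : G y ∈ (extChartAt I' y₀).target := (extChartAt I' y₀).map_source hfy
  have h1 : HasMFDerivAt 𝓘(ℝ, E) I' (f ∘ (extChartAt I x₀).symm) y
      ((mfderiv I I' f ((extChartAt I x₀).symm y)).comp
        (mfderiv 𝓘(ℝ, E) I (extChartAt I x₀).symm y)) :=
    hf.hasMFDerivAt.comp y hs.hasMFDerivAt
  have h2 : HasMFDerivAt 𝓘(ℝ, E) I' ((extChartAt I' y₀).symm ∘ G) y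
      ((mfderiv 𝓘(ℝ, E') I' (extChartAt I' y₀).symm (G y)).comp
        (mfderiv 𝓘(ℝ, E) 𝓘(ℝ, E') G y)) :=
    (mdifferentiableAt_extChartAt_symm hGt).hasMFDerivAt.comp y hGd.hasMFDerivAt
  have he : f ∘ (extChartAt I x₀).symm =ᶠ[𝓝 y] (extChartAt I' y₀).symm ∘ G := by
    have := (hf.comp y hs).continuousAt.preimage_mem_nhds
      ((isOpen_extChartAt_source (I := I') y₀).mem_nhds hfy)
    filter_upwards [this] with z hz
    exact ((extChartAt I' y₀).left_inv hz).symm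
  have h3 := hasMFDerivAt_unique h1 (h2.congr_of_eventuallyEq he)
  ext v
  rw [DiffForm.inChart_apply, DiffForm.pullback_apply,
    ContinuousAlternatingMap.compContinuousLinearMap_apply, DiffForm.inChart_apply]
  have h4 : ∀ w : E, (mfderiv I I' f ((extChartAt I x₀).symm y)
        (mfderiv 𝓘(ℝ, E) I (extChartAt I x₀).symm y w) : E') =
      mfderiv 𝓘(ℝ, E') I' (extChartAt I' y₀).symm (G y) (fderiv ℝ G y w) := by
    intro w
    rw [← mfderiv_eq_fderiv]
    exact congrArg (fun A : E →L[ℝ] E' => A w) h3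
  refine (η.apply_congr ((extChartAt I' y₀).left_inv hfy).symm _).trans ?_
  exact congrArg _ (funext fun i => h4 (v i))

/-- Smoothness of a form at a point. -/
def DiffForm.SmoothAt (η : DiffForm I M k F) (x : M) : Prop :=
  ContDiffAt ℝ ∞ (η.inChart x) (extChartAt I x x)

theorem DiffForm.inChart_pullback_eventuallyEq [IsManifold I ∞ M] [I.Boundaryless]
    [IsManifold I' ∞ M'] [I'.Boundaryless] {f : M → M'} (η : DiffForm I' M' k F) {x₀ : M} {y₀ : M'}
    {x : M} (hx : x ∈ (extChartAt I x₀).source) (hfx : f x ∈ (extChartAt I' y₀).source)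
    (hf : ContMDiffAt I I' ∞ f x) :
    (DiffForm.pullback I f η).inChart x₀ =ᶠ[𝓝 (extChartAt I x₀ x)] fun y =>
      (η.inChart y₀ ((extChartAt I' y₀ ∘ f ∘ (extChartAt I x₀).symm) y)).compContinuousLinearMap
        (fderiv ℝ (extChartAt I' y₀ ∘ f ∘ (extChartAt I x₀).symm) y) := by
  have hc : ContinuousAt (extChartAt I x₀).symm (extChartAt I x₀ x) :=
    continuousAt_extChartAt_symm' hx
  have hx' : (extChartAt I x₀).symm (extChartAt I x₀ x) = x := (extChartAt I x₀).left_inv hx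
  have h1 : ∀ᶠ z in 𝓝 x, MDifferentiableAt I I' f z := by
    have : ContMDiffAt I I' 1 f x := hf.of_le (by simp)
    filter_upwards [(contMDiffAt_iff_contMDiffAt_nhds (by simp)).1 this] with z hz
    exact ContMDiffAt.mdifferentiableAt hz (by simp)
  have h2 : ∀ᶠ z in 𝓝 x, f z ∈ (extChartAt I' y₀).source :=
    hf.continuousAt.preimage_mem_nhds ((isOpen_extChartAt_source y₀).mem_nhds hfx)
  have hc' : Filter.Tendsto (extChartAt I x₀).symm (𝓝 (extChartAt I x₀ x)) (𝓝 x) := by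
    have := hc.tendsto; rwa [hx'] at this
  filter_upwards [hc'.eventually h1, hc'.eventually h2,
    (isOpen_extChartAt_target x₀).mem_nhds ((extChartAt I x₀).map_source hx)] with y a b c
  exact DiffForm.inChart_pullback_of_mem f η x₀ y₀ c b a

theorem contDiffAt_coordinates [IsManifold I ∞ M] [I.Boundaryless]
    [IsManifold I' ∞ M'] {f : M → M'} {x₀ : M} {y₀ : M'}
    {x : M} (hx : x ∈ (extChartAt I x₀).source) (hfx : f x ∈ (extChartAt I' y₀).source)
    (hf : ContMDiffAt I I' ∞ f x) :
    ContDiffAt ℝ ∞ (extChartAt I' y₀ ∘ f ∘ (extChartAt I x₀).symm) (extChartAt I x₀ x) := by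
  have hx' : (extChartAt I x₀).symm (extChartAt I x₀ x) = x := (extChartAt I x₀).left_inv hx
  have h1 : ContMDiffAt 𝓘(ℝ, E) I ∞ (extChartAt I x₀).symm (extChartAt I x₀ x) :=
    (contMDiffOn_extChartAt_symm (n := ∞) x₀).contMDiffAt
      ((isOpen_extChartAt_target x₀).mem_nhds ((extChartAt I x₀).map_source hx))
  have h2 : ContMDiffAt I I' ∞ f ((extChartAt I x₀).symm (extChartAt I x₀ x)) := by rwa [hx']
  have h3 : ContMDiffAt I' 𝓘(ℝ, E') ∞ (extChartAt I' y₀)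
      ((f ∘ (extChartAt I x₀).symm) (extChartAt I x₀ x)) := by
    refine contMDiffAt_extChartAt' ?_
    rw [Function.comp_apply, hx']
    simpa using hfx
  exact (h3.comp _ (h2.comp _ h1)).contDiffAt

/-- Isolates the dependence on A in the inductive step of `contDiff_compContinuousLinearMapCLM`. -/
theorem ContDiff.compL_comp_flip {X Y Z : Type*} [NormedAddCommGroup X] [NormedSpace ℝ X]
    [NormedAddCommGroup Y] [NormedSpace ℝ Y] [NormedAddCommGroup Z] [NormedSpace ℝ Z]
    {T : (E →L[ℝ] E') → X →L[ℝ] Y} (hT : ContDiff ℝ ∞ T) (C : Z →L[ℝ] (E' →L[ℝ] X)) :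
    ContDiff ℝ ∞ (fun A : E →L[ℝ] E' => ContinuousLinearMap.compL ℝ E X Y (T A) ∘L
      (ContinuousLinearMap.compL ℝ E E' X).flip A ∘L C) := by
  have h1 : ContDiff ℝ ∞ (fun A : E →L[ℝ] E' => ContinuousLinearMap.compL ℝ E X Y (T A)) :=
    contDiff_const.clm_apply hT
  have h2 : ContDiff ℝ ∞ (fun A : E →L[ℝ] E' => (ContinuousLinearMap.compL ℝ E E' X).flip A) :=
    ContinuousLinearMap.contDiff _
  exact h1.clm_comp (h2.clm_comp contDiff_const)

/-- Induction on the degree: a (k + 1)-form is (k + 1)⁻¹ times the alternatization of its currying,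
and the pullback of the curried form uses A once on the first argument and once through the pullback
of k-forms. -/
theorem contDiff_compContinuousLinearMapCLM (k : ℕ) :
    ContDiff ℝ ∞ (fun A : E →L[ℝ] E' =>
      (ContinuousAlternatingMap.compContinuousLinearMapCLM A :
        (E' [⋀^Fin k]→L[ℝ] F) →L[ℝ] (E [⋀^Fin k]→L[ℝ] F))) := by
  induction k with
  | zero =>
    have : (fun A : E →L[ℝ] E' =>
      (ContinuousAlternatingMap.compContinuousLinearMapCLM A :
        (E' [⋀^Fin 0]→L[ℝ] F) →L[ℝ] (E [⋀^Fin 0]→L[ℝ] F))) =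
        fun _ => ContinuousAlternatingMap.compContinuousLinearMapCLM 0 := by
      funext A
      ext β v
      exact congrArg β (Subsingleton.elim _ _)
    rw [this]
    exact contDiff_const
  | succ k ih =>
    have : (fun A : E →L[ℝ] E' =>
      (ContinuousAlternatingMap.compContinuousLinearMapCLM A :
        (E' [⋀^Fin (k + 1)]→L[ℝ] F) →L[ℝ] (E [⋀^Fin (k + 1)]→L[ℝ] F))) =
        fun A => ((k + 1 : ℝ)⁻¹ • ContinuousAlternatingMap.alternatizeUncurryFinCLM ℝ E F) ∘L
          ((ContinuousLinearMap.compL ℝ E (E' [⋀^Fin k]→L[ℝ] F) (E [⋀^Fin k]→L[ℝ] F)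
              (ContinuousAlternatingMap.compContinuousLinearMapCLM A)) ∘L
            ((ContinuousLinearMap.compL ℝ E E' (E' [⋀^Fin k]→L[ℝ] F)).flip A) ∘L
            (ContinuousAlternatingMap.curryLeftLI).toContinuousLinearMap) := by
      funext A
      ext β v
      have h1 : (ContinuousAlternatingMap.compContinuousLinearMapCLM A :
          (E' [⋀^Fin k]→L[ℝ] F) →L[ℝ] (E [⋀^Fin k]→L[ℝ] F)) ∘L (β.curryLeft ∘L A) =
          (β.compContinuousLinearMap A).curryLeft := by
        ext x w
        rw [ContinuousAlternatingMap.curryLeft_compContinuousLinearMap]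
        rfl
      have h2 : (((k + 1 : ℝ)⁻¹ • ContinuousAlternatingMap.alternatizeUncurryFinCLM ℝ E F) ∘L
          ((ContinuousLinearMap.compL ℝ E (E' [⋀^Fin k]→L[ℝ] F) (E [⋀^Fin k]→L[ℝ] F)
              (ContinuousAlternatingMap.compContinuousLinearMapCLM A)) ∘L
            ((ContinuousLinearMap.compL ℝ E E' (E' [⋀^Fin k]→L[ℝ] F)).flip A) ∘L
            (ContinuousAlternatingMap.curryLeftLI).toContinuousLinearMap)) β =
          (k + 1 : ℝ)⁻¹ • ContinuousAlternatingMap.alternatizeUncurryFin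
            ((ContinuousAlternatingMap.compContinuousLinearMapCLM A :
              (E' [⋀^Fin k]→L[ℝ] F) →L[ℝ] (E [⋀^Fin k]→L[ℝ] F)) ∘L (β.curryLeft ∘L A)) := rfl
      rw [h2, h1, ContinuousAlternatingMap.alternatizeUncurryFin_curryLeft,
        ← Nat.cast_smul_eq_nsmul ℝ, smul_smul]
      have h3 : ((k : ℝ) + 1)⁻¹ * ((k + 1 : ℕ) : ℝ) = 1 := by
        push_cast
        exact inv_mul_cancel₀ (by positivity)
      rw [h3, one_smul]
      rfl
    rw [this]
    exact contDiff_const.clm_comp (ContDiff.compL_comp_flip ih _)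

theorem ContDiffAt.compContinuousLinearMap_form {V : Type*} [NormedAddCommGroup V] [NormedSpace ℝ V]
    {β : V → E' [⋀^Fin k]→L[ℝ] F} {A : V → E →L[ℝ] E'} {y : V} (hβ : ContDiffAt ℝ ∞ β y)
    (hA : ContDiffAt ℝ ∞ A y) :
    ContDiffAt ℝ ∞ (fun y => (β y).compContinuousLinearMap (A y)) y :=
  ContDiffAt.clm_apply
    (((contDiff_compContinuousLinearMapCLM (F := F) k).contDiffAt (x := A y)).comp y hA) hβ

theorem DiffForm.contDiffAt_inChart_pullback [IsManifold I ∞ M] [I.Boundaryless]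
    [IsManifold I' ∞ M'] [I'.Boundaryless] {f : M → M'} (η : DiffForm I' M' k F) {x₀ : M} {y₀ : M'}
    {x : M} (hx : x ∈ (extChartAt I x₀).source) (hfx : f x ∈ (extChartAt I' y₀).source)
    (hf : ContMDiffAt I I' ∞ f x) (hη : ContDiffAt ℝ ∞ (η.inChart y₀) (extChartAt I' y₀ (f x))) :
    ContDiffAt ℝ ∞ ((DiffForm.pullback I f η).inChart x₀) (extChartAt I x₀ x) := by
  refine ContDiffAt.congr_of_eventuallyEq ?_ (η.inChart_pullback_eventuallyEq hx hfx hf)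
  have hG := contDiffAt_coordinates hx hfx hf
  have hx' : (extChartAt I x₀).symm (extChartAt I x₀ x) = x := (extChartAt I x₀).left_inv hx
  refine ContDiffAt.compContinuousLinearMap_form (β := η.inChart y₀ ∘ _)
    (ContDiffAt.comp _ ?_ hG) (hG.fderiv_right (by simp))
  rw [Function.comp_apply, Function.comp_apply, hx']
  exact hη

theorem DiffForm.pullback_id (η : DiffForm I M k F) : DiffForm.pullback I id η = η := by
  funext x
  ext v
  rw [DiffForm.pullback_apply, mfderiv_id]
  rfl

/-- A change of charts is the pullback by the identity map, read in two different charts. -/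
theorem DiffForm.SmoothAt.contDiffAt_inChart [IsManifold I ∞ M] [I.Boundaryless]
    {η : DiffForm I M k F} {x x₀ : M} (h : η.SmoothAt x) (hx : x ∈ (extChartAt I x₀).source) :
    ContDiffAt ℝ ∞ (η.inChart x₀) (extChartAt I x₀ x) := by
  have := η.contDiffAt_inChart_pullback (f := id) (x₀ := x₀) (y₀ := x) hx
    (mem_extChartAt_source (I := I) x) contMDiffAt_id h
  rwa [DiffForm.pullback_id] at this

theorem DiffForm.isSmooth_iff [IsManifold I ∞ M] [I.Boundaryless] {η : DiffForm I M k F} :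
    η.IsSmooth ↔ ∀ x, η.SmoothAt x := by
  refine ⟨fun h x => (h x).contDiffAt ((isOpen_extChartAt_target x).mem_nhds
    (mem_extChartAt_target x)), fun h x₀ y hy => ?_⟩
  have := (h ((extChartAt I x₀).symm y)).contDiffAt_inChart ((extChartAt I x₀).map_target hy)
  rw [(extChartAt I x₀).right_inv hy] at this
  exact this.contDiffWithinAt

theorem DiffForm.SmoothAt.pullback [IsManifold I ∞ M] [I.Boundaryless]
    [IsManifold I' ∞ M'] [I'.Boundaryless] {f : M → M'} {η : DiffForm I' M' k F} {x : M}
    (hη : η.SmoothAt (f x)) (hf : ContMDiffAt I I' ∞ f x) :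
    (DiffForm.pullback I f η).SmoothAt x :=
  η.contDiffAt_inChart_pullback (mem_extChartAt_source (I := I) x)
    (mem_extChartAt_source (I := I') (f x)) hf hη

theorem DiffForm.IsSmooth.pullback [IsManifold I ∞ M] [I.Boundaryless]
    [IsManifold I' ∞ M'] [I'.Boundaryless] {f : M → M'} {η : DiffForm I' M' k F}
    (hη : η.IsSmooth) (hf : ContMDiff I I' ∞ f) : (DiffForm.pullback I f η).IsSmooth :=
  isSmooth_iff.2 fun x => (isSmooth_iff.1 hη (f x)).pullback (hf x)

theorem DiffForm.IsSmooth.sub {η ζ : DiffForm I M k F} (hη : η.IsSmooth)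
    (hζ : ζ.IsSmooth) : (η - ζ).IsSmooth := fun x₀ => ContDiffOn.sub (hη x₀) (hζ x₀)

theorem DiffForm.SmoothAt.differentiableAt {η : DiffForm I M k F} {x : M} (hη : η.SmoothAt x) :
    DifferentiableAt ℝ (η.inChart x) (extChartAt I x x) :=
  ContDiffAt.differentiableAt hη (by simp)

theorem DiffForm.inChart_congr [IsManifold I ∞ M] [I.Boundaryless] {η ζ : DiffForm I M k F}
    {x : M} (h : ∀ᶠ y in 𝓝 x, η y = ζ y) :
    η.inChart x =ᶠ[𝓝 (extChartAt I x x)] ζ.inChart x := by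
  have hc := continuousAt_extChartAt_symm (I := I) x
  have hc' : Filter.Tendsto (extChartAt I x).symm (𝓝 (extChartAt I x x)) (𝓝 x) := by
    have := hc.tendsto
    rwa [(extChartAt I x).left_inv (mem_extChartAt_source x)] at this
  filter_upwards [hc'.eventually h] with y hy
  ext v
  rw [DiffForm.inChart_apply, DiffForm.inChart_apply, hy]

theorem DiffForm.SmoothAt.congr [IsManifold I ∞ M] [I.Boundaryless] {η ζ : DiffForm I M k F}
    {x : M} (hη : η.SmoothAt x) (h : ∀ᶠ y in 𝓝 x, η y = ζ y) : ζ.SmoothAt x :=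
  ContDiffAt.congr_of_eventuallyEq hη (DiffForm.inChart_congr h).symm

theorem DiffForm.d_apply [IsManifold I ∞ M] (η : DiffForm I M k F) (x : M)
    (v : Fin (k + 1) → E) :
    η.d x v = extDeriv (η.inChart x) (extChartAt I x x) v := by
  have : mfderiv I 𝓘(ℝ, E) (extChartAt I x) x = ContinuousLinearMap.id ℝ _ := mfderiv_extChartAt_self
  unfold DiffForm.d
  rw [this]
  rfl

theorem DiffForm.d_sub {η ζ : DiffForm I M k F} {x : M} (hη : η.SmoothAt x) (hζ : ζ.SmoothAt x) :
    (η - ζ).d x = η.d x - ζ.d x := by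
  have : extDeriv (η.inChart x - ζ.inChart x) (extChartAt I x x) =
      extDeriv (η.inChart x) (extChartAt I x x) - extDeriv (ζ.inChart x) (extChartAt I x x) := by
    unfold extDeriv
    rw [fderiv_sub hη.differentiableAt hζ.differentiableAt]
    exact map_sub (ContinuousAlternatingMap.alternatizeUncurryFinCLM ℝ E F) _ _
  ext v
  exact congrArg (fun A : E [⋀^Fin (k + 1)]→L[ℝ] F =>
    A fun i => mfderiv I 𝓘(ℝ, E) (extChartAt I x) x (v i)) this

/-- In the preferred charts at x and f x this is the naturality of `extDeriv`. The derivative of a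
preferred chart at its own center is the identity, so passing to coordinates costs no correction
term. -/
theorem DiffForm.d_pullback [IsManifold I ∞ M] [I.Boundaryless]
    [IsManifold I' ∞ M'] [I'.Boundaryless] {f : M → M'} {η : DiffForm I' M' k F} {x : M}
    (hη : η.SmoothAt (f x)) (hf : ContMDiffAt I I' ∞ f x) :
    (DiffForm.pullback I f η).d x = DiffForm.pullback I f η.d x := by
  ext v
  have hG := contDiffAt_coordinates (mem_extChartAt_source (I := I) x)
    (mem_extChartAt_source (I := I') (f x)) hf
  have hx' : (extChartAt I x).symm (extChartAt I x x) = x :=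
    (extChartAt I x).left_inv (mem_extChartAt_source x)
  have hGx : (extChartAt I' (f x) ∘ f ∘ (extChartAt I x).symm) (extChartAt I x x) =
      extChartAt I' (f x) (f x) := by
    rw [Function.comp_apply, Function.comp_apply, hx']
  have hη' : DifferentiableAt ℝ (η.inChart (f x))
      ((extChartAt I' (f x) ∘ f ∘ (extChartAt I x).symm) (extChartAt I x x)) := by
    rw [hGx]; exact hη.differentiableAt
  have hD : fderiv ℝ (extChartAt I' (f x) ∘ f ∘ (extChartAt I x).symm) (extChartAt I x x) =
      (mfderiv I I' f x : E →L[ℝ] E') := by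
    have hf1 : MDifferentiableAt I I' f x := hf.mdifferentiableAt (by simp)
    rw [hf1.mfderiv, writtenInExtChartAt, I.range_eq_univ, fderivWithin_univ]
  have key := (η.inChart_pullback_eventuallyEq (mem_extChartAt_source (I := I) x)
    (mem_extChartAt_source (I := I') (f x)) hf).extDeriv_eq.trans
    (extDeriv_pullback hη' hG (by simpa using ENat.LEInfty.out))
  rw [hGx, hD] at key
  refine (DiffForm.d_apply (E := E) (I := I) (DiffForm.pullback I f η) x v).trans ?_
  refine (congrArg (fun A : E [⋀^Fin (k + 1)]→L[ℝ] F => A v) key).trans ?_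
  exact (DiffForm.d_apply (E := E') (I := I') η (f x) _).symm

end FormCalculus

/-! ### One-forms, two-forms and Lie brackets on a vector space -/

section FlatCalculus

variable {E : Type*} [NormedAddCommGroup E] [NormedSpace ℝ E]

/-- A `1`-form on a vector space from a covector. -/
def oneForm (a : E →L[ℝ] ℝ) : E [⋀^Fin 1]→L[ℝ] ℝ :=
  ContinuousAlternatingMap.ofSubsingleton ℝ E ℝ (0 : Fin 1) a

theorem oneForm_apply (a : E →L[ℝ] ℝ) (v : Fin 1 → E) : oneForm a v = a (v 0) := rfl

/-- The identification of covectors with `1`-forms. -/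
def oneFormIso : (E →L[ℝ] ℝ) ≃ₗᵢ[ℝ] (E [⋀^Fin 1]→L[ℝ] ℝ) :=
  ContinuousAlternatingMap.ofSubsingletonLIE (0 : Fin 1)

/-- The bilinear map given by an alternating `2`-form. -/
def toBilin (β : E [⋀^Fin 2]→L[ℝ] ℝ) : E →L[ℝ] E →L[ℝ] ℝ :=
  ((oneFormIso (E := E)).symm :
    (E [⋀^Fin 1]→L[ℝ] ℝ) →L[ℝ] (E →L[ℝ] ℝ)) ∘L β.curryLeft

theorem toBilin_apply (β : E [⋀^Fin 2]→L[ℝ] ℝ) (v w : E) : toBilin β v w = β ![v, w] := by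
  have : toBilin β v w = β.curryLeft v (fun _ => w) := rfl
  rw [this, ContinuousAlternatingMap.curryLeft_apply_apply]
  congr 1
  funext i
  fin_cases i <;> rfl

theorem toBilin_swap (β : E [⋀^Fin 2]→L[ℝ] ℝ) (v w : E) : toBilin β v w = -toBilin β w v := by
  rw [toBilin_apply, toBilin_apply]
  have := β.toAlternatingMap.map_swap ![w, v] (show (0 : Fin 2) ≠ 1 by decide)
  refine Eq.trans ?_ this
  refine congrArg β ?_
  funext i; fin_cases i <;> rfl

theorem contDiffAt_toBilin {V : Type*} [NormedAddCommGroup V] [NormedSpace ℝ V]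
    {β : V → E [⋀^Fin 2]→L[ℝ] ℝ} {y : V} {n : ℕ∞ω} (hβ : ContDiffAt ℝ n β y) :
    ContDiffAt ℝ n (fun y => toBilin (β y)) y := by
  refine contDiffAt_const.clm_comp ?_
  have h : ContDiffAt ℝ n (fun y => (ContinuousAlternatingMap.curryLeftLI :
    (E [⋀^Fin (1 + 1)]→L[ℝ] ℝ) →ₗᵢ[ℝ] (E →L[ℝ] E [⋀^Fin 1]→L[ℝ] ℝ)).toContinuousLinearMap (β y)) y :=
    contDiffAt_const.clm_apply hβ
  exact h

theorem contDiffAt_oneForm {V : Type*} [NormedAddCommGroup V] [NormedSpace ℝ V]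
    {a : V → E →L[ℝ] ℝ} {y : V} {n : ℕ∞ω} (ha : ContDiffAt ℝ n a y) :
    ContDiffAt ℝ n (fun y => oneForm (a y)) y :=
  (oneFormIso (E := E)).contDiff.contDiffAt.comp y ha

theorem contDiffAt_of_oneForm {V : Type*} [NormedAddCommGroup V] [NormedSpace ℝ V]
    {a : V → E →L[ℝ] ℝ} {y : V} {n : ℕ∞ω} (ha : ContDiffAt ℝ n (fun y => oneForm (a y)) y) :
    ContDiffAt ℝ n a y :=
  (oneFormIso (E := E)).symm.contDiff.contDiffAt.comp y ha

theorem extDeriv_oneForm {a : E → E →L[ℝ] ℝ} {p : E} (ha : DifferentiableAt ℝ a p) (v w : E) :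
    extDeriv (fun y => oneForm (a y)) p ![v, w] = fderiv ℝ a p v w - fderiv ℝ a p w v := by
  have h1 : DifferentiableAt ℝ (fun y => oneForm (a y)) p :=
    (oneFormIso (E := E)).contDiff.contDiffAt.differentiableAt
      (n := 1) (by simp) |>.comp p ha
  have h2 : ∀ u : E, fderiv ℝ (fun y => a y u) p = (fderiv ℝ a p).flip u := by
    intro u
    rw [fderiv_clm_apply ha (differentiableAt_const u)]
    simp
  rw [extDeriv_apply h1, Fin.sum_univ_two]
  simp only [oneForm_apply, Fin.removeNth, Fin.val_zero, pow_zero, one_smul, Fin.val_one, pow_one,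
    h2]
  simp [sub_eq_add_neg]

theorem extDeriv_twoForm {β : E → E [⋀^Fin 2]→L[ℝ] ℝ} {p : E} (hβ : DifferentiableAt ℝ β p)
    (hB : DifferentiableAt ℝ (fun y => toBilin (β y)) p) (u v w : E) :
    extDeriv β p ![u, v, w] = fderiv ℝ (fun y => toBilin (β y)) p u v w
      - fderiv ℝ (fun y => toBilin (β y)) p v u w + fderiv ℝ (fun y => toBilin (β y)) p w u v := by
  have h2 : ∀ x y z : E, fderiv ℝ (fun y => toBilin (β y)) p x y z =
      fderiv ℝ (fun q => β q ![y, z]) p x := by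
    intro x y z
    have : (fun q => β q ![y, z]) = fun q => toBilin (β q) y z := by
      funext q; rw [toBilin_apply]
    rw [this, fderiv_clm_apply (hB.clm_apply (differentiableAt_const y)) (differentiableAt_const z),
      fderiv_clm_apply hB (differentiableAt_const y)]
    simp
  rw [extDeriv_apply hβ, Fin.sum_univ_three, h2, h2, h2]
  have e0 : (0 : Fin 3).removeNth ![u, v, w] = ![v, w] := by
    funext i; fin_cases i <;> rfl
  have e1 : (1 : Fin 3).removeNth ![u, v, w] = ![u, w] := by
    funext i; fin_cases i <;> rfl
  have e2 : (2 : Fin 3).removeNth ![u, v, w] = ![u, v] := by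
    funext i; fin_cases i <;> rfl
  rw [e0, e1, e2]
  simp [sub_eq_add_neg]

/-- By the product rule, the derivatives of U and V on the right add up to the contraction with the
bracket, because β is alternating. The remaining terms contain derivatives of β and sum to dβ, which
is zero. -/
theorem toBilin_lieBracket {β : E → E [⋀^Fin 2]→L[ℝ] ℝ} {p : E} (hβ : ContDiffAt ℝ 1 β p)
    (hd : extDeriv β p = 0) {U V : E → E} (hU : DifferentiableAt ℝ U p)
    (hV : DifferentiableAt ℝ V p) (w : E) :
    toBilin (β p) (VectorField.lieBracket ℝ U V p) w =
      extDeriv (fun y => oneForm (toBilin (β y) (V y))) p ![U p, w]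
        - extDeriv (fun y => oneForm (toBilin (β y) (U y))) p ![V p, w]
        - fderiv ℝ (fun y => toBilin (β y) (U y) (V y)) p w := by
  have hB : DifferentiableAt ℝ (fun y => toBilin (β y)) p := (contDiffAt_toBilin hβ).differentiableAt (by simp)
  have h0 := extDeriv_twoForm (hβ.differentiableAt (by simp)) hB (U p) (V p) w
  rw [show extDeriv β p ![U p, V p, w] = 0 from
    congrArg (fun A : E [⋀^Fin (2 + 1)]→L[ℝ] ℝ => A ![U p, V p, w]) hd] at h0
  rw [extDeriv_oneForm (hB.clm_apply hV), extDeriv_oneForm (hB.clm_apply hU),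
    fderiv_clm_apply (hB.clm_apply hU) hV, fderiv_clm_apply hB hU, fderiv_clm_apply hB hV]
  have hs : ∀ x y, toBilin (β p) x y = - toBilin (β p) y x := toBilin_swap (β p)
  have hs' : ∀ u x y, fderiv ℝ (fun y => toBilin (β y)) p u x y =
      - fderiv ℝ (fun y => toBilin (β y)) p u y x := by
    intro u x y
    have h1 : ∀ x y, fderiv ℝ (fun q => toBilin (β q) x y) p u =
        fderiv ℝ (fun y => toBilin (β y)) p u x y := by
      intro x y
      rw [fderiv_clm_apply (hB.clm_apply (differentiableAt_const x)) (differentiableAt_const y),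
        fderiv_clm_apply hB (differentiableAt_const x)]
      simp
    have h2 : (fun q => toBilin (β q) x y) = fun q => - toBilin (β q) y x := by
      funext q
      exact toBilin_swap (β q) x y
    rw [← h1, ← h1, h2, fderiv_fun_neg]
    rfl
  simp only [VectorField.lieBracket, map_sub, add_apply,
    sub_apply, ContinuousLinearMap.comp_apply, ContinuousLinearMap.flip_apply] at h0 ⊢
  rw [hs' w (V p) (U p), hs (fderiv ℝ V p w) (U p)]
  linarith

/-- The second derivatives of h cancel by symmetry; only the derivatives of U and V survive. -/
theorem fderiv_lieBracket {h : E → ℝ} {p : E} (hh : ContDiffAt ℝ 2 h p) {U V : E → E}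
    (hU : DifferentiableAt ℝ U p) (hV : DifferentiableAt ℝ V p) :
    fderiv ℝ h p (VectorField.lieBracket ℝ U V p) =
      fderiv ℝ (fun y => fderiv ℝ h y (V y)) p (U p)
        - fderiv ℝ (fun y => fderiv ℝ h y (U y)) p (V p) := by
  have h1 : DifferentiableAt ℝ (fderiv ℝ h) p :=
    (hh.fderiv_right (m := 1) (by norm_num)).differentiableAt (by simp)
  have h2 : IsSymmSndFDerivAt ℝ h p := hh.isSymmSndFDerivAt (by simp)
  rw [fderiv_clm_apply h1 hV, fderiv_clm_apply h1 hU]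
  simp only [VectorField.lieBracket, map_sub, add_apply,
    ContinuousLinearMap.comp_apply, ContinuousLinearMap.flip_apply]
  rw [h2 (U p) (V p)]
  ring

end FlatCalculus

/-! ### Exterior derivative, vector fields and Lie brackets in coordinates -/

section ChartCalculus

variable {E H : Type*} [NormedAddCommGroup E] [NormedSpace ℝ E] [TopologicalSpace H]
  {I : ModelWithCorners ℝ E H} {M : Type*} [TopologicalSpace M] [ChartedSpace H M]
  {F : Type*} [NormedAddCommGroup F] [NormedSpace ℝ F] {k : ℕ}

/-! The exterior derivative in charts. -/

theorem DiffForm.inChart_vectorSpace (β : DiffForm 𝓘(ℝ, E) E k F) (y : E) : β.inChart y = β := by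
  funext z
  ext v
  rw [DiffForm.inChart_apply]
  have h1 : ∀ f : E → E, f = id → ∀ w : E, (mfderiv 𝓘(ℝ, E) 𝓘(ℝ, E) f z w : E) = w := by
    rintro _ rfl w
    rw [mfderiv_id]
    rfl
  have h2 : ((extChartAt 𝓘(ℝ, E) y).symm : E → E) = id := by
    rw [extChartAt_model_space_eq_id]; rfl
  refine (β.apply_congr (congrFun h2 z) _).trans ?_
  exact congrArg (β z) (funext fun i => h1 _ h2 (v i))

theorem DiffForm.d_vectorSpace (β : DiffForm 𝓘(ℝ, E) E k F) (y : E) (v : Fin (k + 1) → E) :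
    β.d y v = extDeriv (E := E) β y v := by
  rw [DiffForm.d_apply, DiffForm.inChart_vectorSpace]
  rfl

/-- The coordinate expression is the pullback by the inverse chart, a smooth map from a vector
space, and d commutes with it. Thus d, which is defined with a different chart at each point, is
computed in one chart on an open set, as is needed for smoothness of dη and for d ∘ d = 0. -/
theorem DiffForm.inChart_d [IsManifold I ∞ M] [I.Boundaryless] {η : DiffForm I M k F}
    (hη : η.IsSmooth) (x₀ : M) {y : E} (hy : y ∈ (extChartAt I x₀).target) :
    η.d.inChart x₀ y = extDeriv (η.inChart x₀) y := by
  have h1 : ContMDiffAt 𝓘(ℝ, E) I ∞ (extChartAt I x₀).symm y :=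
    (contMDiffOn_extChartAt_symm (n := ∞) x₀).contMDiffAt
      ((isOpen_extChartAt_target x₀).mem_nhds hy)
  have h2 := DiffForm.d_pullback (isSmooth_iff.1 hη ((extChartAt I x₀).symm y)) h1
  ext v
  refine Eq.trans ?_ (DiffForm.d_vectorSpace
    (DiffForm.pullback 𝓘(ℝ, E) (extChartAt I x₀).symm η) y v)
  rw [h2]
  rfl

theorem DiffForm.IsSmooth.d [IsManifold I ∞ M] [I.Boundaryless] {η : DiffForm I M k F}
    (hη : η.IsSmooth) : η.d.IsSmooth := by
  intro x₀
  have h1 : ContDiffOn ℝ ∞ (extDeriv (η.inChart x₀)) (extChartAt I x₀).target := by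
    intro y hy
    have h2 : ContDiffAt ℝ ∞ (fderiv ℝ (η.inChart x₀)) y :=
      ((hη x₀).contDiffAt ((isOpen_extChartAt_target x₀).mem_nhds hy)).fderiv_right (by simp)
    exact (contDiffAt_const.clm_apply h2 : ContDiffAt ℝ ∞ (fun z =>
      ContinuousAlternatingMap.alternatizeUncurryFinCLM ℝ E F (fderiv ℝ (η.inChart x₀) z)) y).contDiffWithinAt
  exact h1.congr fun y hy => DiffForm.inChart_d hη x₀ hy

theorem DiffForm.d_d [IsManifold I ∞ M] [I.Boundaryless] {η : DiffForm I M k F}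
    (hη : η.IsSmooth) (x : M) : η.d.d x = 0 := by
  ext v
  refine (DiffForm.d_apply (E := E) (I := I) η.d x v).trans ?_
  have h1 : η.d.inChart x =ᶠ[𝓝 (extChartAt I x x)] extDeriv (η.inChart x) := by
    filter_upwards [(isOpen_extChartAt_target x).mem_nhds (mem_extChartAt_target x)] with y hy
    exact DiffForm.inChart_d hη x hy
  rw [h1.extDeriv_eq, extDeriv_extDeriv_apply (r := ∞) (isSmooth_iff.1 hη x)
    (by simpa using ENat.LEInfty.out)]
  rfl

/-! Vector fields in charts. -/

/-- The coordinate expression of a vector field in the preferred chart at `x₀`. -/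
def vectorFieldInChart (I : ModelWithCorners ℝ E H) (X : ∀ x : M, TangentSpace I x) (x₀ : M)
    (y : E) : E :=
  mfderiv I 𝓘(ℝ, E) (extChartAt I x₀) ((extChartAt I x₀).symm y) (X ((extChartAt I x₀).symm y))

theorem mfderivWithin_extChartAt_symm_eq [I.Boundaryless] (x₀ : M) (y : E) :
    mfderivWithin 𝓘(ℝ, E) I (extChartAt I x₀).symm (range I) y =
      mfderiv 𝓘(ℝ, E) I (extChartAt I x₀).symm y := by
  rw [I.range_eq_univ, mfderivWithin_univ]

theorem mfderiv_symm_vectorFieldInChart [IsManifold I ∞ M] [I.Boundaryless]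
    (X : ∀ x : M, TangentSpace I x) (x₀ : M) {y : E} (hy : y ∈ (extChartAt I x₀).target) :
    mfderiv 𝓘(ℝ, E) I (extChartAt I x₀).symm y (vectorFieldInChart (E := E) I X x₀ y) =
      X ((extChartAt I x₀).symm y) := by
  have : IsManifold I 1 M := IsManifold.of_le (n := ∞) (by simp)
  have h := mfderivWithin_extChartAt_symm_comp_mfderiv_extChartAt (I := I) hy
  rw [mfderivWithin_extChartAt_symm_eq] at h
  exact congrArg (fun A : E →L[ℝ] E => A (X ((extChartAt I x₀).symm y))) h

theorem mfderiv_extChartAt_comp_symm [IsManifold I ∞ M] [I.Boundaryless]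
    (x₀ : M) {y : E} (hy : y ∈ (extChartAt I x₀).target) (v : E) :
    mfderiv I 𝓘(ℝ, E) (extChartAt I x₀) ((extChartAt I x₀).symm y)
      (mfderiv 𝓘(ℝ, E) I (extChartAt I x₀).symm y v) = v := by
  have : IsManifold I 1 M := IsManifold.of_le (n := ∞) (by simp)
  have h := mfderiv_extChartAt_comp_mfderivWithin_extChartAt_symm (I := I) hy
  rw [mfderivWithin_extChartAt_symm_eq] at h
  exact congrArg (fun A : E →L[ℝ] E => A v) h

theorem mfderiv_extChartAt_symm_self [IsManifold I ∞ M] [I.Boundaryless] (x : M) (v : E) :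
    mfderiv 𝓘(ℝ, E) I (extChartAt I x).symm (extChartAt I x x) v = v := by
  have : IsManifold I 1 M := IsManifold.of_le (n := ∞) (by simp)
  have h := mfderivWithin_range_extChartAt_symm (I := I) (x := x)
  rw [mfderivWithin_extChartAt_symm_eq] at h
  exact congrArg (fun A : E →L[ℝ] E => A v) h

theorem vectorFieldInChart_self [IsManifold I ∞ M] [I.Boundaryless]
    (X : ∀ x : M, TangentSpace I x) (x : M) : vectorFieldInChart I X x (extChartAt I x x) = X x := by
  have h1 := mfderiv_symm_vectorFieldInChart X x (mem_extChartAt_target (I := I) x)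
  have h2 : ∀ z : M, z = x → (X z : E) = X x := by rintro _ rfl; rfl
  exact (mfderiv_extChartAt_symm_self x _).symm.trans
    (h1.trans (h2 _ ((extChartAt I x).left_inv (mem_extChartAt_source x))))

/-- Near x₀ the trivialization of the tangent bundle at x₀ is the derivative of the preferred chart
at x₀, so the fiber component of a section is its coordinate expression. -/
theorem contMDiffAt_vectorField_iff [IsManifold I ∞ M] [I.Boundaryless]
    {X : ∀ x : M, TangentSpace I x} {x₀ : M} :
    ContMDiffAt I I.tangent ∞ (fun x => (⟨x, X x⟩ : TangentBundle I M)) x₀ ↔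
      ContDiffAt ℝ ∞ (vectorFieldInChart I X x₀) (extChartAt I x₀ x₀) := by
  have : IsManifold I 1 M := IsManifold.of_le (n := ∞) (by simp)
  have h0 : ContMDiffAt I I.tangent ∞ (fun x => (⟨x, X x⟩ : TangentBundle I M)) x₀ ↔
      ContMDiffAt I 𝓘(ℝ, E) ∞ (fun x => (trivializationAt E (TangentSpace I) x₀ ⟨x, X x⟩).2) x₀ :=
    Bundle.contMDiffAt_section x₀
  have h1 : (fun x => (trivializationAt E (TangentSpace I) x₀ ⟨x, X x⟩).2) =ᶠ[𝓝 x₀]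
      fun x => (mfderiv I 𝓘(ℝ, E) (extChartAt I x₀) x (X x) : E) := by
    filter_upwards [(chartAt H x₀).open_source.mem_nhds (mem_chart_source H x₀)] with x hx
    have h2 := TangentBundle.continuousLinearMapAt_trivializationAt (I := I) (𝕜 := ℝ) hx
    have h3 : x ∈ (trivializationAt E (TangentSpace I) x₀).baseSet := by
      simpa using hx
    refine Eq.trans ?_ (congrArg (fun A : E →L[ℝ] E => A (X x)) h2)
    exact ((trivializationAt E (TangentSpace I) x₀).continuousLinearMapAt_apply_of_mem ℝ h3 (X x)).symm
  rw [h0, h1.contMDiffAt_iff]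
  have hs : ContMDiffAt 𝓘(ℝ, E) I ∞ (extChartAt I x₀).symm (extChartAt I x₀ x₀) :=
    (contMDiffOn_extChartAt_symm (n := ∞) x₀).contMDiffAt
      ((isOpen_extChartAt_target x₀).mem_nhds (mem_extChartAt_target x₀))
  have hx' : (extChartAt I x₀).symm (extChartAt I x₀ x₀) = x₀ :=
    (extChartAt I x₀).left_inv (mem_extChartAt_source x₀)
  constructor
  · intro h
    exact (ContMDiffAt.comp_of_eq h hs hx').contDiffAt
  · intro h
    have h4 : ContMDiffAt I 𝓘(ℝ, E) ∞ (vectorFieldInChart I X x₀ ∘ extChartAt I x₀) x₀ :=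
      h.contMDiffAt.comp x₀ contMDiffAt_extChartAt
    refine h4.congr_of_eventuallyEq ?_
    filter_upwards [(isOpen_extChartAt_source (I := I) x₀).mem_nhds (mem_extChartAt_source x₀)]
      with x hx
    have h5 : ∀ z : M, z = x → (mfderiv I 𝓘(ℝ, E) (extChartAt I x₀) x (X x) : E) =
      mfderiv I 𝓘(ℝ, E) (extChartAt I x₀) z (X z) := by rintro _ rfl; rfl
    exact h5 _ ((extChartAt I x₀).left_inv hx)

/-- The manifold bracket is the flat bracket of the fields pulled back along the inverse chart. At
the center of the chart the derivative is the identity, so the two values agree without a change of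
basis. -/
theorem mlieBracket_eq_lieBracket_inChart [IsManifold I ∞ M] [I.Boundaryless]
    (X Y : ∀ x : M, TangentSpace I x) (x : M) :
    (VectorField.mlieBracket I X Y x : E) = VectorField.lieBracket ℝ (vectorFieldInChart I X x)
      (vectorFieldInChart I Y x) (extChartAt I x x) := by
  have : IsManifold I 1 M := IsManifold.of_le (n := ∞) (by simp)
  rw [← VectorField.mlieBracketWithin_univ, VectorField.mlieBracketWithin_apply]
  have h0 : (mfderiv I 𝓘(ℝ, E) (extChartAt I x) x : E →L[ℝ] E) = ContinuousLinearMap.id ℝ E :=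
    mfderiv_extChartAt_self
  have h3 : ∀ A : E →L[ℝ] E, A = ContinuousLinearMap.id ℝ E → ∀ w, A.inverse w = w := by
    rintro _ rfl w
    rw [ContinuousLinearMap.inverse_id]
    rfl
  refine (h3 _ h0 _).trans ?_
  rw [preimage_univ, univ_inter]
  have h1 : ∀ Z : (∀ x : M, TangentSpace I x),
      VectorField.mpullbackWithin 𝓘(ℝ, E) I (extChartAt I x).symm Z (range I)
        =ᶠ[𝓝 (extChartAt I x x)] vectorFieldInChart I Z x := by
    intro Z
    filter_upwards [(isOpen_extChartAt_target x).mem_nhds (mem_extChartAt_target x)] with y hy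
    rw [VectorField.mpullbackWithin_apply, ContinuousLinearMap.inverse_eq
      (mfderivWithin_extChartAt_symm_comp_mfderiv_extChartAt (I := I) hy)
      (mfderiv_extChartAt_comp_mfderivWithin_extChartAt_symm (I := I) hy)]
    rfl
  have h2 := Filter.EventuallyEq.lieBracket_vectorField_eq (𝕜 := ℝ) (E := E) (h1 X) (h1 Y)
  have h4 : ∀ U V : E → E, VectorField.lieBracketWithin ℝ U V univ (extChartAt I x x) =
      VectorField.lieBracket ℝ U V (extChartAt I x x) := fun U V => by
    rw [VectorField.lieBracketWithin_univ]
  rw [I.range_eq_univ] at h2 ⊢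
  exact (h4 _ _).trans h2

end ChartCalculus

/-! ### Contraction with a two-form and openness of nondegeneracy -/

section Contraction

variable {E H : Type*} [NormedAddCommGroup E] [NormedSpace ℝ E] [TopologicalSpace H]
  {I : ModelWithCorners ℝ E H} {M : Type*} [TopologicalSpace M] [ChartedSpace H M]

/-- The value of a `2`-form as a bilinear map on the model space. -/
def DiffForm.bilin (η : DiffForm I M 2 ℝ) (x : M) : E →L[ℝ] E →L[ℝ] ℝ :=
  toBilin (E := E) (η x)

theorem DiffForm.bilin_apply (η : DiffForm I M 2 ℝ) (x : M) (v w : E) :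
    η.bilin x v w = η x ![v, w] := toBilin_apply (E := E) (η x) v w

theorem DiffForm.bilin_swap (η : DiffForm I M 2 ℝ) (x : M) (v w : E) :
    η.bilin x v w = -η.bilin x w v := toBilin_swap (E := E) (η x) v w

theorem DiffForm.bilin_self (η : DiffForm I M 2 ℝ) (x : M) (v : E) : η.bilin x v v = 0 := by
  have := η.bilin_swap x v v
  linarith

theorem DiffForm.nondegenerateAt_iff {η : DiffForm I M 2 ℝ} {x : M} :
    η.NondegenerateAt x ↔ Function.Injective (η.bilin x) := by
  rw [injective_iff_map_eq_zero]
  constructor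
  · intro h v hv
    exact h v fun w => (η.bilin_apply x v w).symm.trans (congrArg (fun A : E →L[ℝ] ℝ => A w) hv)
  · intro h v hv
    refine h v (ContinuousLinearMap.ext fun w => ?_)
    exact (η.bilin_apply x v w).trans (hv w)

theorem DiffForm.toBilin_inChart_apply (η : DiffForm I M 2 ℝ) (x₀ : M) (y v w : E) :
    toBilin (η.inChart x₀ y) v w = η.bilin ((extChartAt I x₀).symm y)
      (mfderiv 𝓘(ℝ, E) I (extChartAt I x₀).symm y v)
      (mfderiv 𝓘(ℝ, E) I (extChartAt I x₀).symm y w) := by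
  rw [toBilin_apply, DiffForm.inChart_apply]
  refine Eq.trans ?_ (toBilin_apply (E := E) (η ((extChartAt I x₀).symm y)) _ _).symm
  refine congrArg (fun u : Fin 2 → E => η ((extChartAt I x₀).symm y) u) ?_
  funext i; fin_cases i <;> rfl

/-- The coordinate expression of a covector field. -/
def CovectorField.inChart (α : CovectorField I M) (x₀ : M) (y : E) : E →L[ℝ] ℝ :=
  (show E →L[ℝ] ℝ from α ((extChartAt I x₀).symm y)) ∘L
    (show E →L[ℝ] E from mfderiv 𝓘(ℝ, E) I (extChartAt I x₀).symm y)

theorem CovectorField.inChart_apply (α : CovectorField I M) (x₀ : M) (y v : E) :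
    α.inChart x₀ y v = α ((extChartAt I x₀).symm y)
      (mfderiv 𝓘(ℝ, E) I (extChartAt I x₀).symm y v) := rfl

theorem CovectorField.toForm_inChart (α : CovectorField I M) (x₀ : M) :
    α.toForm.inChart x₀ = fun y => oneForm (α.inChart x₀ y) := rfl

theorem CovectorField.contDiffAt_inChart [IsManifold I ∞ M] [I.Boundaryless] {α : CovectorField I M}
    (hα : α.toForm.IsSmooth) (x : M) :
    ContDiffAt ℝ ∞ (α.inChart x) (extChartAt I x x) :=
  contDiffAt_of_oneForm ((DiffForm.isSmooth_iff.1 hα x : _))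

theorem CovectorField.inChart_vectorField [IsManifold I ∞ M] [I.Boundaryless]
    (α : CovectorField I M) (X : ∀ x : M, TangentSpace I x) (x₀ : M)
    {y : E} (hy : y ∈ (extChartAt I x₀).target) :
    α.inChart x₀ y (vectorFieldInChart I X x₀ y) =
      α ((extChartAt I x₀).symm y) (X ((extChartAt I x₀).symm y)) := by
  rw [CovectorField.inChart_apply]
  exact congrArg (α ((extChartAt I x₀).symm y)) (mfderiv_symm_vectorFieldInChart X x₀ hy)

theorem DiffForm.toBilin_inChart_vectorField [IsManifold I ∞ M] [I.Boundaryless]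
    (η : DiffForm I M 2 ℝ) (X : ∀ x : M, TangentSpace I x) (α : CovectorField I M)
    (h : ∀ x (w : E), η.bilin x (X x) w = α x w) (x₀ : M)
    {y : E} (hy : y ∈ (extChartAt I x₀).target) :
    toBilin (η.inChart x₀ y) (vectorFieldInChart I X x₀ y) = α.inChart x₀ y := by
  ext w
  rw [DiffForm.toBilin_inChart_apply, CovectorField.inChart_apply]
  refine Eq.trans ?_ (h _ _)
  exact congrArg (fun u : E => η.bilin ((extChartAt I x₀).symm y) u
    (mfderiv 𝓘(ℝ, E) I (extChartAt I x₀).symm y w)) (mfderiv_symm_vectorFieldInChart X x₀ hy)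

theorem DiffForm.nondegenerateAt_iff_inChart [IsManifold I ∞ M] [I.Boundaryless]
    (η : DiffForm I M 2 ℝ) (x₀ : M) {y : E} (hy : y ∈ (extChartAt I x₀).target) :
    η.NondegenerateAt ((extChartAt I x₀).symm y) ↔
      Function.Injective (toBilin (η.inChart x₀ y)) := by
  have h1 : ∀ v : E, mfderiv 𝓘(ℝ, E) I (extChartAt I x₀).symm y
      (mfderiv I 𝓘(ℝ, E) (extChartAt I x₀) ((extChartAt I x₀).symm y) v) = v := fun v => by
    have h := mfderiv_symm_vectorFieldInChart (I := I) (M := M) (fun _ => v) x₀ hy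
    exact h
  rw [DiffForm.nondegenerateAt_iff, injective_iff_map_eq_zero, injective_iff_map_eq_zero]
  constructor
  · intro h v hv
    have h2 : η.bilin ((extChartAt I x₀).symm y)
        (mfderiv 𝓘(ℝ, E) I (extChartAt I x₀).symm y v) = 0 := by
      ext w
      have h3 := congrArg (fun A : E →L[ℝ] ℝ =>
        A (mfderiv I 𝓘(ℝ, E) (extChartAt I x₀) ((extChartAt I x₀).symm y) w)) hv
      have h4 := (η.toBilin_inChart_apply x₀ y v _).symm.trans h3
      refine Eq.trans ?_ h4
      exact congrArg _ (h1 w).symm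
    have h5 := h _ h2
    have h6 := mfderiv_extChartAt_comp_symm (I := I) x₀ hy v
    rw [← h6]
    exact (congrArg (fun u : E => (mfderiv I 𝓘(ℝ, E) (extChartAt I x₀)
      ((extChartAt I x₀).symm y) u : E)) h5).trans (ContinuousLinearMap.map_zero _)
  · intro h v hv
    have h2 := h (mfderiv I 𝓘(ℝ, E) (extChartAt I x₀) ((extChartAt I x₀).symm y) v) (by
      ext w
      refine (η.toBilin_inChart_apply x₀ y _ w).trans ?_
      refine (congrArg (fun u : E => η.bilin ((extChartAt I x₀).symm y) u
        (mfderiv 𝓘(ℝ, E) I (extChartAt I x₀).symm y w)) (h1 v)).trans ?_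
      exact congrArg (fun A : E →L[ℝ] ℝ => A _) hv)
    refine (h1 v).symm.trans ?_
    exact (congrArg (fun u : E => (mfderiv 𝓘(ℝ, E) I (extChartAt I x₀).symm y u : E)) h2).trans
      (ContinuousLinearMap.map_zero _)

variable [FiniteDimensional ℝ E]

theorem exists_equiv_of_injective_bilin {B : E →L[ℝ] E →L[ℝ] ℝ} (hB : Function.Injective B) :
    ∃ e : E ≃L[ℝ] (E →L[ℝ] ℝ), (e : E →L[ℝ] E →L[ℝ] ℝ) = B := by
  have h1 : Module.finrank ℝ (E →L[ℝ] ℝ) = Module.finrank ℝ E :=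
    (LinearMap.toContinuousLinearMap (𝕜 := ℝ) (E := E) (F' := ℝ)).finrank_eq.symm.trans
      (Subspace.dual_finrank_eq)
  have : FiniteDimensional ℝ (E →L[ℝ] ℝ) :=
    (LinearMap.toContinuousLinearMap (𝕜 := ℝ) (E := E) (F' := ℝ)).finiteDimensional
  let e := (LinearMap.linearEquivOfInjective (B : E →ₗ[ℝ] (E →L[ℝ] ℝ)) hB h1.symm)
  refine ⟨e.toContinuousLinearEquiv, ?_⟩
  ext v w
  rfl

/-- In finite dimension a nondegenerate form is an invertible operator E → E^*, and the invertible
operators form an open set. -/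
theorem DiffForm.isOpen_nondegenerateAt [IsManifold I ∞ M] [I.Boundaryless]
    {η : DiffForm I M 2 ℝ} (hη : η.IsSmooth) : IsOpen {x | η.NondegenerateAt x} := by
  have : CompleteSpace E := FiniteDimensional.complete ℝ E
  rw [isOpen_iff_mem_nhds]
  intro x₀ hx₀
  have hx' : (extChartAt I x₀).symm (extChartAt I x₀ x₀) = x₀ :=
    (extChartAt I x₀).left_inv (mem_extChartAt_source x₀)
  have h0 : Function.Injective (toBilin (η.inChart x₀ (extChartAt I x₀ x₀))) :=
    (η.nondegenerateAt_iff_inChart x₀ (mem_extChartAt_target x₀)).1 (by rw [hx']; exact hx₀)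
  obtain ⟨e, he⟩ := exists_equiv_of_injective_bilin h0
  have h1 : ContinuousAt (fun y => toBilin (η.inChart x₀ y)) (extChartAt I x₀ x₀) :=
    (contDiffAt_toBilin (DiffForm.isSmooth_iff.1 hη x₀)).continuousAt
  have h2 : ∀ᶠ y in 𝓝 (extChartAt I x₀ x₀), Function.Injective (toBilin (η.inChart x₀ y)) := by
    have h3 := ContinuousLinearEquiv.nhds e
    rw [he] at h3
    filter_upwards [h1 h3] with y ⟨e', he'⟩
    have he2 : (e' : E →L[ℝ] E →L[ℝ] ℝ) = toBilin (η.inChart x₀ y) := he'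
    rw [← he2]
    exact e'.injective
  have h4 : ContinuousAt (extChartAt I x₀) x₀ := continuousAt_extChartAt x₀
  filter_upwards [h4.eventually h2, (isOpen_extChartAt_source (I := I) x₀).mem_nhds
    (mem_extChartAt_source x₀)] with x hx hxs
  have := (η.nondegenerateAt_iff_inChart x₀ ((extChartAt I x₀).map_source hxs)).2 hx
  rwa [(extChartAt I x₀).left_inv hxs] at this

/-- The vector field that corresponds to a smooth `1`-form under a nondegenerate smooth `2`-form is
smooth. -/
theorem contMDiff_vectorField_of_contraction [IsManifold I ∞ M] [I.Boundaryless]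
    {η : DiffForm I M 2 ℝ} (hη : η.IsSmooth) (hnd : ∀ x, η.NondegenerateAt x)
    {α : CovectorField I M} (hα : α.toForm.IsSmooth) {X : ∀ x : M, TangentSpace I x}
    (h : ∀ x (w : E), η.bilin x (X x) w = α x w) :
    ContMDiff I I.tangent ∞ (fun x => (⟨x, X x⟩ : TangentBundle I M)) := by
  have : CompleteSpace E := FiniteDimensional.complete ℝ E
  intro x₀
  rw [contMDiffAt_vectorField_iff]
  have h0 : Function.Injective (toBilin (η.inChart x₀ (extChartAt I x₀ x₀))) :=
    (η.nondegenerateAt_iff_inChart x₀ (mem_extChartAt_target x₀)).1 (hnd _)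
  obtain ⟨e, he⟩ := exists_equiv_of_injective_bilin h0
  have h1 : ContDiffAt ℝ ∞ (fun y => toBilin (η.inChart x₀ y)) (extChartAt I x₀ x₀) :=
    contDiffAt_toBilin (DiffForm.isSmooth_iff.1 hη x₀)
  -- Inversion of operators is smooth near an invertible one; the coordinates of X are this inverse
  -- applied to those of α.
  have h2 : ContDiffAt ℝ ∞ (fun y => (toBilin (η.inChart x₀ y)).inverse) (extChartAt I x₀ x₀) := by
    have h3 := contDiffAt_map_inverse (n := ∞) e
    rw [he] at h3
    exact ContDiffAt.comp (f := fun y => toBilin (η.inChart x₀ y)) _ h3 h1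
  refine (h2.clm_apply (CovectorField.contDiffAt_inChart hα x₀)).congr_of_eventuallyEq ?_
  filter_upwards [(isOpen_extChartAt_target (I := I) x₀).mem_nhds (mem_extChartAt_target x₀)]
    with y hy
  obtain ⟨e', he'⟩ := exists_equiv_of_injective_bilin
    ((η.nondegenerateAt_iff_inChart x₀ hy).1 (hnd _))
  rw [← η.toBilin_inChart_vectorField X α h x₀ hy, ← he', ContinuousLinearMap.inverse_equiv]
  exact (e'.symm_apply_apply _).symm

end Contraction

/-! ### Lie brackets, closed two-forms and the Jacobi identity -/

section Brackets

variable {E H : Type*} [NormedAddCommGroup E] [NormedSpace ℝ E] [TopologicalSpace H]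
  {I : ModelWithCorners ℝ E H} {M : Type*} [TopologicalSpace M] [ChartedSpace H M]
  [IsManifold I ∞ M] [I.Boundaryless]

theorem mvfderiv_apply_eq_fderiv {f : M → ℝ} {x₀ : M} {y : E} (hy : y ∈ (extChartAt I x₀).target)
    (hf : MDifferentiableAt I 𝓘(ℝ, ℝ) f ((extChartAt I x₀).symm y)) (w : E) :
    mvfderiv I f ((extChartAt I x₀).symm y) (mfderiv 𝓘(ℝ, E) I (extChartAt I x₀).symm y w) =
      fderiv ℝ (f ∘ (extChartAt I x₀).symm) y w := by
  have h := mfderiv_comp y hf (mdifferentiableAt_extChartAt_symm (I := I) hy)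
  rw [← mfderiv_eq_fderiv]
  exact (congrArg (fun A : E →L[ℝ] ℝ => A w) h).symm

theorem mvfderiv_eq_fderiv_self {f : M → ℝ} {x : M} (hf : MDifferentiableAt I 𝓘(ℝ, ℝ) f x)
    (w : E) :
    mvfderiv I f x w = fderiv ℝ (f ∘ (extChartAt I x).symm) (extChartAt I x x) w := by
  refine (congrArg (fun A : E →L[ℝ] ℝ => A w) hf.mfderiv).trans ?_
  rw [I.range_eq_univ, fderivWithin_univ]
  rfl

variable (I) in
/-- The differential of a function as a covector field. -/
def differential (f : M → ℝ) : CovectorField I M := fun x => mvfderiv I f x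

theorem differential_inChart {f : M → ℝ} (hf : ContMDiff I 𝓘(ℝ, ℝ) ∞ f) (x₀ : M)
    {y : E} (hy : y ∈ (extChartAt I x₀).target) :
    (differential I f).inChart x₀ y = fderiv ℝ (f ∘ (extChartAt I x₀).symm) y := by
  ext w
  exact mvfderiv_apply_eq_fderiv hy ((hf _).mdifferentiableAt (by simp)) w

theorem contDiffOn_comp_extChartAt_symm {f : M → ℝ} (hf : ContMDiff I 𝓘(ℝ, ℝ) ∞ f) (x₀ : M) :
    ContDiffOn ℝ ∞ (f ∘ (extChartAt I x₀).symm) (extChartAt I x₀).target :=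
  (hf.comp_contMDiffOn (contMDiffOn_extChartAt_symm (n := ∞) x₀)).contDiffOn

theorem contDiffAt_comp_extChartAt_symm {f : M → ℝ} (hf : ContMDiff I 𝓘(ℝ, ℝ) ∞ f) (x : M) :
    ContDiffAt ℝ ∞ (f ∘ (extChartAt I x).symm) (extChartAt I x x) :=
  (contDiffOn_comp_extChartAt_symm hf x).contDiffAt
    ((isOpen_extChartAt_target x).mem_nhds (mem_extChartAt_target x))

theorem differential_isSmooth {f : M → ℝ} (hf : ContMDiff I 𝓘(ℝ, ℝ) ∞ f) :
    (differential I f).toForm.IsSmooth := by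
  intro x₀ y hy
  have hy' := (isOpen_extChartAt_target (I := I) x₀).mem_nhds hy
  have h1 : ContDiffAt ℝ ∞ (fderiv ℝ (f ∘ (extChartAt I x₀).symm)) y :=
    ((contDiffOn_comp_extChartAt_symm hf x₀).contDiffAt hy').fderiv_right (by simp)
  refine ((contDiffAt_oneForm h1).congr_of_eventuallyEq ?_).contDiffWithinAt
  filter_upwards [hy'] with z hz
  rw [CovectorField.toForm_inChart]
  exact congrArg oneForm (differential_inChart hf x₀ hz)

theorem CovectorField.d_toForm_apply (α : CovectorField I M) (x : M)
    (hα : DifferentiableAt ℝ (α.inChart x) (extChartAt I x x)) (v w : E) :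
    α.toForm.d x ![v, w] = fderiv ℝ (α.inChart x) (extChartAt I x x) v w
      - fderiv ℝ (α.inChart x) (extChartAt I x x) w v := by
  rw [← extDeriv_oneForm hα]
  exact DiffForm.d_apply (E := E) (I := I) α.toForm x ![v, w]

theorem d_differential {f : M → ℝ} (hf : ContMDiff I 𝓘(ℝ, ℝ) ∞ f) (x : M) (v w : E) :
    (differential I f).toForm.d x ![v, w] = 0 := by
  have h1 : (differential I f).inChart x =ᶠ[𝓝 (extChartAt I x x)]
      fderiv ℝ (f ∘ (extChartAt I x).symm) := by
    filter_upwards [(isOpen_extChartAt_target (I := I) x).mem_nhds (mem_extChartAt_target x)]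
      with y hy using differential_inChart hf x hy
  have h2 := contDiffAt_comp_extChartAt_symm hf x
  have h3 : DifferentiableAt ℝ (fderiv ℝ (f ∘ (extChartAt I x).symm)) (extChartAt I x x) :=
    (h2.fderiv_right (m := ∞) (by simp)).differentiableAt (by simp)
  rw [CovectorField.d_toForm_apply _ _ (h1.differentiableAt_iff.2 h3), h1.fderiv_eq,
    (h2.isSymmSndFDerivAt (by simpa using ENat.LEInfty.out)) v w, sub_self]

theorem contMDiff_covector_apply {α : CovectorField I M} (hα : α.toForm.IsSmooth)
    {X : ∀ x : M, TangentSpace I x}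
    (hX : ContMDiff I I.tangent ∞ (fun x => (⟨x, X x⟩ : TangentBundle I M))) :
    ContMDiff I 𝓘(ℝ, ℝ) ∞ (fun x => α x (X x)) := by
  intro x₀
  have h1 : ContDiffAt ℝ ∞ (fun y => α.inChart x₀ y (vectorFieldInChart I X x₀ y))
      (extChartAt I x₀ x₀) :=
    (CovectorField.contDiffAt_inChart hα x₀).clm_apply (contMDiffAt_vectorField_iff.1 (hX x₀))
  refine (h1.contMDiffAt.comp x₀ contMDiffAt_extChartAt).congr_of_eventuallyEq ?_
  filter_upwards [(isOpen_extChartAt_source (I := I) x₀).mem_nhds (mem_extChartAt_source x₀)]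
    with x hx
  rw [Function.comp_apply, α.inChart_vectorField X x₀ ((extChartAt I x₀).map_source hx),
    (extChartAt I x₀).left_inv hx]

/-- For a closed `2`-form `η` the contraction with a Lie bracket is
`i_{[X, Y]} η = i_X d(i_Y η) - i_Y d(i_X η) - d(η(X, Y))`. -/
theorem bilin_mlieBracket {η : DiffForm I M 2 ℝ} (hη : η.IsSmooth) {x : M} (hd : η.d x = 0)
    {X Y : ∀ x : M, TangentSpace I x}
    (hX : ContMDiff I I.tangent ∞ (fun x => (⟨x, X x⟩ : TangentBundle I M)))
    (hY : ContMDiff I I.tangent ∞ (fun x => (⟨x, Y x⟩ : TangentBundle I M)))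
    {α β : CovectorField I M} (hα : α.toForm.IsSmooth)
    (hαX : ∀ x (w : E), η.bilin x (X x) w = α x w) (hβY : ∀ x (w : E), η.bilin x (Y x) w = β x w)
    (w : E) :
    η.bilin x (VectorField.mlieBracket I X Y x) w =
      β.toForm.d x ![X x, w] - α.toForm.d x ![Y x, w] - mvfderiv I (fun y => α y (Y y)) x w := by
  have ht := (isOpen_extChartAt_target (I := I) x).mem_nhds (mem_extChartAt_target x)
  have hU := contMDiffAt_vectorField_iff.1 (hX x)
  have hV := contMDiffAt_vectorField_iff.1 (hY x)
  have hη' := DiffForm.isSmooth_iff.1 hη x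
  have hd' : extDeriv (η.inChart x) (extChartAt I x x) = 0 := by
    ext v
    exact (DiffForm.d_apply (E := E) (I := I) η x v).symm.trans
      (congrArg (fun A : E [⋀^Fin (2 + 1)]→L[ℝ] ℝ => A v) hd)
  have key := toBilin_lieBracket (ContDiffAt.of_le hη' (by simp)) hd'
    (hU.differentiableAt (by simp)) (hV.differentiableAt (by simp)) w
  have ea : ∀ {Z : ∀ x : M, TangentSpace I x} {γ : CovectorField I M},
      (∀ x (w : E), η.bilin x (Z x) w = γ x w) →
      (fun y => toBilin (η.inChart x y) (vectorFieldInChart I Z x y))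
        =ᶠ[𝓝 (extChartAt I x x)] γ.inChart x := by
    intro Z γ h
    filter_upwards [ht] with y hy using η.toBilin_inChart_vectorField Z γ h x hy
  have e1 : (fun y => oneForm (toBilin (η.inChart x y) (vectorFieldInChart I Y x y)))
      =ᶠ[𝓝 (extChartAt I x x)] fun y => oneForm (β.inChart x y) :=
    (ea hβY).fun_comp oneForm
  have e2 : (fun y => oneForm (toBilin (η.inChart x y) (vectorFieldInChart I X x y)))
      =ᶠ[𝓝 (extChartAt I x x)] fun y => oneForm (α.inChart x y) :=
    (ea hαX).fun_comp oneForm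
  have e3 : (fun y => toBilin (η.inChart x y) (vectorFieldInChart I X x y)
        (vectorFieldInChart I Y x y)) =ᶠ[𝓝 (extChartAt I x x)]
      (fun y => α y (Y y)) ∘ (extChartAt I x).symm := by
    filter_upwards [ht] with y hy
    rw [η.toBilin_inChart_vectorField X α hαX x hy, α.inChart_vectorField Y x hy]
    rfl
  rw [e1.extDeriv_eq, e2.extDeriv_eq, e3.fderiv_eq,
    ← mvfderiv_eq_fderiv_self ((contMDiff_covector_apply hα hY x).mdifferentiableAt (by simp)),
    vectorFieldInChart_self, vectorFieldInChart_self] at key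
  refine Eq.trans ?_ (key.trans ?_)
  · have h4 := η.toBilin_inChart_apply x (extChartAt I x x)
      (VectorField.lieBracket ℝ (vectorFieldInChart I X x)
        (vectorFieldInChart I Y x) (extChartAt I x x)) w
    refine Eq.trans ?_ h4.symm
    have h5 : ∀ (z : M) (hz : z = x) (a b : E), η.bilin z a b = η.bilin x a b := by
      rintro _ rfl a b; rfl
    refine Eq.trans ?_ (h5 _ ((extChartAt I x).left_inv (mem_extChartAt_source x)) _ _).symm
    exact congrArg₂ (fun a b : E => η.bilin x a b)
      ((mlieBracket_eq_lieBracket_inChart X Y x).trans (mfderiv_extChartAt_symm_self x _).symm)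
      (mfderiv_extChartAt_symm_self x _).symm
  · refine congrArg₂ (fun a b : ℝ => a - b - _) ?_ ?_
    · exact (DiffForm.d_apply (E := E) (I := I) β.toForm x _).symm
    · exact (DiffForm.d_apply (E := E) (I := I) α.toForm x _).symm

theorem mvfderiv_mlieBracket {h : M → ℝ} (hh : ContMDiff I 𝓘(ℝ, ℝ) ∞ h)
    {X Y : ∀ x : M, TangentSpace I x}
    (hX : ContMDiff I I.tangent ∞ (fun x => (⟨x, X x⟩ : TangentBundle I M)))
    (hY : ContMDiff I I.tangent ∞ (fun x => (⟨x, Y x⟩ : TangentBundle I M))) (x : M) :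
    mvfderiv I h x (VectorField.mlieBracket I X Y x) =
      mvfderiv I (fun y => mvfderiv I h y (Y y)) x (X x)
        - mvfderiv I (fun y => mvfderiv I h y (X y)) x (Y x) := by
  have ht := (isOpen_extChartAt_target (I := I) x).mem_nhds (mem_extChartAt_target x)
  have hU := contMDiffAt_vectorField_iff.1 (hX x)
  have hV := contMDiffAt_vectorField_iff.1 (hY x)
  have key := fderiv_lieBracket ((contDiffAt_comp_extChartAt_symm hh x).of_le
    (by simpa using ENat.LEInfty.out)) (hU.differentiableAt (by simp)) (hV.differentiableAt (by simp))
  have e : ∀ Z : (∀ x : M, TangentSpace I x), 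
      (fun y => fderiv ℝ (h ∘ (extChartAt I x).symm) y (vectorFieldInChart I Z x y))
        =ᶠ[𝓝 (extChartAt I x x)] (fun y => mvfderiv I h y (Z y)) ∘ (extChartAt I x).symm := by
    intro Z
    filter_upwards [ht] with y hy
    rw [← differential_inChart hh x hy, CovectorField.inChart_vectorField _ Z x hy]
    rfl
  have hs := fun {Z : ∀ x : M, TangentSpace I x} 
    (hZ : ContMDiff I I.tangent ∞ (fun x => (⟨x, Z x⟩ : TangentBundle I M))) =>
    (contMDiff_covector_apply (differential_isSmooth hh) hZ x).mdifferentiableAt (by simp)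
  rw [(e Y).fderiv_eq, (e X).fderiv_eq, vectorFieldInChart_self, vectorFieldInChart_self] at key
  refine (mvfderiv_eq_fderiv_self ((hh x).mdifferentiableAt (by simp)) _).trans ?_
  refine (congrArg (fun u : E => fderiv ℝ (h ∘ (extChartAt I x).symm) (extChartAt I x x) u)
    (mlieBracket_eq_lieBracket_inChart X Y x)).trans (key.trans ?_)
  exact congrArg₂ (fun a b : ℝ => a - b) (mvfderiv_eq_fderiv_self (hs hY) _).symm
    (mvfderiv_eq_fderiv_self (hs hX) _).symm

/-- The Jacobi identity for the brackets `{f, g} = dg(X_f)`, `i_{X_f} η = df`, of a closed form. -/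
theorem jacobi_of_contraction {η : DiffForm I M 2 ℝ} (hη : η.IsSmooth) {x : M} (hd : η.d x = 0)
    {f g h : M → ℝ} (hf : ContMDiff I 𝓘(ℝ, ℝ) ∞ f) (hg : ContMDiff I 𝓘(ℝ, ℝ) ∞ g)
    (hh : ContMDiff I 𝓘(ℝ, ℝ) ∞ h) {X Y Z : ∀ x : M, TangentSpace I x}
    (hX : ContMDiff I I.tangent ∞ (fun x => (⟨x, X x⟩ : TangentBundle I M)))
    (hY : ContMDiff I I.tangent ∞ (fun x => (⟨x, Y x⟩ : TangentBundle I M)))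
    (hfX : ∀ x (w : E), η.bilin x (X x) w = mvfderiv I f x w)
    (hgY : ∀ x (w : E), η.bilin x (Y x) w = mvfderiv I g x w)
    (hhZ : ∀ x (w : E), η.bilin x (Z x) w = mvfderiv I h x w) :
    mvfderiv I (fun y => mvfderiv I h y (Y y)) x (X x)
      + mvfderiv I (fun y => mvfderiv I f y (Z y)) x (Y x)
      + mvfderiv I (fun y => mvfderiv I g y (X y)) x (Z x) = 0 := by
  -- The contraction of η with [X, Y] is evaluated on Z. Since df and dg are closed, only the
  -- derivative of df(Y) along Z remains. By antisymmetry the same number is -dh([X, Y]), which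
  -- expands into two iterated derivatives. Comparing the two gives the three cyclic terms.
  have h1 := bilin_mlieBracket hη hd hX hY (differential_isSmooth hf)
    hfX hgY (Z x)
  have h1' := h1.trans (congrArg₂ (fun a b : ℝ => a - b
    - mvfderiv I (fun y => differential I f y (Y y)) x (Z x))
    (d_differential hg x (X x) (Z x)) (d_differential hf x (Y x) (Z x)))
  have h2 := η.bilin_swap x (VectorField.mlieBracket I X Y x) (Z x)
  replace h2 := h2.trans (congrArg (fun a : ℝ => -a)
    ((hhZ x _).trans (mvfderiv_mlieBracket hh hX hY x)))
  have hn : ∀ a b : M → ℝ, (∀ y, a y = -b y) → ∀ w : E, mvfderiv I a x w = -mvfderiv I b x w := by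
    intro a b hab w
    have : a = -b := funext hab
    rw [this]
    exact congrArg (fun A : E →L[ℝ] ℝ => A w) (mfderiv_neg (f := b) (x := x))
  have h3 := hn (fun y => mvfderiv I h y (X y)) (fun y => mvfderiv I f y (Z y)) (fun y => by
    exact (hhZ y _).symm.trans ((η.bilin_swap y _ _).trans (congrArg _ (hfX y _)))) (Y x)
  have h4 := hn (fun y => differential I f y (Y y)) (fun y => mvfderiv I g y (X y)) (fun y => by
    exact (hfX y _).symm.trans ((η.bilin_swap y _ _).trans (congrArg _ (hgY y _)))) (Z x)
  simp only [sub_self, zero_sub] at h1'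
  linarith [h1', h2, h3, h4]

end Brackets

/-! ### Derivatives between model spaces, curves and open subsets -/

section ModelDerivative

variable {E H : Type*} [NormedAddCommGroup E] [NormedSpace ℝ E] [TopologicalSpace H]
  {I : ModelWithCorners ℝ E H} {M : Type*} [TopologicalSpace M] [ChartedSpace H M]
  {E' H' : Type*} [NormedAddCommGroup E'] [NormedSpace ℝ E'] [TopologicalSpace H']
  {I' : ModelWithCorners ℝ E' H'} {M' : Type*} [TopologicalSpace M'] [ChartedSpace H' M']
  {E'' H'' : Type*} [NormedAddCommGroup E''] [NormedSpace ℝ E''] [TopologicalSpace H'']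
  {I'' : ModelWithCorners ℝ E'' H''} {M'' : Type*} [TopologicalSpace M''] [ChartedSpace H'' M'']

variable (I I') in
/-- The derivative of a map between manifolds, as a linear map between the model spaces. -/
def mderiv (f : M → M') (x : M) : E →L[ℝ] E' := mfderiv I I' f x

theorem mderiv_comp {g : M' → M''} {f : M → M'} (x : M) (hg : MDifferentiableAt I' I'' g (f x))
    (hf : MDifferentiableAt I I' f x) :
    mderiv I I'' (fun y => g (f y)) x = (mderiv I' I'' g (f x)).comp (mderiv I I' f x) :=
  mfderiv_comp x hg hf

theorem mderiv_comp_of_eq {g : M' → M''} {f : M → M'} {x : M} {y : M'}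
    (hg : MDifferentiableAt I' I'' g y) (hf : MDifferentiableAt I I' f x) (hy : f x = y) :
    mderiv I I'' (fun y => g (f y)) x = (mderiv I' I'' g y).comp (mderiv I I' f x) := by
  subst hy
  exact mderiv_comp x hg hf

theorem mderiv_id (x : M) : mderiv I I (fun y : M => y) x = ContinuousLinearMap.id ℝ E :=
  mfderiv_id

theorem mderiv_const (c : M') (x : M) : mderiv I I' (fun _ : M => c) x = 0 :=
  mfderiv_const

theorem mderiv_congr {f g : M → M'} {x : M} (h : f =ᶠ[𝓝 x] g) :
    mderiv I I' f x = mderiv I I' g x :=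
  h.mfderiv_eq

theorem mderiv_prodMk {f : M → M'} {g : M → M''} {x : M} (hf : MDifferentiableAt I I' f x)
    (hg : MDifferentiableAt I I'' g x) :
    mderiv I (I'.prod I'') (fun y => (f y, g y)) x = (mderiv I I' f x).prod (mderiv I I'' g x) :=
  mfderiv_prodMk hf hg

theorem mderiv_fst (x : M × M') :
    mderiv (I.prod I') I Prod.fst x = ContinuousLinearMap.fst ℝ E E' :=
  mfderiv_fst

theorem mderiv_snd (x : M × M') :
    mderiv (I.prod I') I' Prod.snd x = ContinuousLinearMap.snd ℝ E E' :=
  mfderiv_snd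

theorem mderiv_eq_fderiv {f : E → E'} {x : E} : mderiv 𝓘(ℝ, E) 𝓘(ℝ, E') f x = fderiv ℝ f x :=
  mfderiv_eq_fderiv

theorem pullback_bilin (f : M → M') (η : DiffForm I' M' 2 ℝ) (x : M) (v w : E) :
    (DiffForm.pullback I f η).bilin x v w =
      η.bilin (f x) (mderiv I I' f x v) (mderiv I I' f x w) := by
  refine (DiffForm.bilin_apply _ x v w).trans (Eq.trans ?_ (DiffForm.bilin_apply _ _ _ _).symm)
  rw [DiffForm.pullback_apply]
  congr 1
  funext i
  fin_cases i <;> rfl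

theorem form_ext_of_bilin {η ζ : DiffForm I M 2 ℝ} {x : M}
    (h : ∀ v w : E, η.bilin x v w = ζ.bilin x v w) : η x = ζ x := by
  ext v
  have hv : v = ![v 0, v 1] := by
    funext i
    fin_cases i <;> rfl
  rw [hv]
  exact (DiffForm.bilin_apply η x _ _).symm.trans ((h _ _).trans (DiffForm.bilin_apply ζ x _ _))

theorem velocity_eq_iff {γ : ℝ → M} {x : M} {v : E} :
    velocity I γ = (⟨x, v⟩ : TangentBundle I M) ↔ γ 0 = x ∧ mderiv 𝓘(ℝ, ℝ) I γ 0 1 = v := by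
  constructor
  · intro h
    obtain ⟨h1, h2⟩ := Bundle.TotalSpace.mk.inj h
    exact ⟨h1, eq_of_heq (α := E) h2⟩
  · rintro ⟨rfl, rfl⟩
    rfl

/-- Every tangent vector is the velocity of a smooth curve. -/
theorem exists_curve [IsManifold I ∞ M] [I.Boundaryless] (x : M) (v : E) :
    ∃ γ : ℝ → M, ContMDiff 𝓘(ℝ, ℝ) I ∞ γ ∧ γ 0 = x ∧ mderiv 𝓘(ℝ, ℝ) I γ 0 1 = v := by
  obtain ⟨ε, hε, hball⟩ := Metric.isOpen_iff.1 (isOpen_extChartAt_target (I := I) x) _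
    (mem_extChartAt_target x)
  -- The curve has to be defined on all of ℝ. The line in the chart is therefore reparametrized by c
  -- sin(t / c), which has derivative 1 at t = 0 and keeps the curve in the ball of radius ε as soon
  -- as c‖v‖ < ε.
  obtain ⟨c, hc, hcv⟩ : ∃ c : ℝ, 0 < c ∧ c * ‖v‖ < ε := by
    refine ⟨ε / (‖v‖ + 1), by positivity, ?_⟩
    rw [div_mul_eq_mul_div, div_lt_iff₀ (by positivity)]
    nlinarith [norm_nonneg v]
  have hmem : ∀ t : ℝ, extChartAt I x x + (c * Real.sin (c⁻¹ * t)) • v ∈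
      (extChartAt I x).target := by
    intro t
    apply hball
    rw [Metric.mem_ball, dist_self_add_left, norm_smul, Real.norm_eq_abs, abs_mul, abs_of_pos hc]
    calc c * |Real.sin (c⁻¹ * t)| * ‖v‖ ≤ c * 1 * ‖v‖ := by
          gcongr
          exact Real.abs_sin_le_one _
      _ < ε := by simpa using hcv
  have hs : ContDiff ℝ ∞ fun t : ℝ => extChartAt I x x + (c * Real.sin (c⁻¹ * t)) • v := by
    fun_prop
  have h0 : extChartAt I x x + (c * Real.sin (c⁻¹ * 0)) • v = extChartAt I x x := by simp
  refine ⟨fun t => (extChartAt I x).symm (extChartAt I x x + (c * Real.sin (c⁻¹ * t)) • v),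
    fun t => ?_, ?_, ?_⟩
  · exact ((contMDiffOn_extChartAt_symm x).contMDiffAt
      ((isOpen_extChartAt_target x).mem_nhds (hmem t))).comp t hs.contMDiff.contMDiffAt
  · simp
  · rw [mderiv_comp_of_eq (I' := 𝓘(ℝ, E))
      (mdifferentiableAt_extChartAt_symm (mem_extChartAt_target x))
      (hs.contMDiff.mdifferentiableAt (by simp)) h0, mderiv_eq_fderiv]
    refine (mfderiv_extChartAt_symm_self x _).trans ?_
    have hd : HasDerivAt (fun t : ℝ => extChartAt I x x + (c * Real.sin (c⁻¹ * t)) • v) v 0 := by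
      have h1 : HasDerivAt (fun t : ℝ => c * Real.sin (c⁻¹ * t)) 1 0 := by
        have := (((hasDerivAt_id (0 : ℝ)).const_mul c⁻¹).sin).const_mul c
        simpa [hc.ne'] using this
      simpa using (h1.smul_const v).const_add (extChartAt I x x)
    exact hd.deriv

end ModelDerivative

section OpenSubsets

variable {E H : Type*} [NormedAddCommGroup E] [NormedSpace ℝ E] [TopologicalSpace H]
  {I : ModelWithCorners ℝ E H} {M : Type*} [TopologicalSpace M] [ChartedSpace H M]
  [IsManifold I ∞ M] [I.Boundaryless]
  {E' H' : Type*} [NormedAddCommGroup E'] [NormedSpace ℝ E'] [TopologicalSpace H']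
  {I' : ModelWithCorners ℝ E' H'} {M' : Type*} [TopologicalSpace M'] [ChartedSpace H' M']

/-- The preferred charts of U are restrictions of those of M, so the inclusion is the identity in
coordinates. Hence tangent vectors of Σ and of P × 𝔤^* are literally the same elements of the model
space. -/
theorem mderiv_subtype_val (U : TopologicalSpace.Opens M) (x : U) :
    mderiv I I (Subtype.val : U → M) x = ContinuousLinearMap.id ℝ E := by
  have hd : MDifferentiableAt I I (Subtype.val : U → M) x :=
    (contMDiff_subtype_val (n := ∞)).mdifferentiableAt (by simp)
  have h1 : mderiv I I (Subtype.val : U → M) x = fderivWithin ℝ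
      (writtenInExtChartAt I I x (Subtype.val : U → M)) (range I) (extChartAt I x x) := hd.mfderiv
  rw [h1, I.range_eq_univ, fderivWithin_univ]
  have h2 : writtenInExtChartAt I I x (Subtype.val : U → M) =ᶠ[𝓝 (extChartAt I x x)] id := by
    filter_upwards [(isOpen_extChartAt_target (I := I) x).mem_nhds (mem_extChartAt_target x)]
      with y hy
    exact (extChartAt I x).right_inv hy
  rw [h2.fderiv_eq, fderiv_id]

theorem mderiv_comp_val {U : TopologicalSpace.Opens M} {f : M → M'} {x : U}
    (hf : MDifferentiableAt I I' f x.1) :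
    mderiv I I' (fun y : U => f y.1) x = mderiv I I' f x.1 := by
  rw [mderiv_comp x hf ((contMDiff_subtype_val (n := ∞)).mdifferentiableAt (by simp)),
    mderiv_subtype_val, ContinuousLinearMap.comp_id]

theorem contMDiffAt_opens_iff {U : TopologicalSpace.Opens M} {f : M' → U} {x : M'} :
    ContMDiffAt I' I ∞ f x ↔ ContMDiffAt I' I ∞ (fun y => (f y : M)) x :=
  (ContMDiffAt.subtypeVal_comp_iff U f x).symm

theorem mderiv_val_comp {U : TopologicalSpace.Opens M} {f : M' → U} {x : M'}
    (hf : MDifferentiableAt I' I f x) :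
    mderiv I' I (fun y => (f y : M)) x = mderiv I' I f x := by
  rw [mderiv_comp (g := (Subtype.val : U → M)) x
    ((contMDiff_subtype_val (n := ∞)).mdifferentiableAt (by simp)) hf, mderiv_subtype_val,
    ContinuousLinearMap.id_comp]

end OpenSubsets

/-! ### Descent of maps and forms along projections with local sections -/

section SmoothQuotient

variable {E H : Type*} [NormedAddCommGroup E] [NormedSpace ℝ E] [TopologicalSpace H]
  {I : ModelWithCorners ℝ E H} {X : Type*} [TopologicalSpace X] [ChartedSpace H X]
  {E' H' : Type*} [NormedAddCommGroup E'] [NormedSpace ℝ E'] [TopologicalSpace H']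
  {I' : ModelWithCorners ℝ E' H'} {Q : Type*} [TopologicalSpace Q] [ChartedSpace H' Q]
  {E'' H'' : Type*} [NormedAddCommGroup E''] [NormedSpace ℝ E''] [TopologicalSpace H'']
  {I'' : ModelWithCorners ℝ E'' H''} {N : Type*} [TopologicalSpace N] [ChartedSpace H'' N]

variable (I I') in
/-- Surjective smooth maps with smooth local sections through every point. -/
structure IsSmoothQuotient (π : X → Q) : Prop where
  smooth : ContMDiff I I' ∞ π
  surjective : Function.Surjective π
  exists_section : ∀ x, ∃ s : Q → X, ContMDiffAt I' I ∞ s (π x) ∧ s (π x) = x ∧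
    ∀ᶠ y in 𝓝 (π x), π (s y) = y

namespace IsSmoothQuotient

variable {π : X → Q} (h : IsSmoothQuotient I I' π)
include h

theorem mdifferentiableAt (x : X) : MDifferentiableAt I I' π x :=
  (h.smooth x).mdifferentiableAt (by simp)

theorem surjective_mderiv (x : X) : Function.Surjective (mderiv I I' π x) := by
  obtain ⟨s, hs, hsx, hπs⟩ := h.exists_section x
  intro v
  refine ⟨mderiv I' I s (π x) v, ?_⟩
  have h1 : mderiv I' I' (fun y => π (s y)) (π x) = ContinuousLinearMap.id ℝ E' := by
    rw [mderiv_congr hπs, mderiv_id]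
  rw [mderiv_comp_of_eq (h.mdifferentiableAt x) (hs.mdifferentiableAt (by simp)) hsx] at h1
  exact congrArg (fun A : E' →L[ℝ] E' => A v) h1

theorem isSmoothSubmersion : IsSmoothSubmersion I I' π := ⟨h.smooth, h.surjective_mderiv⟩

/-- Near π x the map f equals f ∘ π ∘ s for a smooth local section s. -/
theorem contMDiffAt_of_comp {f : Q → N} {x : X} (hf : ContMDiffAt I I'' ∞ (fun y => f (π y)) x) :
    ContMDiffAt I' I'' ∞ f (π x) := by
  obtain ⟨s, hs, hsx, hπs⟩ := h.exists_section x
  have h1 : ContMDiffAt I' I'' ∞ (fun y => f (π (s y))) (π x) :=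
    ContMDiffAt.comp_of_eq (g := fun y => f (π y)) hf hs hsx
  exact h1.congr_of_eventuallyEq (hπs.mono fun y hy => congrArg f hy.symm)

theorem contMDiff_of_comp {f : Q → N} (hf : ContMDiff I I'' ∞ (fun y => f (π y))) :
    ContMDiff I' I'' ∞ f := by
  intro y
  obtain ⟨x, rfl⟩ := h.surjective y
  exact h.contMDiffAt_of_comp (hf x)

theorem isOpenQuotientMap : IsOpenQuotientMap π := by
  refine ⟨h.surjective, h.smooth.continuous, ?_⟩
  rw [isOpenMap_iff_nhds_le]
  intro x V hV
  obtain ⟨s, hs, hsx, hπs⟩ := h.exists_section x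
  have h1 : s ⁻¹' (π ⁻¹' V) ∈ 𝓝 (π x) := by
    apply hs.continuousAt.preimage_mem_nhds
    rwa [hsx]
  filter_upwards [h1, hπs] with y hy1 hy2
  rw [mem_preimage, mem_preimage, hy2] at hy1
  exact hy1

variable [IsManifold I ∞ X] [I.Boundaryless] [IsManifold I' ∞ Q] [I'.Boundaryless]
  {F : Type*} [NormedAddCommGroup F] [NormedSpace ℝ F] {k : ℕ}

theorem form_ext {η ζ : Q → E' [⋀^Fin k]→L[ℝ] F} {x : X}
    (e : (η (π x)).compContinuousLinearMap (mderiv I I' π x)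
      = (ζ (π x)).compContinuousLinearMap (mderiv I I' π x)) : η (π x) = ζ (π x) := by
  ext v
  choose u hu using fun i => h.surjective_mderiv x (v i)
  obtain rfl : (fun i => mderiv I I' π x (u i)) = v := funext hu
  exact congrArg (fun A : E [⋀^Fin k]→L[ℝ] F => A u) e

/-- Locally η = s^*(π^*η). For this equality at the points y near π x, both π ∘ s = id on a
neighborhood of y and differentiability of s at y are needed, which explains the two eventual
statements. -/
theorem isSmooth_of_pullback {η : DiffForm I' Q k F} (hη : (DiffForm.pullback I π η).IsSmooth) :
    η.IsSmooth := by
  refine DiffForm.isSmooth_iff.2 fun y => ?_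
  obtain ⟨x, rfl⟩ := h.surjective y
  obtain ⟨s, hs, hsx, hπs⟩ := h.exists_section x
  have h1 : (DiffForm.pullback I π η).SmoothAt (s (π x)) := DiffForm.isSmooth_iff.1 hη _
  refine (h1.pullback hs).congr ?_
  have hs' : ∀ᶠ y in 𝓝 (π x), MDifferentiableAt I' I s y := by
    have : IsManifold I 1 X := IsManifold.of_le (n := ∞) (by simp)
    have : IsManifold I' 1 Q := IsManifold.of_le (n := ∞) (by simp)
    filter_upwards [(contMDiffAt_iff_contMDiffAt_nhds (n := 1) (by simp)).1 (hs.of_le (by simp))]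
      with y hy using hy.mdifferentiableAt (by simp)
  filter_upwards [eventually_eventually_nhds.2 hπs, hs'] with y hy hsy
  have h2 : (mderiv I I' π (s y)).comp (mderiv I' I s y) = ContinuousLinearMap.id ℝ E' := by
    rw [← mderiv_comp y (h.mdifferentiableAt _) hsy, mderiv_congr hy, mderiv_id]
  ext v
  have h3 : ∀ i, mderiv I I' π (s y) (mderiv I' I s y (v i)) = v i := fun i =>
    congrArg (fun A : E' →L[ℝ] E' => A (v i)) h2
  exact (congrArg (fun u : Fin k → E' => η (π (s y)) u) (funext h3)).trans
    (η.apply_congr hy.self_of_nhds v)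

theorem d_eq_zero_of_pullback {η : DiffForm I' Q k F}
    (hη : (DiffForm.pullback I π η).IsSmooth) (hd : ∀ x, (DiffForm.pullback I π η).d x = 0)
    (y : Q) : η.d y = 0 := by
  obtain ⟨x, rfl⟩ := h.surjective y
  refine h.form_ext (η := η.d) (ζ := 0) ?_
  refine Eq.trans ?_ ((DiffForm.d_pullback
    (DiffForm.isSmooth_iff.1 (h.isSmooth_of_pullback hη) _) (h.smooth x)).symm.trans (hd x))
  rfl

end IsSmoothQuotient

end SmoothQuotient

/-! ### Smooth structure on a quotient that has slices -/

section Slices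

variable {E H : Type*} [NormedAddCommGroup E] [NormedSpace ℝ E] [TopologicalSpace H]
  {I : ModelWithCorners ℝ E H} {Y : Type*} [TopologicalSpace Y] [ChartedSpace H Y]
  {F : Type*} [NormedAddCommGroup F] [NormedSpace ℝ F]

variable (I F) in
/-- A slice at `x` for an equivalence relation on an open set `U`: a smooth map `toFun` on a
saturated open subset of `U` whose fibers are the equivalence classes, together with a smooth
section of it. -/
structure QuotientSlice (r : Setoid Y) (U : TopologicalSpace.Opens Y) (x : Y) where
  toFun : Y → F
  invFun : F → Y
  source : Set Y
  target : Set F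
  isOpen_source : IsOpen source
  isOpen_target : IsOpen target
  source_subset : source ⊆ U
  mem_source : x ∈ source
  mapsTo : ∀ y ∈ source, toFun y ∈ target
  mapsTo_inv : ∀ t ∈ target, invFun t ∈ source
  right_inv : ∀ t ∈ target, toFun (invFun t) = t
  saturated : ∀ y ∈ source, ∀ z ∈ U, r y z → z ∈ source ∧ toFun z = toFun y
  separating : ∀ y ∈ source, ∀ z ∈ source, toFun y = toFun z → r y z
  center : invFun (toFun x) = x
  contMDiffOn : ContMDiffOn I 𝓘(ℝ, F) ∞ toFun source
  contMDiffOn_inv : ContMDiffOn 𝓘(ℝ, F) I ∞ invFun target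

namespace QuotientSlice

variable {r : Setoid Y} {U : TopologicalSpace.Opens Y} {x : U}

/-- The quotient of an open subset. -/
abbrev Quot (r : Setoid Y) (U : TopologicalSpace.Opens Y) :=
  Quotient (r.comap (Subtype.val : U → Y))

/-- The quotient map. -/
abbrev proj (r : Setoid Y) (U : TopologicalSpace.Opens Y) : U → Quot r U := Quotient.mk _

variable (r U) in
theorem isQuotientMap_proj : IsQuotientMap (proj r U) := isQuotientMap_quotient_mk'

theorem out_rel (y : U) : r y.1 (proj r U y).out.1 :=
  r.symm' ((Quotient.eq (r := r.comap (Subtype.val : U → Y))).1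
    (Quotient.out_eq (proj r U y)))

variable (s : QuotientSlice I F r U x.1)

theorem out_mem_source_iff (y : U) : (proj r U y).out.1 ∈ s.source ↔ y.1 ∈ s.source :=
  ⟨fun h => (s.saturated _ h _ y.2 (r.symm' (out_rel y))).1,
    fun h => (s.saturated _ h _ (proj r U y).out.2 (out_rel y)).1⟩

theorem toFun_out {y : U} (hy : y.1 ∈ s.source) :
    s.toFun (proj r U y).out.1 = s.toFun y.1 :=
  (s.saturated _ hy _ (proj r U y).out.2 (out_rel y)).2

/-- The section of the quotient map over the slice. -/
def section_ (t : F) : U :=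
  -- Outside the target the value x is a default that only makes the section total.
  open Classical in if h : s.invFun t ∈ U then ⟨s.invFun t, h⟩ else x

theorem coe_section {t : F} (ht : t ∈ s.target) : (s.section_ t).1 = s.invFun t := by
  have h : s.invFun t ∈ U := s.source_subset (s.mapsTo_inv t ht)
  rw [section_, dif_pos h]

theorem contMDiffOn_section [IsManifold I ∞ Y] [I.Boundaryless] :
    ContMDiffOn 𝓘(ℝ, F) I ∞ s.section_ s.target := by
  intro t ht
  refine (contMDiffAt_opens_iff.2 ?_).contMDiffWithinAt
  refine ((s.contMDiffOn_inv t ht).contMDiffAt (s.isOpen_target.mem_nhds ht)).congr_of_eventuallyEq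
    ?_
  filter_upwards [s.isOpen_target.mem_nhds ht] with u hu using s.coe_section hu

theorem isOpen_chart_source : IsOpen {z : Quot r U | z.out.1 ∈ s.source} := by
  refine (isQuotientMap_proj r U).isOpen_preimage.1 ?_
  have : proj r U ⁻¹' {z | z.out.1 ∈ s.source} = Subtype.val ⁻¹' s.source := by
    ext y
    exact s.out_mem_source_iff y
  rw [this]
  exact s.isOpen_source.preimage continuous_subtype_val

/-- The chart of the quotient that is determined by a slice. -/
def chart : OpenPartialHomeomorph (Quot r U) F where
  -- The chosen representative is immaterial: by `saturated` the slice map is constant on classes.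
  -- By `separating` it distinguishes them.
  toFun z := s.toFun z.out.1
  invFun t := proj r U (s.section_ t)
  source := {z | z.out.1 ∈ s.source}
  target := s.target
  map_source' z hz := s.mapsTo _ hz
  map_target' t ht := by
    rw [mem_ofPred_eq, s.out_mem_source_iff, s.coe_section ht]
    exact s.mapsTo_inv t ht
  left_inv' z hz := by
    refine Eq.trans (Quotient.sound ?_) (Quotient.out_eq z)
    have h1 := s.mapsTo _ hz
    refine s.separating _ ?_ _ hz ?_
    · rw [s.coe_section h1]
      exact s.mapsTo_inv _ h1
    · rw [s.coe_section h1, s.right_inv _ h1]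
  right_inv' t ht := by
    have h1 : (s.section_ t).1 ∈ s.source := by
      rw [s.coe_section ht]
      exact s.mapsTo_inv _ ht
    rw [s.toFun_out h1, s.coe_section ht, s.right_inv t ht]
  open_source := s.isOpen_chart_source
  open_target := s.isOpen_target
  continuousOn_toFun := by
    refine ((isQuotientMap_proj r U).continuousOn_isOpen_iff s.isOpen_chart_source).2 ?_
    have h1 : ContinuousOn (fun y : U => s.toFun y.1) (Subtype.val ⁻¹' s.source) :=
      s.contMDiffOn.continuousOn.comp continuous_subtype_val.continuousOn fun y hy => hy
    refine (h1.mono fun y hy => (s.out_mem_source_iff y).1 hy).congr fun y hy => ?_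
    exact s.toFun_out ((s.out_mem_source_iff y).1 hy)
  continuousOn_invFun := by
    refine continuous_quotient_mk'.comp_continuousOn (IsInducing.subtypeVal.continuousOn_iff.2 ?_)
    exact s.contMDiffOn_inv.continuousOn.congr fun t ht => s.coe_section ht

theorem mem_chart_source_iff (y : U) : proj r U y ∈ s.chart.source ↔ y.1 ∈ s.source :=
  s.out_mem_source_iff y

theorem chart_proj {y : U} (hy : y.1 ∈ s.source) : s.chart (proj r U y) = s.toFun y.1 :=
  s.toFun_out hy

theorem chart_symm_apply (t : F) : s.chart.symm t = proj r U (s.section_ t) := rfl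

theorem contDiffOn_transition {x' : U} (s' : QuotientSlice I F r U x'.1) :
    ContDiffOn ℝ ∞ (s.chart.symm ≫ₕ s'.chart) (s.chart.symm ≫ₕ s'.chart).source := by
  have h1 : ∀ t ∈ (s.chart.symm ≫ₕ s'.chart).source, t ∈ s.target ∧ s.invFun t ∈ s'.source := by
    intro t ht
    rw [OpenPartialHomeomorph.trans_source] at ht
    refine ⟨ht.1, ?_⟩
    have := (s'.mem_chart_source_iff (s.section_ t)).1 ht.2
    rwa [s.coe_section ht.1] at this
  have h2 : ContDiffOn ℝ ∞ (fun t => s'.toFun (s.invFun t)) (s.chart.symm ≫ₕ s'.chart).source :=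
    (s'.contMDiffOn.comp (s.contMDiffOn_inv.mono fun t ht => (h1 t ht).1)
      fun t ht => (h1 t ht).2).contDiffOn
  refine h2.congr fun t ht => ?_
  have h3 := h1 t ht
  have h4 : (s.section_ t).1 ∈ s'.source := by
    rw [s.coe_section h3.1]
    exact h3.2
  rw [OpenPartialHomeomorph.trans_apply, s.chart_symm_apply, s'.chart_proj h4, s.coe_section h3.1]

/-- The smooth structure on a quotient that has slices. -/
@[reducible] def chartedSpace (h : ∀ x : U, QuotientSlice I F r U x.1) :
    ChartedSpace F (Quot r U) where
  atlas := range fun x : U => (h x).chart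
  chartAt z := (h z.out).chart
  mem_chart_source z := (h z.out).mem_source
  chart_mem_atlas z := mem_range_self z.out

end QuotientSlice

/-- Slices serve as charts: a transition map is the slice map of one composed with the section of
the other. In these charts the projection is the slice map, and the slice section composed with the
chart is a local section of the projection; the field `center` makes it pass through the given
point. -/
theorem exists_smooth_quotient [IsManifold I ∞ Y] [I.Boundaryless] {r : Setoid Y} {U : TopologicalSpace.Opens Y}
    (h : ∀ x : U, Nonempty (QuotientSlice I F r U x.1)) :
    ∃ (_ : ChartedSpace F (Quotient (r.comap (Subtype.val : U → Y))))
      (_ : IsManifold 𝓘(ℝ, F) ∞ (Quotient (r.comap (Subtype.val : U → Y)))),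
      IsSmoothQuotient I 𝓘(ℝ, F) (Quotient.mk (r.comap (Subtype.val : U → Y))) := by
  replace h := fun x => (h x).some
  let c := QuotientSlice.chartedSpace fun x => (h x)
  have hm : IsManifold 𝓘(ℝ, F) ∞ (Quotient (r.comap (Subtype.val : U → Y))) := by
    apply isManifold_of_contDiffOn
    rintro _ _ ⟨x, rfl⟩ ⟨x', rfl⟩
    simpa using (h x).contDiffOn_transition (h x')
  have hmax : ∀ x, (h x).chart ∈ IsManifold.maximalAtlas 𝓘(ℝ, F) ∞
      (Quotient (r.comap (Subtype.val : U → Y))) := fun x =>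
    IsManifold.subset_maximalAtlas (mem_range_self x)
  refine ⟨c, hm, ⟨fun x => ?_, Quotient.mk_surjective, fun x => ?_⟩⟩
  · have h1 := (contMDiffOn_symm_of_mem_maximalAtlas (hmax x)).contMDiffAt
      ((h x).chart.open_target.mem_nhds ((h x).mapsTo _ (h x).mem_source))
    have h2 : ContMDiffAt I 𝓘(ℝ, F) ∞ (fun y : U => (h x).toFun y.1) x :=
      (((h x).contMDiffOn _ (h x).mem_source).contMDiffAt
        ((h x).isOpen_source.mem_nhds (h x).mem_source)).comp x contMDiff_subtype_val.contMDiffAt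
    refine (h1.comp x h2).congr_of_eventuallyEq ?_
    filter_upwards [((h x).isOpen_source.preimage continuous_subtype_val).mem_nhds
      (h x).mem_source] with y hy
    have := (h x).chart.left_inv (((h x).mem_chart_source_iff y).2 hy)
    rw [(h x).chart_proj hy] at this
    exact this.symm
  · have hx : QuotientSlice.proj r U x ∈ (h x).chart.source :=
      ((h x).mem_chart_source_iff x).2 (h x).mem_source
    have hn := (h x).chart.open_source.mem_nhds hx
    refine ⟨fun z => (h x).section_ ((h x).chart z), ?_, ?_, ?_⟩
    · have h1 := (contMDiffOn_of_mem_maximalAtlas (hmax x)).contMDiffAt hn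
      have h2 := (h x).contMDiffOn_section.contMDiffAt
        ((h x).isOpen_target.mem_nhds ((h x).chart.map_source hx))
      exact h2.comp _ h1
    · apply Subtype.ext
      have h1 := (h x).chart_proj (h x).mem_source
      refine (congrArg (fun t => ((h x).section_ t).1) h1).trans ?_
      rw [(h x).coe_section ((h x).mapsTo _ (h x).mem_source), (h x).center]
    · filter_upwards [hn] with z hz
      exact (h x).chart.left_inv hz

end Slices

theorem isClosed_setOf_rel_val {Y : Type*} [TopologicalSpace Y] (r : Setoid Y)
    (U : TopologicalSpace.Opens Y) (h : IsClosed {z : Y × Y | r z.1 z.2}) :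
    IsClosed {z : U × U | (Quotient.mk (r.comap (Subtype.val : U → Y)) z.1) =
      Quotient.mk (r.comap (Subtype.val : U → Y)) z.2} := by
  have : {z : U × U | (Quotient.mk (r.comap (Subtype.val : U → Y)) z.1) =
      Quotient.mk (r.comap (Subtype.val : U → Y)) z.2} =
      (fun z : U × U => (z.1.1, z.2.1)) ⁻¹' {z : Y × Y | r z.1 z.2} := by
    ext z
    exact Quotient.eq
  rw [this]
  exact h.preimage (by fun_prop)

/-! ### Smoothness of the adjoint and coadjoint actions -/

section AdjointAction

variable {E₀ G : Type*} [NormedAddCommGroup E₀] [NormedSpace ℝ E₀]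
  [TopologicalSpace G] [ChartedSpace E₀ G] [Group G] [LieGroup 𝓘(ℝ, E₀) ∞ G]

/-- Conjugation by g fixes 1, so one chart at 1 serves for both source and target. In it, Ad_g is
the derivative at a fixed point of a map that depends smoothly on the parameter g. -/
theorem contMDiff_lieAd : ContMDiff 𝓘(ℝ, E₀) 𝓘(ℝ, E₀ →L[ℝ] E₀) ∞
    (fun g : G => (lieAd g : E₀ →L[ℝ] E₀)) := by
  have hm : IsManifold 𝓘(ℝ, E₀) ∞ G := inferInstance
  intro g₀
  let φ := extChartAt 𝓘(ℝ, E₀) (1 : G)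
  let ψ := extChartAt 𝓘(ℝ, E₀) g₀
  have hψ : ψ.symm (ψ g₀) = g₀ := ψ.left_inv (mem_extChartAt_source g₀)
  have hφ : φ.symm (φ 1) = 1 := φ.left_inv (mem_extChartAt_source 1)
  have hs : ContMDiff (𝓘(ℝ, E₀).prod 𝓘(ℝ, E₀)) 𝓘(ℝ, E₀) ∞
      (fun z : G × G => z.1 * z.2 * z.1⁻¹) :=
    (contMDiff_fst.mul contMDiff_snd).mul contMDiff_fst.inv
  have h1 : ContMDiffAt 𝓘(ℝ, E₀ × E₀) (𝓘(ℝ, E₀).prod 𝓘(ℝ, E₀)) ∞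
      (fun z : E₀ × E₀ => (ψ.symm z.1, φ.symm z.2)) (ψ g₀, φ 1) := by
    refine ContMDiffAt.prodMk ?_ ?_
    · exact ((contMDiffOn_extChartAt_symm g₀).contMDiffAt
        ((isOpen_extChartAt_target g₀).mem_nhds (mem_extChartAt_target g₀))).comp (ψ g₀, φ 1)
        contDiff_fst.contMDiff.contMDiffAt
    · exact ((contMDiffOn_extChartAt_symm (1 : G)).contMDiffAt
        ((isOpen_extChartAt_target (1 : G)).mem_nhds (mem_extChartAt_target (1 : G)))).comp
        (ψ g₀, φ 1) contDiff_snd.contMDiff.contMDiffAt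
  have h2 : ContMDiffAt 𝓘(ℝ, E₀ × E₀) 𝓘(ℝ, E₀) ∞
      (fun z : E₀ × E₀ => φ (ψ.symm z.1 * φ.symm z.2 * (ψ.symm z.1)⁻¹)) (ψ g₀, φ 1) := by
    refine ContMDiffAt.comp_of_eq (y := (1 : G)) contMDiffAt_extChartAt
      ((hs _).comp (ψ g₀, φ 1) h1) ?_
    simp [hφ]
  have h3 : ContDiffAt ℝ ∞ (fun u => fderiv ℝ
      (fun y => φ (ψ.symm u * φ.symm y * (ψ.symm u)⁻¹)) (φ 1)) (ψ g₀) :=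
    ContDiffAt.fderiv (f := fun u y => φ (ψ.symm u * φ.symm y * (ψ.symm u)⁻¹))
      (g := fun _ => φ 1) h2.contDiffAt contDiffAt_const (by simp)
  refine (h3.contMDiffAt.comp g₀ contMDiffAt_extChartAt).congr_of_eventuallyEq ?_
  filter_upwards [(isOpen_extChartAt_source (I := 𝓘(ℝ, E₀)) g₀).mem_nhds
    (mem_extChartAt_source g₀)] with g hg
  have hd : MDifferentiableAt 𝓘(ℝ, E₀) 𝓘(ℝ, E₀) (fun h : G => g * h * g⁻¹) 1 :=
    ((contMDiff_const.mul contMDiff_id).mul contMDiff_const :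
      ContMDiff 𝓘(ℝ, E₀) 𝓘(ℝ, E₀) ∞ (fun h : G => g * h * g⁻¹)).mdifferentiableAt (by simp)
  have e1 : (lieAd g : E₀ →L[ℝ] E₀) = fderiv ℝ
      (extChartAt 𝓘(ℝ, E₀) (g * 1 * g⁻¹) ∘ (fun h : G => g * h * g⁻¹) ∘ φ.symm) (φ 1) := by
    rw [← fderivWithin_univ]
    refine (hd.mfderiv).trans ?_
    rw [ModelWithCorners.range_eq_univ]
    rfl
  -- The derivative reads the target in the chart at g * 1 * g⁻¹, which has to be replaced by the
  -- chart at 1.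
  have e2 : g * 1 * g⁻¹ = 1 := by simp
  rw [e1, e2, Function.comp_apply, ψ.left_inv hg]
  rfl

theorem contMDiff_coad : ContMDiff (𝓘(ℝ, LieDual E₀).prod 𝓘(ℝ, E₀)) 𝓘(ℝ, LieDual E₀) ∞
    (fun z : LieDual E₀ × G => (z.1 ∘L lieAd z.2 : LieDual E₀)) :=
  contMDiff_fst.clm_comp (contMDiff_lieAd.comp contMDiff_snd)

end AdjointAction

/-! ### Right actions and the differential geometry of a principal bundle -/

section RightActions

variable {E₀ G : Type*} [NormedAddCommGroup E₀] [NormedSpace ℝ E₀]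
  [TopologicalSpace G] [ChartedSpace E₀ G] [Group G] [LieGroup 𝓘(ℝ, E₀) ∞ G]
  {E₁ P : Type*} [NormedAddCommGroup E₁] [NormedSpace ℝ E₁]
  [TopologicalSpace P] [ChartedSpace E₁ P] [MulAction Gᵐᵒᵖ P]
  {E₂ S : Type*} [NormedAddCommGroup E₂] [NormedSpace ℝ E₂]
  [TopologicalSpace S] [ChartedSpace E₂ S]
  {EZ HZ : Type*} [NormedAddCommGroup EZ] [NormedSpace ℝ EZ] [TopologicalSpace HZ]
  {IZ : ModelWithCorners ℝ EZ HZ} {Z : Type*} [TopologicalSpace Z] [ChartedSpace HZ Z]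

variable (E₀ IZ) in
/-- Smooth right actions of a Lie group. -/
structure IsSmoothRightAction (act : Z → G → Z) : Prop where
  smooth : ContMDiff (IZ.prod 𝓘(ℝ, E₀)) IZ ∞ (fun w : Z × G => act w.1 w.2)
  one : ∀ z, act z 1 = z
  mul : ∀ z g h, act z (g * h) = act (act z g) h

/-- The diagonal right action on `P × Z`. -/
def diagAct (act : Z → G → Z) (y : P × Z) (g : G) : P × Z := (op g • y.1, act y.2 g)

theorem isSmoothRightAction_coad : IsSmoothRightAction E₀ 𝓘(ℝ, LieDual E₀)
    (fun (ξ : LieDual E₀) (g : G) => (ξ ∘L lieAd g : LieDual E₀)) where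
  smooth := contMDiff_coad
  one ξ := by simp [lieAd_one]
  mul ξ g h := by simp [lieAd_mul, ContinuousLinearMap.comp_assoc]

theorem IsSmoothRightAction.diag {act : Z → G → Z} (h : IsSmoothRightAction E₀ IZ act) {q : P → S}
    (hq : IsPrincipalBundle E₀ G E₁ E₂ q) :
    IsSmoothRightAction E₀ (𝓘(ℝ, E₁).prod IZ) (diagAct (P := P) act) where
  smooth := by
    refine ContMDiff.prodMk ?_ ?_
    · exact hq.smooth_act.comp ((contMDiff_fst.comp contMDiff_fst).prodMk contMDiff_snd)
    · exact h.smooth.comp ((contMDiff_snd.comp contMDiff_fst).prodMk contMDiff_snd)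
  one y := by simp [diagAct, h.one]
  mul y g k := by simp [diagAct, h.mul, mul_smul]

variable (E₀ IZ) in
/-- The derivative at the unit of an orbit map. -/
def orbitDeriv (act : Z → G → Z) (z : Z) : E₀ →L[ℝ] EZ :=
  mderiv 𝓘(ℝ, E₀) IZ (fun g : G => act z g) 1

theorem IsSmoothRightAction.contMDiff_orbit {act : Z → G → Z} (h : IsSmoothRightAction E₀ IZ act)
    (z : Z) : ContMDiff 𝓘(ℝ, E₀) IZ ∞ (fun g : G => act z g) :=
  h.smooth.comp (contMDiff_const.prodMk contMDiff_id)

theorem IsSmoothRightAction.contMDiff_act {act : Z → G → Z} (h : IsSmoothRightAction E₀ IZ act)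
    (g : G) : ContMDiff IZ IZ ∞ (fun z : Z => act z g) :=
  h.smooth.comp (contMDiff_id.prodMk contMDiff_const)

/-- The generator of the action on `P`. -/
abbrev genP (E₀ G E₁ : Type*) {P : Type*} [NormedAddCommGroup E₀] [NormedSpace ℝ E₀]
  [TopologicalSpace G] [ChartedSpace E₀ G] [Group G]
  [NormedAddCommGroup E₁] [NormedSpace ℝ E₁]
  [TopologicalSpace P] [ChartedSpace E₁ P] [MulAction Gᵐᵒᵖ P] (p : P) : E₀ →L[ℝ] E₁ :=
  orbitDeriv E₀ 𝓘(ℝ, E₁) (fun (p : P) (g : G) => op g • p) p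

namespace IsPrincipalBundle

variable {q : P → S} (hq : IsPrincipalBundle E₀ G E₁ E₂ q)
include hq

theorem isSmoothRightAction :
    IsSmoothRightAction E₀ 𝓘(ℝ, E₁) (fun (p : P) (g : G) => op g • p) where
  smooth := hq.smooth_act
  one p := by simp
  mul p g h := by simp [mul_smul]

theorem exists_trivialization (p : P) : ∃ e : Bundle.Trivialization G q, p ∈ e.source ∧
    ContMDiffOn 𝓘(ℝ, E₁) (𝓘(ℝ, E₂).prod 𝓘(ℝ, E₀)) ∞ e e.source ∧
    ContMDiffOn (𝓘(ℝ, E₂).prod 𝓘(ℝ, E₀)) 𝓘(ℝ, E₁) ∞ e.toOpenPartialHomeomorph.symm e.target ∧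
    ∀ p ∈ e.source, ∀ g : G, e (op g • p) = ((e p).1, (e p).2 * g) := by
  obtain ⟨e, h1, h2, h3, h4⟩ := hq.locally_trivial (q p)
  exact ⟨e, e.mem_source.2 h1, h2, h3, h4⟩

theorem contMDiff_proj : ContMDiff 𝓘(ℝ, E₁) 𝓘(ℝ, E₂) ∞ q := by
  intro p
  obtain ⟨e, hp, he, -, -⟩ := hq.exists_trivialization p
  have h1 := (contMDiffOn_fst (I := 𝓘(ℝ, E₂)) (J := 𝓘(ℝ, E₀)) (n := ∞) (s := univ)).comp he
    fun _ _ => mem_univ _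
  refine (h1.contMDiffAt (e.open_source.mem_nhds hp)).congr_of_eventuallyEq ?_
  filter_upwards [e.open_source.mem_nhds hp] with p' hp'
  exact (e.coe_fst hp').symm

/-- The map `δ` with `p · δ(p, p') = p'` on each fiber. -/
theorem exists_division (p₀ p₁ : P) (h : q p₀ = q p₁) : ∃ δ : P × P → G,
    ContMDiffAt (𝓘(ℝ, E₁).prod 𝓘(ℝ, E₁)) 𝓘(ℝ, E₀) ∞ δ (p₀, p₁) ∧
    ∀ᶠ z in 𝓝 (p₀, p₁), (q z.1 = q z.2 → op (δ z) • z.1 = z.2) ∧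
      ∀ g, op g • z.1 = z.2 → δ z = g := by
  obtain ⟨e, hp, he, -, heq⟩ := hq.exists_trivialization p₀
  have hp₁ : p₁ ∈ e.source := e.mem_source.2 (h ▸ e.mem_source.1 hp)
  have hs : ∀ p ∈ e.source, ContMDiffAt 𝓘(ℝ, E₁) 𝓘(ℝ, E₀) ∞ (fun p => (e p).2) p := fun p hp =>
    contMDiffAt_snd.comp p (he.contMDiffAt (e.open_source.mem_nhds hp))
  -- In a trivialization G acts by right multiplication on the second component, so this quotient is
  -- the only element that can carry the first point to the second.
  refine ⟨fun z => (e z.1).2⁻¹ * (e z.2).2, ?_, ?_⟩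
  · exact (((hs p₀ hp).comp (p₀, p₁) contMDiffAt_fst).inv).mul
      ((hs p₁ hp₁).comp (p₀, p₁) contMDiffAt_snd)
  · filter_upwards [(e.open_source.prod e.open_source).mem_nhds ⟨hp, hp₁⟩] with z hz
    refine ⟨fun hqz => ?_, ?_⟩
    · have h1 : op ((e z.1).2⁻¹ * (e z.2).2) • z.1 ∈ e.source :=
        e.mem_source.2 ((hq.preserves_fibers _ _).symm ▸ e.mem_source.1 hz.1)
      refine e.injOn h1 hz.2 ?_
      refine (heq _ hz.1 _).trans ?_
      rw [mul_inv_cancel_left]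
      exact Prod.ext ((e.coe_fst hz.1).trans (hqz.trans (e.coe_fst hz.2).symm)) rfl
    · rintro g hg
      rw [← hg, heq _ hz.1, inv_mul_cancel_left]

theorem act_injective (p : P) {g h : G} (e : op g • p = op h • p) : g = h := by
  obtain ⟨δ, -, hδ⟩ := hq.exists_division p (op g • p) (hq.preserves_fibers p g).symm
  have := hδ.self_of_nhds.2
  exact (this g rfl).symm.trans (this h e.symm)

/-- The derivative of a trivialization. -/
theorem exists_deriv_equiv (p : P) : ∃ A : E₁ ≃L[ℝ] E₂ × E₀,
    (∀ v, (A v).1 = mderiv 𝓘(ℝ, E₁) 𝓘(ℝ, E₂) q p v) ∧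
    ∃ B : E₀ ≃L[ℝ] E₀, ∀ X, A (genP E₀ G E₁ p X) = (0, B X) := by
  obtain ⟨e, hp, he, hes, heq⟩ := hq.exists_trivialization p
  have h1 : MDifferentiableAt 𝓘(ℝ, E₁) (𝓘(ℝ, E₂).prod 𝓘(ℝ, E₀)) e p :=
    (he.contMDiffAt (e.open_source.mem_nhds hp)).mdifferentiableAt (by simp)
  have h2 : MDifferentiableAt (𝓘(ℝ, E₂).prod 𝓘(ℝ, E₀)) 𝓘(ℝ, E₁)
      e.toOpenPartialHomeomorph.symm (e p) :=
    (hes.contMDiffAt (e.open_target.mem_nhds (e.map_source hp))).mdifferentiableAt (by simp)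
  have h3 : (mderiv (𝓘(ℝ, E₂).prod 𝓘(ℝ, E₀)) 𝓘(ℝ, E₁) e.toOpenPartialHomeomorph.symm (e p)).comp
      (mderiv 𝓘(ℝ, E₁) (𝓘(ℝ, E₂).prod 𝓘(ℝ, E₀)) e p) = ContinuousLinearMap.id ℝ E₁ := by
    rw [← mderiv_comp p h2 h1, ← mderiv_id (I := 𝓘(ℝ, E₁)) p]
    refine mderiv_congr ?_
    filter_upwards [e.open_source.mem_nhds hp] with y hy
      using e.toOpenPartialHomeomorph.left_inv hy
  have h4 : (mderiv 𝓘(ℝ, E₁) (𝓘(ℝ, E₂).prod 𝓘(ℝ, E₀)) e p).comp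
      (mderiv (𝓘(ℝ, E₂).prod 𝓘(ℝ, E₀)) 𝓘(ℝ, E₁) e.toOpenPartialHomeomorph.symm (e p)) =
      ContinuousLinearMap.id ℝ (E₂ × E₀) := by
    rw [← mderiv_comp_of_eq h1 h2 (e.toOpenPartialHomeomorph.left_inv hp),
      ← mderiv_id (I := 𝓘(ℝ, E₂).prod 𝓘(ℝ, E₀)) (e p)]
    refine mderiv_congr ?_
    filter_upwards [e.open_target.mem_nhds (e.map_source hp)] with y hy
      using e.toOpenPartialHomeomorph.right_inv hy
  have hL : ∀ a b : G, MDifferentiableAt 𝓘(ℝ, E₀) 𝓘(ℝ, E₀) (fun g : G => a * g) b := fun a b =>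
    (contMDiff_mul_left (I := 𝓘(ℝ, E₀)) (n := ∞)).mdifferentiableAt (by simp)
  have hLi : ∀ a b : G, (mderiv 𝓘(ℝ, E₀) 𝓘(ℝ, E₀) (fun g : G => a⁻¹ * g) (a * b)).comp
      (mderiv 𝓘(ℝ, E₀) 𝓘(ℝ, E₀) (fun g : G => a * g) b) = ContinuousLinearMap.id ℝ E₀ := by
    intro a b
    rw [← mderiv_comp b (hL _ _) (hL _ _), ← mderiv_id (I := 𝓘(ℝ, E₀)) b]
    simp
  -- In the trivialization the orbit map is g ↦ (q p, (e p).2 * g). Its derivative at 1 is that of a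
  -- left translation, which is invertible, placed in the second factor.
  refine ⟨ContinuousLinearEquiv.equivOfInverse _ _ (fun v => DFunLike.congr_fun h3 v)
    (fun v => DFunLike.congr_fun h4 v), fun v => ?_,
    ContinuousLinearEquiv.equivOfInverse
      (mderiv 𝓘(ℝ, E₀) 𝓘(ℝ, E₀) (fun g : G => (e p).2 * g) 1)
      (mderiv 𝓘(ℝ, E₀) 𝓘(ℝ, E₀) (fun g : G => (e p).2⁻¹ * g) ((e p).2 * 1))
      (fun v => DFunLike.congr_fun (hLi (e p).2 1) v) (fun v => ?_), fun X => ?_⟩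
  · have h5 : mderiv 𝓘(ℝ, E₁) 𝓘(ℝ, E₂) q p = mderiv 𝓘(ℝ, E₁) 𝓘(ℝ, E₂) (fun y => (e y).1) p :=
      mderiv_congr (by
        filter_upwards [e.open_source.mem_nhds hp] with y hy using (e.coe_fst hy).symm)
    rw [h5, mderiv_comp p (g := Prod.fst) (I' := 𝓘(ℝ, E₂).prod 𝓘(ℝ, E₀)) mdifferentiableAt_fst h1,
      mderiv_fst]
    rfl
  · have h6 := hLi (e p).2⁻¹ ((e p).2 * 1)
    rw [inv_mul_cancel_left, inv_inv] at h6
    exact DFunLike.congr_fun h6 v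
  · have h7 : (mderiv 𝓘(ℝ, E₁) (𝓘(ℝ, E₂).prod 𝓘(ℝ, E₀)) e p).comp (genP E₀ G E₁ p) =
        mderiv 𝓘(ℝ, E₀) (𝓘(ℝ, E₂).prod 𝓘(ℝ, E₀)) (fun g : G => ((e p).1, (e p).2 * g)) 1 := by
      rw [genP, orbitDeriv, ← mderiv_comp_of_eq h1
        ((hq.isSmoothRightAction.contMDiff_orbit p).mdifferentiableAt (by simp)) (by simp)]
      exact mderiv_congr (Filter.Eventually.of_forall fun g => heq p hp g)
    rw [mderiv_prodMk mdifferentiableAt_const (hL _ _), mderiv_const] at h7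
    exact DFunLike.congr_fun h7 X

theorem genP_injective (p : P) : Function.Injective (genP E₀ G E₁ p) := by
  obtain ⟨A, -, B, hB⟩ := hq.exists_deriv_equiv p
  intro X Y h
  have := hB X
  rw [h, hB Y] at this
  exact (B.injective (Prod.ext_iff.1 this).2).symm

theorem mderiv_proj_eq_zero_iff (p : P) (v : E₁) :
    mderiv 𝓘(ℝ, E₁) 𝓘(ℝ, E₂) q p v = 0 ↔ ∃ X, genP E₀ G E₁ p X = v := by
  obtain ⟨A, hA, B, hB⟩ := hq.exists_deriv_equiv p
  rw [← hA]
  constructor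
  · intro h
    refine ⟨B.symm (A v).2, A.injective ?_⟩
    rw [hB, B.apply_symm_apply]
    exact Prod.ext h.symm rfl
  · rintro ⟨X, rfl⟩
    rw [hB]

theorem surjective_mderiv_proj (p : P) :
    Function.Surjective (mderiv 𝓘(ℝ, E₁) 𝓘(ℝ, E₂) q p) := by
  obtain ⟨A, hA, -⟩ := hq.exists_deriv_equiv p
  intro w
  refine ⟨A.symm (w, 0), ?_⟩
  rw [← hA, A.apply_symm_apply]

theorem finrank_eq [FiniteDimensional ℝ E₀] [FiniteDimensional ℝ E₂] (p : P) :
    Module.finrank ℝ E₁ = Module.finrank ℝ E₂ + Module.finrank ℝ E₀ := by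
  obtain ⟨A, -⟩ := hq.exists_deriv_equiv p
  rw [A.toLinearEquiv.finrank_eq, Module.finrank_prod]

/-- The orbit relation of a diagonal action is closed. -/
theorem isClosed_orbitRel [T2Space S] [T2Space P] [T2Space Z] {act : Z → G → Z}
    (hact : IsSmoothRightAction E₀ IZ act) :
    IsClosed {w : (P × Z) × (P × Z) | ∃ g, w.2 = diagAct act w.1 g} := by
  rw [← isOpen_compl_iff, isOpen_iff_mem_nhds]
  rintro ⟨⟨p₀, z₀⟩, p₁, z₁⟩ hw
  -- If both points lie over the same point of S, the group element relating nearby points can only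
  -- be δ, and z₀ · δ ≠ z₁ is an open condition. Otherwise q already separates the two orbits.
  by_cases hqp : q p₀ = q p₁
  · obtain ⟨δ, hδ, hδ'⟩ := hq.exists_division p₀ p₁ hqp
    have hne : act z₀ (δ (p₀, p₁)) ≠ z₁ := by
      rintro rfl
      exact hw ⟨δ (p₀, p₁), Prod.ext (hδ'.self_of_nhds.1 hqp).symm rfl⟩
    have hpp : Continuous fun w : (P × Z) × (P × Z) => (w.1.1, w.2.1) := by fun_prop
    have hc : ContinuousAt (fun w : (P × Z) × (P × Z) => act w.1.2 (δ (w.1.1, w.2.1)))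
        ((p₀, z₀), p₁, z₁) := by
      have h1 : ContinuousAt (fun w : (P × Z) × (P × Z) => δ (w.1.1, w.2.1))
          ((p₀, z₀), p₁, z₁) :=
        ContinuousAt.comp (g := δ) (f := fun w : (P × Z) × (P × Z) => (w.1.1, w.2.1))
          hδ.continuousAt hpp.continuousAt
      have h2 : ContinuousAt (fun w : (P × Z) × (P × Z) => (w.1.2, δ (w.1.1, w.2.1)))
          ((p₀, z₀), p₁, z₁) := ContinuousAt.prodMk (by fun_prop) h1
      exact ContinuousAt.comp (g := fun u : Z × G => act u.1 u.2) hact.smooth.continuous.continuousAt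
        h2
    have hev := (hpp.tendsto ((p₀, z₀), p₁, z₁)).eventually hδ'
    have hc' : ContinuousAt (fun w : (P × Z) × (P × Z) => w.2.2) ((p₀, z₀), p₁, z₁) := by fun_prop
    filter_upwards [hev, (hc.ne_iff_eventually_ne hc').1 hne] with w h1 h2
    rintro ⟨g, hg⟩
    have h3 := h1.2 g (congrArg Prod.fst hg).symm
    exact h2 (by rw [h3, hg]; rfl)
  · have hc : Continuous q := hq.contMDiff_proj.continuous
    have ho : IsOpen {w : (P × Z) × (P × Z) | q w.1.1 ≠ q w.2.1} :=
      isOpen_ne_fun (by fun_prop) (by fun_prop)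
    filter_upwards [ho.mem_nhds hqp] with w h1
    rintro ⟨g, hg⟩
    refine h1 ?_
    rw [hg]
    exact (hq.preserves_fibers _ _).symm

end IsPrincipalBundle

end RightActions

/-! ### Slices and tangent spaces of orbits for diagonal actions -/

section OrbitSlices

variable {E₀ G : Type*} [NormedAddCommGroup E₀] [NormedSpace ℝ E₀]
  [TopologicalSpace G] [ChartedSpace E₀ G] [Group G] [LieGroup 𝓘(ℝ, E₀) ∞ G]
  {E₁ P : Type*} [NormedAddCommGroup E₁] [NormedSpace ℝ E₁]
  [TopologicalSpace P] [ChartedSpace E₁ P] [MulAction Gᵐᵒᵖ P]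
  {E₂ S : Type*} [NormedAddCommGroup E₂] [NormedSpace ℝ E₂]
  [TopologicalSpace S] [ChartedSpace E₂ S]
  {EZ HZ : Type*} [NormedAddCommGroup EZ] [NormedSpace ℝ EZ] [TopologicalSpace HZ]
  {IZ : ModelWithCorners ℝ EZ HZ} {Z : Type*} [TopologicalSpace Z] [ChartedSpace HZ Z]
  {F : Type*} [NormedAddCommGroup F] [NormedSpace ℝ F]
  {q : P → S} {act : Z → G → Z} {r : Setoid (P × Z)} {U : TopologicalSpace.Opens (P × Z)}

/-- Slices for the diagonal action on an invariant open subset of `P × Z`. -/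
theorem IsPrincipalBundle.nonempty_quotientSlice [IsManifold 𝓘(ℝ, E₂) ∞ S] [IsManifold IZ ∞ Z]
    [IZ.Boundaryless]
    (hq : IsPrincipalBundle E₀ G E₁ E₂ q) (hact : IsSmoothRightAction E₀ IZ act)
    (hr : ∀ y z, r y z ↔ ∃ g, z = diagAct act y g) (hU : ∀ y ∈ U, ∀ g, diagAct act y g ∈ U)
    (L : (E₂ × EZ) ≃L[ℝ] F) (x : U) :
    Nonempty (QuotientSlice (𝓘(ℝ, E₁).prod IZ) F r U x.1) := by
  obtain ⟨e, hp, he, hes, heq⟩ := hq.exists_trivialization x.1.1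
  let g₀ := (e x.1.1).2
  let φ := extChartAt 𝓘(ℝ, E₂) (q x.1.1)
  let ψ := extChartAt IZ x.1.2
  -- The element n y moves y within its orbit to the point whose group coordinate is g₀. The orbit
  -- is then described by q y.1 and by the translated Z-component. Taking for g₀ the group
  -- coordinate of x makes the slice pass through x.
  let n : P × Z → G := fun y => (e y.1).2⁻¹ * g₀
  have hn : ContMDiffOn (𝓘(ℝ, E₁).prod IZ) 𝓘(ℝ, E₀) ∞ n (Prod.fst ⁻¹' e.source) := by
    have h1 : ContMDiffOn (𝓘(ℝ, E₁).prod IZ) 𝓘(ℝ, E₀) ∞ (fun y : P × Z => (e y.1).2)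
        (Prod.fst ⁻¹' e.source) :=
      contMDiff_snd.comp_contMDiffOn (he.comp contMDiff_fst.contMDiffOn fun _ h => h)
    exact h1.inv.mul contMDiffOn_const
  have hnz : ContMDiffOn (𝓘(ℝ, E₁).prod IZ) IZ ∞ (fun y : P × Z => act y.2 (n y))
      (Prod.fst ⁻¹' e.source) :=
    hact.smooth.comp_contMDiffOn (contMDiffOn_snd.prodMk hn)
  have hpre : IsOpen (Prod.fst ⁻¹' e.source : Set (P × Z)) :=
    e.open_source.preimage continuous_fst
  let σ : F → P × Z := fun t =>
    (e.toOpenPartialHomeomorph.symm (φ.symm (L.symm t).1, g₀), ψ.symm (L.symm t).2)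
  let T₀ : Set F := {t | (L.symm t).1 ∈ φ.target ∧ φ.symm (L.symm t).1 ∈ e.baseSet ∧
    (L.symm t).2 ∈ ψ.target}
  have hφc : ContMDiffOn 𝓘(ℝ, E₂) 𝓘(ℝ, E₂) ∞ φ.symm φ.target := contMDiffOn_extChartAt_symm _
  have hψc : ContMDiffOn 𝓘(ℝ, EZ) IZ ∞ ψ.symm ψ.target := contMDiffOn_extChartAt_symm _
  have hL1 : ContMDiff 𝓘(ℝ, F) 𝓘(ℝ, E₂) ∞ fun t => (L.symm t).1 :=
    (contDiff_fst.comp L.symm.contDiff).contMDiff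
  have hL2 : ContMDiff 𝓘(ℝ, F) 𝓘(ℝ, EZ) ∞ fun t => (L.symm t).2 :=
    (contDiff_snd.comp L.symm.contDiff).contMDiff
  have hT₀ : IsOpen T₀ := by
    have h1 : IsOpen (φ.target ∩ φ.symm ⁻¹' e.baseSet) :=
      hφc.continuousOn.isOpen_inter_preimage (isOpen_extChartAt_target _) e.open_baseSet
    have h2 := (h1.preimage hL1.continuous).inter
      ((isOpen_extChartAt_target (I := IZ) x.1.2).preimage hL2.continuous)
    convert h2 using 1
    ext t
    exact and_assoc.symm
  have hσ : ContMDiffOn 𝓘(ℝ, F) (𝓘(ℝ, E₁).prod IZ) ∞ σ T₀ := by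
    refine ContMDiffOn.prodMk ?_ (hψc.comp hL2.contMDiffOn fun t ht => ht.2.2)
    refine hes.comp ((hφc.comp hL1.contMDiffOn fun t ht => ht.1).prodMk contMDiffOn_const) ?_
    intro t ht
    exact e.mem_target.2 ht.2.1
  have hσe : ∀ t ∈ T₀, (σ t).1 ∈ e.source ∧ e (σ t).1 = (φ.symm (L.symm t).1, g₀) := by
    intro t ht
    have hm : (φ.symm (L.symm t).1, g₀) ∈ e.target := e.mem_target.2 ht.2.1
    exact ⟨e.map_target hm, e.toOpenPartialHomeomorph.right_inv hm⟩
  let W : Set (P × Z) := {y | y ∈ U ∧ y.1 ∈ e.source ∧ q y.1 ∈ φ.source ∧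
    act y.2 (n y) ∈ ψ.source}
  let T : Set F := T₀ ∩ σ ⁻¹' U
  let ρ : P × Z → F := fun y => L (φ (q y.1), ψ (act y.2 (n y)))
  have hcanon : ∀ y ∈ W, ρ y ∈ T₀ ∧ σ (ρ y) = diagAct act y (n y) := by
    rintro y ⟨hyU, hye, hyφ, hyψ⟩
    have h1 : φ.symm (L.symm (ρ y)).1 = q y.1 := by
      simp only [ρ, L.symm_apply_apply]
      exact φ.left_inv hyφ
    have h2 : ψ.symm (L.symm (ρ y)).2 = act y.2 (n y) := by
      simp only [ρ, L.symm_apply_apply]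
      exact ψ.left_inv hyψ
    have h0 : ρ y ∈ T₀ := by
      refine ⟨?_, ?_, ?_⟩
      · simp only [ρ, L.symm_apply_apply]
        exact φ.map_source hyφ
      · rw [h1]
        exact e.mem_source.1 hye
      · simp only [ρ, L.symm_apply_apply]
        exact ψ.map_source hyψ
    refine ⟨h0, Prod.ext ?_ h2⟩
    have h3 : op (n y) • y.1 ∈ e.source :=
      e.mem_source.2 ((hq.preserves_fibers _ _).symm ▸ e.mem_source.1 hye)
    refine e.injOn (hσe _ h0).1 h3 ?_
    refine (hσe _ h0).2.trans (Eq.trans ?_ (heq _ hye _).symm)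
    rw [h1, mul_inv_cancel_left, ← e.coe_fst hye]
  have hWT : ∀ t ∈ T, σ t ∈ W ∧ ρ (σ t) = t := by
    rintro t ⟨ht, htU⟩
    obtain ⟨h1, h2⟩ := hσe t ht
    have h3 : n (σ t) = 1 := by
      simp only [n]
      rw [h2, inv_mul_cancel]
    have h4 : q (σ t).1 = φ.symm (L.symm t).1 := by
      rw [← e.coe_fst h1, h2]
    have h5 : act (σ t).2 (n (σ t)) = ψ.symm (L.symm t).2 := by rw [h3, hact.one]
    refine ⟨⟨htU, h1, ?_, ?_⟩, ?_⟩
    · rw [h4]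
      exact φ.map_target ht.1
    · rw [h5]
      exact ψ.map_target ht.2.2
    · simp only [ρ]
      rw [h4, h5, φ.right_inv ht.1, ψ.right_inv ht.2.2]
      exact L.apply_symm_apply t
  have hqc := hq.contMDiff_proj
  refine ⟨⟨ρ, σ, W, T, ?_, hσ.continuousOn.isOpen_inter_preimage hT₀ U.isOpen, fun y hy => hy.1,
    ?_, fun y hy => ⟨(hcanon y hy).1, ?_⟩, fun t ht => (hWT t ht).1, fun t ht => (hWT t ht).2,
    ?_, ?_, ?_, ?_, hσ.mono inter_subset_left⟩⟩
  · have h1 : IsOpen ((Prod.fst ⁻¹' e.source : Set (P × Z)) ∩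
        (fun y : P × Z => act y.2 (n y)) ⁻¹' ψ.source) :=
      hnz.continuousOn.isOpen_inter_preimage hpre (isOpen_extChartAt_source _)
    have h2 : IsOpen ((fun y : P × Z => q y.1) ⁻¹' φ.source) :=
      (isOpen_extChartAt_source _).preimage (hqc.continuous.comp continuous_fst)
    convert (U.isOpen.inter h1).inter h2 using 1
    ext y
    simp only [W, mem_inter_iff, mem_preimage, SetLike.mem_coe]
    exact ⟨fun h => ⟨⟨h.1, h.2.1, h.2.2.2⟩, h.2.2.1⟩, fun h => ⟨h.1.1, h.1.2.1, h.2, h.1.2.2⟩⟩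
  · refine ⟨x.2, hp, mem_extChartAt_source _, ?_⟩
    simp only [n, g₀, inv_mul_cancel, hact.one]
    exact mem_extChartAt_source _
  · rw [mem_preimage, (hcanon y hy).2]
    exact hU y hy.1 _
  · rintro y ⟨hyU, hye, hyφ, hyψ⟩ z hz hyz
    obtain ⟨g, rfl⟩ := (hr _ _).1 hyz
    have h1 : op g • y.1 ∈ e.source :=
      e.mem_source.2 ((hq.preserves_fibers _ _).symm ▸ e.mem_source.1 hye)
    have h2 : act (diagAct act y g).2 (n (diagAct act y g)) = act y.2 (n y) := by
      -- This equivariance shows that the normalized point, and with it ρ, is constant on orbits.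
      have h3 : n (diagAct act y g) = g⁻¹ * n y := by
        simp only [n, diagAct]
        rw [heq _ hye, mul_inv_rev, mul_assoc]
      rw [h3]
      simp only [diagAct]
      rw [← hact.mul, mul_inv_cancel_left]
    have h4 : q (diagAct act y g).1 = q y.1 := hq.preserves_fibers _ _
    refine ⟨⟨hz, h1, ?_, ?_⟩, ?_⟩
    · rwa [h4]
    · rwa [h2]
    · simp only [ρ]
      rw [h4, h2]
  · intro y hy z hz h
    have h1 : diagAct act y (n y) = diagAct act z (n z) := by
      rw [← (hcanon y hy).2, ← (hcanon z hz).2, h]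
    refine r.trans' ((hr y _).2 ⟨n y, rfl⟩) (r.symm' ((hr z _).2 ⟨n z, h1⟩))
  · have hx : x.1 ∈ W := by
      refine ⟨x.2, hp, mem_extChartAt_source _, ?_⟩
      simp only [n, g₀, inv_mul_cancel, hact.one]
      exact mem_extChartAt_source _
    rw [(hcanon _ hx).2]
    simp only [n, g₀, inv_mul_cancel, diagAct, hact.one, op_one, one_smul]
  · refine L.contDiff.contMDiff.comp_contMDiffOn (ContMDiffOn.prodMk_space ?_ ?_)
    · exact contMDiffOn_extChartAt.comp (hqc.comp contMDiff_fst).contMDiffOn fun y hy => by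
        rw [← extChartAt_source 𝓘(ℝ, E₂)]
        exact hy.2.2.1
    · exact contMDiffOn_extChartAt.comp (hnz.mono fun y hy => hy.2.1) fun y hy => by
        rw [← extChartAt_source IZ]
        exact hy.2.2.2

end OrbitSlices

section OrbitTangent

variable {E₀ G : Type*} [NormedAddCommGroup E₀] [NormedSpace ℝ E₀]
  [TopologicalSpace G] [ChartedSpace E₀ G] [Group G] [LieGroup 𝓘(ℝ, E₀) ∞ G]
  {E₁ P : Type*} [NormedAddCommGroup E₁] [NormedSpace ℝ E₁]
  [TopologicalSpace P] [ChartedSpace E₁ P] [MulAction Gᵐᵒᵖ P] [IsManifold 𝓘(ℝ, E₁) ∞ P]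
  {E₂ S : Type*} [NormedAddCommGroup E₂] [NormedSpace ℝ E₂]
  [TopologicalSpace S] [ChartedSpace E₂ S]
  {EZ HZ : Type*} [NormedAddCommGroup EZ] [NormedSpace ℝ EZ] [TopologicalSpace HZ]
  {IZ : ModelWithCorners ℝ EZ HZ} {Z : Type*} [TopologicalSpace Z] [ChartedSpace HZ Z]
  [IsManifold IZ ∞ Z] [IZ.Boundaryless]
  {EQ HQ : Type*} [NormedAddCommGroup EQ] [NormedSpace ℝ EQ] [TopologicalSpace HQ]
  {IQ : ModelWithCorners ℝ EQ HQ} {Q : Type*} [TopologicalSpace Q] [ChartedSpace HQ Q]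
  {q : P → S} {act : Z → G → Z} {U : TopologicalSpace.Opens (P × Z)}

theorem orbitDeriv_diagAct (hq : IsPrincipalBundle E₀ G E₁ E₂ q)
    (hact : IsSmoothRightAction E₀ IZ act) (y : P × Z) :
    orbitDeriv E₀ (𝓘(ℝ, E₁).prod IZ) (diagAct (G := G) act) y =
      (genP E₀ G E₁ y.1).prod (orbitDeriv E₀ IZ act y.2) :=
  mderiv_prodMk ((hq.isSmoothRightAction.contMDiff_orbit y.1).mdifferentiableAt (by simp))
    ((hact.contMDiff_orbit y.2).mdifferentiableAt (by simp))

theorem IsSmoothRightAction.orbitDeriv_mem_ker {π : U → Q}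
    (hq : IsPrincipalBundle E₀ G E₁ E₂ q) (hact : IsSmoothRightAction E₀ IZ act)
    (hU : ∀ y ∈ U, ∀ g, diagAct act y g ∈ U)
    (hπ : ∀ (y : U) (g : G), π ⟨diagAct act y.1 g, hU y.1 y.2 g⟩ = π y) (x : U)
    (hd : MDifferentiableAt (𝓘(ℝ, E₁).prod IZ) IQ π x) (X : E₀) :
    mderiv (𝓘(ℝ, E₁).prod IZ) IQ π x
      (orbitDeriv E₀ (𝓘(ℝ, E₁).prod IZ) (diagAct act) x.1 X) = 0 := by
  have hdi := hact.diag hq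
  have h1 : ContMDiffAt 𝓘(ℝ, E₀) (𝓘(ℝ, E₁).prod IZ) ∞
      (fun g : G => (⟨diagAct act x.1 g, hU x.1 x.2 g⟩ : U)) 1 :=
    contMDiffAt_opens_iff.2 (hdi.contMDiff_orbit x.1 1)
  have h2 := h1.mdifferentiableAt (by simp)
  have h3 := mderiv_comp_of_eq hd h2 (Subtype.ext (hdi.one x.1))
  have h4 : (fun g : G => π ⟨diagAct act x.1 g, hU x.1 x.2 g⟩) = fun _ => π x :=
    funext fun g => hπ x g
  rw [h4, mderiv_const, ← mderiv_val_comp h2] at h3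
  exact (DFunLike.congr_fun h3 X).symm

/-- Orbit directions lie in the kernel since π is constant on orbits. They form a space of dimension
dim G by freeness, and the kernel has the same dimension because π is a submersion and dim P = dim S
+ dim G. -/
theorem IsSmoothQuotient.mderiv_eq_zero_iff [FiniteDimensional ℝ E₀] [FiniteDimensional ℝ E₁]
    [FiniteDimensional ℝ E₂] [FiniteDimensional ℝ EZ] [FiniteDimensional ℝ EQ] {π : U → Q}
    (h : IsSmoothQuotient (𝓘(ℝ, E₁).prod IZ) IQ π)
    (hq : IsPrincipalBundle E₀ G E₁ E₂ q) (hact : IsSmoothRightAction E₀ IZ act)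
    (hU : ∀ y ∈ U, ∀ g, diagAct act y g ∈ U)
    (hπ : ∀ (y : U) (g : G), π ⟨diagAct act y.1 g, hU y.1 y.2 g⟩ = π y)
    (hdim : Module.finrank ℝ EQ = Module.finrank ℝ E₂ + Module.finrank ℝ EZ) (x : U)
    (v : E₁ × EZ) :
    mderiv (𝓘(ℝ, E₁).prod IZ) IQ π x v = 0 ↔
      ∃ X, orbitDeriv E₀ (𝓘(ℝ, E₁).prod IZ) (diagAct (G := G) act) x.1 X = v := by
  have hd := h.mdifferentiableAt x
  let D := (mderiv (𝓘(ℝ, E₁).prod IZ) IQ π x : E₁ × EZ →ₗ[ℝ] EQ)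
  let O := (orbitDeriv E₀ (𝓘(ℝ, E₁).prod IZ) (diagAct (G := G) act) x.1 : E₀ →ₗ[ℝ] E₁ × EZ)
  have hO : Function.Injective O := by
    intro X Y hXY
    apply hq.genP_injective x.1.1
    have h1 := orbitDeriv_diagAct hq hact x.1
    have h2 : ∀ X, (O X).1 = genP E₀ G E₁ x.1.1 X := fun X =>
      congrArg (fun A : E₀ →L[ℝ] E₁ × EZ => (A X).1) h1
    rw [← h2, ← h2, hXY]
  have hle : LinearMap.range O ≤ LinearMap.ker D := by
    rintro _ ⟨X, rfl⟩
    exact hact.orbitDeriv_mem_ker hq hU hπ x hd X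
  have hrange : Module.finrank ℝ (LinearMap.range D) = Module.finrank ℝ EQ := by
    rw [LinearMap.range_eq_top.2 (h.surjective_mderiv x), finrank_top]
  have heq : LinearMap.range O = LinearMap.ker D := by
    refine Submodule.eq_of_le_of_finrank_eq hle ?_
    have h1 := LinearMap.finrank_range_add_finrank_ker D
    rw [hrange, Module.finrank_prod, hq.finrank_eq x.1.1] at h1
    rw [LinearMap.finrank_range_of_inj hO]
    omega
  have h5 : v ∈ LinearMap.ker D ↔ v ∈ LinearMap.range O := by rw [heq]
  exact h5

end OrbitTangent

/-! ### The form ω, its invariance and its moment map -/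

section FormCalculus

variable {E H : Type*} [NormedAddCommGroup E] [NormedSpace ℝ E] [TopologicalSpace H]
  {I : ModelWithCorners ℝ E H} {M : Type*} [TopologicalSpace M] [ChartedSpace H M]
  {E' H' : Type*} [NormedAddCommGroup E'] [NormedSpace ℝ E'] [TopologicalSpace H']
  {I' : ModelWithCorners ℝ E' H'} {M' : Type*} [TopologicalSpace M'] [ChartedSpace H' M']
  {E'' H'' : Type*} [NormedAddCommGroup E''] [NormedSpace ℝ E''] [TopologicalSpace H'']
  {I'' : ModelWithCorners ℝ E'' H''} {N : Type*} [TopologicalSpace N] [ChartedSpace H'' N]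
  {F : Type*} [NormedAddCommGroup F] [NormedSpace ℝ F] {k : ℕ}

theorem DiffForm.pullback_comp {f : M → M'} {g : M' → N} (η : DiffForm I'' N k F)
    (hg : MDifferentiable I' I'' g) (hf : MDifferentiable I I' f) :
    DiffForm.pullback I f (DiffForm.pullback I' g η) =
      DiffForm.pullback I (fun x => g (f x)) η := by
  funext x
  ext v
  rw [DiffForm.pullback_apply, DiffForm.pullback_apply, DiffForm.pullback_apply]
  refine congrArg (fun u : Fin k → E'' => η (g (f x)) u) (funext fun i => ?_)
  exact (DFunLike.congr_fun (mderiv_comp x (hg (f x)) (hf x)) (v i)).symm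

theorem DiffForm.d_zero [IsManifold I ∞ M] (x : M) : (0 : DiffForm I M k F).d x = 0 := by
  have h : DiffForm.inChart (0 : DiffForm I M k F) x = fun _ => 0 := rfl
  ext v
  refine (DiffForm.d_apply (E := E) (I := I) (0 : DiffForm I M k F) x v).trans ?_
  rw [h, extDeriv, fderiv_fun_const]
  exact DFunLike.congr_fun (map_zero (ContinuousAlternatingMap.alternatizeUncurryFinCLM ℝ E F)) v

/-- The value of a `1`-form on a vector of the model space. -/
def DiffForm.eval₁ (η : DiffForm I M 1 F) (x : M) (v : E) : F := η x ![v]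

theorem DiffForm.eval₁_pullback (f : M → M') (η : DiffForm I' M' 1 F) (x : M) (v : E) :
    (DiffForm.pullback I f η).eval₁ x v = η.eval₁ (f x) (mderiv I I' f x v) := by
  rw [DiffForm.eval₁, DiffForm.pullback_apply]
  refine congrArg (fun u : Fin 1 → E' => η (f x) u) (funext fun i => ?_)
  fin_cases i
  rfl

theorem DiffForm.ext_eval₁ {η ζ : DiffForm I M 1 F} {x : M}
    (h : ∀ v : E, η.eval₁ x v = ζ.eval₁ x v) : η x = ζ x := by
  ext v
  have hv : v = ![v 0] := by
    funext i
    fin_cases i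
    rfl
  rw [hv]
  exact h (v 0)

end FormCalculus

/-- The exterior derivative of a `1`-form on the plane in terms of its restrictions to the axes. -/
theorem d_plane {α : DiffForm 𝓘(ℝ, ℝ × ℝ) (ℝ × ℝ) 1 ℝ} (hα : α.IsSmooth) {a b : ℝ}
    (h1 : HasDerivAt (fun t : ℝ => α.eval₁ (t, 0) (0, 1)) a 0)
    (h2 : HasDerivAt (fun s : ℝ => α.eval₁ (0, s) (1, 0)) b 0) :
    α.d.bilin (0, 0) (1, 0) (0, 1) = a - b := by
  let β : ℝ × ℝ → (ℝ × ℝ) →L[ℝ] ℝ := fun y => (oneFormIso (E := ℝ × ℝ)).symm (α y)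
  have hβ : ∀ y v, β y v = α.eval₁ y v := fun y v => by
    have h := oneForm_apply (β y) ![v]
    refine h.symm.trans ?_
    exact congrArg (fun A : (ℝ × ℝ) [⋀^Fin 1]→L[ℝ] ℝ => A ![v])
      ((oneFormIso (E := ℝ × ℝ)).apply_symm_apply (α y))
  have hαβ : (fun y => oneForm (β y)) = (α : ℝ × ℝ → (ℝ × ℝ) [⋀^Fin 1]→L[ℝ] ℝ) :=
    funext fun y => (oneFormIso (E := ℝ × ℝ)).apply_symm_apply (α y)
  have hs : ContDiffAt ℝ ∞ β (0, 0) := by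
    have h3 : ContDiffAt ℝ ∞ (α.inChart (0, 0)) (0, 0) := DiffForm.isSmooth_iff.1 hα (0, 0)
    rw [DiffForm.inChart_vectorSpace] at h3
    exact (oneFormIso (E := ℝ × ℝ)).symm.contDiff.contDiffAt.comp _ h3
  have hd := hs.differentiableAt (by simp)
  have h4 : α.d.bilin (0, 0) (1, 0) (0, 1) = fderiv ℝ β (0, 0) (1, 0) (0, 1)
      - fderiv ℝ β (0, 0) (0, 1) (1, 0) := by
    rw [DiffForm.bilin_apply, ← extDeriv_oneForm hd, hαβ]
    exact DiffForm.d_vectorSpace α (0, 0) _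
  have h5 : ∀ u v : ℝ × ℝ, HasDerivAt (fun t : ℝ => β (t • u) v) (fderiv ℝ β (0, 0) u v) 0 := by
    intro u v
    have h6 : HasDerivAt (fun t : ℝ => t • u) u 0 := by
      simpa using (hasDerivAt_id (0 : ℝ)).smul_const u
    have h7 : HasFDerivAt β (fderiv ℝ β (0, 0)) ((0 : ℝ) • u) := by
      rw [zero_smul]
      exact hd.hasFDerivAt
    have h8 := h7.comp_hasDerivAt (0 : ℝ) h6
    simpa using h8.clm_apply (hasDerivAt_const (0 : ℝ) v)
  have h9 := (h5 (1, 0) (0, 1)).unique (by simpa [hβ] using h1)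
  have h10 := (h5 (0, 1) (1, 0)).unique (by simpa [hβ] using h2)
  rw [h4, h9, h10]

section Omega

variable {E₀ G : Type*} [NormedAddCommGroup E₀] [NormedSpace ℝ E₀]
  [TopologicalSpace G] [ChartedSpace E₀ G] [Group G] [LieGroup 𝓘(ℝ, E₀) ∞ G]
  {E₁ P : Type*} [NormedAddCommGroup E₁] [NormedSpace ℝ E₁]
  [TopologicalSpace P] [ChartedSpace E₁ P] [MulAction Gᵐᵒᵖ P] [IsManifold 𝓘(ℝ, E₁) ∞ P]
  {E₂ S : Type*} [NormedAddCommGroup E₂] [NormedSpace ℝ E₂]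
  [TopologicalSpace S] [ChartedSpace E₂ S] [IsManifold 𝓘(ℝ, E₂) ∞ S]
  {q : P → S} {ωS : DiffForm 𝓘(ℝ, E₂) S 2 ℝ} (θ : PrincipalConnection E₀ G E₁ P)

theorem isSmoothRightAction_coadAct (hq : IsPrincipalBundle E₀ G E₁ E₂ q) :
    IsSmoothRightAction E₀ (modelSigma E₀ E₁) (coadAct : P × LieDual E₀ → G → P × LieDual E₀) :=
  isSmoothRightAction_coad.diag hq

theorem thetaTilde_eval (x : P × LieDual E₀) (v : E₁ × LieDual E₀) :
    (thetaTilde θ).eval₁ x v = x.2 (θ.form.eval₁ x.1 v.1) := by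
  have h := DiffForm.eval₁_pullback (I := modelSigma E₀ E₁) (fun y : P × LieDual E₀ => y.1)
    θ.form x v
  refine (congrArg x.2 h).trans ?_
  exact congrArg (fun A : E₁ × LieDual E₀ →L[ℝ] E₁ => x.2 (θ.form.eval₁ x.1 (A v))) (mderiv_fst x)

theorem thetaTilde_isSmooth : (thetaTilde θ).IsSmooth := by
  have hΘ : (DiffForm.pullback (modelSigma E₀ E₁) (fun y : P × LieDual E₀ => y.1) θ.form).IsSmooth :=
    θ.smooth.pullback contMDiff_fst
  intro x₀ y hy
  have hn := (isOpen_extChartAt_target (I := modelSigma E₀ E₁) x₀).mem_nhds hy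
  have h1 : ContDiffAt ℝ ∞ _ y := (hΘ x₀).contDiffAt hn
  have h2 : ContDiffAt ℝ ∞ (fun z => ((extChartAt (modelSigma E₀ E₁) x₀).symm z).2) y :=
    ((contMDiff_snd.comp_contMDiffOn (contMDiffOn_extChartAt_symm x₀)).contMDiffAt hn).contDiffAt
  have h3 : ContDiffAt ℝ ∞ (fun z => (ContinuousAlternatingMap.ofSubsingletonLIE
      (𝕜 := ℝ) (E := E₁ × LieDual E₀) (F := E₀) (0 : Fin 1)).symm
      ((DiffForm.pullback (modelSigma E₀ E₁) (fun y : P × LieDual E₀ => y.1) θ.form).inChart x₀ z))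
      y := (LinearIsometryEquiv.contDiff _).contDiffAt.comp y h1
  have h4 : (thetaTilde θ).inChart x₀ = fun z => oneForm
      (((extChartAt (modelSigma E₀ E₁) x₀).symm z).2 ∘L
        (((ContinuousAlternatingMap.ofSubsingletonLIE
          (𝕜 := ℝ) (E := E₁ × LieDual E₀) (F := E₀) (0 : Fin 1)).symm
          ((DiffForm.pullback (modelSigma E₀ E₁) (fun y : P × LieDual E₀ => y.1)
            θ.form).inChart x₀ z)) : (E₁ × LieDual E₀) →L[ℝ] E₀)) := by
    funext z
    ext v
    refine congrArg (fun u : Fin 1 → E₁ × LieDual E₀ => ((extChartAt (modelSigma E₀ E₁) x₀).symm z).2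
      ((DiffForm.pullback (modelSigma E₀ E₁) (fun y : P × LieDual E₀ => y.1)
        θ.form).inChart x₀ z u)) (funext fun i => ?_)
    rw [Subsingleton.elim i 0]
  rw [h4]
  exact (contDiffAt_oneForm (h2.clm_comp h3)).contDiffWithinAt

theorem omega_isSmooth (hq : IsPrincipalBundle E₀ G E₁ E₂ q) (hωS : ωS.IsSmooth) :
    (omega q ωS θ).IsSmooth :=
  (hωS.pullback (hq.contMDiff_proj.comp contMDiff_fst)).sub (thetaTilde_isSmooth θ).d

theorem omega_closed (hq : IsPrincipalBundle E₀ G E₁ E₂ q) (hωS : IsSymplectic ωS)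
    (x : P × LieDual E₀) : (omega q ωS θ).d x = 0 := by
  have h1 : ContMDiff (modelSigma E₀ E₁) 𝓘(ℝ, E₂) ∞ (fun x : P × LieDual E₀ => q x.1) :=
    hq.contMDiff_proj.comp contMDiff_fst
  rw [omega, DiffForm.d_sub (DiffForm.isSmooth_iff.1 (hωS.smooth.pullback h1) x)
    (DiffForm.isSmooth_iff.1 (thetaTilde_isSmooth θ).d x),
    DiffForm.d_pullback (DiffForm.isSmooth_iff.1 hωS.smooth _) (h1 x),
    DiffForm.d_d (thetaTilde_isSmooth θ), sub_zero]
  ext v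
  exact congrArg (fun A : E₂ [⋀^Fin 3]→L[ℝ] ℝ => A fun i =>
    mderiv (modelSigma E₀ E₁) 𝓘(ℝ, E₂) (fun x : P × LieDual E₀ => q x.1) x (v i)) (hωS.closed (q x.1))

theorem omega_bilin (hq : IsPrincipalBundle E₀ G E₁ E₂ q) (x : P × LieDual E₀)
    (v w : E₁ × LieDual E₀) : (omega q ωS θ).bilin x v w =
      ωS.bilin (q x.1) (mderiv 𝓘(ℝ, E₁) 𝓘(ℝ, E₂) q x.1 v.1)
        (mderiv 𝓘(ℝ, E₁) 𝓘(ℝ, E₂) q x.1 w.1) - (thetaTilde θ).d.bilin x v w := by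
  have h1 : mderiv (modelSigma E₀ E₁) 𝓘(ℝ, E₂) (fun x : P × LieDual E₀ => q x.1) x =
      (mderiv 𝓘(ℝ, E₁) 𝓘(ℝ, E₂) q x.1).comp (ContinuousLinearMap.fst ℝ E₁ (LieDual E₀)) := by
    rw [mderiv_comp (I' := 𝓘(ℝ, E₁)) x (hq.contMDiff_proj.mdifferentiableAt (by simp))
      mdifferentiableAt_fst, mderiv_fst]
  have h2 := pullback_bilin (I := modelSigma E₀ E₁) (fun x : P × LieDual E₀ => q x.1) ωS x v w
  rw [h1] at h2
  exact congrArg (fun a : ℝ => a - (thetaTilde θ).d.bilin x v w) h2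

/-- The Ad_g in the action on ξ cancels the Ad_{g⁻¹} in the equivariance of θ. -/
theorem thetaTilde_pullback_coadAct (hq : IsPrincipalBundle E₀ G E₁ E₂ q) (g : G) :
    DiffForm.pullback (modelSigma E₀ E₁) (fun x : P × LieDual E₀ => coadAct x g) (thetaTilde θ) =
      thetaTilde θ := by
  funext x
  refine DiffForm.ext_eval₁ fun v => ?_
  rw [DiffForm.eval₁_pullback, thetaTilde_eval, thetaTilde_eval]
  have h0 : ∀ p, MDifferentiableAt 𝓘(ℝ, E₁) 𝓘(ℝ, E₁) (fun p : P => op g • p) p := fun p =>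
    (hq.isSmoothRightAction.contMDiff_act g).mdifferentiableAt (by simp)
  have h1 : (mderiv (modelSigma E₀ E₁) (modelSigma E₀ E₁)
      (fun x : P × LieDual E₀ => coadAct x g) x v).1 =
      mderiv 𝓘(ℝ, E₁) 𝓘(ℝ, E₁) (fun p : P => op g • p) x.1 v.1 := by
    have h2 := mderiv_comp (I'' := 𝓘(ℝ, E₁)) x (mdifferentiableAt_fst (x := coadAct x g))
      (((isSmoothRightAction_coadAct hq).contMDiff_act g).mdifferentiableAt (by simp))
    rw [mderiv_fst] at h2
    refine (DFunLike.congr_fun h2 v).symm.trans ?_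
    have h3 := mderiv_comp (I := modelSigma E₀ E₁) (I' := 𝓘(ℝ, E₁)) (f := Prod.fst) x (h0 x.1)
      mdifferentiableAt_fst
    rw [mderiv_fst] at h3
    exact DFunLike.congr_fun h3 v
  rw [h1]
  have h4 : θ.form.eval₁ (op g • x.1) (mderiv 𝓘(ℝ, E₁) 𝓘(ℝ, E₁) (fun p : P => op g • p) x.1 v.1) =
      lieAd g⁻¹ (θ.form.eval₁ x.1 v.1) := θ.equivariant g x.1 v.1
  refine (congrArg (fun u : E₀ => x.2 (lieAd g u)) h4).trans ?_
  have h5 := lieAd_mul (E₀ := E₀) g g⁻¹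
  rw [mul_inv_cancel, lieAd_one] at h5
  exact congrArg x.2 (DFunLike.congr_fun h5 _).symm

theorem omega_pullback_coadAct (hq : IsPrincipalBundle E₀ G E₁ E₂ q) (g : G) :
    DiffForm.pullback (modelSigma E₀ E₁) (fun x : P × LieDual E₀ => coadAct x g) (omega q ωS θ) =
      omega q ωS θ := by
  have hs := (isSmoothRightAction_coadAct hq).contMDiff_act g
  have h1 : DiffForm.pullback (modelSigma E₀ E₁) (fun x : P × LieDual E₀ => coadAct x g)
      (thetaTilde θ).d = (thetaTilde θ).d := by
    funext x
    rw [← DiffForm.d_pullback (DiffForm.isSmooth_iff.1 (thetaTilde_isSmooth θ) _) (hs x),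
      thetaTilde_pullback_coadAct θ hq]
  have h2 : DiffForm.pullback (modelSigma E₀ E₁) (fun x : P × LieDual E₀ => coadAct x g)
      (DiffForm.pullback (modelSigma E₀ E₁) (fun x : P × LieDual E₀ => q x.1) ωS) =
      DiffForm.pullback (modelSigma E₀ E₁) (fun x : P × LieDual E₀ => q x.1) ωS := by
    have hqf : MDifferentiable (modelSigma E₀ E₁) 𝓘(ℝ, E₂) (fun x : P × LieDual E₀ => q x.1) :=
      (hq.contMDiff_proj.comp contMDiff_fst).mdifferentiable (by simp)
    rw [DiffForm.pullback_comp ωS hqf (hs.mdifferentiable (by simp))]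
    have h3 : (fun x : P × LieDual E₀ => q (coadAct x g).1) = fun x => q x.1 :=
      funext fun x => hq.preserves_fibers x.1 g
    rw [h3]
  have h4 : ∀ η ζ : DiffForm (modelSigma E₀ E₁) (P × LieDual E₀) 2 ℝ,
      DiffForm.pullback (modelSigma E₀ E₁) (fun x : P × LieDual E₀ => coadAct x g) (η - ζ) =
      DiffForm.pullback (modelSigma E₀ E₁) (fun x : P × LieDual E₀ => coadAct x g) η -
      DiffForm.pullback (modelSigma E₀ E₁) (fun x : P × LieDual E₀ => coadAct x g) ζ :=
    fun _ _ => rfl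
  rw [omega, h4, h2, h1]

end Omega

section PlaneDerivative

variable {E H : Type*} [NormedAddCommGroup E] [NormedSpace ℝ E] [TopologicalSpace H]
  {I : ModelWithCorners ℝ E H} {M : Type*} [TopologicalSpace M] [ChartedSpace H M]

theorem mderiv_plane_fst {C : ℝ × ℝ → M} {a b : ℝ} (hC : MDifferentiableAt 𝓘(ℝ, ℝ × ℝ) I C (a, b)) :
    mderiv 𝓘(ℝ, ℝ × ℝ) I C (a, b) (1, 0) = mderiv 𝓘(ℝ, ℝ) I (fun t => C (t, b)) a 1 := by
  have h1 : HasFDerivAt (fun t : ℝ => (t, b))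
      ((ContinuousLinearMap.id ℝ ℝ).prod (0 : ℝ →L[ℝ] ℝ)) a :=
    (hasFDerivAt_id a).prodMk (hasFDerivAt_const b a)
  rw [mderiv_comp (I' := 𝓘(ℝ, ℝ × ℝ)) a hC h1.differentiableAt.mdifferentiableAt, mderiv_eq_fderiv,
    h1.fderiv]
  rfl

theorem mderiv_plane_snd {C : ℝ × ℝ → M} {a b : ℝ} (hC : MDifferentiableAt 𝓘(ℝ, ℝ × ℝ) I C (a, b)) :
    mderiv 𝓘(ℝ, ℝ × ℝ) I C (a, b) (0, 1) = mderiv 𝓘(ℝ, ℝ) I (fun s => C (a, s)) b 1 := by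
  have h1 : HasFDerivAt (fun s : ℝ => (a, s))
      ((0 : ℝ →L[ℝ] ℝ).prod (ContinuousLinearMap.id ℝ ℝ)) b :=
    (hasFDerivAt_const a b).prodMk (hasFDerivAt_id b)
  rw [mderiv_comp (I' := 𝓘(ℝ, ℝ × ℝ)) b hC h1.differentiableAt.mdifferentiableAt, mderiv_eq_fderiv,
    h1.fderiv]
  rfl

end PlaneDerivative

section ActionDerivative

variable {E₀ G : Type*} [NormedAddCommGroup E₀] [NormedSpace ℝ E₀]
  [TopologicalSpace G] [ChartedSpace E₀ G] [Group G] [LieGroup 𝓘(ℝ, E₀) ∞ G]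
  {EZ HZ : Type*} [NormedAddCommGroup EZ] [NormedSpace ℝ EZ] [TopologicalSpace HZ]
  {IZ : ModelWithCorners ℝ EZ HZ} {Z : Type*} [TopologicalSpace Z] [ChartedSpace HZ Z]

theorem IsSmoothRightAction.surjective_mderiv_act {act : Z → G → Z}
    (h : IsSmoothRightAction E₀ IZ act) (g : G) (z : Z) :
    Function.Surjective (mderiv IZ IZ (fun z => act z g) z) := by
  have hd : ∀ g z, MDifferentiableAt IZ IZ (fun z => act z g) z := fun g z =>
    (h.contMDiff_act g).mdifferentiableAt (by simp)
  have h1 : (mderiv IZ IZ (fun z => act z g) z).comp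
      (mderiv IZ IZ (fun z => act z g⁻¹) (act z g)) = ContinuousLinearMap.id ℝ EZ := by
    rw [← mderiv_comp_of_eq (hd g z) (hd g⁻¹ _) (by rw [← h.mul, mul_inv_cancel, h.one]),
      ← mderiv_id (I := IZ) (act z g)]
    refine mderiv_congr (Filter.Eventually.of_forall fun y => ?_)
    exact (h.mul y g⁻¹ g).symm.trans (by rw [inv_mul_cancel, h.one])
  exact fun v => ⟨_, DFunLike.congr_fun h1 v⟩

end ActionDerivative

section Omega

variable {E₀ G : Type*} [NormedAddCommGroup E₀] [NormedSpace ℝ E₀]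
  [TopologicalSpace G] [ChartedSpace E₀ G] [Group G] [LieGroup 𝓘(ℝ, E₀) ∞ G]
  {E₁ P : Type*} [NormedAddCommGroup E₁] [NormedSpace ℝ E₁]
  [TopologicalSpace P] [ChartedSpace E₁ P] [MulAction Gᵐᵒᵖ P] [IsManifold 𝓘(ℝ, E₁) ∞ P]
  {E₂ S : Type*} [NormedAddCommGroup E₂] [NormedSpace ℝ E₂]
  [TopologicalSpace S] [ChartedSpace E₂ S] [IsManifold 𝓘(ℝ, E₂) ∞ S]
  {q : P → S} {ωS : DiffForm 𝓘(ℝ, E₂) S 2 ℝ} (θ : PrincipalConnection E₀ G E₁ P)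

variable (E₀ G E₁) in
/-- The infinitesimal action on `P × 𝔤^*`. -/
abbrev gen (x : P × LieDual E₀) : E₀ →L[ℝ] E₁ × LieDual E₀ :=
  orbitDeriv E₀ (modelSigma E₀ E₁) (coadAct (G := G)) x

theorem gen_fst (hq : IsPrincipalBundle E₀ G E₁ E₂ q) (x : P × LieDual E₀) (X : E₀) :
    (gen E₀ G E₁ x X).1 = genP E₀ G E₁ x.1 X :=
  congrArg (fun A : E₀ →L[ℝ] E₁ × LieDual E₀ => (A X).1)
    (orbitDeriv_diagAct hq isSmoothRightAction_coad x)

theorem gen_zero_snd (hq : IsPrincipalBundle E₀ G E₁ E₂ q) (p : P) (X : E₀) :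
    (gen E₀ G E₁ (p, (0 : LieDual E₀)) X).2 = 0 := by
  have h1 := congrArg (fun A : E₀ →L[ℝ] E₁ × LieDual E₀ => (A X).2)
    (orbitDeriv_diagAct hq (isSmoothRightAction_coad (E₀ := E₀) (G := G)) (p, (0 : LieDual E₀)))
  refine h1.trans ?_
  have h2 : orbitDeriv E₀ 𝓘(ℝ, LieDual E₀)
      (fun (ξ : LieDual E₀) (g : G) => (ξ ∘L lieAd g : LieDual E₀)) 0 = 0 := by
    rw [orbitDeriv, ← mderiv_const (I := 𝓘(ℝ, E₀)) (I' := 𝓘(ℝ, LieDual E₀)) (0 : LieDual E₀) (1 : G)]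
    simp only [ContinuousLinearMap.zero_comp]
  exact DFunLike.congr_fun h2 X

/-- The base point is written `coadAct x 1`, in accordance with the field `generator` of the
connection, because this is where the derivative of the orbit map at 1 takes its values. -/
theorem thetaTilde_eval_gen (hq : IsPrincipalBundle E₀ G E₁ E₂ q) (x : P × LieDual E₀) (X : E₀) :
    (thetaTilde θ).eval₁ (coadAct x (1 : G)) (gen E₀ G E₁ x X) = x.2 X := by
  rw [thetaTilde_eval, gen_fst hq]
  have h1 : (coadAct x (1 : G)).2 = x.2 := by rw [coadAct_one]
  rw [h1]
  exact congrArg x.2 (θ.generator x.1 X)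

/-- The moment map property of `ω`. -/
theorem omega_gen (hq : IsPrincipalBundle E₀ G E₁ E₂ q) (x : P × LieDual E₀)
    (X : E₀) (w : E₁ × LieDual E₀) :
    (omega q ωS θ).bilin x (gen E₀ G E₁ x X) w = w.2 X := by
  have hact := isSmoothRightAction_coadAct hq
  obtain ⟨c, hc, hc0, hcw⟩ := exists_curve (I := modelSigma E₀ E₁) x w
  have hG : IsManifold 𝓘(ℝ, E₀) ∞ G := inferInstance
  obtain ⟨g, hg, hg0, hgX⟩ := exists_curve (I := 𝓘(ℝ, E₀)) (1 : G) X
  -- A surface replaces the Lie derivative. At C(t, s) = c(s) · g(t), the vector ∂_t for t = 0 is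
  -- the generator of X, and ∂_s for s = 0 is the translate of w by g(t). By invariance θ̃(∂_s) is
  -- constant along the t-axis, while θ̃(∂_t) is ⟨ξ(s), X⟩ along the s-axis; hence dθ̃(∂_t, ∂_s) =
  -- -⟨w.2, X⟩ at the origin, by `d_plane`.
  let C : ℝ × ℝ → P × LieDual E₀ := fun z => coadAct (c z.2) (g z.1)
  have hC : ContMDiff 𝓘(ℝ, ℝ × ℝ) (modelSigma E₀ E₁) ∞ C :=
    hact.smooth.comp ((hc.comp contDiff_snd.contMDiff).prodMk (hg.comp contDiff_fst.contMDiff))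
  have hCd : ∀ z, MDifferentiableAt 𝓘(ℝ, ℝ × ℝ) (modelSigma E₀ E₁) C z := fun z =>
    (hC z).mdifferentiableAt (by simp)
  have hfst : ∀ s, mderiv 𝓘(ℝ, ℝ × ℝ) (modelSigma E₀ E₁) C (0, s) (1, 0) =
      gen E₀ G E₁ (c s) X := by
    intro s
    rw [mderiv_plane_fst (hCd _)]
    have h1 := mderiv_comp_of_eq (x := (0 : ℝ))
      ((hact.contMDiff_orbit (c s) 1).mdifferentiableAt (by simp))
      ((hg 0).mdifferentiableAt (by simp)) hg0
    refine (DFunLike.congr_fun h1 1).trans ?_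
    rw [ContinuousLinearMap.comp_apply, hgX]
    rfl
  have hsnd : ∀ t, mderiv 𝓘(ℝ, ℝ × ℝ) (modelSigma E₀ E₁) C (t, 0) (0, 1) =
      mderiv (modelSigma E₀ E₁) (modelSigma E₀ E₁) (fun y => coadAct y (g t)) x w := by
    intro t
    rw [mderiv_plane_snd (hCd _)]
    have h1 := mderiv_comp_of_eq (x := (0 : ℝ))
      ((hact.contMDiff_act (g t) x).mdifferentiableAt (by simp))
      ((hc 0).mdifferentiableAt (by simp)) hc0
    refine (DFunLike.congr_fun h1 1).trans ?_
    rw [ContinuousLinearMap.comp_apply, hcw]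
  let α := DiffForm.pullback 𝓘(ℝ, ℝ × ℝ) C (thetaTilde θ)
  have hα : α.IsSmooth := (thetaTilde_isSmooth θ).pullback hC
  have h1 : HasDerivAt (fun t : ℝ => α.eval₁ (t, 0) (0, 1)) 0 0 := by
    have h2 : (fun t : ℝ => α.eval₁ (t, 0) (0, 1)) = fun _ => (thetaTilde θ).eval₁ x w := by
      funext t
      rw [DiffForm.eval₁_pullback, hsnd]
      have h3 : C (t, 0) = coadAct x (g t) := by rw [← hc0]
      rw [h3, ← DiffForm.eval₁_pullback (I := modelSigma E₀ E₁) (fun y => coadAct y (g t)),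
        thetaTilde_pullback_coadAct θ hq]
    rw [h2]
    exact hasDerivAt_const _ _
  have h4 : HasDerivAt (fun s : ℝ => α.eval₁ (0, s) (1, 0)) (w.2 X) 0 := by
    have h2 : (fun s : ℝ => α.eval₁ (0, s) (1, 0)) = fun s => (c s).2 X := by
      funext s
      rw [DiffForm.eval₁_pullback, hfst]
      have h3 : C (0, s) = coadAct (c s) (1 : G) := by rw [← hg0]
      rw [h3, thetaTilde_eval_gen θ hq]
    rw [h2]
    have h5 : ContMDiff 𝓘(ℝ, ℝ) 𝓘(ℝ, LieDual E₀) ∞ fun s => (c s).2 := contMDiff_snd.comp hc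
    have h6 : HasDerivAt (fun s => (c s).2) w.2 0 := by
      have h7 : HasFDerivAt (fun s => (c s).2) _ 0 :=
        (h5.contDiff.differentiable (by simp) 0).hasFDerivAt
      have h8 : fderiv ℝ (fun s => (c s).2) 0 1 = w.2 := by
        rw [← mderiv_eq_fderiv, mderiv_comp (I' := modelSigma E₀ E₁) (g := Prod.snd) 0
          mdifferentiableAt_snd ((hc 0).mdifferentiableAt (by simp)), mderiv_snd,
          ContinuousLinearMap.comp_apply, hcw]
        rfl
      rw [← h8]
      exact h7.hasDerivAt
    simpa using h6.clm_apply (hasDerivAt_const (0 : ℝ) X)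
  have h9 := d_plane hα h1 h4
  have hC0 : C (0, 0) = x := by
    show coadAct (c 0) (g 0) = x
    rw [hc0, hg0, coadAct_one]
  have h10 : α.d.bilin (0, 0) (1, 0) (0, 1) =
      (thetaTilde θ).d.bilin x (gen E₀ G E₁ x X) w := by
    have h11 : α.d (0, 0) = DiffForm.pullback 𝓘(ℝ, ℝ × ℝ) C (thetaTilde θ).d (0, 0) :=
      DiffForm.d_pullback (DiffForm.isSmooth_iff.1 (thetaTilde_isSmooth θ) _) (hC _)
    have h12 : α.d.bilin (0, 0) (1, 0) (0, 1) =
        (DiffForm.pullback 𝓘(ℝ, ℝ × ℝ) C (thetaTilde θ).d).bilin (0, 0) (1, 0) (0, 1) := by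
      rw [DiffForm.bilin, h11]
      rfl
    have h13 : mderiv (modelSigma E₀ E₁) (modelSigma E₀ E₁) (fun y => coadAct y (g 0)) x w = w := by
      have h14 : (fun y : P × LieDual E₀ => coadAct y (g 0)) = fun y => y := by
        funext y
        rw [hg0, coadAct_one]
      rw [h14, mderiv_id]
      rfl
    rw [h12, pullback_bilin, hfst, hsnd, hC0, hc0, h13]
  rw [omega_bilin θ hq, gen_fst hq, (hq.mderiv_proj_eq_zero_iff x.1 _).2 ⟨X, rfl⟩, ← h10, h9,
    map_zero]
  simp

theorem omega_gen_right (hq : IsPrincipalBundle E₀ G E₁ E₂ q) (x : P × LieDual E₀)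
    (X : E₀) (w : E₁ × LieDual E₀) :
    (omega q ωS θ).bilin x w (gen E₀ G E₁ x X) = -w.2 X := by
  rw [DiffForm.bilin_swap, omega_gen θ hq]

/-- The form θ̃ pulls back to zero along p ↦ (p, 0), hence so does dθ̃. -/
theorem omega_zero (hq : IsPrincipalBundle E₀ G E₁ E₂ q) (p : P) (v w : E₁) :
    (omega q ωS θ).bilin (p, 0) (v, 0) (w, 0) =
      ωS.bilin (q p) (mderiv 𝓘(ℝ, E₁) 𝓘(ℝ, E₂) q p v) (mderiv 𝓘(ℝ, E₁) 𝓘(ℝ, E₂) q p w) := by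
  let j : P → P × LieDual E₀ := fun p => (p, 0)
  have hj : ContMDiff 𝓘(ℝ, E₁) (modelSigma E₀ E₁) ∞ j := contMDiff_id.prodMk contMDiff_const
  have hjd : ∀ u, mderiv 𝓘(ℝ, E₁) (modelSigma E₀ E₁) j p u = (u, 0) := by
    intro u
    have h1 := mderiv_prodMk (x := p) (mdifferentiableAt_id (I := 𝓘(ℝ, E₁)))
      (mdifferentiableAt_const (I := 𝓘(ℝ, E₁)) (I' := 𝓘(ℝ, LieDual E₀)) (c := (0 : LieDual E₀)))
    refine (DFunLike.congr_fun h1 u).trans ?_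
    have h2 : mderiv 𝓘(ℝ, E₁) 𝓘(ℝ, E₁) (id : P → P) p = ContinuousLinearMap.id ℝ E₁ := mderiv_id p
    rw [h2, mderiv_const]
    rfl
  have h0 : DiffForm.pullback 𝓘(ℝ, E₁) j (thetaTilde θ) = 0 := by
    funext p
    refine DiffForm.ext_eval₁ fun u => ?_
    rw [DiffForm.eval₁_pullback, thetaTilde_eval]
    rfl
  have h3 : (thetaTilde θ).d.bilin (p, 0) (v, 0) (w, 0) = 0 := by
    have h4 := pullback_bilin (I := 𝓘(ℝ, E₁)) j (thetaTilde θ).d p v w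
    rw [hjd, hjd] at h4
    refine h4.symm.trans ?_
    have h5 : DiffForm.pullback 𝓘(ℝ, E₁) j (thetaTilde θ).d p = 0 := by
      rw [← DiffForm.d_pullback (DiffForm.isSmooth_iff.1 (thetaTilde_isSmooth θ) _) (hj p), h0,
        DiffForm.d_zero]
    rw [DiffForm.bilin_apply, h5]
    rfl
  rw [omega_bilin θ hq, h3, sub_zero]

variable [FiniteDimensional ℝ E₀] [FiniteDimensional ℝ E₁]

theorem isOpen_nondegenerateSet (hq : IsPrincipalBundle E₀ G E₁ E₂ q) (hωS : IsSymplectic ωS) :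
    IsOpen (nondegenerateSet q ωS θ) :=
  DiffForm.isOpen_nondegenerateAt (omega_isSmooth θ hq hωS.smooth)

theorem coe_sigma (hq : IsPrincipalBundle E₀ G E₁ E₂ q) (hωS : IsSymplectic ωS) :
    (sigma q ωS θ : Set (P × LieDual E₀)) = nondegenerateSet q ωS θ :=
  (isOpen_nondegenerateSet θ hq hωS).interior_eq

theorem mem_sigma_iff (hq : IsPrincipalBundle E₀ G E₁ E₂ q) (hωS : IsSymplectic ωS)
    (x : P × LieDual E₀) :
    x ∈ sigma q ωS θ ↔ Function.Injective ((omega q ωS θ).bilin x) := by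
  rw [← DiffForm.nondegenerateAt_iff]
  have h : x ∈ (sigma q ωS θ : Set (P × LieDual E₀)) ↔ x ∈ nondegenerateSet q ωS θ := by
    rw [coe_sigma θ hq hωS]
  exact h

theorem omega_bilin_coadAct (hq : IsPrincipalBundle E₀ G E₁ E₂ q) (g : G) (x : P × LieDual E₀)
    (v w : E₁ × LieDual E₀) :
    (omega q ωS θ).bilin (coadAct x g)
      (mderiv (modelSigma E₀ E₁) (modelSigma E₀ E₁) (fun y => coadAct y g) x v)
      (mderiv (modelSigma E₀ E₁) (modelSigma E₀ E₁) (fun y => coadAct y g) x w) =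
      (omega q ωS θ).bilin x v w := by
  rw [← pullback_bilin (I := modelSigma E₀ E₁) (fun y => coadAct y g), omega_pullback_coadAct θ hq]

theorem coadAct_mem_sigma (hq : IsPrincipalBundle E₀ G E₁ E₂ q) (hωS : IsSymplectic ωS) :
    ∀ x ∈ sigma q ωS θ, ∀ g : G, coadAct x g ∈ sigma q ωS θ := by
  intro x hx g
  rw [mem_sigma_iff θ hq hωS, injective_iff_map_eq_zero] at hx ⊢
  intro v hv
  obtain ⟨v, rfl⟩ := (isSmoothRightAction_coadAct hq).surjective_mderiv_act g x v
  rw [hx v, map_zero]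
  refine ContinuousLinearMap.ext fun w => ?_
  rw [← omega_bilin_coadAct θ hq g, hv]
  rfl

/-- Testing a null vector on the generators removes its 𝔤^*-component. Testing on P × 0 and
nondegeneracy of ω_S make the rest vertical, so it is the generator of some X, since 0 is fixed by
the coadjoint action. Testing on 0 × 𝔤^* gives X = 0. -/
theorem mem_sigma_zero (hq : IsPrincipalBundle E₀ G E₁ E₂ q) (hωS : IsSymplectic ωS) (p : P) :
    (p, (0 : LieDual E₀)) ∈ sigma q ωS θ := by
  rw [mem_sigma_iff θ hq hωS, injective_iff_map_eq_zero]
  rintro ⟨v, ζ⟩ hv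
  replace hv : ∀ w, (omega q ωS θ).bilin (p, (0 : LieDual E₀)) (v, ζ) w = 0 := fun w => by
    rw [hv]
    rfl
  have hζ : ζ = 0 := by
    ext X
    have h := hv (gen E₀ G E₁ (p, (0 : LieDual E₀)) X)
    rw [omega_gen_right θ hq] at h
    simpa using h
  subst hζ
  have hqv : mderiv 𝓘(ℝ, E₁) 𝓘(ℝ, E₂) q p v = 0 := by
    refine (injective_iff_map_eq_zero _).1
      (DiffForm.nondegenerateAt_iff.1 (hωS.nondegenerate (q p))) _ ?_
    ext u
    obtain ⟨w, rfl⟩ := hq.surjective_mderiv_proj p u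
    rw [← omega_zero θ hq, hv]
    rfl
  obtain ⟨X, rfl⟩ := (hq.mderiv_proj_eq_zero_iff p v).1 hqv
  have hg : gen E₀ G E₁ (p, (0 : LieDual E₀)) X = (genP E₀ G E₁ p X, 0) :=
    Prod.ext (gen_fst hq _ X) (gen_zero_snd hq p X)
  have hX : X = 0 := by
    by_contra hX
    obtain ⟨ζ, -, hζ⟩ := exists_dual_vector ℝ X (norm_ne_zero_iff.2 hX)
    have h := hv (0, ζ)
    rw [← hg, omega_gen θ hq] at h
    have h' : ζ X = ‖X‖ := hζ
    rw [show ζ X = 0 from h] at h'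
    exact hX (norm_eq_zero.1 h'.symm)
  rw [hX, map_zero]
  rfl

end Omega

/-- If `g` is a moment map direction for `B`, then the `B`-orthogonal of `V × {0}` is its range. -/
theorem exists_eq_of_orthogonal {V W : Type*} [NormedAddCommGroup V] [NormedSpace ℝ V]
    [NormedAddCommGroup W] [NormedSpace ℝ W] [FiniteDimensional ℝ W]
    {B : V × LieDual W →L[ℝ] V × LieDual W →L[ℝ] ℝ} (hB : Function.Injective B)
    {g : W →L[ℝ] V × LieDual W} (hg : ∀ X w, B (g X) w = w.2 X) {u : V × LieDual W}
    (hu : ∀ w : V, B u (w, 0) = 0) : ∃ X, g X = u := by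
  -- As B u vanishes on V × 0, it is a functional on the second factor, the dual of W. By
  -- reflexivity it is evaluation at some X, hence equal to B (g X), and B is injective.
  let f : Module.Dual ℝ (Module.Dual ℝ W) :=
    ((B u : V × LieDual W →ₗ[ℝ] ℝ) ∘ₗ LinearMap.inr ℝ V (LieDual W)) ∘ₗ
      (LinearMap.toContinuousLinearMap : (W →ₗ[ℝ] ℝ) ≃ₗ[ℝ] (W →L[ℝ] ℝ)).toLinearMap
  refine ⟨(Module.evalEquiv ℝ W).symm f, hB (ContinuousLinearMap.ext fun w => ?_)⟩
  rw [hg]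
  have h1 := Module.apply_evalEquiv_symm_apply (R := ℝ) (M := W) (w.2 : W →ₗ[ℝ] ℝ) f
  have h2 : f (w.2 : W →ₗ[ℝ] ℝ) = B u (0, w.2) := rfl
  refine (h1.trans h2).trans ?_
  have h3 : w = (w.1, 0) + (0, w.2) := by simp
  conv_rhs => rw [h3, map_add, hu, zero_add]

/-! ### Poisson reduction and descent of basic forms -/

section Reduction

variable {E H : Type*} [NormedAddCommGroup E] [NormedSpace ℝ E] [TopologicalSpace H]
  {I : ModelWithCorners ℝ E H} {X : Type*} [TopologicalSpace X] [ChartedSpace H X]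
  {E' H' : Type*} [NormedAddCommGroup E'] [NormedSpace ℝ E'] [TopologicalSpace H']
  {I' : ModelWithCorners ℝ E' H'} {Q : Type*} [TopologicalSpace Q] [ChartedSpace H' Q]

theorem mvfderiv_comp_mderiv {π : X → Q} {f : Q → ℝ} {x : X}
    (hf : MDifferentiableAt I' 𝓘(ℝ, ℝ) f (π x)) (hπ : MDifferentiableAt I I' π x) (w : E) :
    mvfderiv I (fun y => f (π y)) x w = mvfderiv I' f (π x) (mderiv I I' π x w) :=
  DFunLike.congr_fun (mderiv_comp x hf hπ) w

theorem covector_apply_congr (α : CovectorField I X) {x y : X} (h : x = y) (v : E) :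
    α x v = α y v := by
  subst h
  rfl

variable [FiniteDimensional ℝ E]

theorem exists_contraction_eq {η : DiffForm I X 2 ℝ} {x : X} (h : η.NondegenerateAt x)
    (a : E →L[ℝ] ℝ) : ∃ v : E, ∀ w, η.bilin x v w = a w := by
  obtain ⟨e, he⟩ := exists_equiv_of_injective_bilin (DiffForm.nondegenerateAt_iff.1 h)
  refine ⟨e.symm a, fun w => ?_⟩
  rw [← he]
  exact congrArg (fun A : E →L[ℝ] ℝ => A w) (e.apply_symm_apply a)

/-- The map `d_xπ ∘ π_η^♯ ∘ (d_xπ)^*`. -/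
def reducedSharp (η : DiffForm I X 2 ℝ) (hη : ∀ x, η.NondegenerateAt x) (D : E →L[ℝ] E') (x : X) :
    (E' →L[ℝ] ℝ) →L[ℝ] E' :=
  D ∘L ((exists_equiv_of_injective_bilin (DiffForm.nondegenerateAt_iff.1 (hη x))).choose.symm :
    (E →L[ℝ] ℝ) →L[ℝ] E) ∘L (ContinuousLinearMap.compL ℝ E E' ℝ).flip D

theorem reducedSharp_apply {η : DiffForm I X 2 ℝ} (hη : ∀ x, η.NondegenerateAt x)
    {D : E →L[ℝ] E'} {x : X} {a : E' →L[ℝ] ℝ} {v : E} (h : ∀ w, η.bilin x v w = a (D w)) :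
    reducedSharp η hη D x a = D v := by
  have he := (exists_equiv_of_injective_bilin (DiffForm.nondegenerateAt_iff.1 (hη x))).choose_spec
  set e := (exists_equiv_of_injective_bilin (DiffForm.nondegenerateAt_iff.1 (hη x))).choose
  have h1 : e v = a ∘L D := by
    ext w
    rw [← ContinuousLinearEquiv.coe_coe, he]
    exact h w
  have h2 : e.symm (a ∘L D) = v := by rw [← h1, e.symm_apply_apply]
  exact congrArg D h2

variable [IsManifold I ∞ X] [I.Boundaryless] [IsManifold I' ∞ Q] [I'.Boundaryless]

/-- Poisson reduction of a symplectic form along a smooth quotient map. -/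
theorem exists_reduced_poissonStructure {η : DiffForm I X 2 ℝ} (hη : IsSymplectic η) {π : X → Q}
    (hπ : IsSmoothQuotient I I' π)
    (hinv : ∀ x x', π x = π x' → ∃ A : E →L[ℝ] E, Function.Surjective A ∧
      (∀ v, mderiv I I' π x' (A v) = mderiv I I' π x v) ∧
      ∀ v w, η.bilin x' (A v) (A w) = η.bilin x v w) :
    ∃ ϖ : PoissonStructure I' Q, ∀ (x : X) (a : E' →L[ℝ] ℝ) (v : E),
      (∀ w, η.bilin x v w = a (mderiv I I' π x w)) → mderiv I I' π x v = ϖ.sharp (π x) a := by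
  -- An arbitrary lift of each point, without continuity. The hypothesis `hinv` makes the value of
  -- the reduced bivector independent of it, which is the content of `key`.
  let s := Function.surjInv hπ.surjective
  have hs : ∀ y, π (s y) = y := Function.surjInv_eq hπ.surjective
  have hnd := hη.nondegenerate
  let sh : ∀ y : Q, (TangentSpace I' y →L[ℝ] ℝ) →ₗ[ℝ] TangentSpace I' y := fun y =>
    (reducedSharp η hnd (mderiv I I' π (s y)) (s y) : (E' →L[ℝ] ℝ) →ₗ[ℝ] E')
  have key : ∀ (x : X) (a : E' →L[ℝ] ℝ) (v : E),
      (∀ w, η.bilin x v w = a (mderiv I I' π x w)) → mderiv I I' π x v = sh (π x) a := by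
    intro x a v h
    obtain ⟨A, hA, hAπ, hAη⟩ := hinv x (s (π x)) (hs (π x)).symm
    rw [← hAπ]
    refine (reducedSharp_apply hnd fun w => ?_).symm
    obtain ⟨w, rfl⟩ := hA w
    rw [hAη, hAπ, h]
  -- The Hamiltonian field V of f ∘ π computes brackets downstairs: {f, g} ∘ π is the derivative of
  -- g ∘ π along V. So smoothness and the Jacobi identity are inherited from X.
  have hham : ∀ f : Q → ℝ, ContMDiff I' 𝓘(ℝ, ℝ) ∞ f → ∃ V : ∀ x : X, TangentSpace I x,
      ContMDiff I I.tangent ∞ (fun x => (⟨x, V x⟩ : TangentBundle I X)) ∧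
      (∀ x (w : E), η.bilin x (V x) w = mvfderiv I (fun y => f (π y)) x w) ∧
      ∀ g : Q → ℝ, ContMDiff I' 𝓘(ℝ, ℝ) ∞ g → ∀ x,
        bracketOf sh f g (π x) = mvfderiv I (fun y => g (π y)) x (V x) := by
    intro f hf
    have hfπ : ContMDiff I 𝓘(ℝ, ℝ) ∞ fun y => f (π y) := hf.comp hπ.smooth
    choose V hV using fun x => exists_contraction_eq (hnd x) (mvfderiv I (fun y => f (π y)) x)
    refine ⟨V, contMDiff_vectorField_of_contraction hη.smooth hnd (differential_isSmooth hfπ) hV,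
      hV, fun g hg x => ?_⟩
    rw [mvfderiv_comp_mderiv ((hg _).mdifferentiableAt (by simp)) (hπ.mdifferentiableAt x)]
    refine congrArg (mvfderiv I' g (π x)) (key x (mvfderiv I' f (π x)) (V x) fun w => ?_).symm
    exact (hV x w).trans (mvfderiv_comp_mderiv ((hf _).mdifferentiableAt (by simp))
      (hπ.mdifferentiableAt x) w)
  have hsm : ∀ f g : Q → ℝ, ContMDiff I' 𝓘(ℝ, ℝ) ∞ f → ContMDiff I' 𝓘(ℝ, ℝ) ∞ g →
      ContMDiff I' 𝓘(ℝ, ℝ) ∞ (bracketOf sh f g) := by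
    intro f g hf hg
    obtain ⟨V, hV, -, hb⟩ := hham f hf
    refine hπ.contMDiff_of_comp ?_
    rw [funext (hb g hg)]
    exact contMDiff_covector_apply (differential_isSmooth (hg.comp hπ.smooth)) hV
  refine ⟨⟨sh, fun y a => ?_, hsm, fun f g h hf hg hh y => ?_⟩, key⟩
  · obtain ⟨x, rfl⟩ := hπ.surjective y
    obtain ⟨v, hv⟩ := exists_contraction_eq (hnd x)
      ((show E' →L[ℝ] ℝ from a) ∘L mderiv I I' π x)
    refine (congrArg a (key x a v hv)).symm.trans ?_
    exact (hv v).symm.trans (η.bilin_self x v)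
  · obtain ⟨x, rfl⟩ := hπ.surjective y
    obtain ⟨U, hU, hfU, hbf⟩ := hham f hf
    obtain ⟨V, hV, hgV, hbg⟩ := hham g hg
    obtain ⟨W, hW, hhW, hbh⟩ := hham h hh
    rw [hbf _ (hsm g h hg hh), hbg _ (hsm h f hh hf), hbh _ (hsm f g hf hg), funext (hbg h hh),
      funext (hbh f hf), funext (hbf g hg)]
    exact jacobi_of_contraction hη.smooth (hη.closed x) (hf.comp hπ.smooth) (hg.comp hπ.smooth)
      (hh.comp hπ.smooth) hU hV hfU hgV hhW

end Reduction

section Descent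

variable {E H : Type*} [NormedAddCommGroup E] [NormedSpace ℝ E] [TopologicalSpace H]
  {I : ModelWithCorners ℝ E H} {X : Type*} [TopologicalSpace X] [ChartedSpace H X]
  {E' H' : Type*} [NormedAddCommGroup E'] [NormedSpace ℝ E'] [TopologicalSpace H']
  {I' : ModelWithCorners ℝ E' H'} {Q : Type*} [TopologicalSpace Q] [ChartedSpace H' Q]

theorem exists_rightInverse [FiniteDimensional ℝ E'] {D : E →L[ℝ] E'}
    (hD : Function.Surjective D) : ∃ R : E' →L[ℝ] E, ∀ v, D (R v) = v := by
  obtain ⟨R, hR⟩ := (D : E →ₗ[ℝ] E').exists_rightInverse_of_surjective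
    (LinearMap.range_eq_top.2 hD)
  exact ⟨LinearMap.toContinuousLinearMap R, fun v => DFunLike.congr_fun hR v⟩

/-- Basic forms descend. -/
theorem exists_form_descent [FiniteDimensional ℝ E'] (η : DiffForm I X 2 ℝ) {π : X → Q}
    (hπ : IsSmoothQuotient I I' π)
    (hinv : ∀ x x', π x = π x' → ∃ A : E →L[ℝ] E, Function.Surjective A ∧
      (∀ v, mderiv I I' π x' (A v) = mderiv I I' π x v) ∧
      ∀ v w, η.bilin x' (A v) (A w) = η.bilin x v w)
    (hker : ∀ x v, mderiv I I' π x v = 0 → ∀ w, η.bilin x v w = 0) :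
    ∃ Ω : DiffForm I' Q 2 ℝ, DiffForm.pullback I π Ω = η := by
  let s := Function.surjInv hπ.surjective
  have hs : ∀ y, π (s y) = y := Function.surjInv_eq hπ.surjective
  choose R hR using fun x => exists_rightInverse (hπ.surjective_mderiv x)
  let Ω : DiffForm I' Q 2 ℝ := fun y =>
    ContinuousAlternatingMap.compContinuousLinearMap (M := E) (M' := E') (η (s y)) (R (s y))
  refine ⟨Ω, funext fun x => form_ext_of_bilin fun v w => ?_⟩
  obtain ⟨A, -, hAπ, hAη⟩ := hinv x (s (π x)) (hs (π x)).symm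
  rw [pullback_bilin, DiffForm.bilin_apply]
  have h1 : ∀ v w : E', Ω (π x) ![v, w] = η.bilin (s (π x)) (R (s (π x)) v) (R (s (π x)) w) := by
    intro v w
    refine Eq.trans ?_ (DiffForm.bilin_apply η _ _ _).symm
    refine congrArg (fun u : Fin 2 → E => η (s (π x)) u) (funext fun i => ?_)
    fin_cases i <;> rfl
  refine (h1 _ _).trans ?_
  -- The lift of dπ(v) chosen at s (π x) and the transported vector A v differ by an element of the
  -- kernel of dπ, which η annihilates.
  have h2 : ∀ v : E, mderiv I I' π (s (π x)) (R (s (π x)) (mderiv I I' π x v) - A v) = 0 := by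
    intro v
    rw [map_sub, hR, hAπ, sub_self]
  have h3 : ∀ v, R (s (π x)) (mderiv I I' π x v) = A v
      + (R (s (π x)) (mderiv I I' π x v) - A v) := fun v => by abel
  rw [h3 v, h3 w]
  simp only [map_add, add_apply, hker _ _ (h2 v), hAη]
  rw [DiffForm.bilin_swap η _ (A v), hker _ _ (h2 w)]
  simp

theorem exists_covector_descent [FiniteDimensional ℝ E'] {D : E →L[ℝ] E'}
    (hD : Function.Surjective D) {b : E →L[ℝ] ℝ} (hb : ∀ v, D v = 0 → b v = 0) :
    ∃ a : E' →L[ℝ] ℝ, ∀ v, a (D v) = b v := by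
  obtain ⟨R, hR⟩ := exists_rightInverse hD
  refine ⟨b ∘L R, fun v => ?_⟩
  have h : D (R (D v) - v) = 0 := by rw [map_sub, hR, sub_self]
  have h1 := hb _ h
  rw [map_sub, sub_eq_zero] at h1
  exact h1

end Descent

/-! ### The manifolds N(P) and (Σ ×_μ Σ)/G and the forms upstairs -/

section Model

variable {E₀ G : Type*} [NormedAddCommGroup E₀] [NormedSpace ℝ E₀]
  [TopologicalSpace G] [ChartedSpace E₀ G] [Group G] [LieGroup 𝓘(ℝ, E₀) ∞ G]
  {E₁ P : Type*} [NormedAddCommGroup E₁] [NormedSpace ℝ E₁]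
  [TopologicalSpace P] [ChartedSpace E₁ P] [MulAction Gᵐᵒᵖ P] [IsManifold 𝓘(ℝ, E₁) ∞ P]
  {E₂ S : Type*} [NormedAddCommGroup E₂] [NormedSpace ℝ E₂]
  [TopologicalSpace S] [ChartedSpace E₂ S] [IsManifold 𝓘(ℝ, E₂) ∞ S]
  {q : P → S} {ωS : DiffForm 𝓘(ℝ, E₂) S 2 ℝ} {θ : PrincipalConnection E₀ G E₁ P}
  [FiniteDimensional ℝ E₀] [FiniteDimensional ℝ E₁]
  (hq : IsPrincipalBundle E₀ G E₁ E₂ q) (hωS : IsSymplectic ωS)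

theorem isSmoothRightAction_coadAct₂ (hq : IsPrincipalBundle E₀ G E₁ E₂ q) :
    IsSmoothRightAction E₀ (modelPairs E₀ E₁)
      (coadAct₂ : P × P × LieDual E₀ → G → P × P × LieDual E₀) :=
  (isSmoothRightAction_coadAct hq).diag hq

include hq hωS in
theorem coadAct₂_mem_sigmaPairs : ∀ z ∈ sigmaPairs q ωS θ, ∀ g : G,
    coadAct₂ z g ∈ sigmaPairs q ωS θ := fun _ hz g =>
  ⟨coadAct_mem_sigma θ hq hωS _ hz.1 g, coadAct_mem_sigma θ hq hωS _ hz.2 g⟩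

theorem projNP_eq_iff {x y : sigma q ωS θ} :
    projNP q ωS θ x = projNP q ωS θ y ↔ ∃ g : G, y.1 = coadAct x.1 g :=
  Quotient.eq (r := (coadSetoid E₀ G P).comap (Subtype.val : sigma q ωS θ → P × LieDual E₀))

theorem projGP_eq_iff {x y : sigmaPairs q ωS θ} :
    projGP q ωS θ x = projGP q ωS θ y ↔ ∃ g : G, y.1 = coadAct₂ x.1 g :=
  Quotient.eq (r := (coadSetoid₂ E₀ G P).comap
    (Subtype.val : sigmaPairs q ωS θ → P × P × LieDual E₀))

include hq hωS in
theorem exists_smooth_NP :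
    ∃ (_ : ChartedSpace (E₂ × LieDual E₀) (NP q ωS θ))
      (_ : IsManifold 𝓘(ℝ, E₂ × LieDual E₀) ∞ (NP q ωS θ)),
      IsSmoothQuotient (modelSigma E₀ E₁) 𝓘(ℝ, E₂ × LieDual E₀) (projNP q ωS θ) :=
  exists_smooth_quotient fun x => hq.nonempty_quotientSlice isSmoothRightAction_coad
    (fun _ _ => Iff.rfl) (coadAct_mem_sigma θ hq hωS) (ContinuousLinearEquiv.refl ℝ _) x

include hq hωS in
-- The slices are those of the diagonal action on P × Z with Z = P × 𝔤^*, whose natural model is E₂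
-- × E₁ × 𝔤^*. A dimension count replaces E₁ by E₂ × E₀, whose use avoids any choice of a splitting
-- of the tangent spaces of P.
theorem exists_smooth_GP [FiniteDimensional ℝ E₂] :
    ∃ (_ : ChartedSpace (E₂ × E₂ × E₀ × LieDual E₀) (GP q ωS θ))
      (_ : IsManifold 𝓘(ℝ, E₂ × E₂ × E₀ × LieDual E₀) ∞ (GP q ωS θ)),
      IsSmoothQuotient (modelPairs E₀ E₁) 𝓘(ℝ, E₂ × E₂ × E₀ × LieDual E₀) (projGP q ωS θ) := by
  refine exists_smooth_quotient fun x => ?_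
  have hfin : Module.finrank ℝ (E₂ × E₁ × LieDual E₀) =
      Module.finrank ℝ (E₂ × E₂ × E₀ × LieDual E₀) := by
    simp only [Module.finrank_prod, hq.finrank_eq x.1.1]
    omega
  exact hq.nonempty_quotientSlice (isSmoothRightAction_coadAct hq)
    (fun _ _ => Iff.rfl) (coadAct₂_mem_sigmaPairs hq hωS)
    (ContinuousLinearEquiv.ofFinrankEq hfin) x

section Topology

include hq in
theorem isClosed_coadSetoid [T2Space S] [T2Space P] :
    IsClosed {w : (P × LieDual E₀) × (P × LieDual E₀) | (coadSetoid E₀ G P) w.1 w.2} :=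
  hq.isClosed_orbitRel isSmoothRightAction_coad

include hq in
theorem isClosed_coadSetoid₂ [T2Space S] [T2Space P] :
    IsClosed {w : (P × P × LieDual E₀) × (P × P × LieDual E₀) |
      (coadSetoid₂ E₀ G P) w.1 w.2} :=
  hq.isClosed_orbitRel (isSmoothRightAction_coadAct hq)

end Topology

section Tangent

theorem contMDiff_proj₁₃ : ContMDiff (modelPairs E₀ E₁) (modelSigma E₀ E₁) ∞
    (fun z : P × P × LieDual E₀ => (z.1, z.2.2)) :=
  contMDiff_fst.prodMk (contMDiff_snd.comp contMDiff_snd)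

theorem mderiv_proj₁₃ (y : P × P × LieDual E₀) (v : E₁ × E₁ × LieDual E₀) :
    mderiv (modelPairs E₀ E₁) (modelSigma E₀ E₁)
      (fun z : P × P × LieDual E₀ => (z.1, z.2.2)) y v = (v.1, v.2.2) := by
  have h1 := mderiv_comp (I := modelPairs E₀ E₁) (I' := modelSigma E₀ E₁)
    (I'' := 𝓘(ℝ, LieDual E₀)) (f := fun z : P × P × LieDual E₀ => z.2) (g := Prod.snd) y
    mdifferentiableAt_snd mdifferentiableAt_snd
  have h2 := mderiv_prodMk (I := modelPairs E₀ E₁) (x := y) (mdifferentiableAt_fst (I := 𝓘(ℝ, E₁)))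
    ((mdifferentiableAt_snd (I := 𝓘(ℝ, E₁)) (I' := 𝓘(ℝ, LieDual E₀))).comp y
      (mdifferentiableAt_snd (I := 𝓘(ℝ, E₁)) (I' := modelSigma E₀ E₁)))
  refine (DFunLike.congr_fun h2 v).trans ?_
  refine Prod.ext (DFunLike.congr_fun (mderiv_fst y) v) ((DFunLike.congr_fun h1 v).trans ?_)
  rw [mderiv_snd]
  have h3 : mderiv (modelPairs E₀ E₁) (modelSigma E₀ E₁) (fun z : P × P × LieDual E₀ => z.2) y v =
      v.2 := DFunLike.congr_fun (mderiv_snd y) v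
  exact (congrArg (ContinuousLinearMap.snd ℝ E₁ (LieDual E₀)) h3 :)

theorem contMDiff_pairSrc :
    ContMDiff (modelPairs E₀ E₁) (modelSigma E₀ E₁) ∞ (pairSrc q ωS θ) := fun z =>
  contMDiffAt_opens_iff.2 ((contMDiff_snd.comp contMDiff_subtype_val) z)

theorem contMDiff_pairTgt :
    ContMDiff (modelPairs E₀ E₁) (modelSigma E₀ E₁) ∞ (pairTgt q ωS θ) := fun z =>
  contMDiffAt_opens_iff.2 ((contMDiff_proj₁₃.comp contMDiff_subtype_val) z)

theorem mderiv_pairSrc (z : sigmaPairs q ωS θ) (v : E₁ × E₁ × LieDual E₀) :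
    mderiv (modelPairs E₀ E₁) (modelSigma E₀ E₁) (pairSrc q ωS θ) z v = v.2 := by
  rw [← mderiv_val_comp ((contMDiff_pairSrc z).mdifferentiableAt (by simp))]
  have h := mderiv_comp_val (I := modelPairs E₀ E₁) (I' := modelSigma E₀ E₁)
    (f := fun y : P × P × LieDual E₀ => y.2) (x := z) mdifferentiableAt_snd
  exact (DFunLike.congr_fun h v).trans (DFunLike.congr_fun (mderiv_snd z.1) v)

theorem mderiv_pairTgt (z : sigmaPairs q ωS θ) (v : E₁ × E₁ × LieDual E₀) :
    mderiv (modelPairs E₀ E₁) (modelSigma E₀ E₁) (pairTgt q ωS θ) z v = (v.1, v.2.2) := by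
  rw [← mderiv_val_comp ((contMDiff_pairTgt z).mdifferentiableAt (by simp))]
  have h := mderiv_comp_val (I := modelPairs E₀ E₁) (I' := modelSigma E₀ E₁)
    (f := fun y : P × P × LieDual E₀ => (y.1, y.2.2)) (x := z)
    ((contMDiff_proj₁₃ _).mdifferentiableAt (by simp))
  exact (DFunLike.congr_fun h v).trans (mderiv_proj₁₃ z.1 v)

theorem omegaSigma_bilin (x : sigma q ωS θ) (v w : E₁ × LieDual E₀) :
    (omegaSigma q ωS θ).bilin x v w = (omega q ωS θ).bilin x.1 v w := by
  rw [omegaSigma, pullback_bilin, mderiv_subtype_val]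
  rfl

theorem omegaPairs_bilin (z : sigmaPairs q ωS θ) (v w : E₁ × E₁ × LieDual E₀) :
    (omegaPairs q ωS θ).bilin z v w =
      (omega q ωS θ).bilin (z.1.2.1, z.1.2.2) v.2 w.2
        - (omega q ωS θ).bilin (z.1.1, z.1.2.2) (v.1, v.2.2) (w.1, w.2.2) := by
  have h1 : (omegaPairs q ωS θ).bilin z v w =
      (DiffForm.pullback (modelPairs E₀ E₁) (pairSrc q ωS θ) (omegaSigma q ωS θ)).bilin z v w
      - (DiffForm.pullback (modelPairs E₀ E₁) (pairTgt q ωS θ) (omegaSigma q ωS θ)).bilin z v w := by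
    rw [DiffForm.bilin_apply, DiffForm.bilin_apply, DiffForm.bilin_apply]
    rfl
  rw [h1, pullback_bilin, pullback_bilin, omegaSigma_bilin, omegaSigma_bilin, mderiv_pairSrc,
    mderiv_pairSrc, mderiv_pairTgt, mderiv_pairTgt]
  rfl

include hq hωS in
theorem omegaSigma_isSymplectic : IsSymplectic (omegaSigma q ωS θ) where
  smooth := (omega_isSmooth θ hq hωS.smooth).pullback contMDiff_subtype_val
  closed x := by
    rw [omegaSigma, DiffForm.d_pullback
      (DiffForm.isSmooth_iff.1 (omega_isSmooth θ hq hωS.smooth) _) (contMDiff_subtype_val x)]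
    ext v
    exact congrArg (fun A : (E₁ × LieDual E₀) [⋀^Fin 3]→L[ℝ] ℝ => A fun i =>
      mderiv (modelSigma E₀ E₁) (modelSigma E₀ E₁) (Subtype.val : sigma q ωS θ → P × LieDual E₀) x
        (v i)) (omega_closed θ hq hωS x.1)
  nondegenerate x := by
    rw [DiffForm.nondegenerateAt_iff]
    have h : (omegaSigma q ωS θ).bilin x = (omega q ωS θ).bilin x.1 :=
      ContinuousLinearMap.ext fun v => ContinuousLinearMap.ext fun w => omegaSigma_bilin x v w
    rw [h]
    exact (mem_sigma_iff θ hq hωS x.1).1 x.2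

include hq hωS in
theorem omegaPairs_isSmooth : (omegaPairs q ωS θ).IsSmooth :=
  ((omegaSigma_isSymplectic hq hωS).smooth.pullback contMDiff_pairSrc).sub
    ((omegaSigma_isSymplectic hq hωS).smooth.pullback contMDiff_pairTgt)

include hq hωS in
theorem omegaPairs_closed (z : sigmaPairs q ωS θ) : (omegaPairs q ωS θ).d z = 0 := by
  have h := omegaSigma_isSymplectic (θ := θ) hq hωS
  have hp : ∀ f : sigmaPairs q ωS θ → sigma q ωS θ,
      ContMDiff (modelPairs E₀ E₁) (modelSigma E₀ E₁) ∞ f →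
      (DiffForm.pullback (modelPairs E₀ E₁) f (omegaSigma q ωS θ)).d z = 0 := by
    intro f hf
    rw [DiffForm.d_pullback (DiffForm.isSmooth_iff.1 h.smooth _) (hf z)]
    ext v
    exact congrArg (fun A : (E₁ × LieDual E₀) [⋀^Fin 3]→L[ℝ] ℝ => A fun i =>
      mderiv (modelPairs E₀ E₁) (modelSigma E₀ E₁) f z (v i)) (h.closed (f z))
  rw [omegaPairs, DiffForm.d_sub
    (DiffForm.isSmooth_iff.1 (h.smooth.pullback contMDiff_pairSrc) z)
    (DiffForm.isSmooth_iff.1 (h.smooth.pullback contMDiff_pairTgt) z), hp _ contMDiff_pairSrc,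
    hp _ contMDiff_pairTgt, sub_zero]

variable (E₀ G) in
/-- The infinitesimal coadjoint action. -/
abbrev genDual (ξ : LieDual E₀) : E₀ →L[ℝ] LieDual E₀ :=
  orbitDeriv E₀ 𝓘(ℝ, LieDual E₀) (fun (ξ : LieDual E₀) (g : G) => (ξ ∘L lieAd g : LieDual E₀)) ξ

include hq in
theorem gen_apply (x : P × LieDual E₀) (X : E₀) :
    gen E₀ G E₁ x X = (genP E₀ G E₁ x.1 X, genDual E₀ G x.2 X) :=
  DFunLike.congr_fun (orbitDeriv_diagAct hq isSmoothRightAction_coad x) X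

include hq in
theorem orbitDeriv_coadAct₂ (z : P × P × LieDual E₀) (X : E₀) :
    orbitDeriv E₀ (modelPairs E₀ E₁) (coadAct₂ (G := G)) z X =
      (genP E₀ G E₁ z.1 X, genP E₀ G E₁ z.2.1 X, genDual E₀ G z.2.2 X) := by
  have h := DFunLike.congr_fun (orbitDeriv_diagAct hq (isSmoothRightAction_coadAct hq) z) X
  refine h.trans (Prod.ext rfl ?_)
  exact gen_apply hq z.2 X

end Tangent

end Model

/-! ### Kernels of the projections and the symplectic form on arrows -/

section QuotientAction

variable {E₀ G : Type*} [NormedAddCommGroup E₀] [NormedSpace ℝ E₀]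
  [TopologicalSpace G] [ChartedSpace E₀ G] [Group G] [LieGroup 𝓘(ℝ, E₀) ∞ G]
  {EZ HZ : Type*} [NormedAddCommGroup EZ] [NormedSpace ℝ EZ] [TopologicalSpace HZ]
  {IZ : ModelWithCorners ℝ EZ HZ} {Z : Type*} [TopologicalSpace Z] [ChartedSpace HZ Z]
  [IsManifold IZ ∞ Z] [IZ.Boundaryless]
  {EQ HQ : Type*} [NormedAddCommGroup EQ] [NormedSpace ℝ EQ] [TopologicalSpace HQ]
  {IQ : ModelWithCorners ℝ EQ HQ} {Q : Type*} [TopologicalSpace Q] [ChartedSpace HQ Q]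
  {act : Z → G → Z} {U : TopologicalSpace.Opens Z} {π : U → Q}

theorem IsSmoothRightAction.mderiv_quotient_act (hact : IsSmoothRightAction E₀ IZ act)
    (hU : ∀ y ∈ U, ∀ g, act y g ∈ U) (hd : ∀ x, MDifferentiableAt IZ IQ π x)
    (hπ : ∀ (y : U) (g : G), π ⟨act y.1 g, hU y.1 y.2 g⟩ = π y) {x x' : U} {g : G}
    (hx : x'.1 = act x.1 g) (v : EZ) :
    mderiv IZ IQ π x' (mderiv IZ IZ (fun y => act y g) x.1 v) = mderiv IZ IQ π x v := by
  let φ : U → U := fun y => ⟨act y.1 g, hU y.1 y.2 g⟩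
  have hφ : MDifferentiableAt IZ IZ φ x :=
    ContMDiffAt.mdifferentiableAt (n := ∞)
      (contMDiffAt_opens_iff.2 (((hact.contMDiff_act g).comp contMDiff_subtype_val) x)) (by simp)
  have h1 := mderiv_comp_of_eq (hd x') hφ (Subtype.ext hx.symm)
  have h2 : (fun y => π (φ y)) = π := funext fun y => hπ y g
  rw [h2, ← mderiv_val_comp hφ] at h1
  have h3 : mderiv IZ IZ (fun y : U => (φ y : Z)) x = mderiv IZ IZ (fun y => act y g) x.1 :=
    mderiv_comp_val ((hact.contMDiff_act g).mdifferentiableAt (by simp))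
  rw [h3] at h1
  exact (DFunLike.congr_fun h1 v).symm

end QuotientAction

section Model

/-- The model of `N(P)`. -/
abbrev modelN (E₀ E₂ : Type*) [NormedAddCommGroup E₀] [NormedSpace ℝ E₀] [NormedAddCommGroup E₂]
    [NormedSpace ℝ E₂] := 𝓘(ℝ, E₂ × LieDual E₀)

/-- The model of the space of arrows. -/
abbrev modelG (E₀ E₂ : Type*) [NormedAddCommGroup E₀] [NormedSpace ℝ E₀] [NormedAddCommGroup E₂]
    [NormedSpace ℝ E₂] := 𝓘(ℝ, E₂ × E₂ × E₀ × LieDual E₀)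

variable {E₀ G : Type*} [NormedAddCommGroup E₀] [NormedSpace ℝ E₀]
  [TopologicalSpace G] [ChartedSpace E₀ G] [Group G] [LieGroup 𝓘(ℝ, E₀) ∞ G]
  {E₁ P : Type*} [NormedAddCommGroup E₁] [NormedSpace ℝ E₁]
  [TopologicalSpace P] [ChartedSpace E₁ P] [MulAction Gᵐᵒᵖ P] [IsManifold 𝓘(ℝ, E₁) ∞ P]
  {E₂ S : Type*} [NormedAddCommGroup E₂] [NormedSpace ℝ E₂]
  [TopologicalSpace S] [ChartedSpace E₂ S] [IsManifold 𝓘(ℝ, E₂) ∞ S]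
  {q : P → S} {ωS : DiffForm 𝓘(ℝ, E₂) S 2 ℝ} {θ : PrincipalConnection E₀ G E₁ P}
  [FiniteDimensional ℝ E₀] [FiniteDimensional ℝ E₁] [FiniteDimensional ℝ E₂]
  (hq : IsPrincipalBundle E₀ G E₁ E₂ q) (hωS : IsSymplectic ωS)

theorem mderiv_coadAct₂_snd (hq : IsPrincipalBundle E₀ G E₁ E₂ q) (g : G) (z : P × P × LieDual E₀)
    (v : E₁ × E₁ × LieDual E₀) :
    (mderiv (modelPairs E₀ E₁) (modelPairs E₀ E₁) (fun y => coadAct₂ y g) z v).2 =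
      mderiv (modelSigma E₀ E₁) (modelSigma E₀ E₁) (fun y => coadAct y g) z.2 v.2 := by
  have hd₂ := ((isSmoothRightAction_coadAct₂ hq).contMDiff_act g z).mdifferentiableAt (n := ∞)
    (by simp)
  have hd := ((isSmoothRightAction_coadAct hq).contMDiff_act g z.2).mdifferentiableAt (n := ∞)
    (by simp)
  have h1 := mderiv_comp (I'' := modelSigma E₀ E₁) (g := Prod.snd) z mdifferentiableAt_snd hd₂
  have h2 := mderiv_comp (I := modelPairs E₀ E₁) (f := Prod.snd) z hd mdifferentiableAt_snd
  rw [mderiv_snd] at h1 h2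
  exact (DFunLike.congr_fun h1 v).symm.trans (DFunLike.congr_fun h2 v)

theorem mderiv_coadAct₂_fst (hq : IsPrincipalBundle E₀ G E₁ E₂ q) (g : G) (z : P × P × LieDual E₀)
    (v : E₁ × E₁ × LieDual E₀) :
    ((mderiv (modelPairs E₀ E₁) (modelPairs E₀ E₁) (fun y => coadAct₂ y g) z v).1,
      (mderiv (modelPairs E₀ E₁) (modelPairs E₀ E₁) (fun y => coadAct₂ y g) z v).2.2) =
      mderiv (modelSigma E₀ E₁) (modelSigma E₀ E₁) (fun y => coadAct y g) (z.1, z.2.2)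
        (v.1, v.2.2) := by
  have hd₂ := ((isSmoothRightAction_coadAct₂ hq).contMDiff_act g z).mdifferentiableAt (n := ∞)
    (by simp)
  have hd := ((isSmoothRightAction_coadAct hq).contMDiff_act g (z.1, z.2.2)).mdifferentiableAt
    (n := ∞) (by simp)
  have hp : ∀ y, MDifferentiableAt (modelPairs E₀ E₁) (modelSigma E₀ E₁)
    (fun z : P × P × LieDual E₀ => (z.1, z.2.2)) y := fun y =>
    (contMDiff_proj₁₃ y).mdifferentiableAt (by simp)
  have h1 := mderiv_comp z (hp (coadAct₂ z g)) hd₂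
  have h2 := mderiv_comp z hd (hp z)
  have h3 := (DFunLike.congr_fun h1 v).symm.trans (DFunLike.congr_fun h2 v)
  exact (mderiv_proj₁₃ (coadAct₂ z g) _).symm.trans
    (h3.trans (congrArg (fun u : E₁ × LieDual E₀ => mderiv (modelSigma E₀ E₁) (modelSigma E₀ E₁)
      (fun y => coadAct y g) (z.1, z.2.2) u) (mderiv_proj₁₃ z v)))

theorem projNP_coadAct (x : sigma q ωS θ) (g : G) (h : coadAct x.1 g ∈ sigma q ωS θ) :
    projNP q ωS θ ⟨coadAct x.1 g, h⟩ = projNP q ωS θ x :=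
  (projNP_eq_iff.2 ⟨g, rfl⟩).symm

theorem projGP_coadAct₂ (x : sigmaPairs q ωS θ) (g : G) (h : coadAct₂ x.1 g ∈ sigmaPairs q ωS θ) :
    projGP q ωS θ ⟨coadAct₂ x.1 g, h⟩ = projGP q ωS θ x :=
  (projGP_eq_iff.2 ⟨g, rfl⟩).symm

section NP

variable [ChartedSpace (E₂ × LieDual E₀) (NP q ωS θ)] [IsManifold (modelN E₀ E₂) ∞ (NP q ωS θ)]
  (hN : IsSmoothQuotient (modelSigma E₀ E₁) (modelN E₀ E₂) (projNP q ωS θ))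

include hq hωS hN

theorem mderiv_projNP_eq_zero_iff (x : sigma q ωS θ) (v : E₁ × LieDual E₀) :
    mderiv (modelSigma E₀ E₁) (modelN E₀ E₂) (projNP q ωS θ) x v = 0 ↔
      ∃ X, gen E₀ G E₁ x.1 X = v :=
  hN.mderiv_eq_zero_iff hq isSmoothRightAction_coad (coadAct_mem_sigma θ hq hωS)
    (fun x g => projNP_coadAct x g _) Module.finrank_prod x v

theorem invariance_NP (x x' : sigma q ωS θ) (h : projNP q ωS θ x = projNP q ωS θ x') :
    ∃ A : E₁ × LieDual E₀ →L[ℝ] E₁ × LieDual E₀, Function.Surjective A ∧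
      (∀ v, mderiv (modelSigma E₀ E₁) (modelN E₀ E₂) (projNP q ωS θ) x' (A v) =
        mderiv (modelSigma E₀ E₁) (modelN E₀ E₂) (projNP q ωS θ) x v) ∧
      ∀ v w, (omegaSigma q ωS θ).bilin x' (A v) (A w) = (omegaSigma q ωS θ).bilin x v w := by
  obtain ⟨g, hg⟩ := projNP_eq_iff.1 h
  have hact := isSmoothRightAction_coadAct hq
  refine ⟨_, hact.surjective_mderiv_act g x.1, fun v => ?_, fun v w => ?_⟩
  · exact hact.mderiv_quotient_act (coadAct_mem_sigma θ hq hωS) hN.mdifferentiableAt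
      (fun x g => projNP_coadAct x g _) hg v
  · rw [omegaSigma_bilin, omegaSigma_bilin, hg, omega_bilin_coadAct θ hq]

theorem exists_poissonStructure :
    ∃ ϖ : PoissonStructure (modelN E₀ E₂) (NP q ωS θ),
      ∀ (x : sigma q ωS θ) (a : E₂ × LieDual E₀ →L[ℝ] ℝ) (v : E₁ × LieDual E₀),
      (∀ w, (omega q ωS θ).bilin x.1 v w =
        a (mderiv (modelSigma E₀ E₁) (modelN E₀ E₂) (projNP q ωS θ) x w)) →
      mderiv (modelSigma E₀ E₁) (modelN E₀ E₂) (projNP q ωS θ) x v =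
        ϖ.sharp (projNP q ωS θ x) a := by
  obtain ⟨ϖ, h⟩ := exists_reduced_poissonStructure (omegaSigma_isSymplectic hq hωS) hN
    (invariance_NP hq hωS hN)
  exact ⟨ϖ, fun x a v hv => h x a v fun w => (omegaSigma_bilin x v w).trans (hv w)⟩

end NP

section GP

variable [ChartedSpace (E₂ × E₂ × E₀ × LieDual E₀) (GP q ωS θ)]
  [IsManifold (modelG E₀ E₂) ∞ (GP q ωS θ)]
  (hΓ : IsSmoothQuotient (modelPairs E₀ E₁) (modelG E₀ E₂) (projGP q ωS θ))

include hq hωS hΓ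

theorem mderiv_projGP_eq_zero_iff (z : sigmaPairs q ωS θ) (v : E₁ × E₁ × LieDual E₀) :
    mderiv (modelPairs E₀ E₁) (modelG E₀ E₂) (projGP q ωS θ) z v = 0 ↔
      ∃ X, (genP E₀ G E₁ z.1.1 X, genP E₀ G E₁ z.1.2.1 X, genDual E₀ G z.1.2.2 X) = v := by
  have hfin : Module.finrank ℝ (E₂ × E₂ × E₀ × LieDual E₀) =
      Module.finrank ℝ E₂ + Module.finrank ℝ (E₁ × LieDual E₀) := by
    simp only [Module.finrank_prod, hq.finrank_eq z.1.1]
    omega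
  rw [hΓ.mderiv_eq_zero_iff hq (isSmoothRightAction_coadAct hq) (coadAct₂_mem_sigmaPairs hq hωS)
    (fun x g => projGP_coadAct₂ x g _) hfin z v]
  refine exists_congr fun X => ?_
  rw [← orbitDeriv_coadAct₂ hq]
  rfl

/-- The contractions of ω with the generator of X at the two ends are both ⟨dμ, X⟩, and the ends
share ξ, so they cancel. Conversely, testing a null vector on variations of p₁ alone and of p₂ alone
shows that its components at the two ends are generators of some X₁ and X₂; testing on variations of
ξ gives X₁ = X₂. -/
theorem omegaPairs_eq_zero_iff (z : sigmaPairs q ωS θ) (v : E₁ × E₁ × LieDual E₀) :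
    mderiv (modelPairs E₀ E₁) (modelG E₀ E₂) (projGP q ωS θ) z v = 0 ↔
      ∀ w, (omegaPairs q ωS θ).bilin z v w = 0 := by
  rw [mderiv_projGP_eq_zero_iff hq hωS hΓ]
  constructor
  · rintro ⟨X, rfl⟩ w
    rw [omegaPairs_bilin]
    have h1 := omega_gen (ωS := ωS) θ hq (z.1.2.1, z.1.2.2) X w.2
    have h2 := omega_gen (ωS := ωS) θ hq (z.1.1, z.1.2.2) X (w.1, w.2.2)
    rw [gen_apply hq] at h1 h2
    rw [h1, h2, sub_self]
  · intro h
    have hi₁ := (mem_sigma_iff θ hq hωS _).1 z.2.1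
    have hi₂ := (mem_sigma_iff θ hq hωS _).1 z.2.2
    obtain ⟨X₁, hX₁⟩ := exists_eq_of_orthogonal hi₁
      (fun X w => omega_gen (ωS := ωS) θ hq (z.1.1, z.1.2.2) X w) (u := (v.1, v.2.2)) fun w => by
        have h1 := h (w, 0)
        rw [omegaPairs_bilin] at h1
        simpa using h1
    obtain ⟨X₂, hX₂⟩ := exists_eq_of_orthogonal hi₂
      (fun X w => omega_gen (ωS := ωS) θ hq (z.1.2.1, z.1.2.2) X w) (u := v.2) fun w => by
        have h1 := h (0, w, 0)
        rw [omegaPairs_bilin] at h1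
        have h2 : ((0 : E₁), (0 : LieDual E₀)) = 0 := rfl
        simpa [h2] using h1
    have hX : X₁ = X₂ := by
      by_contra hne
      obtain ⟨ζ, -, hζ⟩ := exists_dual_vector ℝ (X₂ - X₁)
        (norm_ne_zero_iff.2 (sub_ne_zero.2 (Ne.symm hne)))
      have h1 := h (0, 0, ζ)
      rw [omegaPairs_bilin, ← hX₁, ← hX₂, omega_gen θ hq, omega_gen θ hq] at h1
      have h2 : ζ (X₂ - X₁) = 0 := by rw [map_sub]; exact h1
      have h3 : ζ (X₂ - X₁) = ‖X₂ - X₁‖ := hζ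
      rw [h2] at h3
      exact hne (sub_eq_zero.1 (norm_eq_zero.1 h3.symm)).symm
    refine ⟨X₁, ?_⟩
    rw [gen_apply hq] at hX₁ hX₂
    rw [← hX] at hX₂
    have h3 : genP E₀ G E₁ z.1.1 X₁ = v.1 := congrArg (fun u : E₁ × LieDual E₀ => u.1) hX₁
    have h4 : (genP E₀ G E₁ z.1.2.1 X₁, genDual E₀ G z.1.2.2 X₁) = v.2 := hX₂
    rw [h3, h4]

theorem invariance_GP (z z' : sigmaPairs q ωS θ) (h : projGP q ωS θ z = projGP q ωS θ z') :
    ∃ A : E₁ × E₁ × LieDual E₀ →L[ℝ] E₁ × E₁ × LieDual E₀, Function.Surjective A ∧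
      (∀ v, mderiv (modelPairs E₀ E₁) (modelG E₀ E₂) (projGP q ωS θ) z' (A v) =
        mderiv (modelPairs E₀ E₁) (modelG E₀ E₂) (projGP q ωS θ) z v) ∧
      ∀ v w, (omegaPairs q ωS θ).bilin z' (A v) (A w) = (omegaPairs q ωS θ).bilin z v w := by
  obtain ⟨g, hg⟩ := projGP_eq_iff.1 h
  have hact := isSmoothRightAction_coadAct₂ hq
  refine ⟨_, hact.surjective_mderiv_act g z.1, fun v => ?_, fun v w => ?_⟩
  · exact hact.mderiv_quotient_act (coadAct₂_mem_sigmaPairs hq hωS) hΓ.mdifferentiableAt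
      (fun x g => projGP_coadAct₂ x g _) hg v
  · rw [omegaPairs_bilin, omegaPairs_bilin, mderiv_coadAct₂_fst hq, mderiv_coadAct₂_fst hq,
      mderiv_coadAct₂_snd hq, mderiv_coadAct₂_snd hq, hg]
    exact congrArg₂ (fun a b : ℝ => a - b) (omega_bilin_coadAct θ hq g z.1.2 v.2 w.2)
      (omega_bilin_coadAct θ hq g (z.1.1, z.1.2.2) (v.1, v.2.2) (w.1, w.2.2))

/-- The symplectic form on the space of arrows. -/
theorem exists_symplecticForm_GP :
    ∃ Ω : DiffForm (modelG E₀ E₂) (GP q ωS θ) 2 ℝ, IsSymplectic Ω ∧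
      DiffForm.pullback (modelPairs E₀ E₁) (projGP q ωS θ) Ω = omegaPairs q ωS θ := by
  obtain ⟨Ω, hΩ⟩ := exists_form_descent (omegaPairs q ωS θ) hΓ (invariance_GP hq hωS hΓ)
    fun z v => (omegaPairs_eq_zero_iff hq hωS hΓ z v).1
  have hs : (DiffForm.pullback (modelPairs E₀ E₁) (projGP q ωS θ) Ω).IsSmooth := by
    rw [hΩ]
    exact omegaPairs_isSmooth hq hωS
  refine ⟨Ω, ⟨hΓ.isSmooth_of_pullback hs, hΓ.d_eq_zero_of_pullback hs fun z => ?_, fun y => ?_⟩, hΩ⟩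
  · rw [hΩ]
    exact omegaPairs_closed hq hωS z
  · obtain ⟨z, rfl⟩ := hΓ.surjective y
    rw [DiffForm.nondegenerateAt_iff, injective_iff_map_eq_zero]
    intro v hv
    obtain ⟨v, rfl⟩ := hΓ.surjective_mderiv z v
    -- A null vector of Ω lifts to a null vector of the pullback, and those are killed by the
    -- projection.
    refine (omegaPairs_eq_zero_iff hq hωS hΓ z v).2 fun w => ?_
    rw [← hΩ, pullback_bilin, hv]
    rfl

end GP

end Model

/-! ### The quotient of the pair groupoid as a groupoid -/

section Model

variable {E₀ G : Type*} [NormedAddCommGroup E₀] [NormedSpace ℝ E₀]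
  [TopologicalSpace G] [ChartedSpace E₀ G] [Group G] [LieGroup 𝓘(ℝ, E₀) ∞ G]
  {E₁ P : Type*} [NormedAddCommGroup E₁] [NormedSpace ℝ E₁]
  [TopologicalSpace P] [ChartedSpace E₁ P] [MulAction Gᵐᵒᵖ P] [IsManifold 𝓘(ℝ, E₁) ∞ P]
  {E₂ S : Type*} [NormedAddCommGroup E₂] [NormedSpace ℝ E₂]
  [TopologicalSpace S] [ChartedSpace E₂ S] [IsManifold 𝓘(ℝ, E₂) ∞ S]
  {q : P → S} {ωS : DiffForm 𝓘(ℝ, E₂) S 2 ℝ} {θ : PrincipalConnection E₀ G E₁ P}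
  [FiniteDimensional ℝ E₀] [FiniteDimensional ℝ E₁] [FiniteDimensional ℝ E₂]

/-- The object `[p, ξ]`. -/
def obj {p : P} {ξ : LieDual E₀} (h : (p, ξ) ∈ sigma q ωS θ) : NP q ωS θ :=
  projNP q ωS θ ⟨(p, ξ), h⟩

/-- The arrow `[p₁, p₂, ξ]`. -/
def arr {p₁ p₂ : P} {ξ : LieDual E₀} (h₁ : (p₁, ξ) ∈ sigma q ωS θ)
    (h₂ : (p₂, ξ) ∈ sigma q ωS θ) : GP q ωS θ :=
  projGP q ωS θ ⟨(p₁, p₂, ξ), h₁, h₂⟩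

theorem exists_obj_eq (x : NP q ωS θ) :
    ∃ (p : P) (ξ : LieDual E₀) (h : (p, ξ) ∈ sigma q ωS θ), obj h = x := by
  obtain ⟨x, rfl⟩ := Quotient.exists_rep x
  exact ⟨x.1.1, x.1.2, x.2, rfl⟩

theorem exists_arr_eq (a : GP q ωS θ) :
    ∃ (p₁ p₂ : P) (ξ : LieDual E₀) (h₁ : (p₁, ξ) ∈ sigma q ωS θ) (h₂ : (p₂, ξ) ∈ sigma q ωS θ),
      arr h₁ h₂ = a := by
  obtain ⟨z, rfl⟩ := Quotient.exists_rep a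
  exact ⟨z.1.1, z.1.2.1, z.1.2.2, z.2.1, z.2.2, rfl⟩

theorem obj_eq_iff {p p' : P} {ξ ξ' : LieDual E₀} {h : (p, ξ) ∈ sigma q ωS θ}
    {h' : (p', ξ') ∈ sigma q ωS θ} :
    obj h = obj h' ↔ ∃ g : G, p' = op g • p ∧ ξ' = ξ ∘L lieAd g :=
  projNP_eq_iff.trans (exists_congr fun g => by simp [coadAct])

theorem arr_eq_iff {p₁ p₂ p₁' p₂' : P} {ξ ξ' : LieDual E₀} {h₁ : (p₁, ξ) ∈ sigma q ωS θ}
    {h₂ : (p₂, ξ) ∈ sigma q ωS θ} {h₁' : (p₁', ξ') ∈ sigma q ωS θ}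
    {h₂' : (p₂', ξ') ∈ sigma q ωS θ} :
    arr h₁ h₂ = arr h₁' h₂' ↔
      ∃ g : G, p₁' = op g • p₁ ∧ p₂' = op g • p₂ ∧ ξ' = ξ ∘L lieAd g :=
  projGP_eq_iff.trans (exists_congr fun g => by simp [coadAct₂])

variable (q ωS θ) in
/-- The source map. -/
def gaugeSrc : GP q ωS θ → NP q ωS θ :=
  Quotient.lift (fun z => projNP q ωS θ (pairSrc q ωS θ z)) fun _ _ h =>
    projNP_eq_iff.2 <| h.imp fun _ hg => congrArg Prod.snd hg

variable (q ωS θ) in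
/-- The target map. -/
def gaugeTgt : GP q ωS θ → NP q ωS θ :=
  Quotient.lift (fun z => projNP q ωS θ (pairTgt q ωS θ z)) fun _ _ h =>
    projNP_eq_iff.2 <| h.imp fun _ hg =>
      congrArg (fun u : P × P × LieDual E₀ => (u.1, u.2.2)) hg

/-- The diagonal `Σ → Σ ×_μ Σ`. -/
def pairUnit (q : P → S) (ωS : DiffForm 𝓘(ℝ, E₂) S 2 ℝ) (θ : PrincipalConnection E₀ G E₁ P)
    (x : sigma q ωS θ) : sigmaPairs q ωS θ :=
  ⟨(x.1.1, x.1), x.2, x.2⟩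

/-- The flip of `Σ ×_μ Σ`. -/
def pairInv (q : P → S) (ωS : DiffForm 𝓘(ℝ, E₂) S 2 ℝ) (θ : PrincipalConnection E₀ G E₁ P)
    (z : sigmaPairs q ωS θ) : sigmaPairs q ωS θ :=
  ⟨(z.1.2.1, z.1.1, z.1.2.2), z.2.2, z.2.1⟩

variable (q ωS θ) in
/-- The unit map. -/
def gaugeUnit : NP q ωS θ → GP q ωS θ :=
  Quotient.lift (fun x => projGP q ωS θ (pairUnit q ωS θ x)) fun _ _ h =>
    projGP_eq_iff.2 <| h.imp fun _ hg =>
      congrArg (fun u : P × LieDual E₀ => (u.1, u)) hg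

variable (q ωS θ) in
/-- The inversion. -/
def gaugeInv : GP q ωS θ → GP q ωS θ :=
  Quotient.lift (fun z => projGP q ωS θ (pairInv q ωS θ z)) fun _ _ h =>
    projGP_eq_iff.2 <| h.imp fun _ hg =>
      congrArg (fun u : P × P × LieDual E₀ => (u.2.1, u.1, u.2.2)) hg

/-- The triple fibre product `Σ ×_μ Σ ×_μ Σ`. -/
def sigmaTriples (q : P → S) (ωS : DiffForm 𝓘(ℝ, E₂) S 2 ℝ)
    (θ : PrincipalConnection E₀ G E₁ P) : TopologicalSpace.Opens (P × P × P × LieDual E₀) :=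
  ⟨{t | (t.1, t.2.2.2) ∈ sigma q ωS θ ∧ (t.2.1, t.2.2.2) ∈ sigma q ωS θ ∧
    (t.2.2.1, t.2.2.2) ∈ sigma q ωS θ},
    ((sigma q ωS θ).isOpen.preimage (by fun_prop)).inter
      (((sigma q ωS θ).isOpen.preimage (by fun_prop)).inter
        ((sigma q ωS θ).isOpen.preimage (by fun_prop)))⟩

section Triples

variable (q ωS θ) (t : sigmaTriples q ωS θ)

/-- The first and second entries of a triple. -/
def triple₁₂ : sigmaPairs q ωS θ := ⟨(t.1.1, t.1.2.1, t.1.2.2.2), t.2.1, t.2.2.1⟩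

/-- The second and third entries of a triple. -/
def triple₂₃ : sigmaPairs q ωS θ := ⟨t.1.2, t.2.2⟩

/-- The first and third entries of a triple. -/
def triple₁₃ : sigmaPairs q ωS θ := ⟨(t.1.1, t.1.2.2), t.2.1, t.2.2.2⟩

end Triples

open Classical in
variable (q ωS θ) in
/-- The product. -/
def gaugeMul (a b : GP q ωS θ) : GP q ωS θ :=
  -- Composable pairs are exactly those that come from a triple; for the others the value a is a
  -- meaningless default.
  if h : ∃ t : sigmaTriples q ωS θ,
      projGP q ωS θ (triple₁₂ q ωS θ t) = a ∧ projGP q ωS θ (triple₂₃ q ωS θ t) = b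
  then projGP q ωS θ (triple₁₃ q ωS θ h.choose) else a

section Arrows

variable {p p₁ p₂ p₃ : P} {ξ : LieDual E₀} (h : (p, ξ) ∈ sigma q ωS θ)
  (h₁ : (p₁, ξ) ∈ sigma q ωS θ) (h₂ : (p₂, ξ) ∈ sigma q ωS θ) (h₃ : (p₃, ξ) ∈ sigma q ωS θ)

theorem gaugeSrc_arr : gaugeSrc q ωS θ (arr h₁ h₂) = obj h₂ := rfl

theorem gaugeTgt_arr : gaugeTgt q ωS θ (arr h₁ h₂) = obj h₁ := rfl

theorem gaugeUnit_obj : gaugeUnit q ωS θ (obj h) = arr h h := rfl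

theorem gaugeInv_arr : gaugeInv q ωS θ (arr h₁ h₂) = arr h₂ h₁ := rfl

/-- Two triples that represent the same pair of arrows differ by some g on the first pair and some
g' on the second. Both carry one middle point to the other, so g = g' by freeness, and the outer
pairs differ by g as well. -/
theorem gaugeMul_arr (hq : IsPrincipalBundle E₀ G E₁ E₂ q) :
    gaugeMul q ωS θ (arr h₁ h₂) (arr h₂ h₃) = arr h₁ h₃ := by
  have hex : ∃ t : sigmaTriples q ωS θ,
      projGP q ωS θ (triple₁₂ q ωS θ t) = arr h₁ h₂ ∧
        projGP q ωS θ (triple₂₃ q ωS θ t) = arr h₂ h₃ :=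
    ⟨⟨(p₁, p₂, p₃, ξ), h₁, h₂, h₃⟩, rfl, rfl⟩
  rw [gaugeMul, dif_pos hex]
  obtain ⟨ha, hb⟩ := hex.choose_spec
  obtain ⟨g, e⟩ := projGP_eq_iff.1 ha
  obtain ⟨g', e'⟩ := projGP_eq_iff.1 hb
  have e₂ : p₂ = op g • hex.choose.1.2.1 := congrArg (fun u : P × P × LieDual E₀ => u.2.1) e
  have e₂' : p₂ = op g' • hex.choose.1.2.1 := congrArg Prod.fst e'
  obtain rfl : g = g' := hq.act_injective _ (e₂.symm.trans e₂')
  exact projGP_eq_iff.2 ⟨g, Prod.ext (congrArg (fun u : P × P × LieDual E₀ => u.1) e :)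
    (congrArg (fun u : P × P × LieDual E₀ => u.2) e' :)⟩

variable (hq : IsPrincipalBundle E₀ G E₁ E₂ q) (hωS : IsSymplectic ωS)

include hq hωS

/-- A representative can be translated along its orbit until its first entry is any prescribed
representative of the target. With this and its analogue for the source, composable arrows are
written with a common middle point. -/
theorem exists_arr_of_tgt {c : GP q ωS θ} (hc : obj h = gaugeTgt q ωS θ c) :
    ∃ (p' : P) (h' : (p', ξ) ∈ sigma q ωS θ), arr h h' = c := by
  obtain ⟨p₁, p₂, ξ', h₁, h₂, rfl⟩ := exists_arr_eq c
  obtain ⟨g, e₁, e₂⟩ := obj_eq_iff.1 hc.symm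
  subst e₁ e₂
  exact ⟨op g • p₂, coadAct_mem_sigma θ hq hωS _ h₂ g, (arr_eq_iff.2 ⟨g, rfl, rfl, rfl⟩).symm⟩

theorem exists_arr_of_src {c : GP q ωS θ} (hc : gaugeSrc q ωS θ c = obj h) :
    ∃ (p' : P) (h' : (p', ξ) ∈ sigma q ωS θ), arr h' h = c := by
  obtain ⟨p₁, p₂, ξ', h₁, h₂, rfl⟩ := exists_arr_eq c
  obtain ⟨g, e₁, e₂⟩ := obj_eq_iff.1 hc
  subst e₁ e₂
  exact ⟨op g • p₁, coadAct_mem_sigma θ hq hωS _ h₁ g, (arr_eq_iff.2 ⟨g, rfl, rfl, rfl⟩).symm⟩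

theorem exists_triple_of_composable {a b : GP q ωS θ}
    (hab : gaugeSrc q ωS θ a = gaugeTgt q ωS θ b) :
    ∃ t : sigmaTriples q ωS θ,
      projGP q ωS θ (triple₁₂ q ωS θ t) = a ∧ projGP q ωS θ (triple₂₃ q ωS θ t) = b := by
  obtain ⟨p₁, p₂, ξ, h₁, h₂, rfl⟩ := exists_arr_eq a
  obtain ⟨p₃, h₃, rfl⟩ := exists_arr_of_tgt h₂ hq hωS hab
  exact ⟨⟨(p₁, p₂, p₃, ξ), h₁, h₂, h₃⟩, rfl, rfl⟩

omit hωS in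
theorem gaugeMul_triple (t : sigmaTriples q ωS θ) :
    gaugeMul q ωS θ (projGP q ωS θ (triple₁₂ q ωS θ t)) (projGP q ωS θ (triple₂₃ q ωS θ t)) =
      projGP q ωS θ (triple₁₃ q ωS θ t) :=
  gaugeMul_arr t.2.1 t.2.2.1 t.2.2.2 hq

end Arrows

variable (hq : IsPrincipalBundle E₀ G E₁ E₂ q) (hωS : IsSymplectic ωS)

variable (θ) in
/-- The groupoid `(Σ ×_μ Σ) / G` over `Σ / G`. -/
def gaugeGroupoid (hq : IsPrincipalBundle E₀ G E₁ E₂ q) (hωS : IsSymplectic ωS) :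
    GroupoidOver (GP q ωS θ) (NP q ωS θ) where
  src := gaugeSrc q ωS θ
  tgt := gaugeTgt q ωS θ
  unit := gaugeUnit q ωS θ
  inv := gaugeInv q ωS θ
  mul := gaugeMul q ωS θ
  src_unit x := by obtain ⟨p, ξ, h, rfl⟩ := exists_obj_eq x; rfl
  tgt_unit x := by obtain ⟨p, ξ, h, rfl⟩ := exists_obj_eq x; rfl
  src_inv a := by obtain ⟨p₁, p₂, ξ, h₁, h₂, rfl⟩ := exists_arr_eq a; rfl
  tgt_inv a := by obtain ⟨p₁, p₂, ξ, h₁, h₂, rfl⟩ := exists_arr_eq a; rfl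
  src_mul a b hab := by
    obtain ⟨t, rfl, rfl⟩ := exists_triple_of_composable hq hωS hab
    rw [gaugeMul_triple hq]
    rfl
  tgt_mul a b hab := by
    obtain ⟨t, rfl, rfl⟩ := exists_triple_of_composable hq hωS hab
    rw [gaugeMul_triple hq]
    rfl
  mul_assoc a b c hab hbc := by
    obtain ⟨p₁, p₂, ξ, h₁, h₂, rfl⟩ := exists_arr_eq a
    obtain ⟨p₃, h₃, rfl⟩ := exists_arr_of_tgt h₂ hq hωS hab
    obtain ⟨p₄, h₄, rfl⟩ := exists_arr_of_tgt h₃ hq hωS hbc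
    simp only [gaugeMul_arr _ _ _ hq]
  unit_mul a := by
    obtain ⟨p₁, p₂, ξ, h₁, h₂, rfl⟩ := exists_arr_eq a
    rw [gaugeTgt_arr, gaugeUnit_obj, gaugeMul_arr _ _ _ hq]
  mul_unit a := by
    obtain ⟨p₁, p₂, ξ, h₁, h₂, rfl⟩ := exists_arr_eq a
    rw [gaugeSrc_arr, gaugeUnit_obj, gaugeMul_arr _ _ _ hq]
  inv_mul a := by
    obtain ⟨p₁, p₂, ξ, h₁, h₂, rfl⟩ := exists_arr_eq a
    rw [gaugeSrc_arr, gaugeUnit_obj, gaugeInv_arr, gaugeMul_arr _ _ _ hq]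
  mul_inv a := by
    obtain ⟨p₁, p₂, ξ, h₁, h₂, rfl⟩ := exists_arr_eq a
    rw [gaugeTgt_arr, gaugeUnit_obj, gaugeInv_arr, gaugeMul_arr _ _ _ hq]

theorem isQuotientOfPairGroupoid_gaugeGroupoid :
    IsQuotientOfPairGroupoid q ωS θ (gaugeGroupoid θ hq hωS) where
  src_eq _ := rfl
  tgt_eq _ := rfl
  mul_eq := by
    rintro ⟨⟨p₁, p₂, ξ⟩, h₁, h₂⟩ ⟨⟨p₂', p₃, ξ'⟩, h₂', h₃⟩ ⟨⟨p₁', p₃', ξ''⟩, h₁', h₃'⟩ e₁ e₂ e₃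
    simp only [pairSrc, pairTgt, Subtype.mk.injEq, Prod.mk.injEq] at e₁ e₂ e₃
    obtain ⟨rfl, rfl⟩ := e₁
    obtain ⟨rfl, rfl⟩ := e₂
    obtain ⟨rfl, -⟩ := e₃
    exact gaugeMul_arr h₁ h₂ h₃ hq

end Model

/-! ### Smoothness of the structure maps of the groupoid -/

section Extend

variable {E H : Type*} [NormedAddCommGroup E] [NormedSpace ℝ E] [TopologicalSpace H]
  {I : ModelWithCorners ℝ E H} {M : Type*} [TopologicalSpace M] [ChartedSpace H M]
  {E' H' : Type*} [NormedAddCommGroup E'] [NormedSpace ℝ E'] [TopologicalSpace H']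
  {I' : ModelWithCorners ℝ E' H'} {M' : Type*} [TopologicalSpace M'] [ChartedSpace H' M']

open Classical in
/-- The extension by a constant of a map that is defined on an open subset. -/
def extendOpens {U : TopologicalSpace.Opens M} (f : U → M') (x₀ : U) (y : M) : M' :=
  if h : y ∈ U then f ⟨y, h⟩ else f x₀

theorem extendOpens_apply {U : TopologicalSpace.Opens M} (f : U → M') (x₀ x : U) :
    extendOpens f x₀ x.1 = f x := dif_pos x.2

theorem contMDiffAt_extendOpens {U : TopologicalSpace.Opens M} {f : U → M'} (x₀ : U) {x : U}
    (hf : ContMDiffAt I I' ∞ f x) : ContMDiffAt I I' ∞ (extendOpens f x₀) x.1 :=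
  contMDiffAt_subtype_iff.1 (hf.congr_of_eventuallyEq
    (Filter.Eventually.of_forall fun y => extendOpens_apply f x₀ y))

end Extend

section Model

variable {E₀ G : Type*} [NormedAddCommGroup E₀] [NormedSpace ℝ E₀]
  [TopologicalSpace G] [ChartedSpace E₀ G] [Group G] [LieGroup 𝓘(ℝ, E₀) ∞ G]
  {E₁ P : Type*} [NormedAddCommGroup E₁] [NormedSpace ℝ E₁]
  [TopologicalSpace P] [ChartedSpace E₁ P] [MulAction Gᵐᵒᵖ P] [IsManifold 𝓘(ℝ, E₁) ∞ P]
  {E₂ S : Type*} [NormedAddCommGroup E₂] [NormedSpace ℝ E₂]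
  [TopologicalSpace S] [ChartedSpace E₂ S] [IsManifold 𝓘(ℝ, E₂) ∞ S]
  {q : P → S} {ωS : DiffForm 𝓘(ℝ, E₂) S 2 ℝ} {θ : PrincipalConnection E₀ G E₁ P}
  [FiniteDimensional ℝ E₀] [FiniteDimensional ℝ E₁] [FiniteDimensional ℝ E₂]

theorem contMDiff_triple₁₃ : ContMDiff (𝓘(ℝ, E₁).prod (modelPairs E₀ E₁)) (modelPairs E₀ E₁) ∞
    (triple₁₃ q ωS θ) := fun t =>
  contMDiffAt_opens_iff.2 <| ContMDiff.comp
    (f := (Subtype.val : sigmaTriples q ωS θ → P × P × P × LieDual E₀))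
    (g := fun t : P × P × P × LieDual E₀ => (t.1, t.2.2))
    (contMDiff_fst.prodMk (contMDiff_snd.comp contMDiff_snd)) contMDiff_subtype_val t

theorem contMDiff_pairUnit : ContMDiff (modelSigma E₀ E₁) (modelPairs E₀ E₁) ∞
    (pairUnit q ωS θ) := fun x =>
  contMDiffAt_opens_iff.2 <| ContMDiff.comp
    (f := (Subtype.val : sigma q ωS θ → P × LieDual E₀))
    (g := fun x : P × LieDual E₀ => (x.1, x))
    (contMDiff_fst.prodMk contMDiff_id) contMDiff_subtype_val x

theorem contMDiff_pairInv : ContMDiff (modelPairs E₀ E₁) (modelPairs E₀ E₁) ∞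
    (pairInv q ωS θ) := fun z =>
  contMDiffAt_opens_iff.2 <| ContMDiff.comp
    (f := (Subtype.val : sigmaPairs q ωS θ → P × P × LieDual E₀))
    (g := fun z : P × P × LieDual E₀ => (z.2.1, z.1, z.2.2))
    ((contMDiff_fst.comp contMDiff_snd).prodMk
      (contMDiff_fst.prodMk (contMDiff_snd.comp contMDiff_snd))) contMDiff_subtype_val z

variable [ChartedSpace (E₂ × LieDual E₀) (NP q ωS θ)] [IsManifold (modelN E₀ E₂) ∞ (NP q ωS θ)]
  [ChartedSpace (E₂ × E₂ × E₀ × LieDual E₀) (GP q ωS θ)]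
  [IsManifold (modelG E₀ E₂) ∞ (GP q ωS θ)]
  (hN : IsSmoothQuotient (modelSigma E₀ E₁) (modelN E₀ E₂) (projNP q ωS θ))
  (hΓ : IsSmoothQuotient (modelPairs E₀ E₁) (modelG E₀ E₂) (projGP q ωS θ))
  (hq : IsPrincipalBundle E₀ G E₁ E₂ q) (hωS : IsSymplectic ωS)

include hN hΓ

theorem contMDiff_gaugeSrc : ContMDiff (modelG E₀ E₂) (modelN E₀ E₂) ∞ (gaugeSrc q ωS θ) :=
  hΓ.contMDiff_of_comp (hN.smooth.comp contMDiff_pairSrc)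

theorem contMDiff_gaugeTgt : ContMDiff (modelG E₀ E₂) (modelN E₀ E₂) ∞ (gaugeTgt q ωS θ) :=
  hΓ.contMDiff_of_comp (hN.smooth.comp contMDiff_pairTgt)

theorem contMDiff_gaugeUnit : ContMDiff (modelN E₀ E₂) (modelG E₀ E₂) ∞ (gaugeUnit q ωS θ) :=
  hN.contMDiff_of_comp (hΓ.smooth.comp contMDiff_pairUnit)

omit hN in
theorem contMDiff_gaugeInv : ContMDiff (modelG E₀ E₂) (modelG E₀ E₂) ∞ (gaugeInv q ωS θ) :=
  hΓ.contMDiff_of_comp (hΓ.smooth.comp contMDiff_pairInv)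

theorem mderiv_gaugeSrc (z : sigmaPairs q ωS θ) (v : E₁ × E₁ × LieDual E₀) :
    mderiv (modelG E₀ E₂) (modelN E₀ E₂) (gaugeSrc q ωS θ) (projGP q ωS θ z)
      (mderiv (modelPairs E₀ E₁) (modelG E₀ E₂) (projGP q ωS θ) z v) =
    mderiv (modelSigma E₀ E₁) (modelN E₀ E₂) (projNP q ωS θ) (pairSrc q ωS θ z) v.2 := by
  have h1 := mderiv_comp z ((contMDiff_gaugeSrc hN hΓ _).mdifferentiableAt (by simp))
    (hΓ.mdifferentiableAt z)
  have h2 := mderiv_comp z (hN.mdifferentiableAt (pairSrc q ωS θ z))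
    ((contMDiff_pairSrc z).mdifferentiableAt (by simp))
  refine (DFunLike.congr_fun h1 v).symm.trans ((DFunLike.congr_fun h2 v).trans ?_)
  rw [ContinuousLinearMap.comp_apply, mderiv_pairSrc]

theorem mderiv_gaugeTgt (z : sigmaPairs q ωS θ) (v : E₁ × E₁ × LieDual E₀) :
    mderiv (modelG E₀ E₂) (modelN E₀ E₂) (gaugeTgt q ωS θ) (projGP q ωS θ z)
      (mderiv (modelPairs E₀ E₁) (modelG E₀ E₂) (projGP q ωS θ) z v) =
    mderiv (modelSigma E₀ E₁) (modelN E₀ E₂) (projNP q ωS θ) (pairTgt q ωS θ z)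
      (v.1, v.2.2) := by
  have h1 := mderiv_comp z ((contMDiff_gaugeTgt hN hΓ _).mdifferentiableAt (by simp))
    (hΓ.mdifferentiableAt z)
  have h2 := mderiv_comp z (hN.mdifferentiableAt (pairTgt q ωS θ z))
    ((contMDiff_pairTgt z).mdifferentiableAt (by simp))
  refine (DFunLike.congr_fun h1 v).symm.trans ((DFunLike.congr_fun h2 v).trans ?_)
  rw [ContinuousLinearMap.comp_apply, mderiv_pairTgt]

theorem isSmoothSubmersion_gaugeSrc :
    IsSmoothSubmersion (modelG E₀ E₂) (modelN E₀ E₂) (gaugeSrc q ωS θ) := by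
  refine ⟨contMDiff_gaugeSrc hN hΓ, fun a u => ?_⟩
  obtain ⟨z, rfl⟩ := hΓ.surjective a
  obtain ⟨v, hv⟩ := hN.surjective_mderiv (pairSrc q ωS θ z) u
  exact ⟨_, (mderiv_gaugeSrc hN hΓ z (0, v)).trans hv⟩

theorem isSmoothSubmersion_gaugeTgt :
    IsSmoothSubmersion (modelG E₀ E₂) (modelN E₀ E₂) (gaugeTgt q ωS θ) := by
  refine ⟨contMDiff_gaugeTgt hN hΓ, fun a u => ?_⟩
  obtain ⟨z, rfl⟩ := hΓ.surjective a
  obtain ⟨v, hv⟩ := hN.surjective_mderiv (pairTgt q ωS θ z) u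
  exact ⟨_, (mderiv_gaugeTgt hN hΓ z (v.1, 0, v.2)).trans hv⟩

omit hN [ChartedSpace (E₂ × LieDual E₀) (NP q ωS θ)] [IsManifold (modelN E₀ E₂) ∞ (NP q ωS θ)] in
include hq hωS in
-- Local sections lift the two arrows to pairs. Composability puts the inner points of these pairs
-- into one orbit, and the division map δ gives, smoothly, the element that aligns them. The aligned
-- triple F is smooth near the given point as a map to P × P × P × 𝔤^*, but represents the product
-- only on composable pairs. The projection from triples is extended by a constant in order to
-- compose it with F.
theorem contMDiffOn_gaugeMul :
    ContMDiffOn ((modelG E₀ E₂).prod (modelG E₀ E₂)) (modelG E₀ E₂) ∞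
      (fun z : GP q ωS θ × GP q ωS θ => gaugeMul q ωS θ z.1 z.2)
      {z | gaugeSrc q ωS θ z.1 = gaugeTgt q ωS θ z.2} := by
  rintro ⟨a₀, b₀⟩ hab
  obtain ⟨t₀, rfl, rfl⟩ := exists_triple_of_composable hq hωS hab
  obtain ⟨s₁, hs₁, hs₁', hsec₁⟩ := hΓ.exists_section (triple₁₂ q ωS θ t₀)
  obtain ⟨s₂, hs₂, hs₂', hsec₂⟩ := hΓ.exists_section (triple₂₃ q ωS θ t₀)
  obtain ⟨δ, hδ, hδ'⟩ := hq.exists_division t₀.1.2.1 t₀.1.2.1 rfl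
  have hδ₁ : δ (t₀.1.2.1, t₀.1.2.1) = 1 := hδ'.self_of_nhds.2 1 (one_smul _ _)
  let a₀ := projGP q ωS θ (triple₁₂ q ωS θ t₀)
  let b₀ := projGP q ωS θ (triple₂₃ q ωS θ t₀)
  have hf₁ : ContMDiffAt ((modelG E₀ E₂).prod (modelG E₀ E₂)) (modelPairs E₀ E₁) ∞
      (fun z : GP q ωS θ × GP q ωS θ => (s₁ z.1).1) (a₀, b₀) :=
    (contMDiff_subtype_val _).comp (a₀, b₀) (hs₁.comp (a₀, b₀) contMDiffAt_fst)
  have hf₂ : ContMDiffAt ((modelG E₀ E₂).prod (modelG E₀ E₂)) (modelPairs E₀ E₁) ∞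
      (fun z : GP q ωS θ × GP q ωS θ => (s₂ z.2).1) (a₀, b₀) :=
    (contMDiff_subtype_val _).comp (a₀, b₀) (hs₂.comp (a₀, b₀) contMDiffAt_snd)
  have hd : ContMDiffAt ((modelG E₀ E₂).prod (modelG E₀ E₂)) (𝓘(ℝ, E₁).prod 𝓘(ℝ, E₁)) ∞
      (fun z : GP q ωS θ × GP q ωS θ => ((s₂ z.2).1.1, (s₁ z.1).1.2.1)) (a₀, b₀) :=
    hf₂.fst.prodMk hf₁.snd.fst
  have hval : ((s₂ b₀).1.1, (s₁ a₀).1.2.1) = (t₀.1.2.1, t₀.1.2.1) := by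
    simp only [a₀, b₀, hs₁', hs₂']
    rfl
  have hg := ContMDiffAt.comp_of_eq hδ hd hval
  let F : GP q ωS θ × GP q ωS θ → P × P × P × LieDual E₀ := fun z =>
    ((s₁ z.1).1.1, (s₁ z.1).1.2.1,
      op (δ ((s₂ z.2).1.1, (s₁ z.1).1.2.1)) • (s₂ z.2).1.2.1, (s₁ z.1).1.2.2)
  have hF : ContMDiffAt ((modelG E₀ E₂).prod (modelG E₀ E₂)) (𝓘(ℝ, E₁).prod (modelPairs E₀ E₁)) ∞
      F (a₀, b₀) :=
    hf₁.fst.prodMk (hf₁.snd.fst.prodMk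
      (((hq.smooth_act _).comp (a₀, b₀) (hf₂.snd.fst.prodMk hg)).prodMk hf₁.snd.snd))
  have hF₀ : F (a₀, b₀) = t₀.1 := by
    simp only [F, a₀, b₀, hs₁', hs₂']
    simp only [triple₁₂, triple₂₃, hδ₁, op_one, one_smul]
  have hk := contMDiffAt_extendOpens t₀
    ((hΓ.smooth.comp (contMDiff_triple₁₃ (q := q) (ωS := ωS) (θ := θ))) t₀)
  refine (ContMDiffAt.comp_of_eq hk hF hF₀).contMDiffWithinAt.congr_of_eventuallyEq_of_mem ?_ hab
  have he₁ : ∀ᶠ z : GP q ωS θ × GP q ωS θ in 𝓝 (a₀, b₀), projGP q ωS θ (s₁ z.1) = z.1 :=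
    (continuous_fst.tendsto (a₀, b₀)).eventually hsec₁
  have he₂ : ∀ᶠ z : GP q ωS θ × GP q ωS θ in 𝓝 (a₀, b₀), projGP q ωS θ (s₂ z.2) = z.2 :=
    (continuous_snd.tendsto (a₀, b₀)).eventually hsec₂
  have he₃ := hd.continuousAt.eventually (hval ▸ hδ')
  filter_upwards [nhdsWithin_le_nhds he₁, nhdsWithin_le_nhds he₂, nhdsWithin_le_nhds he₃,
    self_mem_nhdsWithin] with z h₁ h₂ h₃ hz
  have hz' : gaugeSrc q ωS θ z.1 = gaugeTgt q ωS θ z.2 := hz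
  rw [← h₁, ← h₂] at hz'
  obtain ⟨g, hg⟩ := projNP_eq_iff.1 hz'.symm
  have e₁ : (s₁ z.1).1.2.1 = op g • (s₂ z.2).1.1 := congrArg Prod.fst hg
  have e₂ : (s₁ z.1).1.2.2 = (s₂ z.2).1.2.2 ∘L lieAd g := congrArg Prod.snd hg
  have hδg := h₃.2 g e₁.symm
  have hm : (op g • (s₂ z.2).1.2.1, (s₁ z.1).1.2.2) ∈ sigma q ωS θ := by
    rw [e₂]
    exact coadAct_mem_sigma θ hq hωS _ (s₂ z.2).2.2 g
  let t : sigmaTriples q ωS θ := ⟨((s₁ z.1).1.1, (s₁ z.1).1.2.1, op g • (s₂ z.2).1.2.1,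
    (s₁ z.1).1.2.2), (s₁ z.1).2.1, (s₁ z.1).2.2, hm⟩
  have hFt : F z = t.1 := by
    simp only [F, hδg]
    rfl
  have h₅ : projGP q ωS θ (triple₂₃ q ωS θ t) = z.2 := by
    rw [← h₂]
    refine (projGP_eq_iff.2 ⟨g, ?_⟩).symm
    change ((s₁ z.1).1.2.1, op g • (s₂ z.2).1.2.1, (s₁ z.1).1.2.2) = _
    rw [e₁, e₂]
    rfl
  have h₆ : projGP q ωS θ (triple₁₂ q ωS θ t) = z.1 := h₁
  have h₇ := gaugeMul_triple hq t
  rw [h₅, h₆] at h₇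
  refine h₇.trans ?_
  change _ = extendOpens _ t₀ (F z)
  rw [hFt, extendOpens_apply]
  rfl

include hq hωS in
theorem isLieGroupoid_gaugeGroupoid :
    (gaugeGroupoid θ hq hωS).IsLieGroupoid (modelG E₀ E₂) (modelN E₀ E₂) where
  src_submersion := isSmoothSubmersion_gaugeSrc hN hΓ
  tgt_submersion := isSmoothSubmersion_gaugeTgt hN hΓ
  smooth_unit := contMDiff_gaugeUnit hN hΓ
  smooth_inv := contMDiff_gaugeInv hΓ
  smooth_mul := contMDiffOn_gaugeMul hΓ hq hωS

end Model

/-! ### The source is Poisson and the target is anti-Poisson -/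

section Within

variable {E H : Type*} [NormedAddCommGroup E] [NormedSpace ℝ E] [TopologicalSpace H]
  {I : ModelWithCorners ℝ E H} {M : Type*} [TopologicalSpace M] [ChartedSpace H M]
  {E' H' : Type*} [NormedAddCommGroup E'] [NormedSpace ℝ E'] [TopologicalSpace H']
  {I' : ModelWithCorners ℝ E' H'} {M' : Type*} [TopologicalSpace M'] [ChartedSpace H' M']
  {E'' H'' : Type*} [NormedAddCommGroup E''] [NormedSpace ℝ E''] [TopologicalSpace H'']
  {I'' : ModelWithCorners ℝ E'' H''} {M'' : Type*} [TopologicalSpace M''] [ChartedSpace H'' M'']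

variable (I I') in
/-- The derivative of a map within a set, as a linear map between the model spaces. -/
def mderivWithin (f : M → M') (s : Set M) (x : M) : E →L[ℝ] E' := mfderivWithin I I' f s x

/-- No unique differentiability of C is required: whichever derivative within C has been selected,
it computes velocities of images of curves in C. Two curves in C with the same velocity at the same
point therefore have images with the same velocity. -/
theorem mderiv_comp_within {g : M' → M''} {C : Set M'} {f : M → M'} {x : M}
    (hg : MDifferentiableWithinAt I' I'' g C (f x)) (hf : MDifferentiableAt I I' f x)
    (hC : ∀ y, f y ∈ C) (v : E) :
    mderiv I I'' (fun y => g (f y)) x v = mderivWithin I' I'' g C (f x) (mderiv I I' f x v) := by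
  have h := hg.hasMFDerivWithinAt.comp x hf.hasMFDerivAt.hasMFDerivWithinAt
    (s := univ) (fun y _ => hC y)
  exact DFunLike.congr_fun (hasMFDerivWithinAt_univ.1 h).mfderiv v

end Within

section Model

variable {E₀ G : Type*} [NormedAddCommGroup E₀] [NormedSpace ℝ E₀]
  [TopologicalSpace G] [ChartedSpace E₀ G] [Group G] [LieGroup 𝓘(ℝ, E₀) ∞ G]
  {E₁ P : Type*} [NormedAddCommGroup E₁] [NormedSpace ℝ E₁]
  [TopologicalSpace P] [ChartedSpace E₁ P] [MulAction Gᵐᵒᵖ P] [IsManifold 𝓘(ℝ, E₁) ∞ P]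
  {E₂ S : Type*} [NormedAddCommGroup E₂] [NormedSpace ℝ E₂]
  [TopologicalSpace S] [ChartedSpace E₂ S] [IsManifold 𝓘(ℝ, E₂) ∞ S]
  {q : P → S} {ωS : DiffForm 𝓘(ℝ, E₂) S 2 ℝ} {θ : PrincipalConnection E₀ G E₁ P}
  [FiniteDimensional ℝ E₀] [FiniteDimensional ℝ E₁] [FiniteDimensional ℝ E₂]
  [ChartedSpace (E₂ × LieDual E₀) (NP q ωS θ)] [IsManifold (modelN E₀ E₂) ∞ (NP q ωS θ)]
  [ChartedSpace (E₂ × E₂ × E₀ × LieDual E₀) (GP q ωS θ)]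
  [IsManifold (modelG E₀ E₂) ∞ (GP q ωS θ)]

variable (q ωS θ) in
/-- The derivative of the projection `Σ → N(P)`. -/
abbrev derivNP (x : sigma q ωS θ) : E₁ × LieDual E₀ →L[ℝ] E₂ × LieDual E₀ :=
  mderiv (modelSigma E₀ E₁) (modelN E₀ E₂) (projNP q ωS θ) x

variable (q ωS θ) in
/-- The derivative of the projection `Σ ×_μ Σ → (Σ ×_μ Σ) / G`. -/
abbrev derivGP (z : sigmaPairs q ωS θ) :
    E₁ × E₁ × LieDual E₀ →L[ℝ] E₂ × E₂ × E₀ × LieDual E₀ :=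
  mderiv (modelPairs E₀ E₁) (modelG E₀ E₂) (projGP q ωS θ) z

variable
  (hN : IsSmoothQuotient (modelSigma E₀ E₁) (modelN E₀ E₂) (projNP q ωS θ))
  (hΓ : IsSmoothQuotient (modelPairs E₀ E₁) (modelG E₀ E₂) (projGP q ωS θ))
  (hq : IsPrincipalBundle E₀ G E₁ E₂ q) (hωS : IsSymplectic ωS)
  {Ω : DiffForm (modelG E₀ E₂) (GP q ωS θ) 2 ℝ}
  (hΩ : DiffForm.pullback (modelPairs E₀ E₁) (projGP q ωS θ) Ω = omegaPairs q ωS θ)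

include hΩ in
theorem bilin_derivGP (z : sigmaPairs q ωS θ) (v w : E₁ × E₁ × LieDual E₀) :
    Ω.bilin (projGP q ωS θ z) (derivGP q ωS θ z v) (derivGP q ωS θ z w) =
      (omega q ωS θ).bilin (z.1.2.1, z.1.2.2) v.2 w.2
        - (omega q ωS θ).bilin (z.1.1, z.1.2.2) (v.1, v.2.2) (w.1, w.2.2) := by
  rw [← omegaPairs_bilin, ← hΩ, pullback_bilin]

include hq hωS in
theorem exists_gen_eq (x : sigma q ωS θ) {u : E₁ × LieDual E₀}
    (hu : ∀ w : E₁, (omega q ωS θ).bilin x.1 u (w, 0) = 0) : ∃ X, gen E₀ G E₁ x.1 X = u :=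
  exists_eq_of_orthogonal ((mem_sigma_iff θ hq hωS _).1 x.2)
    (fun X w => omega_gen (ωS := ωS) θ hq x.1 X w) hu

include hq hωS hN in
theorem derivNP_gen (x : sigma q ωS θ) (X : E₀) : derivNP q ωS θ x (gen E₀ G E₁ x.1 X) = 0 :=
  (mderiv_projNP_eq_zero_iff hq hωS hN x _).2 ⟨X, rfl⟩

include hq hωS hΓ in
theorem derivGP_gen (z : sigmaPairs q ωS θ) (X : E₀) :
    derivGP q ωS θ z (genP E₀ G E₁ z.1.1 X, genP E₀ G E₁ z.1.2.1 X, genDual E₀ G z.1.2.2 X) = 0 :=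
  (mderiv_projGP_eq_zero_iff hq hωS hΓ z _).2 ⟨X, rfl⟩

section Poisson

variable {ϖ : PoissonStructure (modelN E₀ E₂) (NP q ωS θ)}
  (hϖ : ∀ (x : sigma q ωS θ) (a : E₂ × LieDual E₀ →L[ℝ] ℝ) (v : E₁ × LieDual E₀),
    (∀ w, (omega q ωS θ).bilin x.1 v w = a (derivNP q ωS θ x w)) →
      derivNP q ωS θ x v = ϖ.sharp (projNP q ωS θ x) a)

include hϖ in
theorem isPoissonMap_projNP : IsPoissonMap (omegaSigma q ωS θ) ϖ (projNP q ωS θ) :=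
  fun x v a h => hϖ x a v fun w =>
    (omegaSigma_bilin x v w).symm.trans ((DiffForm.bilin_apply (E := E₁ × LieDual E₀)
      (I := modelSigma E₀ E₁) _ x v w).trans (h w))

include hN hΓ hq hωS hΩ hϖ

/-- Let Ω(V, ·) = s^*α. Variations of p₁ alone are killed by ds, so the target component of a lift
of V is orthogonal to a fiber of μ and is the generator of some X. Then ω contracts the source
component minus the generator of X to α ∘ dπ, with π the projection to N(P), and the generator is
invisible in N(P). -/
theorem isPoissonMap_gaugeSrc : IsPoissonMap Ω ϖ (gaugeSrc q ωS θ) := by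
  intro a V α hV
  obtain ⟨z, rfl⟩ := hΓ.surjective a
  obtain ⟨v, rfl⟩ := hΓ.surjective_mderiv z V
  let α' : E₂ × LieDual E₀ →L[ℝ] ℝ := α
  have h : ∀ w : E₁ × E₁ × LieDual E₀, (omega q ωS θ).bilin (z.1.2.1, z.1.2.2) v.2 w.2
      - (omega q ωS θ).bilin (z.1.1, z.1.2.2) (v.1, v.2.2) (w.1, w.2.2) =
      α' (derivNP q ωS θ (pairSrc q ωS θ z) w.2) := by
    intro w
    rw [← bilin_derivGP hΩ, ← mderiv_gaugeSrc hN hΓ z w]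
    exact (DiffForm.bilin_apply _ _ _ _).trans (hV _)
  obtain ⟨X, hX⟩ := exists_gen_eq hq hωS (pairTgt q ωS θ z) (u := (v.1, v.2.2)) fun w => by
    have h1 := h (w, 0)
    rw [map_zero, map_zero, map_zero, zero_sub, neg_eq_zero] at h1
    exact h1
  have h2 : derivNP q ωS θ (pairSrc q ωS θ z) (v.2 - gen E₀ G E₁ (pairSrc q ωS θ z).1 X) =
      ϖ.sharp (projNP q ωS θ (pairSrc q ωS θ z)) α' := by
    refine hϖ _ α' _ fun w => ?_
    rw [map_sub, sub_apply, omega_gen θ hq]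
    have h3 := h (0, w)
    have h4 : (omega q ωS θ).bilin (z.1.1, z.1.2.2) (v.1, v.2.2) (0, w.2) = w.2 X := by
      rw [← hX]
      exact omega_gen θ hq _ X _
    rw [h4] at h3
    exact h3
  rw [map_sub, derivNP_gen hN hq hωS, sub_zero] at h2
  exact (mderiv_gaugeSrc hN hΓ z v).trans h2

/-- The argument for the source with the two ends exchanged. The sign comes from the term -t^*ω of
Ω. -/
theorem isAntiPoissonMap_gaugeTgt : IsAntiPoissonMap Ω ϖ (gaugeTgt q ωS θ) := by
  intro a V α hV
  obtain ⟨z, rfl⟩ := hΓ.surjective a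
  obtain ⟨v, rfl⟩ := hΓ.surjective_mderiv z V
  let α' : E₂ × LieDual E₀ →L[ℝ] ℝ := α
  have h : ∀ w : E₁ × E₁ × LieDual E₀, (omega q ωS θ).bilin (z.1.2.1, z.1.2.2) v.2 w.2
      - (omega q ωS θ).bilin (z.1.1, z.1.2.2) (v.1, v.2.2) (w.1, w.2.2) =
      α' (derivNP q ωS θ (pairTgt q ωS θ z) (w.1, w.2.2)) := by
    intro w
    rw [← bilin_derivGP hΩ, ← mderiv_gaugeTgt hN hΓ z w]
    exact (DiffForm.bilin_apply _ _ _ _).trans (hV _)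
  have h00 : ((0 : E₁), (0 : LieDual E₀)) = 0 := rfl
  obtain ⟨X, hX⟩ := exists_gen_eq hq hωS (pairSrc q ωS θ z) (u := v.2) fun w => by
    have h1 := h (0, w, 0)
    simp only [h00, map_zero, sub_zero] at h1
    exact h1
  have h2 : derivNP q ωS θ (pairTgt q ωS θ z)
      (gen E₀ G E₁ (pairTgt q ωS θ z).1 X - (v.1, v.2.2)) = ϖ.sharp (projNP q ωS θ (pairTgt q ωS θ z)) α' := by
    refine hϖ _ α' _ fun w => ?_
    rw [map_sub, sub_apply, omega_gen θ hq]
    have h3 := h (w.1, 0, w.2)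
    have h4 : (omega q ωS θ).bilin (z.1.2.1, z.1.2.2) v.2 (0, w.2) = w.2 X := by
      rw [← hX]
      exact omega_gen θ hq _ X _
    rw [h4] at h3
    exact h3
  rw [map_sub, derivNP_gen hN hq hωS, zero_sub] at h2
  refine (mderiv_gaugeTgt hN hΓ z v).trans ?_
  exact (neg_neg _).symm.trans (congrArg (fun u : E₂ × LieDual E₀ => -u) h2)

end Poisson

end Model

/-! ### The graph of the product is Lagrangian -/

section Triple

variable {E H : Type*} [NormedAddCommGroup E] [NormedSpace ℝ E] [TopologicalSpace H]
  {I : ModelWithCorners ℝ E H} {M : Type*} [TopologicalSpace M] [ChartedSpace H M]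

theorem tripleForm_bilin (Ω : DiffForm I M 2 ℝ) (x : M × M × M) (v w : E × E × E) :
    (tripleForm Ω).bilin x v w = Ω.bilin x.1 v.1 w.1 + Ω.bilin x.2.1 v.2.1 w.2.1
      - Ω.bilin x.2.2 v.2.2 w.2.2 := by
  have h : (tripleForm Ω).bilin x v w =
      (DiffForm.pullback (I.prod (I.prod I)) (fun z : M × M × M => z.1) Ω).bilin x v w
      + (DiffForm.pullback (I.prod (I.prod I)) (fun z : M × M × M => z.2.1) Ω).bilin x v w
      - (DiffForm.pullback (I.prod (I.prod I)) (fun z : M × M × M => z.2.2) Ω).bilin x v w := by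
    rw [DiffForm.bilin_apply, DiffForm.bilin_apply, DiffForm.bilin_apply, DiffForm.bilin_apply]
    rfl
  have h₁ : ∀ u : E × E × E,
      mderiv (I.prod (I.prod I)) I (fun z : M × M × M => z.1) x u = u.1 :=
    DFunLike.congr_fun (mderiv_fst x)
  have h₂ : ∀ u : E × E × E,
      mderiv (I.prod (I.prod I)) (I.prod I) (fun z : M × M × M => z.2) x u = u.2 :=
    DFunLike.congr_fun (mderiv_snd x)
  have h₃ : ∀ u : E × E × E,
      mderiv (I.prod (I.prod I)) I (fun z : M × M × M => z.2.1) x u = u.2.1 := fun u => by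
    have := mderiv_comp (I := I.prod (I.prod I)) (I' := I.prod I) (I'' := I)
      (f := fun z : M × M × M => z.2) (g := Prod.fst) x mdifferentiableAt_fst mdifferentiableAt_snd
    refine (DFunLike.congr_fun this u).trans ?_
    rw [mderiv_fst]
    exact (congrArg (ContinuousLinearMap.fst ℝ E E) (h₂ u) :)
  have h₄ : ∀ u : E × E × E,
      mderiv (I.prod (I.prod I)) I (fun z : M × M × M => z.2.2) x u = u.2.2 := fun u => by
    have := mderiv_comp (I := I.prod (I.prod I)) (I' := I.prod I) (I'' := I)
      (f := fun z : M × M × M => z.2) (g := Prod.snd) x mdifferentiableAt_snd mdifferentiableAt_snd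
    refine (DFunLike.congr_fun this u).trans ?_
    rw [mderiv_snd]
    exact (congrArg (ContinuousLinearMap.snd ℝ E E) (h₂ u) :)
  rw [h, pullback_bilin, pullback_bilin, pullback_bilin, h₁, h₁, h₃, h₃, h₄, h₄]

end Triple

section Model

variable {E₀ G : Type*} [NormedAddCommGroup E₀] [NormedSpace ℝ E₀]
  [TopologicalSpace G] [ChartedSpace E₀ G] [Group G] [LieGroup 𝓘(ℝ, E₀) ∞ G]
  {E₁ P : Type*} [NormedAddCommGroup E₁] [NormedSpace ℝ E₁]
  [TopologicalSpace P] [ChartedSpace E₁ P] [MulAction Gᵐᵒᵖ P] [IsManifold 𝓘(ℝ, E₁) ∞ P]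
  {E₂ S : Type*} [NormedAddCommGroup E₂] [NormedSpace ℝ E₂]
  [TopologicalSpace S] [ChartedSpace E₂ S] [IsManifold 𝓘(ℝ, E₂) ∞ S]
  {q : P → S} {ωS : DiffForm 𝓘(ℝ, E₂) S 2 ℝ} {θ : PrincipalConnection E₀ G E₁ P}
  [FiniteDimensional ℝ E₀] [FiniteDimensional ℝ E₁] [FiniteDimensional ℝ E₂]

section Triples

/-- The model with corners of `P × P × P × 𝔤^*`. -/
abbrev modelTriples (E₀ E₁ : Type*) [NormedAddCommGroup E₀] [NormedSpace ℝ E₀]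
    [NormedAddCommGroup E₁] [NormedSpace ℝ E₁] := 𝓘(ℝ, E₁).prod (modelPairs E₀ E₁)

theorem contMDiff_triple₁₂ : ContMDiff (modelTriples E₀ E₁) (modelPairs E₀ E₁) ∞
    (triple₁₂ q ωS θ) := fun t =>
  contMDiffAt_opens_iff.2 <| ContMDiff.comp
    (f := (Subtype.val : sigmaTriples q ωS θ → P × P × P × LieDual E₀))
    (g := fun t : P × P × P × LieDual E₀ => (t.1, t.2.1, t.2.2.2))
    (contMDiff_fst.prodMk (contMDiff_proj₁₃.comp contMDiff_snd)) contMDiff_subtype_val t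

theorem contMDiff_triple₂₃ : ContMDiff (modelTriples E₀ E₁) (modelPairs E₀ E₁) ∞
    (triple₂₃ q ωS θ) := fun t =>
  contMDiffAt_opens_iff.2 <| ContMDiff.comp
    (f := (Subtype.val : sigmaTriples q ωS θ → P × P × P × LieDual E₀))
    (g := fun t : P × P × P × LieDual E₀ => t.2)
    contMDiff_snd contMDiff_subtype_val t

theorem mderiv_snd_triple (t : sigmaTriples q ωS θ) (v : E₁ × E₁ × E₁ × LieDual E₀) :
    mderiv (modelTriples E₀ E₁) (modelPairs E₀ E₁)
      (fun y : sigmaTriples q ωS θ => y.1.2) t v = v.2 :=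
  (DFunLike.congr_fun (mderiv_comp_val (I := modelTriples E₀ E₁) (I' := modelPairs E₀ E₁)
    (f := fun y : P × P × P × LieDual E₀ => y.2) (x := t) mdifferentiableAt_snd) v).trans
    (DFunLike.congr_fun (mderiv_snd t.1) v)

theorem mderiv_fst_triple (t : sigmaTriples q ωS θ) (v : E₁ × E₁ × E₁ × LieDual E₀) :
    mderiv (modelTriples E₀ E₁) 𝓘(ℝ, E₁) (fun y : sigmaTriples q ωS θ => y.1.1) t v = v.1 :=
  (DFunLike.congr_fun (mderiv_comp_val (I := modelTriples E₀ E₁) (I' := 𝓘(ℝ, E₁))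
    (f := fun y : P × P × P × LieDual E₀ => y.1) (x := t) mdifferentiableAt_fst) v).trans
    (DFunLike.congr_fun (mderiv_fst t.1) v)

theorem mderiv_triple₂₃ (t : sigmaTriples q ωS θ) (v : E₁ × E₁ × E₁ × LieDual E₀) :
    mderiv (modelTriples E₀ E₁) (modelPairs E₀ E₁) (triple₂₃ q ωS θ) t v = v.2 := by
  rw [← mderiv_val_comp ((contMDiff_triple₂₃ t).mdifferentiableAt (by simp))]
  exact mderiv_snd_triple t v

theorem mdifferentiableAt_snd_triple (t : sigmaTriples q ωS θ) :
    MDifferentiableAt (modelTriples E₀ E₁) (modelPairs E₀ E₁)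
      (fun y : sigmaTriples q ωS θ => y.1.2) t :=
  ContMDiffAt.mdifferentiableAt (n := ∞)
    ((contMDiff_snd.comp contMDiff_subtype_val) t) (by simp)

theorem mdifferentiableAt_fst_triple (t : sigmaTriples q ωS θ) :
    MDifferentiableAt (modelTriples E₀ E₁) 𝓘(ℝ, E₁)
      (fun y : sigmaTriples q ωS θ => y.1.1) t :=
  ContMDiffAt.mdifferentiableAt (n := ∞)
    ((contMDiff_fst.comp contMDiff_subtype_val) t) (by simp)

theorem mderiv_triple₁₃ (t : sigmaTriples q ωS θ) (v : E₁ × E₁ × E₁ × LieDual E₀) :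
    mderiv (modelTriples E₀ E₁) (modelPairs E₀ E₁) (triple₁₃ q ωS θ) t v = (v.1, v.2.2) := by
  rw [← mderiv_val_comp ((contMDiff_triple₁₃ t).mdifferentiableAt (by simp))]
  have h2 := mderiv_comp (I := modelTriples E₀ E₁) (I' := modelPairs E₀ E₁)
    (I'' := modelSigma E₀ E₁) (f := fun y : sigmaTriples q ωS θ => y.1.2) (g := Prod.snd) t
    mdifferentiableAt_snd (mdifferentiableAt_snd_triple t)
  have h3 := mderiv_prodMk (mdifferentiableAt_fst_triple t)
    (mdifferentiableAt_snd.comp t (mdifferentiableAt_snd_triple t))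
  refine (DFunLike.congr_fun h3 v).trans ?_
  refine Prod.ext (mderiv_fst_triple t v) ((DFunLike.congr_fun h2 v).trans ?_)
  rw [mderiv_snd]
  exact (congrArg (ContinuousLinearMap.snd ℝ E₁ (E₁ × LieDual E₀)) (mderiv_snd_triple t v) :)

theorem mderiv_triple₁₂ (t : sigmaTriples q ωS θ) (v : E₁ × E₁ × E₁ × LieDual E₀) :
    mderiv (modelTriples E₀ E₁) (modelPairs E₀ E₁) (triple₁₂ q ωS θ) t v =
      (v.1, v.2.1, v.2.2.2) := by
  rw [← mderiv_val_comp ((contMDiff_triple₁₂ t).mdifferentiableAt (by simp))]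
  have hp := (contMDiff_proj₁₃ (E₀ := E₀) (E₁ := E₁) t.1.2).mdifferentiableAt (n := ∞) (by simp)
  have h2 := mderiv_comp t hp (mdifferentiableAt_snd_triple t)
  have h3 := mderiv_prodMk (mdifferentiableAt_fst_triple t)
    (hp.comp t (mdifferentiableAt_snd_triple t))
  refine (DFunLike.congr_fun h3 v).trans ?_
  refine Prod.ext (mderiv_fst_triple t v) ((DFunLike.congr_fun h2 v).trans ?_)
  refine (mderiv_proj₁₃ t.1.2 _).trans ?_
  exact (congrArg (fun u : E₁ × E₁ × LieDual E₀ => (u.1, u.2.2)) (mderiv_snd_triple t v) :)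

end Triples

variable [ChartedSpace (E₂ × LieDual E₀) (NP q ωS θ)] [IsManifold (modelN E₀ E₂) ∞ (NP q ωS θ)]
  [ChartedSpace (E₂ × E₂ × E₀ × LieDual E₀) (GP q ωS θ)]
  [IsManifold (modelG E₀ E₂) ∞ (GP q ωS θ)]
  (hN : IsSmoothQuotient (modelSigma E₀ E₁) (modelN E₀ E₂) (projNP q ωS θ))
  (hΓ : IsSmoothQuotient (modelPairs E₀ E₁) (modelG E₀ E₂) (projGP q ωS θ))
  (hq : IsPrincipalBundle E₀ G E₁ E₂ q) (hωS : IsSymplectic ωS)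
  {Ω : DiffForm (modelG E₀ E₂) (GP q ωS θ) 2 ℝ}
  (hΩ : DiffForm.pullback (modelPairs E₀ E₁) (projGP q ωS θ) Ω = omegaPairs q ωS θ)

variable (q ωS θ) in
/-- The parametrization of the graph of the product by triples. -/
def tripleGraph (t : sigmaTriples q ωS θ) : GP q ωS θ × GP q ωS θ × GP q ωS θ :=
  (projGP q ωS θ (triple₁₂ q ωS θ t), projGP q ωS θ (triple₂₃ q ωS θ t),
    projGP q ωS θ (triple₁₃ q ωS θ t))

variable (q ωS θ) in
/-- The derivative of the parametrization of the graph. -/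
def derivGraph (t : sigmaTriples q ωS θ) (v : E₁ × E₁ × E₁ × LieDual E₀) :
    (E₂ × E₂ × E₀ × LieDual E₀) × (E₂ × E₂ × E₀ × LieDual E₀) × (E₂ × E₂ × E₀ × LieDual E₀) :=
  (derivGP q ωS θ (triple₁₂ q ωS θ t) (v.1, v.2.1, v.2.2.2),
    derivGP q ωS θ (triple₂₃ q ωS θ t) v.2, derivGP q ωS θ (triple₁₃ q ωS θ t) (v.1, v.2.2))

include hq hωS in
theorem mem_mulGraph_iff {x : GP q ωS θ × GP q ωS θ × GP q ωS θ} :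
    x ∈ (gaugeGroupoid θ hq hωS).mulGraph ↔ ∃ t, tripleGraph q ωS θ t = x := by
  constructor
  · rintro ⟨h1, h2⟩
    obtain ⟨t, ha, hb⟩ := exists_triple_of_composable hq hωS h1
    refine ⟨t, Prod.ext ha (Prod.ext hb (Eq.trans ?_ h2))⟩
    change _ = gaugeMul q ωS θ _ _
    rw [← ha, ← hb, gaugeMul_triple hq]
    rfl
  · rintro ⟨t, rfl⟩
    exact ⟨rfl, gaugeMul_triple hq t⟩

include hΓ in
theorem contMDiff_tripleGraph : ContMDiff (modelTriples E₀ E₁)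
    ((modelG E₀ E₂).prod ((modelG E₀ E₂).prod (modelG E₀ E₂))) ∞ (tripleGraph q ωS θ) :=
  (hΓ.smooth.comp contMDiff_triple₁₂).prodMk
    ((hΓ.smooth.comp contMDiff_triple₂₃).prodMk (hΓ.smooth.comp contMDiff_triple₁₃))

include hΓ in
theorem mderiv_tripleGraph (t : sigmaTriples q ωS θ) (v : E₁ × E₁ × E₁ × LieDual E₀) :
    mderiv (modelTriples E₀ E₁) ((modelG E₀ E₂).prod ((modelG E₀ E₂).prod (modelG E₀ E₂)))
      (tripleGraph q ωS θ) t v = derivGraph q ωS θ t v := by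
  have hd : ∀ f : sigmaTriples q ωS θ → sigmaPairs q ωS θ,
      ContMDiff (modelTriples E₀ E₁) (modelPairs E₀ E₁) ∞ f →
      MDifferentiableAt (modelTriples E₀ E₁) (modelG E₀ E₂) (fun t => projGP q ωS θ (f t)) t :=
    fun f hf => ((hΓ.smooth.comp hf) t).mdifferentiableAt (by simp)
  have hc : ∀ f : sigmaTriples q ωS θ → sigmaPairs q ωS θ,
      ContMDiff (modelTriples E₀ E₁) (modelPairs E₀ E₁) ∞ f →
      mderiv (modelTriples E₀ E₁) (modelG E₀ E₂) (fun t => projGP q ωS θ (f t)) t v =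
        derivGP q ωS θ (f t) (mderiv (modelTriples E₀ E₁) (modelPairs E₀ E₁) f t v) :=
    fun f hf => DFunLike.congr_fun (mderiv_comp t (hΓ.mdifferentiableAt (f t))
      ((hf t).mdifferentiableAt (by simp))) v
  have h2 := mderiv_prodMk (hd _ contMDiff_triple₂₃) (hd _ contMDiff_triple₁₃)
  have h1 := mderiv_prodMk (hd _ contMDiff_triple₁₂)
    ((hd _ contMDiff_triple₂₃).prodMk (hd _ contMDiff_triple₁₃))
  refine (DFunLike.congr_fun h1 v).trans (Prod.ext ?_ ((DFunLike.congr_fun h2 v).trans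
    (Prod.ext ?_ ?_)))
  · refine (hc _ contMDiff_triple₁₂).trans ?_
    rw [mderiv_triple₁₂]
    rfl
  · refine (hc _ contMDiff_triple₂₃).trans ?_
    rw [mderiv_triple₂₃]
    rfl
  · refine (hc _ contMDiff_triple₁₃).trans ?_
    rw [mderiv_triple₁₃]
    rfl

include hΓ in
theorem exists_curve_in_mulGraph (t : sigmaTriples q ωS θ) (v : E₁ × E₁ × E₁ × LieDual E₀) :
    ∃ γ : ℝ → GP q ωS θ × GP q ωS θ × GP q ωS θ,
      ContMDiff 𝓘(ℝ, ℝ) ((modelG E₀ E₂).prod ((modelG E₀ E₂).prod (modelG E₀ E₂))) ∞ γ ∧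
      (∀ s, γ s ∈ (gaugeGroupoid θ hq hωS).mulGraph) ∧ γ 0 = tripleGraph q ωS θ t ∧
      mderiv 𝓘(ℝ, ℝ) ((modelG E₀ E₂).prod ((modelG E₀ E₂).prod (modelG E₀ E₂))) γ 0 1 =
        derivGraph q ωS θ t v := by
  obtain ⟨c, hc, hc0, hcv⟩ := exists_curve (I := modelTriples E₀ E₁) t v
  refine ⟨fun s => tripleGraph q ωS θ (c s), (contMDiff_tripleGraph hΓ).comp hc,
    fun s => (mem_mulGraph_iff hq hωS).2 ⟨_, rfl⟩, congrArg _ hc0, ?_⟩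
  have h := mderiv_comp_of_eq (((contMDiff_tripleGraph hΓ) t).mdifferentiableAt (by simp))
    ((hc 0).mdifferentiableAt (by simp)) hc0
  refine (DFunLike.congr_fun h (1 : ℝ)).trans ?_
  rw [ContinuousLinearMap.comp_apply, hcv, mderiv_tripleGraph hΓ]

include hN hΓ hq hωS

/-- Tangent vectors of the graph are defined by curves, which need not come with smooth lifts to
triples. A velocity in the graph is instead determined by its first two components through the
derivative of the product, and these satisfy ds = dt, which suffices to lift them to a tangent
vector of the triple fibre product. -/
theorem mem_tangentVectors_mulGraph_iff (t : sigmaTriples q ωS θ)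
    (V : (E₂ × E₂ × E₀ × LieDual E₀) × (E₂ × E₂ × E₀ × LieDual E₀) ×
      (E₂ × E₂ × E₀ × LieDual E₀)) :
    V ∈ tangentVectors ((modelG E₀ E₂).prod ((modelG E₀ E₂).prod (modelG E₀ E₂)))
      (gaugeGroupoid θ hq hωS).mulGraph (tripleGraph q ωS θ t) ↔
      ∃ v, derivGraph q ωS θ t v = V := by
  constructor
  swap
  · rintro ⟨v, rfl⟩
    obtain ⟨γ, hγ, hm, h0, hv⟩ := exists_curve_in_mulGraph hΓ hq hωS t v
    exact ⟨γ, hγ, hm, velocity_eq_iff.2 ⟨h0, hv⟩⟩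
  rintro ⟨γ, hγ, hm, hvel⟩
  obtain ⟨h0, hV⟩ := velocity_eq_iff.1 hvel
  obtain ⟨u, hu⟩ := hΓ.surjective_mderiv (triple₁₂ q ωS θ t) V.1
  obtain ⟨u', hu'⟩ := hΓ.surjective_mderiv (triple₂₃ q ωS θ t) V.2.1
  let dG := (modelG E₀ E₂).prod ((modelG E₀ E₂).prod (modelG E₀ E₂))
  -- the derivative of the pair of factors of a curve in the graph
  have key : ∀ (c : ℝ → GP q ωS θ × GP q ωS θ × GP q ωS θ), ContMDiff 𝓘(ℝ, ℝ) dG ∞ c →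
      (∀ s, c s ∈ (gaugeGroupoid θ hq hωS).mulGraph) → c 0 = tripleGraph q ωS θ t →
      mderiv (modelG E₀ E₂) (modelN E₀ E₂) (gaugeSrc q ωS θ) (tripleGraph q ωS θ t).1
          (mderiv 𝓘(ℝ, ℝ) dG c 0 1).1 =
        mderiv (modelG E₀ E₂) (modelN E₀ E₂) (gaugeTgt q ωS θ) (tripleGraph q ωS θ t).2.1
          (mderiv 𝓘(ℝ, ℝ) dG c 0 1).2.1 ∧
      (mderiv 𝓘(ℝ, ℝ) dG c 0 1).2.2 =
        mderivWithin ((modelG E₀ E₂).prod (modelG E₀ E₂)) (modelG E₀ E₂)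
          (fun z : GP q ωS θ × GP q ωS θ => gaugeMul q ωS θ z.1 z.2)
          {z | gaugeSrc q ωS θ z.1 = gaugeTgt q ωS θ z.2}
          ((tripleGraph q ωS θ t).1, (tripleGraph q ωS θ t).2.1)
          ((mderiv 𝓘(ℝ, ℝ) dG c 0 1).1, (mderiv 𝓘(ℝ, ℝ) dG c 0 1).2.1) := by
    intro c hc hcm hc0
    have hd : MDifferentiableAt 𝓘(ℝ, ℝ) dG c 0 := (hc 0).mdifferentiableAt (by simp)
    have hd₁ : MDifferentiableAt 𝓘(ℝ, ℝ) (modelG E₀ E₂) (fun s => (c s).1) 0 := hd.fst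
    have hd₂ : MDifferentiableAt 𝓘(ℝ, ℝ) (modelG E₀ E₂) (fun s => (c s).2.1) 0 := hd.snd.fst
    have hd₃ : MDifferentiableAt 𝓘(ℝ, ℝ) (modelG E₀ E₂) (fun s => (c s).2.2) 0 := hd.snd.snd
    have e := mderiv_prodMk hd₁ (hd₂.prodMk hd₃)
    have e' := mderiv_prodMk hd₂ hd₃
    have e₁ : (mderiv 𝓘(ℝ, ℝ) dG c 0 1).1 = mderiv 𝓘(ℝ, ℝ) (modelG E₀ E₂) (fun s => (c s).1) 0 1 :=
      congrArg Prod.fst (DFunLike.congr_fun e (1 : ℝ))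
    have e₂ : (mderiv 𝓘(ℝ, ℝ) dG c 0 1).2.1 =
        mderiv 𝓘(ℝ, ℝ) (modelG E₀ E₂) (fun s => (c s).2.1) 0 1 :=
      (congrArg (fun u : _ × (E₂ × E₂ × E₀ × LieDual E₀) × _ => u.2.1)
        (DFunLike.congr_fun e (1 : ℝ)) :).trans
        (congrArg Prod.fst (DFunLike.congr_fun e' (1 : ℝ)))
    have e₃ : (mderiv 𝓘(ℝ, ℝ) dG c 0 1).2.2 =
        mderiv 𝓘(ℝ, ℝ) (modelG E₀ E₂) (fun s => (c s).2.2) 0 1 :=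
      (congrArg (fun u : _ × _ × (E₂ × E₂ × E₀ × LieDual E₀) => u.2.2)
        (DFunLike.congr_fun e (1 : ℝ)) :).trans
        (congrArg Prod.snd (DFunLike.congr_fun e' (1 : ℝ)))
    rw [e₁, e₂, e₃]
    constructor
    · have f₁ := mderiv_comp_of_eq ((contMDiff_gaugeSrc hN hΓ _).mdifferentiableAt (by simp)) hd₁
        (congrArg Prod.fst hc0)
      have f₂ := mderiv_comp_of_eq ((contMDiff_gaugeTgt hN hΓ _).mdifferentiableAt (by simp)) hd₂
        (congrArg (fun u => u.2.1) hc0)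
      have f₃ : (fun s => gaugeSrc q ωS θ (c s).1) = fun s => gaugeTgt q ωS θ (c s).2.1 :=
        funext fun s => (hcm s).1
      rw [f₃] at f₁
      exact DFunLike.congr_fun (f₁.symm.trans f₂) (1 : ℝ)
    · have hc0' : ((c 0).1, (c 0).2.1) =
          ((tripleGraph q ωS θ t).1, (tripleGraph q ωS θ t).2.1) := by rw [hc0]
      have f₁ := mderiv_comp_within (I' := (modelG E₀ E₂).prod (modelG E₀ E₂))
        (f := fun s => ((c s).1, (c s).2.1)) (x := (0 : ℝ))
        ((contMDiffOn_gaugeMul hΓ hq hωS _ (hcm 0).1).mdifferentiableWithinAt (by simp))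
        (hd₁.prodMk hd₂) (fun s => (hcm s).1) (1 : ℝ)
      have f₂ : (fun s => gaugeMul q ωS θ (c s).1 (c s).2.1) = fun s => (c s).2.2 :=
        funext fun s => (hcm s).2
      have f₃ := DFunLike.congr_fun (mderiv_prodMk hd₁ hd₂) (1 : ℝ)
      refine (congrArg (fun f => mderiv 𝓘(ℝ, ℝ) (modelG E₀ E₂) f 0 1) f₂).symm.trans (f₁.trans ?_)
      rw [f₃, hc0']
      rfl
  obtain ⟨k₁, k₂⟩ := key γ hγ hm h0
  have k₁' : derivNP q ωS θ (pairSrc q ωS θ (triple₁₂ q ωS θ t)) (u.2 - (u'.1, u'.2.2)) = 0 := by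
    rw [hV, ← hu, ← hu'] at k₁
    rw [map_sub, sub_eq_zero]
    exact (mderiv_gaugeSrc hN hΓ _ u).symm.trans (k₁.trans (mderiv_gaugeTgt hN hΓ _ u'))
  obtain ⟨X, hX⟩ := (mderiv_projNP_eq_zero_iff hq hωS hN _ _).1 k₁'
  rw [gen_apply hq] at hX
  have hX₁ : genP E₀ G E₁ t.1.2.1 X = u.2.1 - u'.1 := congrArg Prod.fst hX
  have hX₂ : genDual E₀ G t.1.2.2.2 X = u.2.2 - u'.2.2 := congrArg Prod.snd hX
  -- The lifts u and u' need not agree at the middle point; by ds = dt they differ there by the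
  -- generator of X. Moving u' along the orbit direction of X makes them agree without changing its
  -- class.
  let v : E₁ × E₁ × E₁ × LieDual E₀ := (u.1, u.2.1, u'.2.1 + genP E₀ G E₁ t.1.2.2.1 X, u.2.2)
  have hv₂ : derivGP q ωS θ (triple₂₃ q ωS θ t) v.2 = V.2.1 := by
    have e : v.2 = u' + (genP E₀ G E₁ t.1.2.1 X, genP E₀ G E₁ t.1.2.2.1 X,
        genDual E₀ G t.1.2.2.2 X) := by
      rw [hX₁, hX₂]
      refine Prod.ext ?_ (Prod.ext rfl ?_)
      · exact (add_sub_cancel _ _).symm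
      · exact (add_sub_cancel _ _).symm
    rw [e, map_add, hu']
    exact (congrArg (fun u => V.2.1 + u)
      (derivGP_gen hΓ hq hωS (triple₂₃ q ωS θ t) X)).trans (add_zero _)
  refine ⟨v, ?_⟩
  -- The new curve has the same first two velocities as γ, so `key` forces the third ones to
  -- coincide.
  obtain ⟨c, hc, hcm, hc0, hcv⟩ := exists_curve_in_mulGraph hΓ hq hωS t v
  have k₃ := (key c hc hcm hc0).2
  rw [hcv] at k₃
  rw [hV] at k₂
  have hv₁ : (derivGraph q ωS θ t v).1 = V.1 := hu
  have hv₂' : (derivGraph q ωS θ t v).2.1 = V.2.1 := hv₂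
  rw [hv₁, hv₂'] at k₃
  exact Prod.ext hv₁ (Prod.ext hv₂' (k₃.trans k₂.symm))

include hΩ in
-- Each value of Ω is a difference of two values of ω. Regrouped by the points p₁, p₂, p₃, the sum
-- tests one point at a time, and each term measures the failure of a, b, c to come from one tangent
-- vector of triples.
theorem tripleForm_derivGraph (t : sigmaTriples q ωS θ) (a b c : E₁ × E₁ × LieDual E₀)
    (w : E₁ × E₁ × E₁ × LieDual E₀) :
    (tripleForm Ω).bilin (tripleGraph q ωS θ t) (derivGP q ωS θ (triple₁₂ q ωS θ t) a,
      derivGP q ωS θ (triple₂₃ q ωS θ t) b, derivGP q ωS θ (triple₁₃ q ωS θ t) c)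
      (derivGraph q ωS θ t w) =
    (omega q ωS θ).bilin (t.1.1, t.1.2.2.2) ((c.1, c.2.2) - (a.1, a.2.2)) (w.1, w.2.2.2)
      + (omega q ωS θ).bilin (t.1.2.1, t.1.2.2.2) (a.2 - (b.1, b.2.2)) (w.2.1, w.2.2.2)
      + (omega q ωS θ).bilin (t.1.2.2.1, t.1.2.2.2) (b.2 - c.2) w.2.2 := by
  rw [tripleForm_bilin]
  have h₁ := bilin_derivGP hΩ (triple₁₂ q ωS θ t) a (w.1, w.2.1, w.2.2.2)
  have h₂ := bilin_derivGP hΩ (triple₂₃ q ωS θ t) b w.2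
  have h₃ := bilin_derivGP hΩ (triple₁₃ q ωS θ t) c (w.1, w.2.2)
  simp only [map_sub, sub_apply]
  refine (congrArg₂ (fun x y : ℝ => x - y) (congrArg₂ (fun x y : ℝ => x + y) h₁ h₂) h₃).trans ?_
  simp only [triple₁₂, triple₂₃, triple₁₃]
  ring

include hΩ in
theorem isLagrangian_mulGraph :
    IsLagrangian (tripleForm Ω) (gaugeGroupoid θ hq hωS).mulGraph := by
  intro x hx V
  obtain ⟨t, rfl⟩ := (mem_mulGraph_iff hq hωS).1 hx
  refine (mem_tangentVectors_mulGraph_iff hN hΓ hq hωS t V).trans ?_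
  constructor
  · rintro ⟨v, rfl⟩ W hW
    obtain ⟨w, rfl⟩ := (mem_tangentVectors_mulGraph_iff hN hΓ hq hωS t W).1 hW
    refine (DiffForm.bilin_apply _ _ _ _).symm.trans
      ((tripleForm_derivGraph hN hΓ hq hωS hΩ t _ _ _ w).trans ?_)
    simp
  · intro h
    obtain ⟨a, ha⟩ := hΓ.surjective_mderiv (triple₁₂ q ωS θ t) V.1
    obtain ⟨b, hb⟩ := hΓ.surjective_mderiv (triple₂₃ q ωS θ t) V.2.1
    obtain ⟨c, hc⟩ := hΓ.surjective_mderiv (triple₁₃ q ωS θ t) V.2.2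
    have hV : V = (derivGP q ωS θ (triple₁₂ q ωS θ t) a,
        derivGP q ωS θ (triple₂₃ q ωS θ t) b, derivGP q ωS θ (triple₁₃ q ωS θ t) c) :=
      Prod.ext ha.symm (Prod.ext hb.symm hc.symm)
    have h' : ∀ w : E₁ × E₁ × E₁ × LieDual E₀,
        (omega q ωS θ).bilin (t.1.1, t.1.2.2.2) ((c.1, c.2.2) - (a.1, a.2.2)) (w.1, w.2.2.2)
        + (omega q ωS θ).bilin (t.1.2.1, t.1.2.2.2) (a.2 - (b.1, b.2.2)) (w.2.1, w.2.2.2)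
        + (omega q ωS θ).bilin (t.1.2.2.1, t.1.2.2.2) (b.2 - c.2) w.2.2 = 0 := by
      intro w
      rw [← tripleForm_derivGraph hN hΓ hq hωS hΩ t, ← hV]
      exact (DiffForm.bilin_apply _ _ _ _).trans
        (h _ ((mem_tangentVectors_mulGraph_iff hN hΓ hq hωS t _).2 ⟨w, rfl⟩))
    have h00 : ((0 : E₁), (0 : LieDual E₀)) = 0 := rfl
    obtain ⟨X₁, hX₁⟩ := exists_gen_eq hq hωS ⟨(t.1.1, t.1.2.2.2), t.2.1⟩
      (u := (c.1, c.2.2) - (a.1, a.2.2)) fun w => by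
        have h1 := h' (w, 0)
        simp only [Prod.fst_zero, Prod.snd_zero, h00, map_zero, add_zero] at h1
        exact h1
    obtain ⟨X₂, hX₂⟩ := exists_gen_eq hq hωS ⟨(t.1.2.1, t.1.2.2.2), t.2.2.1⟩
      (u := a.2 - (b.1, b.2.2)) fun w => by
        have h1 := h' (0, w, 0)
        simp only [Prod.snd_zero, h00, map_zero, add_zero, zero_add] at h1
        exact h1
    obtain ⟨X₃, hX₃⟩ := exists_gen_eq hq hωS ⟨(t.1.2.2.1, t.1.2.2.2), t.2.2.2⟩
      (u := b.2 - c.2) fun w => by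
        have h1 := h' (0, 0, w, 0)
        simp only [h00, map_zero, zero_add] at h1
        exact h1
    -- At each of the three points the mismatch of the lifts is a generator; variations of ξ alone,
    -- which move all three points at once, relate the three generators.
    have hX : X₁ + X₂ + X₃ = 0 := by
      by_contra hne
      obtain ⟨ζ, -, hζ⟩ := exists_dual_vector ℝ (X₁ + X₂ + X₃) (norm_ne_zero_iff.2 hne)
      have h1 := h' (0, 0, 0, ζ)
      rw [← hX₁, ← hX₂, ← hX₃, omega_gen θ hq, omega_gen θ hq, omega_gen θ hq] at h1
      have h2 : ζ (X₁ + X₂ + X₃) = 0 := by rw [map_add, map_add]; exact h1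
      have h3 : ζ (X₁ + X₂ + X₃) = ‖X₁ + X₂ + X₃‖ := hζ
      rw [h2] at h3
      exact hne (norm_eq_zero.1 h3.symm)
    have hX' : X₂ = -X₁ - X₃ := by
      rw [eq_comm, sub_eq_iff_eq_add, neg_eq_iff_add_eq_zero]
      rw [← hX]
      abel
    rw [gen_apply hq] at hX₁ hX₂ hX₃
    have p₁ : genP E₀ G E₁ t.1.1 X₁ = c.1 - a.1 := congrArg Prod.fst hX₁
    have d₁ : genDual E₀ G t.1.2.2.2 X₁ = c.2.2 - a.2.2 := congrArg Prod.snd hX₁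
    have p₂ : genP E₀ G E₁ t.1.2.1 X₂ = a.2.1 - b.1 := congrArg Prod.fst hX₂
    have d₂ : genDual E₀ G t.1.2.2.2 X₂ = a.2.2 - b.2.2 := congrArg Prod.snd hX₂
    have p₃ : genP E₀ G E₁ t.1.2.2.1 X₃ = b.2.1 - c.2.1 := congrArg Prod.fst hX₃
    -- The lift a is kept and b is moved by the generator of X₂, so that the two agree at the middle
    -- point. Since X₂ = -X₁ - X₃, the resulting outer pair is c moved by the generator of -X₁, and
    -- so has the class of c.
    refine ⟨(a.1, a.2.1, b.2.1 + genP E₀ G E₁ t.1.2.2.1 X₂, a.2.2), ?_⟩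
    rw [hV]
    refine Prod.ext rfl (Prod.ext ?_ ?_)
    · have e : (a.2.1, b.2.1 + genP E₀ G E₁ t.1.2.2.1 X₂, a.2.2) = b +
          (genP E₀ G E₁ t.1.2.1 X₂, genP E₀ G E₁ t.1.2.2.1 X₂, genDual E₀ G t.1.2.2.2 X₂) := by
        rw [p₂, d₂]
        refine Prod.ext ?_ (Prod.ext rfl ?_)
        · exact (add_sub_cancel _ _).symm
        · exact (add_sub_cancel _ _).symm
      change derivGP q ωS θ (triple₂₃ q ωS θ t)
        (a.2.1, b.2.1 + genP E₀ G E₁ t.1.2.2.1 X₂, a.2.2) = _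
      rw [e, map_add]
      exact (congrArg (fun u => derivGP q ωS θ (triple₂₃ q ωS θ t) b + u)
        (derivGP_gen hΓ hq hωS (triple₂₃ q ωS θ t) X₂)).trans (add_zero _)
    · have e : (a.1, b.2.1 + genP E₀ G E₁ t.1.2.2.1 X₂, a.2.2) = c -
          (genP E₀ G E₁ t.1.1 X₁, genP E₀ G E₁ t.1.2.2.1 X₁, genDual E₀ G t.1.2.2.2 X₁) := by
        rw [hX', map_sub, map_neg, p₃, p₁, d₁]
        refine Prod.ext ?_ (Prod.ext ?_ ?_)
        · exact (sub_sub_cancel _ _).symm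
        · change _ = c.2.1 - genP E₀ G E₁ t.1.2.2.1 X₁
          simp only
          abel
        · exact (sub_sub_cancel _ _).symm
      change derivGP q ωS θ (triple₁₃ q ωS θ t)
        (a.1, b.2.1 + genP E₀ G E₁ t.1.2.2.1 X₂, a.2.2) = _
      rw [e, map_sub]
      exact (congrArg (fun u => derivGP q ωS θ (triple₁₃ q ωS θ t) c - u)
        (derivGP_gen hΓ hq hωS (triple₁₃ q ωS θ t) X₁)).trans (sub_zero _)

end Model

/-! ### The Lie algebroid of a symplectic groupoid with anti-Poisson target -/

section Forms

variable {E H : Type*} [NormedAddCommGroup E] [NormedSpace ℝ E] [TopologicalSpace H]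
  {I : ModelWithCorners ℝ E H} {M : Type*} [TopologicalSpace M] [ChartedSpace H M]
  {F : Type*} [NormedAddCommGroup F] [NormedSpace ℝ F] {k : ℕ}

theorem DiffForm.isSmooth_zero : (0 : DiffForm I M k F).IsSmooth := by
  intro x₀
  have h : (0 : DiffForm I M k F).inChart x₀ = fun _ => 0 := by
    funext y
    ext v
    rfl
  rw [h]
  exact contDiffOn_const

theorem DiffForm.IsSmooth.neg {η : DiffForm I M k F} (hη : η.IsSmooth) : (-η).IsSmooth := by
  rw [← zero_sub]
  exact DiffForm.isSmooth_zero.sub hη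

theorem DiffForm.d_neg [IsManifold I ∞ M] [I.Boundaryless] {η : DiffForm I M k F}
    (hη : η.IsSmooth) (x : M) : (-η).d x = -η.d x := by
  rw [← zero_sub, DiffForm.d_sub (DiffForm.isSmooth_iff.1 DiffForm.isSmooth_zero x)
    (DiffForm.isSmooth_iff.1 hη x), DiffForm.d_zero, zero_sub]

end Forms

section PullbackBracket

variable {E H : Type*} [NormedAddCommGroup E] [NormedSpace ℝ E] [TopologicalSpace H]
  {I : ModelWithCorners ℝ E H} {Γ : Type*} [TopologicalSpace Γ] [ChartedSpace H Γ]
  [IsManifold I ∞ Γ] [I.Boundaryless] [FiniteDimensional ℝ E]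
  {E' H' : Type*} [NormedAddCommGroup E'] [NormedSpace ℝ E'] [TopologicalSpace H']
  {I' : ModelWithCorners ℝ E' H'} {M : Type*} [TopologicalSpace M] [ChartedSpace H' M]
  [IsManifold I' ∞ M] [I'.Boundaryless]

variable (I) in
/-- The covector field `-t^* α`. -/
def negPullback (t : Γ → M) (α : CovectorField I' M) : CovectorField I Γ := fun a =>
  let c : E' →L[ℝ] ℝ := α (t a)
  let b : E →L[ℝ] ℝ := -(c ∘L mderiv I I' t a)
  b

theorem negPullback_toForm (t : Γ → M) (α : CovectorField I' M) :
    (negPullback I t α).toForm = -DiffForm.pullback I t α.toForm := by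
  funext a
  ext v
  rfl

theorem negPullback_isSmooth {t : Γ → M} (ht : ContMDiff I I' ∞ t) {α : CovectorField I' M}
    (hα : α.toForm.IsSmooth) : (negPullback I t α).toForm.IsSmooth := by
  rw [negPullback_toForm]
  exact (hα.pullback ht).neg

theorem d_negPullback {t : Γ → M} (ht : ContMDiff I I' ∞ t) {α : CovectorField I' M}
    (hα : α.toForm.IsSmooth) (a : Γ) (v w : E) :
    (negPullback I t α).toForm.d a ![v, w] =
      -α.toForm.d (t a) ![mderiv I I' t a v, mderiv I I' t a w] := by
  rw [negPullback_toForm, DiffForm.d_neg (hα.pullback ht),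
    DiffForm.d_pullback (DiffForm.isSmooth_iff.1 hα _) (ht a)]
  refine congrArg (fun r : ℝ => -r) ((DiffForm.pullback_apply t _ a _).trans ?_)
  refine congrArg (fun u : Fin 2 → E' => α.toForm.d (t a) u) (funext fun i => ?_)
  fin_cases i <;> rfl

/-- For fields that contract to -t^*α and -t^*β, every term of `bilin_mlieBracket` is a pullback by
t. The auxiliary function f expresses that α(dt(Y)) comes from the base, so that its differential is
also a pullback. -/
theorem bilin_mlieBracket_pullback {η : DiffForm I Γ 2 ℝ} (hη : η.IsSmooth) {a : Γ}
    (hd : η.d a = 0) {t : Γ → M} (ht : ContMDiff I I' ∞ t) {X Y : ∀ x : Γ, TangentSpace I x}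
    (hX : ContMDiff I I.tangent ∞ (fun x => (⟨x, X x⟩ : TangentBundle I Γ)))
    (hY : ContMDiff I I.tangent ∞ (fun x => (⟨x, Y x⟩ : TangentBundle I Γ)))
    {α β : CovectorField I' M} (hα : α.toForm.IsSmooth) (hβ : β.toForm.IsSmooth)
    (hαX : ∀ x (w : E), η.bilin x (X x) w = negPullback I t α x w)
    (hβY : ∀ x (w : E), η.bilin x (Y x) w = negPullback I t β x w)
    {f : M → ℝ} (hf : MDifferentiableAt I' 𝓘(ℝ, ℝ) f (t a))
    (hfY : ∀ x, f (t x) = α (t x) (mderiv I I' t x (Y x))) (w : E) :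
    η.bilin a (VectorField.mlieBracket I X Y a) w =
      -(β.toForm.d (t a) ![mderiv I I' t a (X a), mderiv I I' t a w]
        - α.toForm.d (t a) ![mderiv I I' t a (Y a), mderiv I I' t a w]
        - mvfderiv I' f (t a) (mderiv I I' t a w)) := by
  rw [bilin_mlieBracket hη hd hX hY (negPullback_isSmooth ht hα) hαX hβY w]
  have h1 : (fun x => negPullback I t α x (Y x)) = fun x => -f (t x) :=
    funext fun x => by
      rw [hfY]
      rfl
  have hft : MDifferentiableAt I 𝓘(ℝ, ℝ) (fun x => f (t x)) a :=
    hf.comp a ((ht a).mdifferentiableAt (by simp))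
  have h2 : mvfderiv I (fun x => negPullback I t α x (Y x)) a w =
      -mvfderiv I' f (t a) (mderiv I I' t a w) := by
    rw [h1, ← mvfderiv_comp_mderiv hf ((ht a).mdifferentiableAt (by simp))]
    exact DFunLike.congr_fun (hft.hasMFDerivAt.neg).mfderiv w
  have h3 := d_negPullback ht hβ a (X a) w
  have h4 := d_negPullback ht hα a (Y a) w
  refine (congrArg₂ (fun x y : ℝ => x - y) (congrArg₂ (fun x y : ℝ => x - y) h3 h4) h2).trans ?_
  ring

end PullbackBracket

section Cotangent

variable {E H : Type*} [NormedAddCommGroup E] [NormedSpace ℝ E] [TopologicalSpace H]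
  {I : ModelWithCorners ℝ E H} {M : Type*} [TopologicalSpace M] [ChartedSpace H M]

/-- Cartan's formula for the first Lie derivative produces d(β(π^♯α)), which cancels the last term
of the bracket. What remains has the shape of the formula for Ω([X, Y], ·). -/
theorem cotangentBracket_apply (π : PoissonStructure I M) (α β : CovectorField I M) (x : M)
    (u : E) : π.cotangentBracket α β x u =
      β.toForm.d x ![π.sharp x (α x), u] - α.toForm.d x ![π.sharp x (β x), u]
        - mvfderiv I (fun y => α y (π.sharp y (β y))) x u := by
  have h : ∀ (X : ∀ x : M, TangentSpace I x) (γ : CovectorField I M),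
      lieDerivative X γ x u = γ.toForm.d x ![X x, u] + mvfderiv I (fun y => γ y (X y)) x u := by
    intro X γ
    refine congrArg (fun r : ℝ => r + mvfderiv I (fun y => γ y (X y)) x u) ?_
    refine congrArg (fun m : Fin 2 → E => γ.toForm.d x m) (funext fun i => ?_)
    fin_cases i <;> rfl
  have h1 := h (fun y => π.sharp y (α y)) β
  have h2 := h (fun y => π.sharp y (β y)) α
  refine (congrArg₂ (fun x y : ℝ => x - y) (congrArg₂ (fun x y : ℝ => x - y) h1 h2)
    (Eq.refl (mvfderiv I (fun y => β y (π.sharp y (α y))) x u))).trans ?_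
  ring

end Cotangent

section Algebroid

variable {E H : Type*} [NormedAddCommGroup E] [NormedSpace ℝ E] [TopologicalSpace H]
  {I : ModelWithCorners ℝ E H} {Γ : Type*} [TopologicalSpace Γ] [ChartedSpace H Γ]
  [IsManifold I ∞ Γ] [I.Boundaryless] [FiniteDimensional ℝ E]
  {E' H' : Type*} [NormedAddCommGroup E'] [NormedSpace ℝ E'] [TopologicalSpace H']
  {I' : ModelWithCorners ℝ E' H'} {M : Type*} [TopologicalSpace M] [ChartedSpace H' M]
  [IsManifold I' ∞ M] [I'.Boundaryless]

/-- The inverse of a nondegenerate `2`-form. -/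
def contractionSharp (η : DiffForm I Γ 2 ℝ) (hη : ∀ x, η.NondegenerateAt x) (x : Γ) :
    (E →L[ℝ] ℝ) →L[ℝ] E :=
  reducedSharp η hη (ContinuousLinearMap.id ℝ E) x

theorem bilin_contractionSharp {η : DiffForm I Γ 2 ℝ} (hη : ∀ x, η.NondegenerateAt x) (x : Γ)
    (a : E →L[ℝ] ℝ) (w : E) : η.bilin x (contractionSharp η hη x a) w = a w := by
  obtain ⟨v, hv⟩ := exists_contraction_eq (hη x) a
  have h : contractionSharp η hη x a = v :=
    reducedSharp_apply hη (D := ContinuousLinearMap.id ℝ E) hv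
  rw [h, hv]

theorem eq_of_bilin_eq {η : DiffForm I Γ 2 ℝ} {x : Γ} (hη : η.NondegenerateAt x) {v v' : E}
    (h : ∀ w, η.bilin x v w = η.bilin x v' w) : v = v' :=
  DiffForm.nondegenerateAt_iff.1 hη (ContinuousLinearMap.ext h)

/-- The map `T_x^*M → T_{u(x)}Γ` that sends `a` to the vector `v` with `Ω(v, ·) = -a ∘ dt`. -/
def algebroidMap (𝒢 : GroupoidOver Γ M) (Ω : DiffForm I Γ 2 ℝ) (hΩ : ∀ x, Ω.NondegenerateAt x)
    (D : E →L[ℝ] E') (x : M) : (E' →L[ℝ] ℝ) →ₗ[ℝ] E where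
  toFun a := contractionSharp Ω hΩ (𝒢.unit x) (-(a ∘L D))
  map_add' a b := by rw [ContinuousLinearMap.add_comp, neg_add, map_add]
  map_smul' c a := by rw [ContinuousLinearMap.smul_comp, RingHom.id_apply, ← map_smul, smul_neg]

variable (I') in
/-- The map `T^*M → A` for a symplectic groupoid. -/
def cotangentAlgebroidMap (𝒢 : GroupoidOver Γ M) (Ω : DiffForm I Γ 2 ℝ)
    (hΩ : ∀ x, Ω.NondegenerateAt x) :
    ∀ x : M, (TangentSpace I' x →L[ℝ] ℝ) →ₗ[ℝ] TangentSpace I (𝒢.unit x) := fun x =>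
  let Φ : (E' →L[ℝ] ℝ) →ₗ[ℝ] E := algebroidMap 𝒢 Ω hΩ (mderiv I I' 𝒢.tgt (𝒢.unit x)) x
  Φ

variable (𝒢 : GroupoidOver Γ M) {Ω : DiffForm I Γ 2 ℝ}

theorem bilin_cotangentAlgebroidMap (hΩ : ∀ x, Ω.NondegenerateAt x) (x : M) (a : E' →L[ℝ] ℝ)
    (w : E) : Ω.bilin (𝒢.unit x) (cotangentAlgebroidMap I' 𝒢 Ω hΩ x a) w =
      -(a (mderiv I I' 𝒢.tgt (𝒢.unit x) w)) :=
  bilin_contractionSharp hΩ _ _ w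

theorem PoissonStructure.sharp_congr (π : PoissonStructure I' M) {x y : M} (h : x = y)
    (a : E' →L[ℝ] ℝ) : (π.sharp x a : E') = π.sharp y a := by
  subst h
  rfl

theorem tangentBundle_ext {x y : M} {v w : E'} (h : x = y) (hv : v = w) :
    (⟨x, v⟩ : TangentBundle I' M) = ⟨y, w⟩ := by
  subst h hv
  rfl

variable {𝒢}

/-- The cotangent algebroid of the base of a symplectic groupoid. -/
theorem isCotangentAlgebroidIso_algebroidMap (hΩ : IsSymplectic Ω) (h𝒢 : 𝒢.IsLieGroupoid I I')
    {π : PoissonStructure I' M} (hπ : IsAntiPoissonMap Ω π 𝒢.tgt)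
    (hker : ∀ x (v : E), mderiv I I' 𝒢.src (𝒢.unit x) v = 0 →
      ∃ a : E' →L[ℝ] ℝ, ∀ w, Ω.bilin (𝒢.unit x) v w = -(a (mderiv I I' 𝒢.tgt (𝒢.unit x) w)))
    (hsrc : ∀ x (v : E) (a : E' →L[ℝ] ℝ),
      (∀ w, Ω.bilin (𝒢.unit x) v w = -(a (mderiv I I' 𝒢.tgt (𝒢.unit x) w))) →
        mderiv I I' 𝒢.src (𝒢.unit x) v = 0)
    (hinv : ∀ (α : CovectorField I' M) (g : Γ) (w : E),
      Ω.bilin g (𝒢.rightInvariantExt I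
        (fun x => cotangentAlgebroidMap I' 𝒢 Ω hΩ.nondegenerate x (α x)) g) w =
          negPullback I 𝒢.tgt α g w) :
    IsCotangentAlgebroidIso 𝒢 π (cotangentAlgebroidMap I' 𝒢 Ω hΩ.nondegenerate) := by
  have ht := h𝒢.tgt_submersion.smooth
  have hnd := hΩ.nondegenerate
  have hbil := bilin_cotangentAlgebroidMap (I' := I') 𝒢 hnd
  set Φ := cotangentAlgebroidMap I' 𝒢 Ω hΩ.nondegenerate
  let R : CovectorField I' M → ∀ g : Γ, TangentSpace I g := fun α =>
    𝒢.rightInvariantExt I (fun x => Φ x (α x))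
  have hR : ∀ α g (w : E), Ω.bilin g (R α g) w = negPullback I 𝒢.tgt α g w := hinv
  have hRs : ∀ α : CovectorField I' M, α.toForm.IsSmooth →
      ContMDiff I I.tangent ∞ (fun g => (⟨g, R α g⟩ : TangentBundle I Γ)) := fun α hα =>
    contMDiff_vectorField_of_contraction hΩ.smooth hnd (negPullback_isSmooth ht hα) (hR α)
  -- The sign in Ω(R α, ·) = -t^*α is chosen so that it cancels the sign of the anti-Poisson map t.
  have hRt : ∀ α g, mderiv I I' 𝒢.tgt g (R α g) = π.sharp (𝒢.tgt g) (α (𝒢.tgt g)) := by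
    intro α g
    let b : E' →L[ℝ] ℝ := α (𝒢.tgt g)
    have h1 := hπ g (R α g) (-b) fun w =>
      (DiffForm.bilin_apply (E := E) (I := I) _ _ _ _).symm.trans (hR α g w)
    refine h1.trans ?_
    have h2 : (π.sharp (𝒢.tgt g) (-b) : E') = -π.sharp (𝒢.tgt g) b :=
      map_neg (π.sharp (𝒢.tgt g)) b
    exact (congrArg (fun u : E' => -u) h2).trans (neg_neg _)
  have hRu : ∀ (α : CovectorField I' M) x, (R α (𝒢.unit x) : E) = Φ x (α x) := by
    intro α x
    refine eq_of_bilin_eq (hnd (𝒢.unit x)) fun w => (hR α _ w).trans ?_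
    refine Eq.trans ?_ (hbil x _ w).symm
    exact congrArg (fun r : ℝ => -r) (covector_apply_congr α (𝒢.tgt_unit x) _)
  refine ⟨fun x a b hab => ?_, fun x => ?_, fun α hα => ?_, fun x a => ?_, fun α β hα hβ x => ?_⟩
  · refine ContinuousLinearMap.ext fun u => ?_
    obtain ⟨w, hw⟩ := h𝒢.tgt_submersion.surjective_mfderiv (𝒢.unit x) u
    have h1 := hbil x a w
    have h2 := hbil x b w
    have h3 := congrArg (fun v : E => Ω.bilin (𝒢.unit x) v w) hab
    have h4 := neg_injective (h1.symm.trans (h3.trans h2))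
    have h5 : (mderiv I I' 𝒢.tgt (𝒢.unit x) w : E') = u := hw
    exact (congrArg (fun u : E' => (a : E' →L[ℝ] ℝ) u) h5).symm.trans
      (h4.trans (congrArg (fun u : E' => (b : E' →L[ℝ] ℝ) u) h5))
  · refine Set.ext fun v => ⟨?_, fun hv => ?_⟩
    · rintro ⟨a, rfl⟩
      exact hsrc x (Φ x a : E) a (hbil x a)
    · obtain ⟨a, ha⟩ := hker x v hv
      have h1 : (Φ x a : E) = v :=
        eq_of_bilin_eq (hnd (𝒢.unit x)) fun w => (hbil x a w).trans (ha w).symm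
      exact ⟨a, h1⟩
  · refine ((hRs α hα).comp h𝒢.smooth_unit).congr fun x => ?_
    exact (tangentBundle_ext (E' := E) (I' := I) rfl (hRu α x)).symm
  · let b : E' →L[ℝ] ℝ := a
    have h1 := hπ (𝒢.unit x) (Φ x b) (-b) fun w =>
      (DiffForm.bilin_apply (E := E) (I := I) _ _ _ _).symm.trans (hbil x b w)
    refine tangentBundle_ext (𝒢.tgt_unit x) (h1.trans ?_)
    have h2 : (π.sharp (𝒢.tgt (𝒢.unit x)) (-b) : E') = -π.sharp (𝒢.tgt (𝒢.unit x)) b :=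
      map_neg (π.sharp (𝒢.tgt (𝒢.unit x))) b
    exact ((congrArg (fun u : E' => -u) h2).trans (neg_neg _)).trans
      (π.sharp_congr (𝒢.tgt_unit x) b)
  -- A Poisson structure provides smoothness only of brackets of functions, so smoothness of π(β, α)
  -- is obtained on Γ: f ∘ t is, up to sign, the smooth form -t^*α evaluated on the smooth field R
  -- β, and f is recovered by composing with the units.
  · let f : M → ℝ := fun y => α y (π.sharp y (β y))
    have hft : ∀ g, f (𝒢.tgt g) = α (𝒢.tgt g) (mderiv I I' 𝒢.tgt g (R β g)) := fun g =>
      (congrArg (fun u : E' => α (𝒢.tgt g) u) (hRt β g)).symm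
    have hfs : ContMDiff I 𝓘(ℝ, ℝ) ∞ fun g => f (𝒢.tgt g) := by
      have h1 := (contMDiff_covector_apply (negPullback_isSmooth ht hα) (hRs β hβ)).neg
      refine h1.congr fun g => (hft g).trans ?_
      exact (neg_neg _).symm
    have hf : ContMDiff I' 𝓘(ℝ, ℝ) ∞ f :=
      (hfs.comp h𝒢.smooth_unit).congr fun y => congrArg f (𝒢.tgt_unit y).symm
    refine eq_of_bilin_eq (hnd (𝒢.unit x)) fun w => ?_
    refine (bilin_mlieBracket_pullback hΩ.smooth (hΩ.closed _) ht (hRs α hα) (hRs β hβ) hα hβ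
      (hR α) (hR β) ((hf _).mdifferentiableAt (by simp)) hft w).trans ?_
    refine Eq.trans ?_ (hbil x _ w).symm
    refine congrArg (fun r : ℝ => -r) ?_
    refine Eq.trans ?_ (covector_apply_congr (π.cotangentBracket α β) (𝒢.tgt_unit x) _)
    refine Eq.trans ?_ (cotangentBracket_apply π α β _ _).symm
    rw [hRt, hRt]

end Algebroid

section RightInvariant

variable {E H : Type*} [NormedAddCommGroup E] [NormedSpace ℝ E] [TopologicalSpace H]
  {I : ModelWithCorners ℝ E H} {Γ : Type*} [TopologicalSpace Γ] [ChartedSpace H Γ] {M : Type*}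

/-- The transport along `unit_mul` changes only the base point of the vector, not its value in the
model space. -/
theorem rightInvariantExt_eq (𝒢 : GroupoidOver Γ M) (a : ∀ x : M, TangentSpace I (𝒢.unit x))
    (g : Γ) : (𝒢.rightInvariantExt I a g : E) =
      mderivWithin I I (fun h => 𝒢.mul h g) (𝒢.src ⁻¹' {𝒢.tgt g}) (𝒢.unit (𝒢.tgt g))
        (a (𝒢.tgt g)) := by
  have h : ∀ {b b' : Γ} (e : b = b') (w : TangentSpace I b),
      @Eq E (e ▸ w : TangentSpace I b') w := by
    rintro _ _ rfl w
    rfl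
  exact h _ _

end RightInvariant

/-! ### Right invariant vector fields and the cotangent algebroid of N(P) -/

section Model

variable {E₀ G : Type*} [NormedAddCommGroup E₀] [NormedSpace ℝ E₀]
  [TopologicalSpace G] [ChartedSpace E₀ G] [Group G] [LieGroup 𝓘(ℝ, E₀) ∞ G]
  {E₁ P : Type*} [NormedAddCommGroup E₁] [NormedSpace ℝ E₁]
  [TopologicalSpace P] [ChartedSpace E₁ P] [MulAction Gᵐᵒᵖ P] [IsManifold 𝓘(ℝ, E₁) ∞ P]
  {E₂ S : Type*} [NormedAddCommGroup E₂] [NormedSpace ℝ E₂]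
  [TopologicalSpace S] [ChartedSpace E₂ S] [IsManifold 𝓘(ℝ, E₂) ∞ S]
  {q : P → S} {ωS : DiffForm 𝓘(ℝ, E₂) S 2 ℝ} {θ : PrincipalConnection E₀ G E₁ P}
  [FiniteDimensional ℝ E₀] [FiniteDimensional ℝ E₁] [FiniteDimensional ℝ E₂]
  [ChartedSpace (E₂ × LieDual E₀) (NP q ωS θ)] [IsManifold (modelN E₀ E₂) ∞ (NP q ωS θ)]
  [ChartedSpace (E₂ × E₂ × E₀ × LieDual E₀) (GP q ωS θ)]
  [IsManifold (modelG E₀ E₂) ∞ (GP q ωS θ)]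
  (hN : IsSmoothQuotient (modelSigma E₀ E₁) (modelN E₀ E₂) (projNP q ωS θ))
  (hΓ : IsSmoothQuotient (modelPairs E₀ E₁) (modelG E₀ E₂) (projGP q ωS θ))
  (hq : IsPrincipalBundle E₀ G E₁ E₂ q) (hωS : IsSymplectic ωS)
  {Ω : DiffForm (modelG E₀ E₂) (GP q ωS θ) 2 ℝ}
  (hΩ : DiffForm.pullback (modelPairs E₀ E₁) (projGP q ωS θ) Ω = omegaPairs q ωS θ)

section FiberMap

variable (q ωS θ) in
/-- The open set of the points `p` with `(p, ξ) ∈ Σ`. -/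
def sigmaFiber (ξ : LieDual E₀) : TopologicalSpace.Opens P :=
  ⟨{p | (p, ξ) ∈ sigma q ωS θ}, (sigma q ωS θ).isOpen.preimage (by fun_prop)⟩

variable {p₂ : P} {ξ : LieDual E₀}

/-- The map `p ↦ (p, p₂, ξ)`. -/
def pairLeft (h₂ : (p₂, ξ) ∈ sigma q ωS θ) (p : sigmaFiber q ωS θ ξ) : sigmaPairs q ωS θ :=
  ⟨(p.1, p₂, ξ), p.2, h₂⟩

/-- The map `p ↦ [p, p₂, ξ]` to the source fiber of `[p₂, ξ]`. -/
def fiberMap (h₂ : (p₂, ξ) ∈ sigma q ωS θ) : P → GP q ωS θ :=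
  extendOpens (fun p : sigmaFiber q ωS θ ξ => projGP q ωS θ (pairLeft h₂ p)) ⟨p₂, h₂⟩

theorem fiberMap_apply (h₂ : (p₂, ξ) ∈ sigma q ωS θ) {p : P} (h : (p, ξ) ∈ sigma q ωS θ) :
    fiberMap h₂ p = arr h h₂ :=
  extendOpens_apply _ _ (⟨p, h⟩ : sigmaFiber q ωS θ ξ)

/-- The constant extension also stays in the source fiber. Hence `mderiv_comp_within` applies with
the whole of P as domain. -/
theorem gaugeSrc_fiberMap (h₂ : (p₂, ξ) ∈ sigma q ωS θ) (p : P) :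
    gaugeSrc q ωS θ (fiberMap h₂ p) = obj h₂ := by
  unfold fiberMap extendOpens
  split <;> rfl

theorem contMDiff_pairLeft (h₂ : (p₂, ξ) ∈ sigma q ωS θ) :
    ContMDiff 𝓘(ℝ, E₁) (modelPairs E₀ E₁) ∞ (pairLeft h₂) := fun p =>
  contMDiffAt_opens_iff.2 ((contMDiff_subtype_val.prodMk contMDiff_const) p)

theorem mderiv_pairLeft (h₂ : (p₂, ξ) ∈ sigma q ωS θ) (p : sigmaFiber q ωS θ ξ) (v : E₁) :
    mderiv 𝓘(ℝ, E₁) (modelPairs E₀ E₁) (pairLeft h₂) p v = (v, 0) := by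
  rw [← mderiv_val_comp ((contMDiff_pairLeft h₂ p).mdifferentiableAt (by simp))]
  have h := mderiv_prodMk (I := 𝓘(ℝ, E₁)) (I' := 𝓘(ℝ, E₁)) (I'' := modelSigma E₀ E₁)
    (f := (Subtype.val : sigmaFiber q ωS θ ξ → P)) (g := fun _ => (p₂, ξ)) (x := p)
    ((contMDiff_subtype_val (n := ∞)).mdifferentiableAt (by simp)) mdifferentiableAt_const
  rw [mderiv_subtype_val, mderiv_const] at h
  exact DFunLike.congr_fun h v

include hΓ

theorem contMDiffAt_fiberMap (h₂ : (p₂, ξ) ∈ sigma q ωS θ) {p : P} (h : (p, ξ) ∈ sigma q ωS θ) :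
    ContMDiffAt 𝓘(ℝ, E₁) (modelG E₀ E₂) ∞ (fiberMap h₂) p :=
  contMDiffAt_extendOpens _ (x := (⟨p, h⟩ : sigmaFiber q ωS θ ξ))
    ((hΓ.smooth.comp (contMDiff_pairLeft h₂)) _)

theorem mderiv_fiberMap (h₂ : (p₂, ξ) ∈ sigma q ωS θ) {p : P} (h : (p, ξ) ∈ sigma q ωS θ)
    (v : E₁) : mderiv 𝓘(ℝ, E₁) (modelG E₀ E₂) (fiberMap h₂) p v =
      derivGP q ωS θ ⟨(p, p₂, ξ), h, h₂⟩ (v, 0) := by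
  let x : sigmaFiber q ωS θ ξ := ⟨p, h⟩
  have h1 := mderiv_comp_val (x := x)
    ((contMDiffAt_fiberMap hΓ h₂ h).mdifferentiableAt (by simp))
  have h2 : (fun y : sigmaFiber q ωS θ ξ => fiberMap h₂ y.1) =
      fun y => projGP q ωS θ (pairLeft h₂ y) := funext fun y => extendOpens_apply _ _ y
  have h3 := mderiv_comp x (hΓ.mdifferentiableAt (pairLeft h₂ x))
    ((contMDiff_pairLeft h₂ x).mdifferentiableAt (by simp))
  rw [h2, h3] at h1
  refine (DFunLike.congr_fun h1 v).symm.trans ?_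
  rw [ContinuousLinearMap.comp_apply, mderiv_pairLeft]
  rfl

end FiberMap

section Algebroid

include hN hq hωS in
-- Vectors tangent to a fiber of μ are ω-orthogonal to the orbits, so their contractions with ω
-- descend to N(P). Together with `exists_horizontal_of_covector` this identifies the covectors of
-- N(P) at [p, ξ] with the vectors of P at p.
theorem exists_covector_of_horizontal (x : sigma q ωS θ) (u : E₁) :
    ∃ a : E₂ × LieDual E₀ →L[ℝ] ℝ, ∀ w,
      a (derivNP q ωS θ x w) = (omega q ωS θ).bilin x.1 (u, 0) w := by
  refine exists_covector_descent (hN.surjective_mderiv x) fun v hv => ?_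
  obtain ⟨X, rfl⟩ := (mderiv_projNP_eq_zero_iff hq hωS hN x v).1 hv
  rw [DiffForm.bilin_swap, omega_gen θ hq]
  simp

include hN hq hωS in
theorem exists_horizontal_of_covector (x : sigma q ωS θ) (a : E₂ × LieDual E₀ →L[ℝ] ℝ) :
    ∃ u : E₁, ∀ w, (omega q ωS θ).bilin x.1 (u, 0) w = a (derivNP q ωS θ x w) := by
  have hx : (omega q ωS θ).NondegenerateAt x.1 := by
    rw [DiffForm.nondegenerateAt_iff]
    exact (mem_sigma_iff θ hq hωS _).1 x.2
  obtain ⟨v, hv⟩ := exists_contraction_eq hx (a ∘L derivNP q ωS θ x)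
  have h0 : v.2 = 0 := by
    ext X
    have h1 := hv (gen E₀ G E₁ x.1 X)
    rw [DiffForm.bilin_swap, omega_gen θ hq, ContinuousLinearMap.comp_apply,
      derivNP_gen hN hq hωS, map_zero, neg_eq_zero] at h1
    exact h1
  refine ⟨v.1, fun w => ?_⟩
  rw [← h0]
  exact hv w

include hΩ in
theorem bilin_derivGP_left (z : sigmaPairs q ωS θ) (u : E₁) (w : E₁ × E₁ × LieDual E₀) :
    Ω.bilin (projGP q ωS θ z) (derivGP q ωS θ z (u, 0)) (derivGP q ωS θ z w) =
      -(omega q ωS θ).bilin (z.1.1, z.1.2.2) (u, 0) (w.1, w.2.2) := by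
  rw [bilin_derivGP hΩ]
  simp

variable (hΩs : IsSymplectic Ω)

include hN hΓ hq hωS hΩ hΩs

/-- Moving only p₁ in the direction u gives a solution of Ω(V, ·) = -a ∘ dt, and nondegeneracy of Ω
makes the solution unique. -/
theorem exists_derivGP_left_eq (z : sigmaPairs q ωS θ) {V : E₂ × E₂ × E₀ × LieDual E₀}
    {a : E₂ × LieDual E₀ →L[ℝ] ℝ} {u : E₁}
    (hu : ∀ w, (omega q ωS θ).bilin (z.1.1, z.1.2.2) (u, 0) w =
      a (derivNP q ωS θ (pairTgt q ωS θ z) w))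
    (hV : ∀ W, Ω.bilin (projGP q ωS θ z) V W =
      -(a (mderiv (modelG E₀ E₂) (modelN E₀ E₂) (gaugeTgt q ωS θ) (projGP q ωS θ z) W))) :
    V = derivGP q ωS θ z (u, 0) := by
  refine eq_of_bilin_eq (hΩs.nondegenerate _) fun W => (hV W).trans ?_
  obtain ⟨w, rfl⟩ := hΓ.surjective_mderiv z W
  rw [bilin_derivGP_left hΩ, hu]
  exact congrArg (fun r : ℝ => -r)
    (congrArg (fun v : E₂ × LieDual E₀ => a v) (mderiv_gaugeTgt hN hΓ z w))

/-- Right translation by [p₁, p₂, ξ] maps [p, p₁, ξ] to [p, p₂, ξ]. It therefore carries the class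
of a variation u of the first entry at the unit to the class of the same variation at the arrow, and
the contraction of Ω with such a variation involves only ω at (p₁, ξ), that is, the covector at the
target. -/
theorem rightInvariantExt_gaugeGroupoid (α : CovectorField (modelN E₀ E₂) (NP q ωS θ))
    (g : GP q ωS θ) (W : E₂ × E₂ × E₀ × LieDual E₀) :
    Ω.bilin g ((gaugeGroupoid θ hq hωS).rightInvariantExt (modelG E₀ E₂)
      (fun x => cotangentAlgebroidMap (modelN E₀ E₂) (gaugeGroupoid θ hq hωS) Ω
        hΩs.nondegenerate x (α x)) g) W =
      negPullback (modelG E₀ E₂) (gaugeGroupoid θ hq hωS).tgt α g W := by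
  obtain ⟨p₁, p₂, ξ, h₁, h₂, rfl⟩ := exists_arr_eq g
  let a : E₂ × LieDual E₀ →L[ℝ] ℝ := α (obj h₁)
  obtain ⟨u, hu⟩ := exists_horizontal_of_covector hN hq hωS ⟨(p₁, ξ), h₁⟩ a
  have hΦ : (cotangentAlgebroidMap (modelN E₀ E₂) (gaugeGroupoid θ hq hωS) Ω
      hΩs.nondegenerate (obj h₁) a : E₂ × E₂ × E₀ × LieDual E₀) =
      mderiv 𝓘(ℝ, E₁) (modelG E₀ E₂) (fiberMap h₁) p₁ u := by
    rw [mderiv_fiberMap hΓ h₁ h₁]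
    exact exists_derivGP_left_eq hN hΓ hq hωS hΩ hΩs ⟨(p₁, p₁, ξ), h₁, h₁⟩ hu
      (bilin_cotangentAlgebroidMap (gaugeGroupoid θ hq hωS) hΩs.nondegenerate (obj h₁) a)
  have hmul : MDifferentiableWithinAt (modelG E₀ E₂) (modelG E₀ E₂)
      (fun h => gaugeMul q ωS θ h (arr h₁ h₂)) (gaugeSrc q ωS θ ⁻¹' {obj h₁})
      (fiberMap h₁ p₁) := by
    rw [fiberMap_apply h₁ h₁]
    have h3 := (contMDiffOn_gaugeMul hΓ hq hωS (arr h₁ h₁, arr h₁ h₂) rfl)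
    exact (ContMDiffWithinAt.comp (f := fun h => (h, arr h₁ h₂)) (arr h₁ h₁) h3
      (contMDiffWithinAt_id.prodMk contMDiffWithinAt_const)
      (fun h hh => hh)).mdifferentiableWithinAt (by simp)
  have hd := mderiv_comp_within hmul
    ((contMDiffAt_fiberMap hΓ h₁ h₁).mdifferentiableAt (by simp)) (gaugeSrc_fiberMap h₁) u
  have hloc : (fun p => gaugeMul q ωS θ (fiberMap h₁ p) (arr h₁ h₂)) =ᶠ[𝓝 p₁] fiberMap h₂ := by
    filter_upwards [(sigmaFiber q ωS θ ξ).isOpen.mem_nhds h₁] with p hp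
    rw [fiberMap_apply h₁ hp, fiberMap_apply h₂ hp, gaugeMul_arr hp h₁ h₂ hq]
  have hR : ((gaugeGroupoid θ hq hωS).rightInvariantExt (modelG E₀ E₂)
      (fun x => cotangentAlgebroidMap (modelN E₀ E₂) (gaugeGroupoid θ hq hωS) Ω
        hΩs.nondegenerate x (α x)) (arr h₁ h₂) : E₂ × E₂ × E₀ × LieDual E₀) =
      derivGP q ωS θ ⟨(p₁, p₂, ξ), h₁, h₂⟩ (u, 0) := by
    refine (rightInvariantExt_eq _ _ _).trans ?_
    rw [mderiv_congr hloc, mderiv_fiberMap hΓ h₂ h₁] at hd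
    refine Eq.trans ?_ hd.symm
    rw [fiberMap_apply h₁ h₁, ← hΦ]
    rfl
  obtain ⟨w, rfl⟩ := hΓ.surjective_mderiv ⟨(p₁, p₂, ξ), h₁, h₂⟩ W
  refine (congrArg (fun V : E₂ × E₂ × E₀ × LieDual E₀ => Ω.bilin (arr h₁ h₂) V
    (derivGP q ωS θ ⟨(p₁, p₂, ξ), h₁, h₂⟩ w)) hR).trans ?_
  refine (bilin_derivGP_left hΩ _ _ _).trans ?_
  refine congrArg (fun r : ℝ => -r) ((hu _).trans ?_)
  exact congrArg (fun v : E₂ × LieDual E₀ => a v)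
    (mderiv_gaugeTgt hN hΓ ⟨(p₁, p₂, ξ), h₁, h₂⟩ w).symm

theorem integrates_gaugeGroupoid {ϖ : PoissonStructure (modelN E₀ E₂) (NP q ωS θ)}
    (hϖ : ∀ (x : sigma q ωS θ) (a : E₂ × LieDual E₀ →L[ℝ] ℝ) (v : E₁ × LieDual E₀),
      (∀ w, (omega q ωS θ).bilin x.1 v w = a (derivNP q ωS θ x w)) →
        derivNP q ωS θ x v = ϖ.sharp (projNP q ωS θ x) a) :
    (gaugeGroupoid θ hq hωS).Integrates Ω ϖ := by
  have hanti := isAntiPoissonMap_gaugeTgt hN hΓ hq hωS hΩ hϖ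
  have hLie := isLieGroupoid_gaugeGroupoid hN hΓ hq hωS
  refine ⟨⟨hLie, hΩs, isLagrangian_mulGraph hN hΓ hq hωS hΩ⟩,
    isPoissonMap_gaugeSrc hN hΓ hq hωS hΩ hϖ, hanti, _,
    isCotangentAlgebroidIso_algebroidMap hΩs hLie hanti (fun x V hV => ?_) (fun x V a hV => ?_)
      (rightInvariantExt_gaugeGroupoid hN hΓ hq hωS hΩ hΩs)⟩
  · obtain ⟨p, ξ, h, rfl⟩ := exists_obj_eq x
    let z : sigmaPairs q ωS θ := ⟨(p, p, ξ), h, h⟩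
    obtain ⟨v, rfl⟩ := hΓ.surjective_mderiv z V
    obtain ⟨X, hX⟩ := (mderiv_projNP_eq_zero_iff hq hωS hN (pairSrc q ωS θ z) v.2).1
      ((mderiv_gaugeSrc hN hΓ z v).symm.trans hV)
    rw [gen_apply hq] at hX
    -- A vector killed by ds has a generator as its source component. Subtracting the diagonal orbit
    -- direction of X leaves its class unchanged and makes it a variation of the first entry alone.
    have e : derivGP q ωS θ z v = derivGP q ωS θ z (v.1 - genP E₀ G E₁ p X, 0) := by
      have h1 := derivGP_gen hΓ hq hωS z X
      have h2 : v = (v.1 - genP E₀ G E₁ p X, 0) +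
          (genP E₀ G E₁ p X, genP E₀ G E₁ p X, genDual E₀ G ξ X) := by
        refine Prod.ext (sub_add_cancel _ _).symm ?_
        exact hX.symm.trans (zero_add _).symm
      exact (congrArg (derivGP q ωS θ z) h2).trans ((map_add _ _ _).trans
        ((congrArg (fun u => _ + u) h1).trans (add_zero _)))
    obtain ⟨a, ha⟩ := exists_covector_of_horizontal hN hq hωS ⟨(p, ξ), h⟩
      (v.1 - genP E₀ G E₁ p X)
    refine ⟨a, fun W => ?_⟩
    obtain ⟨w, rfl⟩ := hΓ.surjective_mderiv z W
    refine (congrArg (fun V : E₂ × E₂ × E₀ × LieDual E₀ => Ω.bilin (projGP q ωS θ z) V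
      (derivGP q ωS θ z w)) e).trans ((bilin_derivGP_left hΩ _ _ _).trans ?_)
    refine congrArg (fun r : ℝ => -r) ((ha _).symm.trans ?_)
    exact congrArg (fun v : E₂ × LieDual E₀ => a v) (mderiv_gaugeTgt hN hΓ z w).symm
  · obtain ⟨p, ξ, h, rfl⟩ := exists_obj_eq x
    let z : sigmaPairs q ωS θ := ⟨(p, p, ξ), h, h⟩
    obtain ⟨u, hu⟩ := exists_horizontal_of_covector hN hq hωS ⟨(p, ξ), h⟩ a
    have e := exists_derivGP_left_eq hN hΓ hq hωS hΩ hΩs z hu hV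
    have h1 := mderiv_gaugeSrc hN hΓ z (u, 0)
    rw [← e] at h1
    exact h1.trans (map_zero _)

end Algebroid

end Model

/-! ### Topology of the quotients, source fibers and invariant neighborhoods -/

section Model

variable {E₀ G : Type*} [NormedAddCommGroup E₀] [NormedSpace ℝ E₀]
  [TopologicalSpace G] [ChartedSpace E₀ G] [Group G] [LieGroup 𝓘(ℝ, E₀) ∞ G]
  {E₁ P : Type*} [NormedAddCommGroup E₁] [NormedSpace ℝ E₁]
  [TopologicalSpace P] [ChartedSpace E₁ P] [MulAction Gᵐᵒᵖ P] [IsManifold 𝓘(ℝ, E₁) ∞ P]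
  {E₂ S : Type*} [NormedAddCommGroup E₂] [NormedSpace ℝ E₂]
  [TopologicalSpace S] [ChartedSpace E₂ S] [IsManifold 𝓘(ℝ, E₂) ∞ S]
  {q : P → S} {ωS : DiffForm 𝓘(ℝ, E₂) S 2 ℝ} {θ : PrincipalConnection E₀ G E₁ P}
  [FiniteDimensional ℝ E₀] [FiniteDimensional ℝ E₁] [FiniteDimensional ℝ E₂]
  [ChartedSpace (E₂ × LieDual E₀) (NP q ωS θ)] [IsManifold (modelN E₀ E₂) ∞ (NP q ωS θ)]
  [ChartedSpace (E₂ × E₂ × E₀ × LieDual E₀) (GP q ωS θ)]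
  [IsManifold (modelG E₀ E₂) ∞ (GP q ωS θ)]
  (hN : IsSmoothQuotient (modelSigma E₀ E₁) (modelN E₀ E₂) (projNP q ωS θ))
  (hΓ : IsSmoothQuotient (modelPairs E₀ E₁) (modelG E₀ E₂) (projGP q ωS θ))
  (hq : IsPrincipalBundle E₀ G E₁ E₂ q) (hωS : IsSymplectic ωS)

section Topology

omit [ChartedSpace (E₂ × E₂ × E₀ × LieDual E₀) (GP q ωS θ)]
  [IsManifold (modelG E₀ E₂) ∞ (GP q ωS θ)]

include hN hq in
theorem t2Space_NP [T2Space P] [T2Space S] : T2Space (NP q ωS θ) :=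
  (t2Space_iff_of_isOpenQuotientMap hN.isOpenQuotientMap).2
    (isClosed_setOf_rel_val (coadSetoid E₀ G P) (sigma q ωS θ) (isClosed_coadSetoid hq))

include hN in
theorem secondCountableTopology_NP [SecondCountableTopology P] :
    SecondCountableTopology (NP q ωS θ) := by
  have : SecondCountableTopology (LieDual E₀) := inferInstance
  exact hN.isOpenQuotientMap.isQuotientMap.secondCountableTopology hN.isOpenQuotientMap.isOpenMap

end Topology

section Topology

include hΓ hq in
theorem t2Space_GP [T2Space P] [T2Space S] : T2Space (GP q ωS θ) :=
  (t2Space_iff_of_isOpenQuotientMap hΓ.isOpenQuotientMap).2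
    (isClosed_setOf_rel_val (coadSetoid₂ E₀ G P) (sigmaPairs q ωS θ) (isClosed_coadSetoid₂ hq))

include hΓ in
theorem secondCountableTopology_GP [SecondCountableTopology P] :
    SecondCountableTopology (GP q ωS θ) :=
  hΓ.isOpenQuotientMap.isQuotientMap.secondCountableTopology hΓ.isOpenQuotientMap.isOpenMap

include hΓ hq hωS in
/-- The source fibers of the groupoid. -/
theorem isDiffeomorphicToSubmanifold_srcFiber [CompactSpace P] [T2Space P] [T2Space S] {p₂ : P}
    {ξ : LieDual E₀} (h₂ : (p₂, ξ) ∈ sigma q ωS θ) (hξ : ∀ p, (p, ξ) ∈ sigma q ωS θ) :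
    IsDiffeomorphicToSubmanifold 𝓘(ℝ, E₁) (modelG E₀ E₂) P (gaugeSrc q ωS θ ⁻¹' {obj h₂}) := by
  have hs : ContMDiff 𝓘(ℝ, E₁) (modelG E₀ E₂) ∞ (fiberMap h₂) := fun p =>
    contMDiffAt_fiberMap hΓ h₂ (hξ p)
  have := t2Space_GP hΓ hq
  refine ⟨fiberMap h₂, hs, (hs.continuous.isClosedEmbedding fun p p' e => ?_).isEmbedding,
    fun p => ?_, Set.ext fun c => ⟨?_, fun hc => ?_⟩⟩
  -- A group element identifying two classes with the same second entry fixes p₂ and so is 1. The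
  -- infinitesimal version of this argument gives the immersion property below.
  · rw [fiberMap_apply h₂ (hξ p), fiberMap_apply h₂ (hξ p')] at e
    obtain ⟨g, e₁, e₂, -⟩ := arr_eq_iff.1 e
    have hg : g = 1 := hq.act_injective p₂ (by rw [← e₂, op_one, one_smul])
    rw [e₁, hg, op_one, one_smul]
  · refine (injective_iff_map_eq_zero (mderiv 𝓘(ℝ, E₁) (modelG E₀ E₂) (fiberMap h₂) p)).2
      fun v hv => ?_
    rw [mderiv_fiberMap hΓ h₂ (hξ p)] at hv
    obtain ⟨X, hX⟩ := (mderiv_projGP_eq_zero_iff hq hωS hΓ _ _).1 hv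
    have hX₂ : genP E₀ G E₁ p₂ X = 0 :=
      congrArg (fun u : E₁ × E₁ × LieDual E₀ => u.2.1) hX
    have hX₁ : genP E₀ G E₁ p X = v := congrArg (fun u : E₁ × E₁ × LieDual E₀ => u.1) hX
    have hX₀ : X = 0 := hq.genP_injective p₂ (hX₂.trans (map_zero _).symm)
    rw [← hX₁, hX₀, map_zero]
  · rintro ⟨p, rfl⟩
    exact gaugeSrc_fiberMap h₂ p
  · obtain ⟨p, h, rfl⟩ := exists_arr_of_src h₂ hq hωS hc
    exact ⟨p, fiberMap_apply h₂ h⟩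

end Topology

include hN hΓ hq hωS in
-- Since source and target of an arrow share ξ, any condition on ξ that is invariant under the
-- coadjoint action cuts out an invariant set of N(P). The condition used is that P × {ξ} lies in
-- the preimage of W in Σ.
theorem exists_invariant_neighborhood [CompactSpace P] [T2Space P] [T2Space S]
    {W : Set (NP q ωS θ)} (hW : IsOpen W) (hSW : zeroSection q ωS θ ⊆ W) :
    ∃ U : Set (NP q ωS θ), IsOpen U ∧ zeroSection q ωS θ ⊆ U ∧ U ⊆ W ∧
      (∀ a, gaugeSrc q ωS θ a ∈ U ↔ gaugeTgt q ωS θ a ∈ U) ∧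
      ∀ x ∈ U, IsDiffeomorphicToSubmanifold 𝓘(ℝ, E₁) (modelG E₀ E₂) P
        (gaugeSrc q ωS θ ⁻¹' {x}) := by
  let O : Set (P × LieDual E₀) := Subtype.val '' (projNP q ωS θ ⁻¹' W)
  have hO : IsOpen O := (sigma q ωS θ).isOpen.isOpenMap_subtype_val _
    (hW.preimage hN.smooth.continuous)
  let V : Set (LieDual E₀) := {ξ | ∀ p : P, (p, ξ) ∈ O}
  -- The tube lemma: P is compact, so the projection of the closed complement of O to 𝔤^* is closed.
  have hV : IsOpen V := by
    have h1 : V = (Prod.snd '' Oᶜ)ᶜ := by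
      ext ξ
      simp [V]
    rw [h1, isOpen_compl_iff]
    exact isClosedMap_snd_of_compactSpace _ hO.isClosed_compl
  have hOσ : ∀ {x}, x ∈ O → x ∈ sigma q ωS θ := by
    rintro _ ⟨x, -, rfl⟩
    exact x.2
  have hVinv : ∀ ξ ∈ V, ∀ g : G, (ξ ∘L lieAd g : LieDual E₀) ∈ V := by
    intro ξ hξ g p
    obtain ⟨x, hx, hxp⟩ := hξ (op g⁻¹ • p)
    have e : coadAct x.1 g = (p, ξ ∘L lieAd g) := by
      rw [hxp]
      simp [coadAct, smul_smul]
    have hm := coadAct_mem_sigma θ hq hωS x.1 x.2 g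
    refine ⟨⟨_, hm⟩, ?_, e⟩
    rw [mem_preimage, projNP_coadAct]
    exact hx
  let U : Set (NP q ωS θ) := projNP q ωS θ '' {x | x.1.2 ∈ V}
  have hU : ∀ {p : P} {ξ : LieDual E₀} (h : (p, ξ) ∈ sigma q ωS θ), obj h ∈ U ↔ ξ ∈ V := by
    intro p ξ h
    refine ⟨?_, fun hξ => ⟨⟨(p, ξ), h⟩, hξ, rfl⟩⟩
    rintro ⟨⟨⟨p', ξ'⟩, h'⟩, hξ', e⟩
    obtain ⟨g, -, e₂⟩ := obj_eq_iff.1 (show obj h' = obj h from e)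
    rw [e₂]
    exact hVinv ξ' hξ' g
  refine ⟨U, ?_, ?_, ?_, fun a => ?_, fun x hx => ?_⟩
  · exact hN.isOpenQuotientMap.isOpenMap _
      (hV.preimage (continuous_snd.comp continuous_subtype_val))
  · rintro _ ⟨x, hx, rfl⟩
    have hp : ∀ p : P, (p, x.1.2) ∈ sigma q ωS θ := fun p => by
      rw [show x.1.2 = 0 from hx]
      exact mem_sigma_zero θ hq hωS p
    exact ⟨x, fun p => ⟨⟨(p, x.1.2), hp p⟩, hSW ⟨⟨(p, x.1.2), hp p⟩, hx, rfl⟩, rfl⟩, rfl⟩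
  · rintro _ ⟨x, hx, rfl⟩
    obtain ⟨y, hy, hyx⟩ := hx x.1.1
    rw [← Subtype.ext hyx]
    exact hy
  · obtain ⟨p₁, p₂, ξ, h₁, h₂, rfl⟩ := exists_arr_eq a
    exact (hU h₂).trans (hU h₁).symm
  · obtain ⟨p, ξ, h, rfl⟩ := exists_obj_eq x
    exact isDiffeomorphicToSubmanifold_srcFiber hΓ hq hωS h
      fun p => hOσ ((hU h).1 hx p)

end Model

end LocalModel

end

/-! ### Assembly of the main theorem -/

theorem mainTheorem9
    -- the structure group
    {E₀ : Type*} [NormedAddCommGroup E₀] [NormedSpace ℝ E₀] [FiniteDimensional ℝ E₀]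
    {G : Type*} [TopologicalSpace G] [T2Space G] [SecondCountableTopology G]
    [ChartedSpace E₀ G] [Group G] [LieGroup 𝓘(ℝ, E₀) ∞ G]
    -- the total space
    {E₁ : Type*} [NormedAddCommGroup E₁] [NormedSpace ℝ E₁] [FiniteDimensional ℝ E₁]
    {P : Type*} [TopologicalSpace P] [T2Space P] [SecondCountableTopology P]
    [ChartedSpace E₁ P] [IsManifold 𝓘(ℝ, E₁) ∞ P] [MulAction Gᵐᵒᵖ P]
    -- the base
    {E₂ : Type*} [NormedAddCommGroup E₂] [NormedSpace ℝ E₂] [FiniteDimensional ℝ E₂]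
    {S : Type*} [TopologicalSpace S] [T2Space S] [SecondCountableTopology S]
    [ChartedSpace E₂ S] [IsManifold 𝓘(ℝ, E₂) ∞ S]
    -- the principal bundle, the symplectic form on the base and the principal connection
    (q : P → S) (hq : LocalModel.IsPrincipalBundle E₀ G E₁ E₂ q)
    (ωS : LocalModel.DiffForm 𝓘(ℝ, E₂) S 2 ℝ) (hωS : LocalModel.IsSymplectic ωS)
    (θ : LocalModel.PrincipalConnection E₀ G E₁ P) :
    -- the set where `ω` is nondegenerate is open, `G`-invariant and contains `P × {0}`
    (LocalModel.sigma q ωS θ : Set (P × LocalModel.LieDual E₀))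
        = LocalModel.nondegenerateSet q ωS θ ∧
    (∀ x ∈ LocalModel.sigma q ωS θ, ∀ g : G,
        LocalModel.coadAct x g ∈ LocalModel.sigma q ωS θ) ∧
    (∀ p : P, (p, (0 : LocalModel.LieDual E₀)) ∈ LocalModel.sigma q ωS θ) ∧
    -- `N(P) = Σ / G` is a manifold, with the smooth structure of the quotient
    T2Space (LocalModel.NP q ωS θ) ∧
    SecondCountableTopology (LocalModel.NP q ωS θ) ∧
    ∃ (_ : ChartedSpace (E₂ × LocalModel.LieDual E₀) (LocalModel.NP q ωS θ))
      (_ : IsManifold 𝓘(ℝ, E₂ × LocalModel.LieDual E₀) ∞ (LocalModel.NP q ωS θ)),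
    LocalModel.IsSmoothSubmersion (LocalModel.modelSigma E₀ E₁)
      𝓘(ℝ, E₂ × LocalModel.LieDual E₀) (LocalModel.projNP q ωS θ) ∧
    -- with the reduced Poisson structure `π_P`
    ∃ π : LocalModel.PoissonStructure 𝓘(ℝ, E₂ × LocalModel.LieDual E₀) (LocalModel.NP q ωS θ),
    LocalModel.IsPoissonMap (LocalModel.omegaSigma q ωS θ) π (LocalModel.projNP q ωS θ) ∧
    -- `(Σ ×_μ Σ) / G` is a Hausdorff manifold, with the smooth structure of the quotient
    T2Space (LocalModel.GP q ωS θ) ∧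
    SecondCountableTopology (LocalModel.GP q ωS θ) ∧
    ∃ (_ : ChartedSpace (E₂ × E₂ × E₀ × LocalModel.LieDual E₀) (LocalModel.GP q ωS θ))
      (_ : IsManifold 𝓘(ℝ, E₂ × E₂ × E₀ × LocalModel.LieDual E₀) ∞ (LocalModel.GP q ωS θ)),
    LocalModel.IsSmoothSubmersion (LocalModel.modelPairs E₀ E₁)
      𝓘(ℝ, E₂ × E₂ × E₀ × LocalModel.LieDual E₀) (LocalModel.projGP q ωS θ) ∧
    -- the groupoid structure and the symplectic form induced by `s^* ω - t^* ω`
    ∃ (𝒢 : LocalModel.GroupoidOver (LocalModel.GP q ωS θ) (LocalModel.NP q ωS θ))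
      (Ω : LocalModel.DiffForm 𝓘(ℝ, E₂ × E₂ × E₀ × LocalModel.LieDual E₀)
        (LocalModel.GP q ωS θ) 2 ℝ),
    LocalModel.IsQuotientOfPairGroupoid q ωS θ 𝒢 ∧
    LocalModel.DiffForm.pullback (LocalModel.modelPairs E₀ E₁) (LocalModel.projGP q ωS θ) Ω
      = LocalModel.omegaPairs q ωS θ ∧
    𝒢.Integrates Ω π ∧
    -- if `P` is compact: small invariant neighborhoods of `S` on which the `s`-fibers are copies
    -- of `P`
    (CompactSpace P →
      ∀ W : Set (LocalModel.NP q ωS θ), IsOpen W → LocalModel.zeroSection q ωS θ ⊆ W →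
        ∃ U : Set (LocalModel.NP q ωS θ), IsOpen U ∧ LocalModel.zeroSection q ωS θ ⊆ U ∧ U ⊆ W ∧
          (∀ a, 𝒢.src a ∈ U ↔ 𝒢.tgt a ∈ U) ∧
          ∀ x ∈ U, LocalModel.IsDiffeomorphicToSubmanifold 𝓘(ℝ, E₁)
            𝓘(ℝ, E₂ × E₂ × E₀ × LocalModel.LieDual E₀) P (𝒢.src ⁻¹' {x})) := by
  obtain ⟨cN, mN, hN⟩ := LocalModel.exists_smooth_NP (θ := θ) hq hωS
  obtain ⟨cΓ, mΓ, hΓ⟩ := LocalModel.exists_smooth_GP (θ := θ) hq hωS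
  obtain ⟨ϖ, hϖ⟩ := LocalModel.exists_poissonStructure hq hωS hN
  obtain ⟨Ω, hΩs, hΩ⟩ := LocalModel.exists_symplecticForm_GP hq hωS hΓ
  refine ⟨LocalModel.coe_sigma θ hq hωS, LocalModel.coadAct_mem_sigma θ hq hωS,
    LocalModel.mem_sigma_zero θ hq hωS, LocalModel.t2Space_NP hN hq,
    LocalModel.secondCountableTopology_NP hN, cN, mN, hN.isSmoothSubmersion, ϖ,
    LocalModel.isPoissonMap_projNP hϖ, LocalModel.t2Space_GP hΓ hq,
    LocalModel.secondCountableTopology_GP hΓ, cΓ, mΓ, hΓ.isSmoothSubmersion,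
    LocalModel.gaugeGroupoid θ hq hωS, Ω,
    LocalModel.isQuotientOfPairGroupoid_gaugeGroupoid hq hωS, hΩ,
    LocalModel.integrates_gaugeGroupoid hN hΓ hq hωS hΩ hΩs hϖ, ?_⟩
  intro _ W hW hSW
  exact LocalModel.exists_invariant_neighborhood hN hΓ hq hωS hW hSW
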